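/- **Setting.** Consider the planar 4-body problem with masses $m_1,\dots,m_4>0$ near a simultaneous collision of the binaries $(m_1,m_2)$ and $(m_3,m_4)$. Put $M_1=\frac{m_1m_2}{m_1+m_2}$, $M_2=\frac{m_3m_4}{m_3+m_4}$, $k_1=m_1m_2$, $k_2=m_3m_4$, $a_j=16k_j^2M_j$. Let $Q_j$ be the difference vectors inside the binaries, $x$ the vector joining their centres of mass, $P_j,y$ the conjugate momenta. Let $4k_jM_jQ_j=\tfrac12z_j^2$, $(4k_jM_j)^{-1}P_j=\bar z_j^{-1}u_j$ (Levi-Civita variables), $\Gamma_j=u_j/|u_j|=e^{i\theta_j}$, $\zeta_j=I_j+iL_j=a_j^{-1/3}\bar u_jz_j$, $h_j=a_j^{2/3}|z_j|^{-2}(|u_j|^2-1)$. In the coordinates $(\zeta_1,\zeta_2,u)$, $u=(h_1,h_2,\Gamma_1,\Gamma_2,x,y)$ (on the branch $|u_j|>1/\sqrt2$, and with $\Gamma_j$ measured by the angle $\theta_j$), let $X$ be the vector field of the 4-body problem with respect to the time $\tau$, $dt=|\zeta_1|^2|\zeta_2|^2d\tau$; it is smooth near $\zeta_1=\zeta_2=0$,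 $x\ne0$. Fix a simultaneous binary collision $(0,u^*)$ with $x^*\neq0$. *Normal form coordinates* at $(0,u^*)$ are coordinates given by a smooth change of variables near $(0,u^*)$ that differs from the identity by $O(|\zeta|^2)$, in which (keeping the names of the variables) $X$ reads, with errors $O(|\zeta|^{10})$ uniformly for $u$ near $u^*$, $$I_1'=|\zeta_2|^2+R^4_1+R_1^6+R^8_1,\quad I_2'=|\zeta_1|^2+R^4_2+R_2^6+R^8_2,\quad h_1'=a_1^{-1/3}R^9,\quad h_2'=-a_2^{-1/3}R^9,$$ $$L_1'=L_2'=0,\quad \Gamma_1'=\Gamma_2'=0,\quad x'=y'=0,$$ where the $R^k$ are homogeneous polynomials of degree $k$ in $(I_1,L_1,I_2,L_2)$ with coefficients smooth in $h$ (for $k=4,6$) or in $u$ (for $k=8,9$). An *approximate integral* is a function $\kappa=(I_1^3+3I_1L_1^2)-(I_2^3+3I_2L_2^2)+G^5+G^7$ of the normal form coordinates, with $G^k$ a homogeneous polynomial of degree $k$ in $(I_1,L_1,I_2,L_2)$ with coefficients smooth in $h$, such that $\kappa'=O(|\zeta|^{11})$ near $(0,u^*)$, i.e. $\kappa'$ vanishes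 to all orders determined by the normal form. Let $J_1=\frac12(I_1+I_2)$, $J_2=\frac12(I_1-I_2)$, and blow up $(J_1,L_1,J_2,L_2)=0$: the chart $U_\alpha$ has $(J_1,L_1,J_2,L_2)=r_\alpha(1,\beta_\alpha,\gamma_\alpha,\delta_\alpha)$ and the chart $U_\gamma$ has $(J_1,L_1,J_2,L_2)=r_\gamma(\alpha_\gamma,\beta_\gamma,1,\delta_\gamma)$. The collision manifold is $r=0$. Let $X_\gamma$ be the desingularised field $r_\gamma^{-1}X$ in $U_\gamma$, extended continuously to $r_\gamma=0$. Let $\tilde\gamma_\alpha=\frac16r_\alpha^{-3}\kappa$ (extended to $r_\alpha=0$) and $\Sigma^\pm_{\tilde\gamma_\alpha}=\{\tilde\gamma_\alpha=\pm1\}$, near the collision manifold. On $\Sigma^+_{\tilde\gamma_\alpha}$ use the coordinates $(r_{\alpha1},\beta_{\alpha1},\delta_{\alpha1},u_1)$, the values of $(r_\alpha,\beta_\alpha,\delta_\alpha,u)$; on $\Sigma^-_{\tilde\gamma_\alpha}$ use coordinates $(r_{\alpha2},\beta_{\alpha2},\delta_{\alpha2},u_2)$ for the point with $(r_\alpha,\beta_\alpha,\delta_\alpha,u)=(-r_{\alpha2},-\beta_{\alpha2},-\delta_{\alpha2},u_2)$.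 **Lemma.** Normal form coordinates with an approximate integral $\kappa$ exist at $(0,u^*)$. For every choice of normal form coordinates and of $\kappa$ there are $a>0$, a neighbourhood $N$ of $u^*$ and a constant $C$ such that for all $|r_{\alpha1}|<a$, $|\beta_{\alpha1}|\le1$, $|\delta_{\alpha1}|\le1$, $u_1\in N$ there is exactly one point of $\Sigma^+_{\tilde\gamma_\alpha}$ near the collision manifold with the coordinates $(r_{\alpha1},\beta_{\alpha1},\delta_{\alpha1},u_1)$; the orbit of $X_\gamma$ through it (taken in the direction of decreasing $\alpha_\gamma$) reaches $\Sigma^-_{\tilde\gamma_\alpha}$; and the coordinates $(r_{\alpha2},\beta_{\alpha2},\delta_{\alpha2},u_2)=T_{\tilde\gamma_\alpha}(r_{\alpha1},\beta_{\alpha1},\delta_{\alpha1},u_1)$ of the first point where it does satisfy $$|r_{\alpha2}-r_{\alpha1}|\le C|r_{\alpha1}|^7,\quad|\beta_{\alpha2}-\beta_{\alpha1}|\le C|r_{\alpha1}|^7,\quad|\delta_{\alpha2}-\delta_{\alpha1}|\le C|r_{\alpha1}|^7,\quad|u_2-u_1|\le C|r_{\alpha1}|^8 .$$ -/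

import Mathlib

open Filter Topology Asymptotics
open scoped ContDiff ComplexConjugate

namespace SBC

noncomputable section

/-! ### The planar four-body problem near simultaneous binary collision -/

/-- The variables `u = (h, θ, x, y)`: scaled intrinsic energies `h = (h₁, h₂)` of the two binaries,
angles `θ = (θ₁, θ₂)` coordinatising the unit complex numbers `Γⱼ = exp (i θⱼ)`, the vector `x`
joining the centres of mass of the binaries, and its conjugate momentum `y`.  This is also a
coordinatisation of the manifold of simultaneous binary collisions `ζ₁ = ζ₂ = 0`. -/
abbrev Base : Type := (Fin 2 → ℝ) × (Fin 2 → ℝ) × ℂ × ℂ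

/-- Generalised Levi-Civita coordinates `(ζ, u)` with `ζ = (ζ₁, ζ₂)`, `ζⱼ = Iⱼ + i Lⱼ`.
The two binaries are indexed by `Fin 2`; the index of the other binary is `j.rev`. -/
abbrev Phase : Type := (Fin 2 → ℂ) × Base

/-- The scaled intrinsic energies `h` of `u`. -/
def Base.energy (u : Base) : Fin 2 → ℝ := u.1
/-- The angles `θ` of `u`, `Γⱼ = exp (i θⱼ)`. -/
def Base.angle (u : Base) : Fin 2 → ℝ := u.2.1
/-- The separation `x` of the two centres of mass. -/
def Base.sep (u : Base) : ℂ := u.2.2.1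
/-- The momentum `y` conjugate to `x`. -/
def Base.mom (u : Base) : ℂ := u.2.2.2

/-- Bodies `0, 1` form the first binary and bodies `2, 3` the second; `redMass m j` is `Mⱼ`. -/
def redMass (m : Fin 4 → ℝ) : Fin 2 → ℝ :=
  ![m 0 * m 1 / (m 0 + m 1), m 2 * m 3 / (m 2 + m 3)]

/-- `kⱼ`, the product of the two masses of the `j`-th binary. -/
def massProd (m : Fin 4 → ℝ) : Fin 2 → ℝ := ![m 0 * m 1, m 2 * m 3]

/-- `aⱼ = 16 kⱼ² Mⱼ`. -/
def aConst (m : Fin 4 → ℝ) (j : Fin 2) : ℝ := 16 * massProd m j ^ 2 * redMass m j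

/-- `aⱼ ^ (1/3)`. -/
def aRoot (m : Fin 4 → ℝ) (j : Fin 2) : ℝ := aConst m j ^ (1 / 3 : ℝ)

/-- `μ`, the inverse of the reduced mass of the two binaries. -/
def muConst (m : Fin 4 → ℝ) : ℝ :=
  (m 0 + m 1 + m 2 + m 3) / ((m 0 + m 1) * (m 2 + m 3))

/-- The part of the (negative) Newtonian potential coupling the two binaries, in terms of the
difference vectors `Q₁, Q₂` inside the binaries and of `x`. -/
def coupling (m : Fin 4 → ℝ) (Q : Fin 2 → ℂ) (x : ℂ) : ℝ :=
  m 0 * m 2 / ‖x + ((redMass m 0 / m 0 : ℝ) : ℂ) * Q 0 - ((redMass m 1 / m 2 : ℝ) : ℂ) * Q 1‖ +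
  m 0 * m 3 / ‖x + ((redMass m 0 / m 0 : ℝ) : ℂ) * Q 0 + ((redMass m 1 / m 3 : ℝ) : ℂ) * Q 1‖ +
  m 1 * m 2 / ‖x - ((redMass m 0 / m 1 : ℝ) : ℂ) * Q 0 - ((redMass m 1 / m 2 : ℝ) : ℂ) * Q 1‖ +
  m 1 * m 3 / ‖x - ((redMass m 0 / m 1 : ℝ) : ℂ) * Q 0 + ((redMass m 1 / m 3 : ℝ) : ℂ) * Q 1‖

/-- The coupling potential in the Levi-Civita variables `zⱼ`, where `4 kⱼ Mⱼ Qⱼ = zⱼ² / 2`. -/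
def couplingLC (m : Fin 4 → ℝ) (z : Fin 2 → ℂ) (x : ℂ) : ℝ :=
  coupling m (fun j => z j ^ 2 / ((8 * massProd m j * redMass m j : ℝ) : ℂ)) x

/-- Gradient of the coupling potential with respect to `zⱼ ∈ ℂ ≅ ℝ²`. -/
def gradZ (m : Fin 4 → ℝ) (z : Fin 2 → ℂ) (x : ℂ) (j : Fin 2) : ℂ :=
  gradient (fun w : ℂ => couplingLC m (Function.update z j w) x) (z j)

/-- Gradient of the coupling potential with respect to `x ∈ ℂ ≅ ℝ²`. -/
def gradX (m : Fin 4 → ℝ) (z : Fin 2 → ℂ) (x : ℂ) : ℂ :=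
  gradient (fun w : ℂ => couplingLC m z w) x

/-- `Uⱼ = |uⱼ|`, the magnitude of the Levi-Civita momentum: the solution of
`hⱼ |ζⱼ|² = U² (U² - 1)` on the branch `U > 1/√2`, where `U = 1` at `ζⱼ = 0`. -/
def magU (q : Phase) (j : Fin 2) : ℝ :=
  √((1 + √(1 + 4 * q.2.energy j * ‖q.1 j‖ ^ 2)) / 2)

theorem magU_spec (q : Phase) (j : Fin 2) (hq : 0 ≤ 1 + 4 * q.2.energy j * ‖q.1 j‖ ^ 2) :
    magU q j ^ 2 * (magU q j ^ 2 - 1) = q.2.energy j * ‖q.1 j‖ ^ 2 := by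
  have h1 : magU q j ^ 2 = (1 + √(1 + 4 * q.2.energy j * ‖q.1 j‖ ^ 2)) / 2 :=
    Real.sq_sqrt (by positivity)
  rw [h1]
  nlinarith [Real.sq_sqrt hq]

/-- `Γⱼ = exp (i θⱼ)`. -/
def Gam (q : Phase) (j : Fin 2) : ℂ := Complex.exp ((q.2.angle j : ℂ) * Complex.I)

/-- The Levi-Civita position `zⱼ = aⱼ^(1/3) Uⱼ⁻¹ Γⱼ ζⱼ`. -/
def zLC (m : Fin 4 → ℝ) (q : Phase) (j : Fin 2) : ℂ :=
  ((aRoot m j / magU q j : ℝ) : ℂ) * Gam q j * q.1 j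

/-- The vector field of the planar four-body problem in generalised Levi-Civita coordinates, in the
fictitious time `τ` with `dt = |ζ₁|² |ζ₂|² dτ`.  With `g` the real gradient of the coupling potential
`K`, `2 ∂K/∂zⱼ` is `conj g`. -/
def field (m : Fin 4 → ℝ) (q : Phase) : Phase :=
  (fun j =>
      ((‖q.1 j.rev‖ ^ 2 * (magU q j ^ 2 + 2 * q.2.energy j * ‖q.1 j‖ ^ 2) : ℝ) : ℂ) +
        ((‖q.1 j.rev‖ ^ 2 * ‖q.1 j‖ ^ 2 / aRoot m j : ℝ) : ℂ) *
          (zLC m q j * conj (gradZ m (zLC m q) q.2.sep j)),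
   fun j =>
      2 * ‖q.1 j.rev‖ ^ 2 * magU q j ^ 3 *
        (Gam q j * conj (gradZ m (zLC m q) q.2.sep j)).re,
   fun j =>
      ‖q.1 j.rev‖ ^ 2 * (q.2.energy j * (q.1 j).im -
        ‖q.1 j‖ ^ 2 * (Gam q j * conj (gradZ m (zLC m q) q.2.sep j)).im / magU q j),
   ((‖q.1 0‖ ^ 2 * ‖q.1 1‖ ^ 2 * muConst m : ℝ) : ℂ) * q.2.mom,
   ((‖q.1 0‖ ^ 2 * ‖q.1 1‖ ^ 2 : ℝ) : ℂ) * gradX m (zLC m q) q.2.sep)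

/-! ### Normal form -/

/-- A family, smooth near `p₀`, of homogeneous real polynomials of degree `k` in
`(I₁, L₁, I₂, L₂)`. -/
def IsHomFamily {P : Type} [NormedAddCommGroup P] [NormedSpace ℝ P] (k : ℕ) (p₀ : P)
    (R : P → MvPolynomial (Fin 4) ℝ) : Prop :=
  (∀ p, (R p).IsHomogeneous k) ∧ ∀ d, ContDiffAt ℝ ∞ (fun p => (R p).coeff d) p₀

/-- The real coordinates `(I₁, L₁, I₂, L₂)` of `ζ`. -/
def realCoords (ζ : Fin 2 → ℂ) : Fin 4 → ℝ := ![(ζ 0).re, (ζ 0).im, (ζ 1).re, (ζ 1).im]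

/-- The vector field `X` expressed in the new coordinates `Φ`. -/
def transformedField (m : Fin 4 → ℝ) (Φ : OpenPartialHomeomorph Phase Phase) (Q : Phase) : Phase :=
  fderiv ℝ Φ (Φ.symm Q) (field m (Φ.symm Q))

/-- The coordinate change `Φ`, defined near the simultaneous binary collision `(0, u₀)`, is smooth
and near-identity and brings `X` to the normal form
`Iⱼ' = |ζ_k|² + R⁴ⱼ + R⁶ⱼ + R⁸ⱼ` (`k` the other index), `Lⱼ' = 0`,
`h₁' = a₁^(-1/3) R⁹`, `h₂' = - a₂^(-1/3) R⁹`, `Γⱼ' = x' = y' = 0`,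
up to and including degree `9` in `ζ`, locally uniformly in `u`. -/
def IsNormalForm (m : Fin 4 → ℝ) (u₀ : Base) (Φ : OpenPartialHomeomorph Phase Phase) : Prop :=
  (0, u₀) ∈ Φ.source ∧ ContDiffOn ℝ ∞ Φ Φ.source ∧ ContDiffOn ℝ ∞ Φ.symm Φ.target ∧
  ((fun q : Phase => Φ q - q) =O[𝓝 (0, u₀)] fun q => ‖q.1‖ ^ 2) ∧
  ∃ (R₄ R₆ : Fin 2 → (Fin 2 → ℝ) → MvPolynomial (Fin 4) ℝ)
    (R₈ : Fin 2 → Base → MvPolynomial (Fin 4) ℝ) (R₉ : Base → MvPolynomial (Fin 4) ℝ),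
    (∀ j, IsHomFamily 4 u₀.energy (R₄ j)) ∧ (∀ j, IsHomFamily 6 u₀.energy (R₆ j)) ∧
    (∀ j, IsHomFamily 8 u₀ (R₈ j)) ∧ IsHomFamily 9 u₀ R₉ ∧
    ((fun Q : Phase => transformedField m Φ Q -
        ((fun j => ((‖Q.1 j.rev‖ ^ 2 + (R₄ j Q.2.energy).eval (realCoords Q.1) +
            (R₆ j Q.2.energy).eval (realCoords Q.1) +
            (R₈ j Q.2).eval (realCoords Q.1) : ℝ) : ℂ),
          ![(R₉ Q.2).eval (realCoords Q.1) / aRoot m 0,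
            -((R₉ Q.2).eval (realCoords Q.1) / aRoot m 1)],
          0, 0, 0) : Phase))
      =O[𝓝 (0, u₀)] fun Q => ‖Q.1‖ ^ 10)

/-- The cubic `(I₁³ + 3 I₁ L₁²) - (I₂³ + 3 I₂ L₂²)` in `v = (I₁, L₁, I₂, L₂)`. -/
def kappaLead (v : Fin 4 → ℝ) : ℝ :=
  (v 0 ^ 3 + 3 * v 0 * v 1 ^ 2) - (v 2 ^ 3 + 3 * v 2 * v 3 ^ 2)

/-- `κ = (I₁³ + 3 I₁ L₁²) - (I₂³ + 3 I₂ L₂²) + G⁵ + G⁷` in the normal form coordinates. -/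
def kappa (G₅ G₇ : (Fin 2 → ℝ) → MvPolynomial (Fin 4) ℝ) (Q : Phase) : ℝ :=
  kappaLead (realCoords Q.1) + (G₅ Q.2.energy).eval (realCoords Q.1) +
    (G₇ Q.2.energy).eval (realCoords Q.1)

/-- `κ` is an integral of the normal form: `κ' = 0` up to and including degree `10` in `ζ`, the
degrees that the normal form to degree `9` determines. -/
def IsApproxIntegral (m : Fin 4 → ℝ) (u₀ : Base) (Φ : OpenPartialHomeomorph Phase Phase)
    (G₅ G₇ : (Fin 2 → ℝ) → MvPolynomial (Fin 4) ℝ) : Prop :=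
  IsHomFamily 5 u₀.energy G₅ ∧ IsHomFamily 7 u₀.energy G₇ ∧
  ((fun Q : Phase => fderiv ℝ (kappa G₅ G₇) Q (transformedField m Φ Q))
    =O[𝓝 (0, u₀)] fun Q => ‖Q.1‖ ^ 11)

/-! ### Blow-up

With `J₁ = (I₁ + I₂)/2`, `J₂ = (I₁ - I₂)/2`, the point `(J₁, L₁, J₂, L₂) = 0` is blown up.  The
`α`-chart has `(J₁, L₁, J₂, L₂) = r_α (1, β_α, γ_α, δ_α)`, the `γ`-chart has
`(J₁, L₁, J₂, L₂) = r_γ (α_γ, β_γ, 1, δ_γ)`; they are related by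
`r_α = r_γ α_γ`, `β_α = β_γ / α_γ`, `δ_α = δ_γ / α_γ`.  The collision manifold is `r = 0`. -/

/-- Points `(r_γ, α_γ, β_γ, δ_γ, u)` of the `γ`-chart. -/
abbrev Chart : Type := ℝ × ℝ × ℝ × ℝ × Base

/-- The blow-down map from the `γ`-chart to the normal form coordinates. -/
def blowDown : Chart → Phase := fun (r, α, β, δ, u) =>
  (![⟨r * (α + 1), r * β⟩, ⟨r * (α - 1), r * δ⟩], u)

/-- The desingularised vector field `r_γ⁻¹ X` in the `γ`-chart.  For `r ≠ 0` it is the pull-back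
under the blow-down map of the transformed vector field, divided by `r`; for `r = 0`
it is the continuous extension of this field to the collision manifold. -/
def blowUpField (m : Fin 4 → ℝ) (Φ : OpenPartialHomeomorph Phase Phase) : Chart → Chart :=
  fun (r, α, β, δ, u) =>
    if r = 0 then
      (0, 1 + 3 * α ^ 2 + (β ^ 2 + δ ^ 2) / 2 + α * (β ^ 2 - δ ^ 2) / 2,
        β * (2 * α + (β ^ 2 - δ ^ 2) / 2), δ * (2 * α + (β ^ 2 - δ ^ 2) / 2), 0)
    else
      let V := transformedField m Φ (blowDown (r, α, β, δ, u))
      let dJ₁ : ℝ := ((V.1 0).re + (V.1 1).re) / 2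
      let dJ₂ : ℝ := ((V.1 0).re - (V.1 1).re) / 2
      let dL₁ : ℝ := (V.1 0).im
      let dL₂ : ℝ := (V.1 1).im
      r⁻¹ • (dJ₂, (dJ₁ - α * dJ₂) / r, (dL₁ - β * dJ₂) / r, (dL₂ - δ * dJ₂) / r, V.2)

/-- `γ̃_α = r_α⁻³ κ / 6` as a function on the `γ`-chart where `α_γ ≠ 0`; the power `r_γ³` has
been cancelled, so that the formula is meaningful on the collision manifold too. -/
def gammaTilde (G₅ G₇ : (Fin 2 → ℝ) → MvPolynomial (Fin 4) ℝ) : Chart → ℝ :=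
  fun (r, α, β, δ, u) =>
    (kappaLead ![α + 1, β, α - 1, δ] + r ^ 2 * (G₅ u.energy).eval ![α + 1, β, α - 1, δ] +
      r ^ 4 * (G₇ u.energy).eval ![α + 1, β, α - 1, δ]) / (6 * α ^ 3)

/-- The section `γ̃_α = σ`; the faces `Σ⁺` and `Σ⁻` are the cases `σ = 1` and `σ = -1`. -/
def OnFace (G₅ G₇ : (Fin 2 → ℝ) → MvPolynomial (Fin 4) ℝ) (σ : ℝ) (w : Chart) : Prop :=
  w.2.1 ≠ 0 ∧ gammaTilde G₅ G₇ w = σ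

/-- The coordinates `(σ r_α, σ β_α, σ δ_α, u)` on the section `γ̃_α = σ`: a point of `Σ⁺` with
coordinates `(r, β, δ, u)` has `(r_α, β_α, δ_α) = (r, β, δ)`, a point of `Σ⁻` with these
coordinates has `(r_α, β_α, δ_α) = (-r, -β, -δ)`. -/
def faceCoords (σ : ℝ) : Chart → ℝ × ℝ × ℝ × Base := fun (r, α, β, δ, u) =>
  (σ * (r * α), σ * (β / α), σ * (δ / α), u)

/-- `w₂` is the first point of `Σ⁻` on the orbit of the desingularised vector field that leaves
`w₁` in the direction of decreasing `α_γ`, that is, from `Σ⁺` to `Σ⁻` (the field is only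
used as a line field, and on the collision manifold it runs from `Σ⁻` to `Σ⁺`). -/
def IsTransition (m : Fin 4 → ℝ) (Φ : OpenPartialHomeomorph Phase Phase)
    (G₅ G₇ : (Fin 2 → ℝ) → MvPolynomial (Fin 4) ℝ) (w₁ w₂ : Chart) : Prop :=
  ∃ (s : ℝ) (c : ℝ → Chart), 0 < s ∧ c 0 = w₁ ∧ c s = w₂ ∧
    (∀ t ∈ Set.Icc 0 s, blowDown (c t) ∈ Φ.target ∧
      HasDerivWithinAt c (-blowUpField m Φ (c t)) (Set.Icc 0 s) t) ∧
    OnFace G₅ G₇ (-1) w₂ ∧ ∀ t ∈ Set.Ico 0 s, ¬ OnFace G₅ G₇ (-1) (c t)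

end

end SBC

open SBC

/-! There are two halves: normal form coordinates with an approximate integral exist, and any such
pair forces the transition to be the identity up to order seven.

Existence. The coupling potential is expanded in the squares z_j². Positions are measured from the
centres of mass, so the terms linear in one of the squares cancel on summation over the two bodies
of that binary. The part that depends on one binary therefore starts with a quartic form Re(c z⁴) +
d|z|⁴, and the part that depends on both vanishes to order 8 (`vanishOrder_binPot`,
`vanishOrder_mixPot`). Consequently binary j moves with |ζ_k|² times the field of an isolated
binary, k being the other index, up to mixed terms of high order (`eventually_binProj_field`). Along
the isolated field, normalised by I' = 1, a truncated Taylor series in I is an antiderivative with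
remainder of order 8, and the factor |ζ_k|² adds two orders. Subtracting from a function the
antiderivative of its rate makes it constant up to order 10, apart from mixed terms
(`vanishOrder_fderiv_sub_binAnti`). This settles the angles, x and y. The energy rates that survive
have order 9 and come from the mixed potential; subtracting a multiple of it from the second energy
makes the two weighted rates opposite.

To ζ a correction F + iG of degree 7 is added. Write ρ = |ζ|² and let Q be the quartic form in ζ.
The form G removes the imaginary part of the rate. The form F is dictated by κ. Let κ be the
difference of two functions K(h_j, ζ_j) with ∂K/∂I = 3ρ - 9hρ² + 30h²ρ³, a truncation of 3ρ/(1 + 3hρ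
- h²ρ² + 2h³ρ³), the denominator being the leading rate of I. Then κ' cancels in degrees 4, 6 and 8,
and in degree 10 it cancels if ∂(ρF)/∂I = -(5/2)ρ²Q - 35h³ρ⁴ - 2LG. The integration constants of F
and G make this solvable in polynomials (`binForm_deriv_corrRe`, `vanishOrder_kappa_nfVec`).

Transition. With ε = r_α at the start, divide (J₁, L₁, J₂, L₂) by ε and use lower case letters for
the quotients. The orbit starts at j₁ = 1 with ε⁻³κ = 6. After division of the field by -r_γ = -εj₂,
the coordinate j₁ decreases at a definite rate, the rescaled L and u drift by O(ε⁸), and ε⁻³κ drifts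
by O(ε⁷). On Σ⁻ one has ε⁻³κ = -6j₁³, hence j₁ = -1 + O(ε⁷), and all the estimates follow
(`FieldBounds.exists_transit`). The near conservation of κ also keeps j₂ away from 0, so the orbit
stays in the γ-chart (`bounds_of_scaledKappa`). Monotonicity of κ in j₂ gives the unique point of Σ⁺
(`FieldBounds.exists_start`). A one-sided Lipschitz estimate across r = 0 gives uniqueness of the
orbit (`FieldBounds.exists_lipschitz`), so the transition is a well-defined map. -/

namespace SBC

noncomputable section

/-! ### Germs vanishing to a given order along `ζ = 0` -/

section VanishOrder

variable {E B F G H : Type} [NormedAddCommGroup E] [NormedSpace ℝ E] [NormedAddCommGroup B]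
  [NormedSpace ℝ B] [NormedAddCommGroup F] [NormedSpace ℝ F] [NormedAddCommGroup G]
  [NormedSpace ℝ G] [NormedAddCommGroup H] [NormedSpace ℝ H]

/-- `VanishOrder p₀ k f`: the function `f` of `(ζ, u)` is smooth near `(0, p₀)`, and belongs there to
the `k`-th power of the ideal generated by the linear functions of `ζ`. -/
inductive VanishOrder (p₀ : B) : ℕ → (E × B → F) → Prop
  | smooth {f : E × B → F} : ContDiffAt ℝ ω f (0, p₀) → VanishOrder p₀ 0 f
  | mul {k : ℕ} {f : E × B → F} (l : E →L[ℝ] ℝ) : VanishOrder p₀ k f →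
      VanishOrder p₀ (k + 1) (fun q => l q.1 • f q)
  | add {k : ℕ} {f g : E × B → F} : VanishOrder p₀ k f → VanishOrder p₀ k g →
      VanishOrder p₀ k (fun q => f q + g q)
  | congr {k : ℕ} {f g : E × B → F} : VanishOrder p₀ k f → f =ᶠ[𝓝 (0, p₀)] g →
      VanishOrder p₀ k g

namespace VanishOrder

variable {p₀ : B} {k n a b : ℕ} {f g : E × B → F}

theorem contDiffAt (h : VanishOrder p₀ k f) : ContDiffAt ℝ ω f (0, p₀) := by
  induction h with
  | smooth h => exact h
  | mul l _ ih => exact (l.contDiff.contDiffAt.comp _ contDiffAt_fst).smul ih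
  | add _ _ ih₁ ih₂ => exact ih₁.add ih₂
  | congr _ e ih => exact ih.congr_of_eventuallyEq e.symm

theorem isBigO (h : VanishOrder p₀ k f) : f =O[𝓝 (0, p₀)] fun q => ‖q.1‖ ^ k := by
  induction h with
  | smooth h => simpa using h.continuousAt.isBigO_one ℝ
  | @mul k f l _ ih =>
    have h1 : (fun q : E × B => l q.1) =O[𝓝 (0, p₀)] fun q => ‖q.1‖ :=
      (l.isBigO_comp (fun q : E × B => q.1) _).norm_right
    exact (h1.smul ih).congr_right fun q => by simp [pow_succ, mul_comm]
  | add _ _ ih₁ ih₂ => exact ih₁.add ih₂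
  | congr _ e ih => exact ih.congr' e EventuallyEq.rfl

theorem mono (h : VanishOrder p₀ k f) {j : ℕ} (hj : j ≤ k) : VanishOrder p₀ j f := by
  induction h generalizing j with
  | smooth h => obtain rfl : j = 0 := by omega
                exact smooth h
  | @mul k f l hf ih =>
    cases j with
    | zero => exact smooth (mul l hf).contDiffAt
    | succ j => exact mul l (ih (by omega))
  | add _ _ ih₁ ih₂ => exact add (ih₁ hj) (ih₂ hj)
  | congr _ e ih => exact congr (ih hj) e

/-- Continuous bilinear maps add orders. -/
theorem bilin (L : F →L[ℝ] G →L[ℝ] H) {g : E × B → G} (hf : VanishOrder p₀ a f)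
    (hg : VanishOrder p₀ b g) : VanishOrder p₀ (a + b) (fun q => L (f q) (g q)) := by
  induction hf with
  | @smooth f hf =>
    rw [zero_add]
    induction hg with
    | smooth hg => exact smooth ((L.contDiff.contDiffAt.comp _ hf).clm_apply hg)
    | mul l _ ih => exact congr (mul l ih) (by filter_upwards with q using by simp)
    | add _ _ ih₁ ih₂ => exact congr (add ih₁ ih₂) (by filter_upwards with q using by simp)
    | congr _ e ih => exact congr ih (by filter_upwards [e] with q hq using by rw [hq])
  | @mul k f l _ ih =>
    rw [show k + 1 + b = k + b + 1 by ring]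
    exact congr (mul l ih) (by filter_upwards with q using by simp)
  | add _ _ ih₁ ih₂ => exact congr (add ih₁ ih₂) (by filter_upwards with q using by simp)
  | congr _ e ih => exact congr ih (by filter_upwards [e] with q hq using by rw [hq])

theorem clm (L : F →L[ℝ] G) (hf : VanishOrder p₀ k f) : VanishOrder p₀ k (fun q => L (f q)) := by
  induction hf with
  | smooth hf => exact smooth (L.contDiff.contDiffAt.comp _ hf)
  | mul l _ ih => exact congr (mul l ih) (by filter_upwards with q using by simp)
  | add _ _ ih₁ ih₂ => exact congr (add ih₁ ih₂) (by filter_upwards with q using by simp)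
  | congr _ e ih => exact congr ih (by filter_upwards [e] with q hq using by rw [hq])

theorem smul {s : E × B → ℝ} (hs : VanishOrder p₀ a s) (hf : VanishOrder p₀ b f) :
    VanishOrder p₀ (a + b) (fun q => s q • f q) :=
  bilin (ContinuousLinearMap.lsmul ℝ ℝ) hs hf

theorem mul' {A : Type} [NormedRing A] [NormedAlgebra ℝ A] {f g : E × B → A}
    (hf : VanishOrder p₀ a f) (hg : VanishOrder p₀ b g) :
    VanishOrder p₀ (a + b) (fun q => f q * g q) :=
  bilin (ContinuousLinearMap.mul ℝ A) hf hg

theorem neg (hf : VanishOrder p₀ k f) : VanishOrder p₀ k (fun q => -f q) :=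
  clm (-ContinuousLinearMap.id ℝ F) hf

theorem sub (hf : VanishOrder p₀ k f) (hg : VanishOrder p₀ k g) :
    VanishOrder p₀ k (fun q => f q - g q) :=
  congr (add hf hg.neg) (by filter_upwards with q using by rw [sub_eq_add_neg])

theorem const_mul {A : Type} [NormedRing A] [NormedAlgebra ℝ A] {f : E × B → A} (c : A)
    (hf : VanishOrder p₀ k f) : VanishOrder p₀ k (fun q => c * f q) :=
  clm (ContinuousLinearMap.mul ℝ A c) hf

theorem zero (k : ℕ) : VanishOrder p₀ k (fun _ : E × B => (0 : F)) := by
  induction k with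
  | zero => exact smooth contDiffAt_const
  | succ k ih => exact congr (mul 0 ih) (by filter_upwards with q using by simp)

theorem sum {ι : Type} (s : Finset ι) {f : ι → E × B → F} (h : ∀ i ∈ s, VanishOrder p₀ k (f i)) :
    VanishOrder p₀ k (fun q => ∑ i ∈ s, f i q) := by
  classical
  induction s using Finset.induction_on with
  | empty => simpa using zero k
  | insert i s hi ih =>
    simp only [Finset.sum_insert hi]
    exact add (h i (by simp)) (ih fun j hj => h j (by simp [hj]))

theorem pow {A : Type} [NormedRing A] [NormedAlgebra ℝ A] {f : E × B → A}
    (hf : VanishOrder p₀ a f) (n : ℕ) : VanishOrder p₀ (n * a) (fun q => f q ^ n) := by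
  induction n with
  | zero => simpa using smooth contDiffAt_const
  | succ n ih => simpa [pow_succ, add_mul] using mul' ih hf

theorem prodMk {g : E × B → G} (hf : VanishOrder p₀ k f) (hg : VanishOrder p₀ k g) :
    VanishOrder p₀ k (fun q => (f q, g q)) :=
  congr (add (clm (ContinuousLinearMap.inl ℝ F G) hf) (clm (ContinuousLinearMap.inr ℝ F G) hg))
    (by filter_upwards with q using by simp)

theorem pi {ι : Type} [Fintype ι] {f : E × B → ι → F}
    (hf : ∀ i, VanishOrder p₀ k (fun q => f q i)) : VanishOrder p₀ k f := by
  classical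
  refine congr (sum Finset.univ fun i _ =>
    clm (ContinuousLinearMap.single ℝ (fun _ : ι => F) i) (hf i)) ?_
  filter_upwards with q
  ext j
  simp [Finset.sum_apply, Pi.single_apply]

/-- A continuous linear function of `ζ` vanishes to first order. -/
theorem linear [FiniteDimensional ℝ E] (L : E →L[ℝ] F) :
    VanishOrder p₀ 1 (fun q : E × B => L q.1) := by
  let b := Module.finBasis ℝ E
  refine congr (sum Finset.univ fun i _ => mul (p₀ := p₀) (f := fun _ => L (b i))
    (LinearMap.toContinuousLinearMap (b.coord i)) (smooth contDiffAt_const)) ?_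
  filter_upwards with q
  conv_rhs => rw [← b.sum_repr q.1]
  simp only [map_sum, map_smul]
  rfl

theorem eventually_contDiffAt (hf : VanishOrder p₀ k f) :
    ∀ᶠ q in 𝓝 ((0 : E), p₀), ContDiffAt ℝ 1 f q :=
  (hf.contDiffAt.of_le (m := 1) le_top).eventually (by simp)

theorem eventually_differentiableAt (hf : VanishOrder p₀ k f) :
    ∀ᶠ q in 𝓝 ((0 : E), p₀), DifferentiableAt ℝ f q :=
  hf.eventually_contDiffAt.mono fun _ h => h.differentiableAt (by simp)

theorem smooth_fderiv {v : E × B → E × B} (hf : ContDiffAt ℝ ω f (0, p₀))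
    (hv : ContDiffAt ℝ ω v (0, p₀)) : ContDiffAt ℝ ω (fun q => fderiv ℝ f q (v q)) (0, p₀) :=
  (hf.fderiv_right le_top).clm_apply hv

theorem fderiv_mul_eventuallyEq (l : E →L[ℝ] ℝ) (hf : VanishOrder p₀ k f) :
    ∀ᶠ q in 𝓝 ((0 : E), p₀), ∀ w : E × B, fderiv ℝ (fun q => l q.1 • f q) q w =
      l w.1 • f q + l q.1 • fderiv ℝ f q w := by
  filter_upwards [hf.eventually_differentiableAt] with q hq w
  have h := (l.hasFDerivAt.comp q (hasFDerivAt_fst (𝕜 := ℝ) (p := q))).smul hq.hasFDerivAt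
  have e : (fun q : E × B => l q.1 • f q) = (l ∘ Prod.fst : E × B → ℝ) • f := rfl
  rw [e, h.fderiv]
  simp [add_comm]

/-- Differentiation along a smooth vector field lowers the order by at most one. -/
theorem fderiv_apply (hf : VanishOrder p₀ k f) {v : E × B → E × B}
    (hv : ContDiffAt ℝ ω v (0, p₀)) : VanishOrder p₀ (k - 1) (fun q => fderiv ℝ f q (v q)) := by
  induction hf with
  | smooth h => exact smooth (smooth_fderiv h hv)
  | @mul k f l hf ih =>
    refine congr (add ?_ ?_) (p₀ := p₀) (k := k + 1 - 1)
      (f := fun q => l (v q).1 • f q + l q.1 • fderiv ℝ f q (v q))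
      ((fderiv_mul_eventuallyEq l hf).mono fun q hq => (hq (v q)).symm)
    · have h1 : VanishOrder p₀ 0 (fun q => l (v q).1) :=
        smooth (l.contDiff.contDiffAt.comp _ (contDiffAt_fst.comp _ hv))
      simpa using h1.smul hf
    -- The order `k - 1` is a truncated difference: for `k = 0` nothing beyond smoothness is
    -- claimed.
    · cases k with
      | zero => exact smooth ((mul l ih).contDiffAt)
      | succ k => exact mul l ih
  | add h₁ h₂ ih₁ ih₂ =>
    refine congr (add ih₁ ih₂) ?_
    filter_upwards [h₁.eventually_differentiableAt, h₂.eventually_differentiableAt] with q h1 h2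
    rw [fderiv_fun_add h1 h2]; rfl
  | congr _ e ih =>
    refine congr ih ?_
    filter_upwards [e.fderiv (𝕜 := ℝ)] with q hq
    rw [hq]

/-- Composition with a smooth map whose first component vanishes to order `a`. -/
theorem comp {E' B' : Type} [NormedAddCommGroup E'] [NormedSpace ℝ E'] [NormedAddCommGroup B']
    [NormedSpace ℝ B'] {p₁ : B'} {f : E' × B' → F} (hf : VanishOrder p₁ k f)
    {ψ : E × B → E' × B'} (hψ : ContDiffAt ℝ ω ψ (0, p₀)) (h0 : ψ (0, p₀) = (0, p₁))
    (h1 : VanishOrder p₀ a (fun q => (ψ q).1)) : VanishOrder p₀ (k * a) (fun q => f (ψ q)) := by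
  induction hf with
  | smooth h =>
    rw [zero_mul]
    exact smooth (ContDiffAt.comp (0, p₀) (by rwa [h0]) hψ)
  | @mul k f l hf ih =>
    rw [show (k + 1) * a = a + k * a by ring]
    exact (clm l h1).smul ih
  | add _ _ ih₁ ih₂ => exact add ih₁ ih₂
  | congr _ e ih =>
    refine congr ih ?_
    have : Tendsto ψ (𝓝 (0, p₀)) (𝓝 (0, p₁)) := h0 ▸ hψ.continuousAt
    exact this.eventually e

/-- Differentiation at the image of a smooth map `ψ`, in a direction with components of orders
`c + 1` and `c`. -/
theorem fderiv_comp_apply {E' B' : Type} [NormedAddCommGroup E'] [NormedSpace ℝ E']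
    [NormedAddCommGroup B'] [NormedSpace ℝ B'] {p₁ : B'} {f : E' × B' → F}
    (hf : VanishOrder p₁ k f) {ψ : E × B → E' × B'} (hψ : ContDiffAt ℝ ω ψ (0, p₀))
    (h0 : ψ (0, p₀) = (0, p₁)) (h1 : VanishOrder p₀ 1 (fun q => (ψ q).1))
    {w : E × B → E' × B'} {c : ℕ} (hw₁ : VanishOrder p₀ (c + 1) (fun q => (w q).1))
    (hw₂ : VanishOrder p₀ c (fun q => (w q).2)) :
    VanishOrder p₀ (k + c) (fun q => fderiv ℝ f (ψ q) (w q)) := by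
  have ht : Tendsto ψ (𝓝 (0, p₀)) (𝓝 (0, p₁)) := h0 ▸ hψ.continuousAt
  induction hf with
  | @smooth f h =>
    have h3 : VanishOrder p₀ c w := congr (prodMk (hw₁.mono (Nat.le_succ c)) hw₂) EventuallyEq.rfl
    have h4 : VanishOrder p₀ 0 (fun q => fderiv ℝ f (ψ q)) := smooth
      (ContDiffAt.comp (0, p₀) (g := fderiv ℝ f) (by rw [h0]; exact h.fderiv_right le_top)
        hψ)
    exact bilin (ContinuousLinearMap.id ℝ _) h4 h3
  | @mul k f l hf ih =>
    -- Product rule. In the first summand a factor of order 1 is replaced by one of order `c + 1`;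
    -- in the second the factor survives and the induction hypothesis applies.
    refine congr (add ?_ ?_) (p₀ := p₀) (k := k + 1 + c)
      (f := fun q => l (w q).1 • f (ψ q) + l (ψ q).1 • fderiv ℝ f (ψ q) (w q)) ?_
    · simpa [add_comm, add_left_comm] using (clm l hw₁).smul (by simpa using comp hf hψ h0 h1)
    · rw [show k + 1 + c = 1 + (k + c) by ring]
      exact (clm l h1).smul ih
    · filter_upwards [ht.eventually (fderiv_mul_eventuallyEq l hf)] with q hq using (hq (w q)).symm
  | add h₁ h₂ ih₁ ih₂ =>
    refine congr (add ih₁ ih₂) ?_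
    filter_upwards [ht.eventually h₁.eventually_differentiableAt,
      ht.eventually h₂.eventually_differentiableAt] with q h1 h2
    rw [fderiv_fun_add h1 h2]; rfl
  | congr _ e ih =>
    refine congr ih ?_
    filter_upwards [ht.eventually (e.fderiv (𝕜 := ℝ))] with q hq
    rw [hq]

/-- Differentiation along a vector field with components of orders `c + 1` and `c`. -/
theorem fderiv_apply_of_field [FiniteDimensional ℝ E] (hf : VanishOrder p₀ k f)
    {v : E × B → E × B} {c : ℕ} (h₁ : VanishOrder p₀ (c + 1) (fun q => (v q).1))
    (h₂ : VanishOrder p₀ c (fun q => (v q).2)) :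
    VanishOrder p₀ (k + c) (fun q => fderiv ℝ f q (v q)) :=
  fderiv_comp_apply (ψ := fun q => q) hf contDiffAt_id rfl
    (linear (ContinuousLinearMap.id ℝ E)) h₁ h₂

/-- A near-identity change of variables alters a function of order `k` by terms of order
`k + 2`. -/
theorem comp_sub_isBigO (hf : VanishOrder p₀ k f) {ψ : E × B → E × B}
    (h0 : ψ (0, p₀) = (0, p₀)) (hψ : ContinuousAt ψ (0, p₀))
    (h1 : (fun q => (ψ q).1 - q.1) =O[𝓝 (0, p₀)] fun q => ‖q.1‖ ^ 3)
    (h2 : (fun q => ψ q - q) =O[𝓝 (0, p₀)] fun q => ‖q.1‖ ^ 2) :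
    (fun q => f (ψ q) - f q) =O[𝓝 (0, p₀)] fun q => ‖q.1‖ ^ (k + 2) := by
  have ht : Tendsto ψ (𝓝 (0, p₀)) (𝓝 (0, p₀)) := by simpa only [ContinuousAt, h0] using hψ
  have h3 : (fun q => (ψ q).1) =O[𝓝 (0, p₀)] fun q => ‖q.1‖ := by
    have e1 : (fun q : E × B => ‖q.1‖ ^ 3) =O[𝓝 (0, p₀)] fun q => ‖q.1‖ := by
      have hb : (fun q : E × B => ‖q.1‖ ^ 2) =O[𝓝 (0, p₀)] fun _ => (1 : ℝ) :=
        ContinuousAt.tendsto (f := fun q : E × B => ‖q.1‖ ^ 2) (by fun_prop) |>.isBigO_one ℝ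
      exact (hb.mul (isBigO_refl (fun q : E × B => ‖q.1‖) _)).congr
        (fun q => by ring) (fun q => by ring)
    have := (h1.trans e1).add (isBigO_refl (fun q : E × B => q.1) (𝓝 (0, p₀))).norm_right
    simpa using this
  induction hf with
  | @smooth f h =>
    have hd : ContDiffAt ℝ 1 f (0, p₀) := h.of_le le_top
    obtain ⟨K, t, ht', hK⟩ := hd.exists_lipschitzOnWith
    refine IsBigO.trans (IsBigO.of_bound K ?_) (by rw [zero_add]; exact h2)
    filter_upwards [ht ht', ht'] with q hq1 hq2
    simpa [dist_eq_norm] using hK.dist_le_mul _ hq1 _ hq2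
  | @mul k f l hf ih =>
    -- The difference of products is `l (ψ - id) · f ∘ ψ + l · (f ∘ ψ - f)`. The first summand loses
    -- a linear factor, so the first component of `ψ - id` must be one order smaller than the rest.
    have e1 : (fun q => l ((ψ q).1 - q.1)) =O[𝓝 (0, p₀)] fun q : E × B => ‖q.1‖ ^ 3 :=
      (l.isBigO_comp _ _).trans h1
    have e2 : (fun q : E × B => l q.1) =O[𝓝 (0, p₀)] fun q => ‖q.1‖ :=
      (l.isBigO_comp (fun q : E × B => q.1) _).norm_right
    have e3 : (fun q => f (ψ q)) =O[𝓝 (0, p₀)] fun q : E × B => ‖q.1‖ ^ k :=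
      (hf.isBigO.comp_tendsto ht).trans (h3.norm_left.pow k)
    have := ((e1.smul e3).congr_right (g₂ := fun q => ‖q.1‖ ^ (k + 1 + 2))
      fun q => by simp; ring).add
      ((e2.smul ih).congr_right (g₂ := fun q => ‖q.1‖ ^ (k + 1 + 2)) fun q => by simp; ring)
    refine this.congr_left fun q => ?_
    simp only [map_sub, sub_smul, smul_sub]
    abel
  | add _ _ ih₁ ih₂ => exact (ih₁.add ih₂).congr_left fun q => sub_add_sub_comm _ _ _ _
  | congr _ e ih =>
    exact ih.congr' (by filter_upwards [e, ht.eventually e] with q h1 h2 using by rw [h1, h2])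
      EventuallyEq.rfl

end VanishOrder

end VanishOrder

end

end SBC

namespace SBC

noncomputable section

/-! ### Smooth families of homogeneous polynomials -/

namespace IsHomFamily

variable {P : Type} [NormedAddCommGroup P] [NormedSpace ℝ P] {k l : ℕ} {p₀ : P}
  {R S : P → MvPolynomial (Fin 4) ℝ}

theorem C {c : P → ℝ} (hc : ContDiffAt ℝ ∞ c p₀) :
    IsHomFamily 0 p₀ (fun p => MvPolynomial.C (c p)) := by
  classical
  refine ⟨fun p => MvPolynomial.isHomogeneous_C _ _, fun d => ?_⟩
  simp only [MvPolynomial.coeff_C]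
  split_ifs
  · exact hc
  · exact contDiffAt_const

theorem X (i : Fin 4) : IsHomFamily 1 p₀ (fun _ => MvPolynomial.X i) :=
  ⟨fun _ => MvPolynomial.isHomogeneous_X _ _, fun _ => contDiffAt_const⟩

theorem add (hR : IsHomFamily k p₀ R) (hS : IsHomFamily k p₀ S) :
    IsHomFamily k p₀ (fun p => R p + S p) :=
  ⟨fun p => (hR.1 p).add (hS.1 p), fun d => by
    simpa only [MvPolynomial.coeff_add] using (hR.2 d).add (hS.2 d)⟩

theorem mul (hR : IsHomFamily k p₀ R) (hS : IsHomFamily l p₀ S) :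
    IsHomFamily (k + l) p₀ (fun p => R p * S p) := by
  classical
  refine ⟨fun p => (hR.1 p).mul (hS.1 p), fun d => ?_⟩
  simp only [MvPolynomial.coeff_mul]
  exact ContDiffAt.sum fun x _ => (hR.2 x.1).mul (hS.2 x.2)

theorem smul {c : P → ℝ} (hc : ContDiffAt ℝ ∞ c p₀) (hR : IsHomFamily k p₀ R) :
    IsHomFamily k p₀ (fun p => MvPolynomial.C (c p) * R p) := by
  simpa using (C hc).mul hR

theorem neg (hR : IsHomFamily k p₀ R) : IsHomFamily k p₀ (fun p => -R p) := by
  simpa using hR.smul (c := fun _ => (-1 : ℝ)) contDiffAt_const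

theorem sub (hR : IsHomFamily k p₀ R) (hS : IsHomFamily k p₀ S) :
    IsHomFamily k p₀ (fun p => R p - S p) := by
  simpa only [sub_eq_add_neg] using hR.add hS.neg

theorem pow (hR : IsHomFamily k p₀ R) (n : ℕ) : IsHomFamily (n * k) p₀ (fun p => R p ^ n) := by
  induction n with
  | zero => simpa using C (p₀ := p₀) (c := fun _ => (1 : ℝ)) contDiffAt_const
  | succ n ih => simpa [pow_succ, add_mul] using ih.mul hR

theorem zero (k : ℕ) : IsHomFamily k p₀ (fun _ => 0) :=
  ⟨fun _ => MvPolynomial.isHomogeneous_zero _ _ _, fun _ => by simpa using contDiffAt_const⟩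

theorem sum {ι : Type} (s : Finset ι) {R : ι → P → MvPolynomial (Fin 4) ℝ}
    (h : ∀ i ∈ s, IsHomFamily k p₀ (R i)) : IsHomFamily k p₀ (fun p => ∑ i ∈ s, R i p) := by
  classical
  induction s using Finset.induction_on with
  | empty => simpa using zero k
  | insert i s hi ih =>
    simp only [Finset.sum_insert hi]
    exact (h i (by simp)).add (ih fun j hj => h j (by simp [hj]))

theorem comp {P' : Type} [NormedAddCommGroup P'] [NormedSpace ℝ P'] {p₁ : P'} {φ : P' → P}
    (hR : IsHomFamily k p₀ R) (hφ : ContDiffAt ℝ ∞ φ p₁) (h0 : φ p₁ = p₀) :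
    IsHomFamily k p₁ (fun p => R (φ p)) :=
  ⟨fun _ => hR.1 _, fun d => ContDiffAt.comp (g := fun p => (R p).coeff d) p₁
    (h0 ▸ hR.2 d) hφ⟩

/-- The index set is that of all exponents of degree `k`, independent of `p`, in contrast to the
support. Smoothness and bounds in `p` thereby reduce to finitely many coefficients. -/
theorem eval_eq (hR : IsHomFamily k p₀ R) (p : P) (v : Fin 4 → ℝ) :
    (R p).eval v = ∑ d ∈ (Finset.univ : Finset (Fin 4)).finsuppAntidiag k,
      (R p).coeff d * ∏ i, v i ^ d i := by
  rw [MvPolynomial.eval_eq']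
  refine Finset.sum_subset (fun d hd => ?_) fun d _ hd => ?_
  · have := hR.1 p (MvPolynomial.mem_support_iff.1 hd)
    rw [Finset.mem_finsuppAntidiag]
    refine ⟨?_, Finset.subset_univ _⟩
    rw [Finsupp.weight_apply, Finsupp.sum_fintype _ _ (by simp)] at this
    simpa using this
  · rw [MvPolynomial.notMem_support_iff.1 hd, zero_mul]

theorem eval_smul (hR : IsHomFamily k p₀ R) (p : P) (c : ℝ) (v : Fin 4 → ℝ) :
    (R p).eval (fun i => c * v i) = c ^ k * (R p).eval v := by
  rw [hR.eval_eq, hR.eval_eq, Finset.mul_sum]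
  refine Finset.sum_congr rfl fun d hd => ?_
  have h := (Finset.mem_finsuppAntidiag.1 hd).1
  simp only [mul_pow, Finset.prod_mul_distrib, Finset.prod_pow_eq_pow_sum]
  rw [h]; ring

theorem contDiffAt_eval (hR : IsHomFamily k p₀ R) (v : Fin 4 → ℝ) :
    ContDiffAt ℝ ∞ (fun q : P × (Fin 4 → ℝ) => (R q.1).eval q.2) (p₀, v) := by
  simp only [hR.eval_eq]
  refine ContDiffAt.sum fun d _ => ContDiffAt.mul ?_ ?_
  · exact ContDiffAt.comp (g := fun p => (R p).coeff d) (p₀, v) (hR.2 d) contDiffAt_fst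
  · fun_prop

theorem eval_bound (hR : IsHomFamily k p₀ R) :
    ∃ C, ∀ᶠ p in 𝓝 p₀, ∀ v : Fin 4 → ℝ, |(R p).eval v| ≤ C * ‖v‖ ^ k := by
  refine ⟨∑ d ∈ (Finset.univ : Finset (Fin 4)).finsuppAntidiag k, (|(R p₀).coeff d| + 1), ?_⟩
  have h : ∀ᶠ p in 𝓝 p₀, ∀ d ∈ (Finset.univ : Finset (Fin 4)).finsuppAntidiag k,
      |(R p).coeff d| < |(R p₀).coeff d| + 1 := by
    rw [Filter.eventually_all_finset]
    intro d _
    exact (hR.2 d).continuousAt.abs.eventually_lt continuousAt_const (by simp)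
  filter_upwards [h] with p hp v
  rw [hR.eval_eq, Finset.sum_mul]
  refine (Finset.abs_sum_le_sum_abs _ _).trans (Finset.sum_le_sum fun d hd => ?_)
  rw [abs_mul, Finset.abs_prod]
  refine mul_le_mul (hp d hd).le ?_ (Finset.prod_nonneg fun _ _ => abs_nonneg _) (by positivity)
  rw [← (Finset.mem_finsuppAntidiag.1 hd).1, ← Finset.prod_pow_eq_pow_sum]
  refine Finset.prod_le_prod (fun _ _ => abs_nonneg _) fun i _ => ?_
  rw [abs_pow]
  exact pow_le_pow_left₀ (abs_nonneg _) (norm_le_pi_norm v i) _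

end IsHomFamily

/-- The real coordinates of `ζ`, as a linear map. -/
def realCoordsL (i : Fin 4) : (Fin 2 → ℂ) →L[ℝ] ℝ :=
  ![Complex.reCLM ∘L ContinuousLinearMap.proj 0, Complex.imCLM ∘L ContinuousLinearMap.proj 0,
    Complex.reCLM ∘L ContinuousLinearMap.proj 1, Complex.imCLM ∘L ContinuousLinearMap.proj 1] i

theorem realCoordsL_apply (i : Fin 4) (ζ : Fin 2 → ℂ) : realCoordsL i ζ = realCoords ζ i := by
  fin_cases i <;> simp [realCoordsL, realCoords]

theorem contDiff_realCoords : ContDiff ℝ ∞ realCoords := by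
  rw [contDiff_pi]
  intro i
  simp only [← realCoordsL_apply]
  exact (realCoordsL i).contDiff

theorem exists_linear_realCoords (l : (Fin 2 → ℂ) →L[ℝ] ℝ) :
    ∃ c : Fin 4 → ℝ, ∀ ζ, l ζ = ∑ i, c i * realCoords ζ i := by
  refine ⟨![l (Pi.single 0 1), l (Pi.single 0 Complex.I), l (Pi.single 1 1),
    l (Pi.single 1 Complex.I)], fun ζ => ?_⟩
  have h : ζ = (ζ 0).re • (Pi.single 0 1 : Fin 2 → ℂ) +
      (ζ 0).im • (Pi.single 0 Complex.I : Fin 2 → ℂ) +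
      (ζ 1).re • (Pi.single 1 1 : Fin 2 → ℂ) +
      (ζ 1).im • (Pi.single 1 Complex.I : Fin 2 → ℂ) := by
    ext i
    fin_cases i <;> simp
  conv_lhs => rw [h]
  simp only [map_add, map_smul, Fin.sum_univ_four, realCoords]
  simp [mul_comm]

/-- The homogeneous part of lowest degree of a function that vanishes to order `k`. -/
theorem VanishOrder.exists_leading {B : Type} [NormedAddCommGroup B] [NormedSpace ℝ B] {u₀ : B}
    {k : ℕ} {f : (Fin 2 → ℂ) × B → ℝ} (hf : VanishOrder u₀ k f) :
    ∃ R : B → MvPolynomial (Fin 4) ℝ, IsHomFamily k u₀ R ∧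
      VanishOrder u₀ k (fun q => (R q.2).eval (realCoords q.1)) ∧
      (fun q => f q - (R q.2).eval (realCoords q.1)) =O[𝓝 (0, u₀)] fun q => ‖q.1‖ ^ (k + 1) := by
  induction hf with
  | @smooth f h =>
    have hs : ContDiffAt ℝ ω (fun u => f (0, u)) u₀ :=
      ContDiffAt.comp u₀ h (by fun_prop)
    -- In order zero the leading part is the restriction to `ζ = 0`, and the error is of first order
    -- because `f` is locally Lipschitz.
    refine ⟨fun u => MvPolynomial.C (f (0, u)), IsHomFamily.C (hs.of_le le_top), ?_, ?_⟩
    · refine .smooth ?_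
      simp only [MvPolynomial.eval_C]
      exact ContDiffAt.comp (0, u₀) (g := fun u => f (0, u)) hs contDiffAt_snd
    have hd : ContDiffAt ℝ 1 f (0, u₀) := h.of_le le_top
    obtain ⟨K, t, ht', hK⟩ := hd.exists_lipschitzOnWith
    have ht2 : Tendsto (fun q : (Fin 2 → ℂ) × B => ((0 : Fin 2 → ℂ), q.2)) (𝓝 (0, u₀))
        (𝓝 (0, u₀)) := Continuous.tendsto' (by fun_prop) _ _ rfl
    refine IsBigO.of_bound K ?_
    filter_upwards [ht', ht2 ht'] with q hq1 hq2
    simpa [dist_eq_norm, Prod.norm_def] using hK.dist_le_mul _ hq1 _ hq2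
  | @mul k f l hf ih =>
    obtain ⟨R, hR, hV, h⟩ := ih
    obtain ⟨c, hc⟩ := exists_linear_realCoords l
    refine ⟨fun u => (∑ i, MvPolynomial.C (c i) * MvPolynomial.X i) * R u, ?_, ?_, ?_⟩
    · have h1 : IsHomFamily 1 u₀ (fun _ => ∑ i, MvPolynomial.C (c i) * MvPolynomial.X i) :=
        IsHomFamily.sum _ fun i _ => IsHomFamily.smul (c := fun _ => c i) contDiffAt_const
          (IsHomFamily.X i)
      rw [add_comm]
      exact h1.mul hR
    · refine (hV.mul l).congr ?_
      filter_upwards with q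
      simp [hc, Finset.sum_mul]
    · have e2 : (fun q : (Fin 2 → ℂ) × B => l q.1) =O[𝓝 (0, u₀)] fun q => ‖q.1‖ :=
        (l.isBigO_comp (fun q : (Fin 2 → ℂ) × B => q.1) _).norm_right
      refine (e2.mul h).congr (fun q => ?_) fun q => by ring
      simp [hc, mul_sub, Finset.sum_mul]
  | add _ _ ih₁ ih₂ =>
    obtain ⟨R, hR, hV, h⟩ := ih₁
    obtain ⟨S, hS, hV', h'⟩ := ih₂
    exact ⟨_, hR.add hS, (hV.add hV').congr (by filter_upwards with q using by simp), (h.add h').congr_left fun q => by simp; ring⟩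
  | congr _ e ih =>
    obtain ⟨R, hR, hV, h⟩ := ih
    exact ⟨R, hR, hV, h.congr' (by filter_upwards [e] with q hq using by rw [hq]) EventuallyEq.rfl⟩

end

end SBC

namespace SBC

noncomputable section

/-! ### Antiderivatives along a vector field -/

section Antiderivative

variable {E B F : Type} [NormedAddCommGroup E] [NormedSpace ℝ E] [NormedAddCommGroup B]
  [NormedSpace ℝ B] [NormedAddCommGroup F] [NormedSpace ℝ F]

/-- The derivative of `f` along the vector field `v`. -/
def dirDeriv (v : E × B → E × B) (f : E × B → F) : E × B → F := fun q => fderiv ℝ f q (v q)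

/-- A truncated series for the antiderivative of `p` along a vector field `v` with `v l = 1`. -/
def antideriv (l : E →L[ℝ] ℝ) (v : E × B → E × B) (N : ℕ) (p : E × B → F) : E × B → F := fun q =>
  ∑ n ∈ Finset.range N, ((-1) ^ n * l q.1 ^ (n + 1) / (n + 1).factorial : ℝ) •
    (dirDeriv v)^[n] p q

variable {p₀ : B} {l : E →L[ℝ] ℝ} {v : E × B → E × B} {p : E × B → F} {k : ℕ}

theorem vanishOrder_iterate_dirDeriv (hv : ContDiffAt ℝ ω v (0, p₀)) (hp : VanishOrder p₀ k p)
    (n : ℕ) : VanishOrder p₀ (k - n) ((dirDeriv v)^[n] p) := by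
  induction n with
  | zero => exact hp
  | succ n ih =>
    rw [Function.iterate_succ_apply', ← Nat.sub_sub]
    exact ih.fderiv_apply hv

theorem vanishOrder_linear_pow (l : E →L[ℝ] ℝ) (n : ℕ) :
    VanishOrder p₀ n (fun q : E × B => l q.1 ^ n) := by
  have h : VanishOrder p₀ 1 (fun q : E × B => l q.1) :=
    ((VanishOrder.smooth (f := fun _ => (1 : ℝ)) contDiffAt_const).mul l).congr
      (by filter_upwards with q using by simp)
  simpa using h.pow n

theorem vanishOrder_antideriv (hv : ContDiffAt ℝ ω v (0, p₀)) (hp : VanishOrder p₀ k p) (N : ℕ) :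
    VanishOrder p₀ (k + 1) (antideriv l v N p) := by
  refine VanishOrder.sum _ fun n _ => ?_
  have h1 : VanishOrder p₀ (n + 1) (fun q : E × B =>
      ((-1) ^ n * l q.1 ^ (n + 1) / (n + 1).factorial : ℝ)) :=
    ((vanishOrder_linear_pow l (n + 1)).const_mul ((-1) ^ n / (n + 1).factorial : ℝ)).congr
      (by filter_upwards with q using by ring)
  -- The orders add up to `(n + 1) + (k - n) ≥ k + 1`, also for `n > k`, where the truncated
  -- difference is 0.
  exact (h1.smul (vanishOrder_iterate_dirDeriv hv hp n)).mono (by omega)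

theorem dirDeriv_antideriv (hv : ContDiffAt ℝ ω v (0, p₀)) (hp : VanishOrder p₀ k p)
    (hl : ∀ᶠ q in 𝓝 (0, p₀), l (v q).1 = 1) (N : ℕ) :
    dirDeriv v (antideriv l v N p) =ᶠ[𝓝 (0, p₀)] fun q =>
      p q - ((-1) ^ N * l q.1 ^ N / N.factorial : ℝ) • (dirDeriv v)^[N] p q := by
  induction N with
  | zero =>
    have e : antideriv l v 0 p = fun _ => 0 := by funext q; simp [antideriv]
    filter_upwards with q
    simp [dirDeriv, e]
  | succ N ih =>
    have hD := vanishOrder_iterate_dirDeriv hv hp N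
    filter_upwards [ih, hl, hD.eventually_differentiableAt,
      (vanishOrder_antideriv (l := l) hv hp N).eventually_differentiableAt] with q hq hlq hDq hSq
    have e : antideriv l v (N + 1) p = fun q => antideriv l v N p q +
        ((-1) ^ N * l q.1 ^ (N + 1) / (N + 1).factorial : ℝ) • (dirDeriv v)^[N] p q := by
      funext q; simp [antideriv, Finset.sum_range_succ]
    have h1 : HasFDerivAt (fun q : E × B => l q.1) (l ∘L ContinuousLinearMap.fst ℝ E B) q :=
      (l ∘L ContinuousLinearMap.fst ℝ E B).hasFDerivAt
    have h2 : HasFDerivAt (fun q : E × B =>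
        ((-1) ^ N * l q.1 ^ (N + 1) / (N + 1).factorial : ℝ)) _ q :=
      ((h1.pow (N + 1)).const_mul ((-1 : ℝ) ^ N / (N + 1).factorial)).congr_of_eventuallyEq
        (by filter_upwards with q using by ring)
    -- The sum telescopes. Since `l` has rate 1, differentiating the power of `l` in the new term
    -- cancels the old remainder; differentiating the iterated derivative gives the new remainder.
    have h3 := hSq.hasFDerivAt.add (h2.smul hDq.hasFDerivAt)
    have h4 := congrArg (fun L => L (v q)) h3.fderiv
    rw [dirDeriv, e, Function.iterate_succ_apply']
    refine h4.trans ?_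
    rw [dirDeriv] at hq
    have hf : ((N + 1).factorial : ℝ) = (N + 1) * N.factorial := by
      push_cast [Nat.factorial_succ]; ring
    have hN : (N.factorial : ℝ) ≠ 0 := by positivity
    simp only [add_apply, smul_apply,
      ContinuousLinearMap.smulRight_apply, hq, dirDeriv, ContinuousLinearMap.comp_apply,
      ContinuousLinearMap.coe_fst', hlq, smul_eq_mul, mul_one, nsmul_eq_mul]
    rw [hf]
    have e1 : (-1 : ℝ) ^ N / ((N + 1) * N.factorial) * (((N + 1 : ℕ) : ℝ) * l q.1 ^ (N + 1 - 1))
        = (-1) ^ N * l q.1 ^ N / N.factorial := by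
      have : ((N : ℝ) + 1) ≠ 0 := by positivity
      push_cast
      field_simp
    rw [e1]
    have e2 : ((-1 : ℝ) ^ (N + 1) * l q.1 ^ (N + 1) / ((N + 1) * N.factorial)) =
        -((-1) ^ N * l q.1 ^ (N + 1) / ((N + 1) * N.factorial)) := by ring
    rw [e2, neg_smul]
    abel

end Antiderivative

end

end SBC

namespace SBC

noncomputable section

/-! ### Expansion of the coupling potential -/

/-- The relative change of `‖x‖²` on translation of `x` by `w`. -/
def relSq (q : ℂ × ℂ) : ℝ :=
  2 * (conj q.2 * q.1).re / ‖q.2‖ ^ 2 + ‖q.1‖ ^ 2 / ‖q.2‖ ^ 2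

/-- The expansion of `(1 + T) ^ (-1/2)` to third order. -/
def invSqrtPoly (T : ℝ) : ℝ := 1 - T / 2 + 3 * T ^ 2 / 8 - 5 * T ^ 3 / 16

/-- The remainder of the expansion of `(1 + T) ^ (-1/2)`, divided by `T ^ 4`. -/
def invSqrtRem (T : ℝ) : ℝ :=
  -((25 * T ^ 3 - 35 * T ^ 2 + 56 * T - 140) / 256) / ((1 + T) * (1 / √(1 + T) + invSqrtPoly T))

/-- With `P = invSqrtPoly T`, the polynomial `1 - P² (1 + T)` is divisible by `T ^ 4`. Factoring `1
/ (1 + T) - P²` as a difference of squares and dividing by the positive sum isolates the error. -/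
theorem inv_sqrt_eq {T : ℝ} (hT : 0 < 1 + T) (h : 0 < 1 / √(1 + T) + invSqrtPoly T) :
    1 / √(1 + T) = invSqrtPoly T + T ^ 4 * invSqrtRem T := by
  have h1 : (1 / √(1 + T)) ^ 2 * (1 + T) = 1 := by
    rw [div_pow, Real.sq_sqrt hT.le]; field_simp
  have h2 : (1 / √(1 + T) - invSqrtPoly T) * ((1 + T) * (1 / √(1 + T) + invSqrtPoly T)) =
      T ^ 4 * -((25 * T ^ 3 - 35 * T ^ 2 + 56 * T - 140) / 256) := by
    have : (1 / √(1 + T) - invSqrtPoly T) * ((1 + T) * (1 / √(1 + T) + invSqrtPoly T)) =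
      (1 / √(1 + T)) ^ 2 * (1 + T) - invSqrtPoly T ^ 2 * (1 + T) := by ring
    rw [this, h1, invSqrtPoly]; ring
  rw [invSqrtRem, ← mul_div_assoc, ← h2, mul_div_cancel_right₀ _ (by positivity)]
  ring

theorem contDiffAt_invSqrtRem : ContDiffAt ℝ ω invSqrtRem 0 := by
  unfold invSqrtRem invSqrtPoly
  have h0 : ContDiffAt ℝ ω (fun T : ℝ => √(1 + T)) 0 :=
    ContDiffAt.sqrt (by fun_prop) (by simp)
  have h1 : ContDiffAt ℝ ω (fun T : ℝ => 1 / √(1 + T)) 0 :=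
    contDiffAt_const.div h0 (by simp)
  refine ContDiffAt.div (by fun_prop) ?_ (by norm_num)
  exact ContDiffAt.mul (by fun_prop) (h1.add (by fun_prop))

section Expansion

variable {x₀ : ℂ}

theorem contDiffAt_norm_snd_sq_inv (hx : x₀ ≠ 0) {E : Type} [NormedAddCommGroup E]
    [NormedSpace ℝ E] : ContDiffAt ℝ ω (fun q : E × ℂ => 1 / ‖q.2‖ ^ 2) (0, x₀) := by
  refine contDiffAt_const.div ?_ (by simpa using hx)
  exact (contDiff_norm_sq ℝ (n := ω)).contDiffAt.comp _ contDiffAt_snd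

theorem contDiffAt_norm_snd_inv (hx : x₀ ≠ 0) {E : Type} [NormedAddCommGroup E]
    [NormedSpace ℝ E] : ContDiffAt ℝ ω (fun q : E × ℂ => 1 / ‖q.2‖) (0, x₀) :=
  contDiffAt_const.div (contDiffAt_snd.norm ℝ (by simpa using hx)) (by simpa using hx)

theorem vanishOrder_re_mul (hx : x₀ ≠ 0) :
    VanishOrder x₀ 1 (fun q : ℂ × ℂ => 2 * (conj q.2 * q.1).re / ‖q.2‖ ^ 2) := by
  have h1 : VanishOrder x₀ 1 (fun q : ℂ × ℂ => q.1) :=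
    VanishOrder.linear (ContinuousLinearMap.id ℝ ℂ)
  have h2 : VanishOrder x₀ 0 (fun q : ℂ × ℂ => conj q.2) :=
    .smooth (Complex.conjCLE.contDiff.contDiffAt.comp _ contDiffAt_snd)
  have h3 : VanishOrder x₀ 0 (fun q : ℂ × ℂ => 1 / ‖q.2‖ ^ 2) :=
    .smooth (contDiffAt_norm_snd_sq_inv hx)
  exact ((h3.mul' ((h2.mul' h1).clm Complex.reCLM)).const_mul 2).congr
    (by filter_upwards with q using by simp; ring)

theorem vanishOrder_norm_sq {B : Type} [NormedAddCommGroup B] [NormedSpace ℝ B] {p₀ : B}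
    {E : Type} [NormedAddCommGroup E] [NormedSpace ℝ E] {f : E × B → ℂ} {k : ℕ}
    (hf : VanishOrder p₀ k f) : VanishOrder p₀ (2 * k) (fun q => ‖f q‖ ^ 2) := by
  have h := (hf.clm Complex.reCLM).pow 2 |>.add ((hf.clm Complex.imCLM).pow 2)
  refine h.congr ?_
  filter_upwards with q
  simp only [Complex.sq_norm, Complex.normSq_apply, Complex.reCLM_apply, Complex.imCLM_apply]
  ring

theorem vanishOrder_norm_sq_div (hx : x₀ ≠ 0) :
    VanishOrder x₀ 2 (fun q : ℂ × ℂ => ‖q.1‖ ^ 2 / ‖q.2‖ ^ 2) := by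
  have h1 : VanishOrder x₀ 1 (fun q : ℂ × ℂ => q.1) :=
    VanishOrder.linear (ContinuousLinearMap.id ℝ ℂ)
  have h3 : VanishOrder x₀ 0 (fun q : ℂ × ℂ => 1 / ‖q.2‖ ^ 2) :=
    .smooth (contDiffAt_norm_snd_sq_inv hx)
  exact (h3.mul' (vanishOrder_norm_sq h1)).congr (by filter_upwards with q using by ring)

/-- The second order part of the expansion of `‖x‖ / ‖x + w‖`. -/
def quadPart (q : ℂ × ℂ) : ℝ :=
  -(‖q.1‖ ^ 2 / ‖q.2‖ ^ 2) / 2 + 3 * (2 * (conj q.2 * q.1).re / ‖q.2‖ ^ 2) ^ 2 / 8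

/-- The third order part of the expansion of `‖x‖ / ‖x + w‖`. -/
def cubicPart (q : ℂ × ℂ) : ℝ :=
  3 * (2 * (conj q.2 * q.1).re / ‖q.2‖ ^ 2) * (‖q.1‖ ^ 2 / ‖q.2‖ ^ 2) / 4 -
    5 * (2 * (conj q.2 * q.1).re / ‖q.2‖ ^ 2) ^ 3 / 16

/-- One has `‖x + w‖ = ‖x‖ √(1 + T)` with `T = relSq`, the sum of a part of order 1 and a part of
order 2 in `w`. Collecting the cubic Taylor polynomial in `T` by order in `w` gives the displayed
terms. -/
theorem vanishOrder_inv_norm_add (hx : x₀ ≠ 0) : VanishOrder x₀ 4 (fun q : ℂ × ℂ =>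
    1 / ‖q.2 + q.1‖ - 1 / ‖q.2‖ * (1 - (2 * (conj q.2 * q.1).re / ‖q.2‖ ^ 2) / 2 +
      quadPart q + cubicPart q)) := by
  have h1 := vanishOrder_re_mul hx
  have h2 := vanishOrder_norm_sq_div hx
  have hT : VanishOrder x₀ 1 relSq := h1.add (h2.mono (by norm_num))
  have hT0 : relSq (0, x₀) = 0 := by simp [relSq]
  have hr : VanishOrder x₀ 0 (fun q => invSqrtRem (relSq q)) :=
    .smooth (ContDiffAt.comp (g := invSqrtRem) (0, x₀) (by rw [hT0]; exact contDiffAt_invSqrtRem)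
      hT.contDiffAt)
  have hi : VanishOrder x₀ 0 (fun q : ℂ × ℂ => 1 / ‖q.2‖) := .smooth (contDiffAt_norm_snd_inv hx)
  have e1 := (hT.pow 4).mul' hr
  -- `e2` to `e5` are the monomials of the cubic polynomial in `T` that already have order at least
  -- 4 in `w`.
  have e2 : VanishOrder x₀ 4 _ := (h2.pow 2).const_mul (3 / 8 : ℝ)
  have e3 : VanishOrder x₀ 4 _ := ((h1.pow 2).mul' h2).const_mul (-15 / 16 : ℝ)
  have e4 : VanishOrder x₀ 4 _ := ((h1.mul' (h2.pow 2)).const_mul (-15 / 16 : ℝ)).mono (by norm_num)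
  have e5 : VanishOrder x₀ 4 _ := ((h2.pow 3).const_mul (-5 / 16 : ℝ)).mono (by norm_num)
  refine (hi.mul' (e1.add (e2.add (e3.add (e4.add e5))))).congr ?_
  have hc : ContinuousAt relSq (0, x₀) := hT.contDiffAt.continuousAt
  have g1 : ∀ᶠ q in 𝓝 ((0 : ℂ), x₀), 0 < 1 + relSq q := by
    refine (continuousAt_const.add hc).eventually (lt_mem_nhds (by simp [hT0]))
  have g2 : ∀ᶠ q in 𝓝 ((0 : ℂ), x₀), 0 < 1 / √(1 + relSq q) + invSqrtPoly (relSq q) := by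
    have : ContinuousAt (fun T : ℝ => 1 / √(1 + T) + invSqrtPoly T) (relSq (0, x₀)) := by
      rw [hT0]
      unfold invSqrtPoly
      refine ContinuousAt.add (ContinuousAt.div (by fun_prop) (by fun_prop) (by simp)) (by fun_prop)
    exact (ContinuousAt.comp (x := ((0 : ℂ), x₀)) this hc).eventually
      (lt_mem_nhds (by simp [hT0, invSqrtPoly]))
  have g3 : ∀ᶠ q in 𝓝 ((0 : ℂ), x₀), q.2 ≠ 0 := continuousAt_snd.eventually_ne hx
  filter_upwards [g1, g2, g3] with q h1 h2 h3
  have hn : ‖q.2 + q.1‖ = ‖q.2‖ * √(1 + relSq q) := by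
    have : ‖q.2‖ ^ 2 ≠ 0 := by simpa using h3
    refine (sq_eq_sq₀ (norm_nonneg _) (by positivity)).1 ?_
    rw [mul_pow, Real.sq_sqrt h1.le, relSq, mul_add, mul_add, mul_div_cancel₀ _ this, mul_div_cancel₀ _ this, mul_one]
    simp only [Complex.sq_norm, Complex.normSq_apply, Complex.add_re, Complex.add_im,
      Complex.mul_re, Complex.conj_re, Complex.conj_im]
    ring
  have hs := inv_sqrt_eq h1 h2
  have : 1 / ‖q.2 + q.1‖ = 1 / ‖q.2‖ * (1 / √(1 + relSq q)) := by rw [hn]; ring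
  rw [this, hs]
  simp only [relSq, invSqrtPoly, quadPart, cubicPart]
  ring

end Expansion

end

end SBC

namespace SBC

noncomputable section

/-! ### Cancellation of low-order coupling by the choice of centres of mass -/

section Decoupling

variable {x₀ : ℂ}

/-- The inverse of the distance from `-x` to a combination of the squares of `z₁` and `z₂`. -/
def invDist (s t : ℝ) (q : (Fin 2 → ℂ) × ℂ) : ℝ :=
  1 / ‖q.2 + ((s : ℂ) * q.1 0 ^ 2 + (t : ℂ) * q.1 1 ^ 2)‖

/-- The inverse of the distance from `-x` to a multiple of `z²`. -/
def invDistOne (s : ℝ) (q : ℂ × ℂ) : ℝ := 1 / ‖q.2 + (s : ℂ) * q.1 ^ 2‖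

/-- The expansion of `1 / ‖x + w‖` to third order. -/
def invNormExpansion (q : ℂ × ℂ) : ℝ :=
  1 / ‖q.2‖ * (1 - (2 * (conj q.2 * q.1).re / ‖q.2‖ ^ 2) / 2 + quadPart q + cubicPart q)

theorem vanishOrder_proj {B : Type} [NormedAddCommGroup B] [NormedSpace ℝ B] {p₀ : B} (j : Fin 2) :
    VanishOrder p₀ 1 (fun q : (Fin 2 → ℂ) × B => q.1 j) :=
  VanishOrder.linear (ContinuousLinearMap.proj (R := ℝ) (φ := fun _ : Fin 2 => ℂ) j)

theorem vanishOrder_invDist (hx : x₀ ≠ 0) (s t : ℝ) : VanishOrder x₀ 8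
    (fun q : (Fin 2 → ℂ) × ℂ => invDist s t q -
      invNormExpansion ((s : ℂ) * q.1 0 ^ 2 + (t : ℂ) * q.1 1 ^ 2, q.2)) := by
  have h1 : VanishOrder x₀ 2 (fun q : (Fin 2 → ℂ) × ℂ =>
      (s : ℂ) * q.1 0 ^ 2 + (t : ℂ) * q.1 1 ^ 2) :=
    (((vanishOrder_proj 0).pow 2).const_mul (s : ℂ)).add
      (((vanishOrder_proj 1).pow 2).const_mul (t : ℂ))
  exact VanishOrder.comp (ψ := fun q : (Fin 2 → ℂ) × ℂ =>
    ((s : ℂ) * q.1 0 ^ 2 + (t : ℂ) * q.1 1 ^ 2, q.2)) (vanishOrder_inv_norm_add hx)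
    (h1.contDiffAt.prodMk contDiffAt_snd) (by simp) h1

/-- The expansion is a cubic polynomial in `(s, t)`. A mixed second difference removes the pure
powers, which leaves three monomials. -/
theorem exists_invNormExpansion_mixed (Z W x : ℂ) : ∃ c₁₁ c₂₁ c₁₂ : ℝ, ∀ s t : ℝ,
    invNormExpansion ((s : ℂ) * Z + (t : ℂ) * W, x) -
      invNormExpansion ((s : ℂ) * Z + ((0 : ℝ) : ℂ) * W, x) -
      invNormExpansion (((0 : ℝ) : ℂ) * Z + (t : ℂ) * W, x) +
      invNormExpansion (((0 : ℝ) : ℂ) * Z + ((0 : ℝ) : ℂ) * W, x) =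
    s * t * c₁₁ + s ^ 2 * t * c₂₁ + s * t ^ 2 * c₁₂ := by
  have hn : ∀ s t : ℝ, ‖(s : ℂ) * Z + (t : ℂ) * W‖ ^ 2 = s ^ 2 * ‖Z‖ ^ 2 +
      s * t * (2 * (conj Z * W).re) + t ^ 2 * ‖W‖ ^ 2 := fun s t => by
    simp only [Complex.sq_norm, Complex.normSq_apply, Complex.add_re, Complex.add_im,
      Complex.mul_re, Complex.mul_im, Complex.conj_re, Complex.conj_im, Complex.ofReal_re,
      Complex.ofReal_im]
    ring
  have hr : ∀ s t : ℝ, (conj x * ((s : ℂ) * Z + (t : ℂ) * W)).re =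
      s * (conj x * Z).re + t * (conj x * W).re := fun s t => by
    simp only [Complex.add_re, Complex.add_im, Complex.mul_re, Complex.mul_im, Complex.conj_re,
      Complex.conj_im, Complex.ofReal_re, Complex.ofReal_im]
    ring
  generalize hA : (conj x * Z).re = A at hr
  generalize hB : (conj x * W).re = B at hr
  generalize hN : 2 * (conj Z * W).re = N at hn
  generalize hX : (‖x‖ ^ 2)⁻¹ = X
  refine ⟨1 / ‖x‖ * (-N * X / 2 + 3 * A * B * X ^ 2),
    1 / ‖x‖ * (3 / 2 * X ^ 2 * (A * N + B * ‖Z‖ ^ 2) - 15 / 2 * X ^ 3 * A ^ 2 * B),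
    1 / ‖x‖ * (3 / 2 * X ^ 2 * (B * N + A * ‖W‖ ^ 2) - 15 / 2 * X ^ 3 * A * B ^ 2), fun s t => ?_⟩
  simp only [invNormExpansion, quadPart, cubicPart, hn, hr, div_eq_mul_inv, hX]
  ring

/-- Attraction of two binaries by four pairwise terms: beyond the parts depending on one binary
only, the potential vanishes to order `8` in the Levi-Civita variables. -/
theorem vanishOrder_mixed (hx : x₀ ≠ 0) (μ ν s t : Fin 2 → ℝ) (hs : μ 0 * s 0 + μ 1 * s 1 = 0)
    (ht : ν 0 * t 0 + ν 1 * t 1 = 0) :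
    VanishOrder x₀ 8 (fun q : (Fin 2 → ℂ) × ℂ => ∑ i, ∑ l, μ i * ν l *
      (invDist (s i) (t l) q - invDist (s i) 0 q - invDist 0 (t l) q + invDist 0 0 q)) := by
  have h := VanishOrder.sum Finset.univ fun i _ => VanishOrder.sum Finset.univ fun l _ =>
    ((((vanishOrder_invDist hx (s i) (t l)).sub (vanishOrder_invDist hx (s i) 0)).sub
      (vanishOrder_invDist hx 0 (t l))).add (vanishOrder_invDist hx 0 0)).const_mul (μ i * ν l)
  refine h.congr ?_
  filter_upwards with q
  obtain ⟨c₁, c₂, c₃, hc⟩ := exists_invNormExpansion_mixed (q.1 0 ^ 2) (q.1 1 ^ 2) q.2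
  -- Each of the three monomials is linear in `s` or in `t`, so its weighted sum contains one of the
  -- vanishing first moments `hs`, `ht`.
  have key : ∑ i, ∑ l, μ i * ν l * (s i * t l * c₁ + s i ^ 2 * t l * c₂ + s i * t l ^ 2 * c₃)
      = 0 := by
    simp only [Fin.sum_univ_two]
    linear_combination (ν 0 * t 0 * c₁ + ν 0 * t 0 ^ 2 * c₃ + ν 1 * t 1 * c₁ +
      ν 1 * t 1 ^ 2 * c₃) * hs + (μ 0 * s 0 ^ 2 * c₂ + μ 1 * s 1 ^ 2 * c₂) * ht
  refine eq_of_sub_eq_zero ((Finset.sum_sub_distrib _ _).symm.trans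
    (Eq.trans ?_ (neg_eq_zero.2 key)))
  rw [← Finset.sum_neg_distrib]
  refine Finset.sum_congr rfl fun i _ => ?_
  rw [← Finset.sum_sub_distrib, ← Finset.sum_neg_distrib]
  refine Finset.sum_congr rfl fun l _ => ?_
  rw [← hc]
  ring

/-- The part depending on one binary starts with a quartic form in the Levi-Civita variable. -/
theorem vanishOrder_single (hx : x₀ ≠ 0) (μ s : Fin 2 → ℝ) (hs : μ 0 * s 0 + μ 1 * s 1 = 0) :
    ∃ (c : ℂ → ℂ) (d : ℂ → ℝ), ContDiffAt ℝ ω c x₀ ∧ ContDiffAt ℝ ω d x₀ ∧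
      VanishOrder x₀ 6 (fun q : ℂ × ℂ => ∑ i, μ i * (invDistOne (s i) q - invDistOne 0 q) -
        ((c q.2 * q.1 ^ 4).re + d q.2 * (‖q.1‖ ^ 2) ^ 2)) := by
  have hinv : ContDiffAt ℝ ω (fun x : ℂ => 1 / ‖x‖) x₀ :=
    contDiffAt_const.div (contDiffAt_id.norm ℝ hx) (by simpa using hx)
  -- The terms linear in `z²` cancel by `hs`. The quadratic ones are rewritten with `2 (Re w)² = Re
  -- w² + |w|²` for `w = conj x * z²`. This gives the coefficient `3/4` of `Re (conj x² z⁴) / |x|⁵`,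
  -- and `3/4 - 1/2 = 1/4` for `|z|⁴ / |x|³`.
  refine ⟨fun x => ((3 / 4 * (μ 0 * s 0 ^ 2 + μ 1 * s 1 ^ 2) * (1 / ‖x‖) ^ 5 : ℝ) : ℂ) * conj x ^ 2,
    fun x => (μ 0 * s 0 ^ 2 + μ 1 * s 1 ^ 2) / 4 * (1 / ‖x‖) ^ 3, ?_, ?_, ?_⟩
  · refine ContDiffAt.mul (Complex.ofRealCLM.contDiff.contDiffAt.comp x₀ ?_)
      ((Complex.conjCLE.contDiff.contDiffAt).pow 2)
    exact contDiffAt_const.mul (hinv.pow 5)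
  · exact contDiffAt_const.mul (hinv.pow 3)
  have hz : VanishOrder x₀ 1 (fun q : ℂ × ℂ => q.1) :=
    VanishOrder.linear (ContinuousLinearMap.id ℝ ℂ)
  have hw : ∀ s : ℝ, VanishOrder x₀ 2 (fun q : ℂ × ℂ => (s : ℂ) * q.1 ^ 2) := fun s =>
    (hz.pow 2).const_mul (s : ℂ)
  have hrem : ∀ s : ℝ, VanishOrder x₀ 6 (fun q : ℂ × ℂ => invDistOne s q - 1 / ‖q.2‖ *
      (1 - (2 * (conj q.2 * ((s : ℂ) * q.1 ^ 2)).re / ‖q.2‖ ^ 2) / 2 +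
        quadPart ((s : ℂ) * q.1 ^ 2, q.2))) := fun s => by
    have hψ : ContDiffAt ℝ ω (fun q : ℂ × ℂ => ((s : ℂ) * q.1 ^ 2, q.2)) (0, x₀) :=
      (hw s).contDiffAt.prodMk contDiffAt_snd
    have h1 := VanishOrder.comp (vanishOrder_inv_norm_add hx) hψ (by simp) (hw s)
    have h2 := VanishOrder.comp (vanishOrder_re_mul hx) hψ (by simp) (hw s)
    have h3 := VanishOrder.comp (vanishOrder_norm_sq_div hx) hψ (by simp) (hw s)
    have h4 : VanishOrder x₀ 6 _ := ((h2.mul' h3).const_mul (3 / 4 : ℝ))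
    have h5 : VanishOrder x₀ 6 _ := ((h2.pow 3).const_mul (-5 / 16 : ℝ))
    have hi : VanishOrder x₀ 0 (fun q : ℂ × ℂ => 1 / ‖q.2‖) := .smooth (contDiffAt_norm_snd_inv hx)
    refine ((h1.mono (by norm_num)).add (hi.mul' (h4.add h5))).congr ?_
    filter_upwards with q
    simp only [invDistOne, cubicPart]
    ring
  refine (VanishOrder.sum Finset.univ fun i _ =>
    ((hrem (s i)).sub (hrem 0)).const_mul (μ i)).congr ?_
  have g3 : ∀ᶠ q in 𝓝 ((0 : ℂ), x₀), q.2 ≠ 0 := continuousAt_snd.eventually_ne hx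
  filter_upwards [g3] with q hq
  have hr : ∀ s : ℝ, (conj q.2 * ((s : ℂ) * q.1 ^ 2)).re = s * (conj q.2 * q.1 ^ 2).re :=
    fun s => by
      simp only [Complex.mul_re, Complex.mul_im, Complex.ofReal_re, Complex.ofReal_im]
      ring
  have hn : ∀ s : ℝ, ‖(s : ℂ) * q.1 ^ 2‖ ^ 2 = s ^ 2 * (‖q.1‖ ^ 2) ^ 2 := fun s => by
    rw [norm_mul, norm_pow, Complex.norm_real, mul_pow, Real.norm_eq_abs, sq_abs]
  have hre : (conj q.2 * q.1 ^ 2).re ^ 2 * 2 = (conj q.2 ^ 2 * q.1 ^ 4).re +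
      ‖q.2‖ ^ 2 * (‖q.1‖ ^ 2) ^ 2 := by
    have e1 : conj q.2 ^ 2 * q.1 ^ 4 = (conj q.2 * q.1 ^ 2) ^ 2 := by ring
    have e2 : ‖q.2‖ ^ 2 * (‖q.1‖ ^ 2) ^ 2 = ‖conj q.2 * q.1 ^ 2‖ ^ 2 := by
      rw [norm_mul, norm_pow, Complex.norm_conj]; ring
    rw [e1, e2]
    generalize conj q.2 * q.1 ^ 2 = w
    rw [Complex.sq_norm, Complex.normSq_apply, pow_two w, Complex.mul_re]; ring
  have hn0 : ‖q.2‖ ≠ 0 := by simpa using hq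
  have hc : (((3 / 4 * (μ 0 * s 0 ^ 2 + μ 1 * s 1 ^ 2) * (1 / ‖q.2‖) ^ 5 : ℝ) : ℂ) * conj q.2 ^ 2 *
      q.1 ^ 4).re = 3 / 4 * (μ 0 * s 0 ^ 2 + μ 1 * s 1 ^ 2) * (1 / ‖q.2‖) ^ 5 *
      ((conj q.2 * q.1 ^ 2).re ^ 2 * 2 - ‖q.2‖ ^ 2 * (‖q.1‖ ^ 2) ^ 2) := by
    rw [hre, mul_assoc, Complex.re_ofReal_mul]
    ring
  simp only [hc, quadPart, hr, hn, Fin.sum_univ_two]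
  have hs' : μ 1 * s 1 = -(μ 0 * s 0) := by linear_combination hs
  field_simp
  linear_combination ((conj q.2 * q.1 ^ 2).re * ‖q.2‖ ^ 2 * 64) * hs'

end Decoupling

end

end SBC

namespace SBC

noncomputable section

/-! ### Splitting of the coupling potential into single and mixed parts -/

section Potential

/-- The masses of the two bodies of the `j`-th binary. -/
def binMass (m : Fin 4 → ℝ) (j : Fin 2) : Fin 2 → ℝ := ![![m 0, m 1], ![m 2, m 3]] j

/-- The coefficients of the Levi-Civita variables `zⱼ²` in the positions of the bodies. -/
def binCoeff (m : Fin 4 → ℝ) (j : Fin 2) : Fin 2 → ℝ :=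
  ![![redMass m 0 / m 0 / (8 * massProd m 0 * redMass m 0),
      -(redMass m 0 / m 1 / (8 * massProd m 0 * redMass m 0))],
    ![-(redMass m 1 / m 2 / (8 * massProd m 1 * redMass m 1)),
      redMass m 1 / m 3 / (8 * massProd m 1 * redMass m 1)]] j

theorem binMass_coeff {m : Fin 4 → ℝ} (hm : ∀ i, 0 < m i) (j : Fin 2) :
    binMass m j 0 * binCoeff m j 0 + binMass m j 1 * binCoeff m j 1 = 0 := by
  have h0 := (hm 0).ne'
  have h1 := (hm 1).ne'
  have h2 := (hm 2).ne'
  have h3 := (hm 3).ne'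
  fin_cases j
  · simp [binMass, binCoeff]; field_simp; ring
  · simp [binMass, binCoeff]; field_simp; ring

theorem couplingLC_eq (m : Fin 4 → ℝ) (q : (Fin 2 → ℂ) × ℂ) : couplingLC m q.1 q.2 =
    ∑ i, ∑ l, binMass m 0 i * binMass m 1 l *
      invDist (binCoeff m 0 i) (binCoeff m 1 l) q := by
  simp only [couplingLC, coupling, invDist, Fin.sum_univ_two, binMass, binCoeff]
  simp only [Matrix.cons_val_zero, Matrix.cons_val_one]
  have e : ∀ (r m c : ℝ) (z : ℂ), ((r / m : ℝ) : ℂ) * (z ^ 2 / (c : ℂ)) =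
    ((r / m / c : ℝ) : ℂ) * z ^ 2 := fun r m c z => by push_cast; ring
  simp only [e, Complex.ofReal_neg, neg_mul]
  simp only [div_eq_mul_inv, one_mul]
  simp only [sub_eq_add_neg, add_assoc]

/-- The part of the coupling potential that depends on the `j`-th binary only. -/
def binPot (m : Fin 4 → ℝ) (j : Fin 2) (q : ℂ × ℂ) : ℝ :=
  couplingLC m (Pi.single j q.1) q.2 - couplingLC m 0 q.2

/-- The part of the coupling potential that depends on both binaries. -/
def mixPot (m : Fin 4 → ℝ) (q : (Fin 2 → ℂ) × ℂ) : ℝ :=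
  couplingLC m q.1 q.2 - couplingLC m 0 q.2 - binPot m 0 (q.1 0, q.2) - binPot m 1 (q.1 1, q.2)

variable {m : Fin 4 → ℝ} {x₀ : ℂ}

/-- Setting `z_j = 0` amounts to setting the coefficient of `z_j²` to 0 in `invDist`. The mixed part
is thus the weighted mixed second difference, to which the first moments of both binaries apply. -/
theorem vanishOrder_mixPot (hm : ∀ i, 0 < m i) (hx : x₀ ≠ 0) :
    VanishOrder x₀ 8 (mixPot m) := by
  refine (vanishOrder_mixed hx _ _ _ _ (binMass_coeff hm 0) (binMass_coeff hm 1)).congr ?_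
  filter_upwards with q
  have h0 := couplingLC_eq m q
  have h1 := couplingLC_eq m (0, q.2)
  have h2 := couplingLC_eq m (Pi.single 0 (q.1 0), q.2)
  have h3 := couplingLC_eq m (Pi.single 1 (q.1 1), q.2)
  simp only [mixPot, binPot] at *
  rw [h0, h1, h2, h3]
  simp only [Fin.sum_univ_two, invDist]
  simp
  ring

theorem vanishOrder_binPot (hm : ∀ i, 0 < m i) (hx : x₀ ≠ 0) (j : Fin 2) :
    ∃ (c : ℂ → ℂ) (d : ℂ → ℝ), ContDiffAt ℝ ω c x₀ ∧ ContDiffAt ℝ ω d x₀ ∧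
      VanishOrder x₀ 6 (fun q : ℂ × ℂ => binPot m j q -
        ((c q.2 * q.1 ^ 4).re + d q.2 * (‖q.1‖ ^ 2) ^ 2)) := by
  obtain ⟨c, d, hc, hd, h⟩ := vanishOrder_single hx
    -- With its variable set to zero, the other binary acts as a point carrying its total mass.
    (fun i => (binMass m j.rev 0 + binMass m j.rev 1) * binMass m j i) (binCoeff m j)
    (by linear_combination (binMass m j.rev 0 + binMass m j.rev 1) * binMass_coeff hm j)
  refine ⟨c, d, hc, hd, h.congr ?_⟩
  filter_upwards with q
  congr 1
  have h1 := couplingLC_eq m (0, q.2)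
  have h2 := couplingLC_eq m (Pi.single j q.1, q.2)
  simp only [binPot] at *
  rw [h1, h2]
  fin_cases j <;> simp [Fin.sum_univ_two, invDist, invDistOne] <;> ring

end Potential

end

end SBC

namespace SBC

noncomputable section

/-! ### Conjugate gradients -/

section ConjGrad

variable {E B F : Type} [NormedAddCommGroup E] [NormedSpace ℝ E] [NormedAddCommGroup B]
  [NormedSpace ℝ B] [NormedAddCommGroup F] [NormedSpace ℝ F]

/-- The conjugate of the gradient of a linear functional on `ℂ`. -/
def conjGrad : (ℂ →L[ℝ] ℝ) →L[ℝ] ℂ :=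
  Complex.ofRealCLM ∘L ContinuousLinearMap.apply ℝ ℝ (1 : ℂ) -
    (ContinuousLinearMap.mul ℝ ℂ Complex.I) ∘L Complex.ofRealCLM ∘L
      ContinuousLinearMap.apply ℝ ℝ Complex.I

theorem conjGrad_apply (L : ℂ →L[ℝ] ℝ) : conjGrad L = (L 1 : ℂ) - Complex.I * (L Complex.I : ℂ) :=
  rfl

theorem conj_gradient (f : ℂ → ℝ) (z : ℂ) : conj (gradient f z) = conjGrad (fderiv ℝ f z) := by
  have h : ∀ w, fderiv ℝ f z w = (conj (gradient f z) * w).re := fun w => by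
    rw [mul_comm, ← Complex.inner]
    exact (InnerProductSpace.toDual_symm_apply (𝕜 := ℝ)).symm
  rw [conjGrad_apply, h, h]
  apply Complex.ext <;> simp

/-- The conjugate gradient of `f` along an embedding `e` of `ℂ`. -/
def dirGrad (e : ℂ →L[ℝ] E × B) (f : E × B → ℝ) (q : E × B) : ℂ := conjGrad (fderiv ℝ f q ∘L e)

variable {p₀ : B} {k : ℕ} {f g : E × B → ℝ}

theorem vanishOrder_dirGrad (e : ℂ →L[ℝ] E × B) (hf : VanishOrder p₀ k f) :
    VanishOrder p₀ (k - 1) (dirGrad e f) := by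
  have h : ∀ w, VanishOrder p₀ (k - 1) (fun q => ((fderiv ℝ f q (e w) : ℝ) : ℂ)) := fun w =>
    (hf.fderiv_apply (v := fun _ => e w) contDiffAt_const).clm Complex.ofRealCLM
  exact (h 1).sub ((h Complex.I).const_mul Complex.I)

/-- No order is lost here, because derivatives along the base do not act on the linear factors in
the first variable. -/
theorem vanishOrder_dirGrad_inr [FiniteDimensional ℝ E] {p₀ : ℂ} {f : E × ℂ → ℝ}
    (hf : VanishOrder p₀ k f) : VanishOrder p₀ k (dirGrad (ContinuousLinearMap.inr ℝ E ℂ) f) := by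
  have h : ∀ w, VanishOrder p₀ k
      (fun q => ((fderiv ℝ f q (ContinuousLinearMap.inr ℝ E ℂ w) : ℝ) : ℂ)) := fun w =>
    (hf.fderiv_apply_of_field (c := 0) (v := fun _ => ContinuousLinearMap.inr ℝ E ℂ w)
      (by simpa using VanishOrder.zero 1) (.smooth contDiffAt_const)).clm Complex.ofRealCLM
  exact (h 1).sub ((h Complex.I).const_mul Complex.I)

theorem dirGrad_add (e : ℂ →L[ℝ] E × B) {q : E × B} (hf : DifferentiableAt ℝ f q)
    (hg : DifferentiableAt ℝ g q) :
    dirGrad e (fun q => f q + g q) q = dirGrad e f q + dirGrad e g q := by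
  rw [dirGrad, dirGrad, dirGrad, fderiv_fun_add hf hg, ContinuousLinearMap.add_comp, map_add]

theorem dirGrad_sub (e : ℂ →L[ℝ] E × B) {q : E × B} (hf : DifferentiableAt ℝ f q)
    (hg : DifferentiableAt ℝ g q) :
    dirGrad e (fun q => f q - g q) q = dirGrad e f q - dirGrad e g q := by
  rw [dirGrad, dirGrad, dirGrad, fderiv_fun_sub hf hg, ContinuousLinearMap.sub_comp, map_sub]

theorem dirGrad_comp {E' B' : Type} [NormedAddCommGroup E'] [NormedSpace ℝ E']
    [NormedAddCommGroup B'] [NormedSpace ℝ B'] (e : ℂ →L[ℝ] E' × B') (L : E' × B' →L[ℝ] E × B)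
    {q : E' × B'} (hf : DifferentiableAt ℝ f (L q)) :
    dirGrad e (fun q => f (L q)) q = dirGrad (L ∘L e) f (L q) := by
  have : fderiv ℝ (fun q => f (L q)) q = fderiv ℝ f (L q) ∘L L :=
    (hf.hasFDerivAt.comp q L.hasFDerivAt).fderiv
  rw [dirGrad, dirGrad, this, ContinuousLinearMap.comp_assoc]

end ConjGrad

/-! ### Gradients of the coupling potential -/

section Gradients

variable {m : Fin 4 → ℝ} {x₀ : ℂ}

/-- The embedding of the `j`-th coordinate. -/
def inlSingle (B : Type) [NormedAddCommGroup B] [NormedSpace ℝ B] (j : Fin 2) :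
    ℂ →L[ℝ] (Fin 2 → ℂ) × B :=
  ContinuousLinearMap.inl ℝ (Fin 2 → ℂ) B ∘L ContinuousLinearMap.single ℝ (fun _ : Fin 2 => ℂ) j

theorem contDiffAt_couplingLC (m : Fin 4 → ℝ) (hx : x₀ ≠ 0) :
    ContDiffAt ℝ ω (fun q : (Fin 2 → ℂ) × ℂ => couplingLC m q.1 q.2) (0, x₀) := by
  simp only [couplingLC_eq]
  refine ContDiffAt.sum fun i _ => ContDiffAt.sum fun l _ => contDiffAt_const.mul ?_
  refine contDiffAt_const.div (ContDiffAt.norm ℝ ?_ (by simpa using hx)) (by simpa using hx)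
  have h : ∀ j : Fin 2, ContDiffAt ℝ ω (fun q : (Fin 2 → ℂ) × ℂ => q.1 j) (0, x₀) := fun j =>
    ((contDiff_apply ℝ ℂ j).comp contDiff_fst).contDiffAt
  exact contDiffAt_snd.add ((contDiffAt_const.mul ((h 0).pow 2)).add
    (contDiffAt_const.mul ((h 1).pow 2)))

theorem conj_gradZ {z : Fin 2 → ℂ} {x : ℂ} (j : Fin 2)
    (h : DifferentiableAt ℝ (fun q : (Fin 2 → ℂ) × ℂ => couplingLC m q.1 q.2) (z, x)) :
    conj (gradZ m z x j) =
      dirGrad (inlSingle ℂ j) (fun q : (Fin 2 → ℂ) × ℂ => couplingLC m q.1 q.2) (z, x) := by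
  rw [gradZ, conj_gradient, dirGrad]
  congr 1
  have h1 := hasFDerivAt_update (𝕜 := ℝ) z (i := j) (z j)
  have h2 : HasFDerivAt (𝕜 := ℝ) (fun w : ℂ => (Function.update z j w, x)) _ (z j) :=
    h1.prodMk (hasFDerivAt_const (𝕜 := ℝ) x (z j))
  have h3 : HasFDerivAt (fun q : (Fin 2 → ℂ) × ℂ => couplingLC m q.1 q.2)
      (fderiv ℝ (fun q : (Fin 2 → ℂ) × ℂ => couplingLC m q.1 q.2) (z, x))
      (Function.update z j (z j), x) := by
    rw [Function.update_eq_self]; exact h.hasFDerivAt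
  refine (h3.comp (z j) h2).fderiv.trans ?_
  refine ContinuousLinearMap.ext fun w => ?_
  simp only [ContinuousLinearMap.comp_apply, inlSingle]
  congr 1
  refine Prod.ext ?_ rfl
  ext i
  rcases eq_or_ne i j with rfl | hij
  · simp
  · simp [hij]

theorem conj_gradX {z : Fin 2 → ℂ} {x : ℂ}
    (h : DifferentiableAt ℝ (fun q : (Fin 2 → ℂ) × ℂ => couplingLC m q.1 q.2) (z, x)) :
    conj (gradX m z x) = dirGrad (ContinuousLinearMap.inr ℝ _ ℂ)
      (fun q : (Fin 2 → ℂ) × ℂ => couplingLC m q.1 q.2) (z, x) := by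
  rw [gradX, conj_gradient, dirGrad]
  congr 1
  have h2 : HasFDerivAt (fun w : ℂ => (z, w)) _ x :=
    (hasFDerivAt_const (𝕜 := ℝ) z x).prodMk (hasFDerivAt_id x)
  exact (h.hasFDerivAt.comp x h2).fderiv

/-- Forgetting one of the binaries. -/
def forget (j : Fin 2) : (Fin 2 → ℂ) × ℂ →L[ℝ] ℂ × ℂ :=
  (ContinuousLinearMap.proj (R := ℝ) (φ := fun _ : Fin 2 => ℂ) j ∘L
    ContinuousLinearMap.fst ℝ _ _).prod (ContinuousLinearMap.snd ℝ _ _)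

theorem forget_apply (j : Fin 2) (q : (Fin 2 → ℂ) × ℂ) : forget j q = (q.1 j, q.2) := rfl

theorem contDiffAt_binPot (m : Fin 4 → ℝ) (hx : x₀ ≠ 0) (j : Fin 2) :
    ContDiffAt ℝ ω (binPot m j) (0, x₀) := by
  have h1 : ContDiffAt ℝ ω (fun q : ℂ × ℂ => ((Pi.single j q.1 : Fin 2 → ℂ), q.2)) (0, x₀) :=
    (((ContinuousLinearMap.single ℝ (fun _ : Fin 2 => ℂ) j).contDiff.comp contDiff_fst).prodMk
      contDiff_snd).contDiffAt
  have h2 : ContDiffAt ℝ ω (fun q : ℂ × ℂ => ((0 : Fin 2 → ℂ), q.2)) (0, x₀) :=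
    contDiffAt_const.prodMk contDiffAt_snd
  have e1 : ((Pi.single j (0 : ℂ) : Fin 2 → ℂ), x₀) = (0, x₀) := by rw [Pi.single_zero]
  have h3 := ContDiffAt.comp (g := fun q : (Fin 2 → ℂ) × ℂ => couplingLC m q.1 q.2) ((0 : ℂ), x₀)
    (by rw [e1]; exact contDiffAt_couplingLC m hx) h1
  have h4 := ContDiffAt.comp (g := fun q : (Fin 2 → ℂ) × ℂ => couplingLC m q.1 q.2) ((0 : ℂ), x₀)
    (contDiffAt_couplingLC m hx) h2
  exact h3.sub h4

/-- The potential is its value at `z = 0` plus two single parts plus the mixed part. A derivative in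
`z_j` sees only the `j`-th single part and the mixed part; a derivative in `x` sees all four. -/
theorem eventually_dirGrad_coupling (hm : ∀ i, 0 < m i) (hx : x₀ ≠ 0) :
    ∀ᶠ q in 𝓝 ((0 : Fin 2 → ℂ), x₀), 
      (∀ j, conj (gradZ m q.1 q.2 j) = dirGrad (ContinuousLinearMap.inl ℝ ℂ ℂ) (binPot m j)
        (q.1 j, q.2) + dirGrad (inlSingle ℂ j) (mixPot m) q) ∧
      conj (gradX m q.1 q.2) = conjGrad (fderiv ℝ (fun x => couplingLC m 0 x) q.2) +
        dirGrad (ContinuousLinearMap.inr ℝ ℂ ℂ) (binPot m 0) (q.1 0, q.2) +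
        dirGrad (ContinuousLinearMap.inr ℝ ℂ ℂ) (binPot m 1) (q.1 1, q.2) +
        dirGrad (ContinuousLinearMap.inr ℝ _ ℂ) (mixPot m) q := by
  have hK := contDiffAt_couplingLC m hx
  have hM := vanishOrder_mixPot hm hx
  have hB : ∀ j, ∀ᶠ q in 𝓝 ((0 : Fin 2 → ℂ), x₀), DifferentiableAt ℝ (binPot m j) (forget j q) :=
    fun j => by
      have h1 := (VanishOrder.smooth (contDiffAt_binPot m hx j)).eventually_differentiableAt
      exact Tendsto.eventually ((forget j).continuous.tendsto' _ _ rfl) h1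
  have h00 : ContDiffAt ℝ ω (fun x => couplingLC m 0 x) x₀ :=
    ContDiffAt.comp (g := fun q : (Fin 2 → ℂ) × ℂ => couplingLC m q.1 q.2)
      (f := fun x : ℂ => ((0 : Fin 2 → ℂ), x)) x₀ hK (contDiffAt_const.prodMk contDiffAt_id)
  have h0 : ∀ᶠ q in 𝓝 ((0 : Fin 2 → ℂ), x₀), DifferentiableAt ℝ (fun x => couplingLC m 0 x) q.2 := by
    have h1 : ∀ᶠ x in 𝓝 x₀, ContDiffAt ℝ 1 (fun x => couplingLC m 0 x) x :=
      (h00.of_le (m := 1) le_top).eventually (by simp)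
    exact (continuous_snd.tendsto' ((0 : Fin 2 → ℂ), x₀) x₀ rfl).eventually
      (h1.mono fun x h => h.differentiableAt (by simp))
  filter_upwards [(VanishOrder.smooth hK).eventually_differentiableAt,
    hM.eventually_differentiableAt, hB 0, hB 1, h0] with q hKq hMq hB0 hB1 h0q
  have hB0' : DifferentiableAt ℝ (fun q => binPot m 0 (forget 0 q)) q :=
    hB0.comp q (forget 0).differentiableAt
  have hB1' : DifferentiableAt ℝ (fun q => binPot m 1 (forget 1 q)) q :=
    hB1.comp q (forget 1).differentiableAt
  have h0' : DifferentiableAt ℝ (fun q : (Fin 2 → ℂ) × ℂ => couplingLC m 0 q.2) q :=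
    h0q.comp q differentiableAt_snd
  have e : (fun q : (Fin 2 → ℂ) × ℂ => couplingLC m q.1 q.2) = fun q =>
      couplingLC m 0 q.2 + binPot m 0 (forget 0 q) + binPot m 1 (forget 1 q) + mixPot m q := by
    funext q
    simp only [forget_apply, mixPot]
    ring
  have key : ∀ d : ℂ →L[ℝ] (Fin 2 → ℂ) × ℂ,
      dirGrad d (fun q : (Fin 2 → ℂ) × ℂ => couplingLC m q.1 q.2) q =
        conjGrad (fderiv ℝ (fun x => couplingLC m 0 x) q.2 ∘L ContinuousLinearMap.snd ℝ _ _ ∘L d) +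
        dirGrad (forget 0 ∘L d) (binPot m 0) (forget 0 q) +
        dirGrad (forget 1 ∘L d) (binPot m 1) (forget 1 q) + dirGrad d (mixPot m) q := fun d => by
    rw [e, dirGrad_add d (f := fun q : (Fin 2 → ℂ) × ℂ => couplingLC m 0 q.2 +
      binPot m 0 (forget 0 q) + binPot m 1 (forget 1 q)) ((h0'.add hB0').add hB1') hMq,
      dirGrad_add d (f := fun q : (Fin 2 → ℂ) × ℂ => couplingLC m 0 q.2 +
      binPot m 0 (forget 0 q)) (h0'.add hB0') hB1', dirGrad_add d h0' hB0',
      dirGrad_comp d (forget 0) hB0, dirGrad_comp d (forget 1) hB1]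
    congr 3
    have h6 : fderiv ℝ (fun q : (Fin 2 → ℂ) × ℂ => couplingLC m 0 q.2) q =
      fderiv ℝ (fun x => couplingLC m 0 x) q.2 ∘L ContinuousLinearMap.snd ℝ _ _ :=
      (h0q.hasFDerivAt.comp q hasFDerivAt_snd).fderiv
    rw [dirGrad, h6, ContinuousLinearMap.comp_assoc]
  have hz : ∀ j : Fin 2, ContinuousLinearMap.snd ℝ _ _ ∘L inlSingle ℂ j = 0 := fun j => by
    refine ContinuousLinearMap.ext fun w => ?_
    simp [inlSingle]
  have hd : ∀ j : Fin 2, forget j ∘L inlSingle ℂ j = ContinuousLinearMap.inl ℝ ℂ ℂ := fun j => by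
    refine ContinuousLinearMap.ext fun w => ?_
    simp [inlSingle, forget]
  have hne : ∀ i j : Fin 2, i ≠ j → forget i ∘L inlSingle ℂ j = 0 := fun i j hij => by
    refine ContinuousLinearMap.ext fun w => ?_
    simp [inlSingle, forget, hij]
  have hr : ∀ j : Fin 2, forget j ∘L ContinuousLinearMap.inr ℝ _ ℂ =
      ContinuousLinearMap.inr ℝ ℂ ℂ := fun j => by
    refine ContinuousLinearMap.ext fun w => ?_
    simp [forget]
  have hzero : ∀ (f : ℂ × ℂ → ℝ) (q), dirGrad (0 : ℂ →L[ℝ] ℂ × ℂ) f q = 0 := fun f q => by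
    rw [dirGrad, ContinuousLinearMap.comp_zero, map_zero]
  refine ⟨fun j => ?_, ?_⟩
  · rw [conj_gradZ j hKq, key, hz, ContinuousLinearMap.comp_zero, map_zero]
    fin_cases j
    · have h1 := hd 0
      have h2 := hne 1 0 (by decide)
      simp only [Fin.zero_eta, h1, h2, hzero, forget_apply]
      ring
    · have h1 := hd 1
      have h2 := hne 0 1 (by decide)
      simp only [Fin.mk_one, h1, h2, hzero, forget_apply]
      ring
  · rw [conj_gradX hKq, key, hr, hr]
    simp only [forget_apply]
    congr 1

/-- The conjugate gradient of the quartic leading part. -/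
theorem dirGrad_quartic {B : Type} [NormedAddCommGroup B] [NormedSpace ℝ B] {c : B → ℂ}
    {d : B → ℝ} {q : ℂ × B} (hc : DifferentiableAt ℝ c q.2)
    (hd : DifferentiableAt ℝ d q.2) :
    dirGrad (ContinuousLinearMap.inl ℝ ℂ B)
      (fun q : ℂ × B => (c q.2 * q.1 ^ 4).re + d q.2 * (‖q.1‖ ^ 2) ^ 2) q =
      4 * c q.2 * q.1 ^ 3 + ((4 * d q.2 * ‖q.1‖ ^ 2 : ℝ) : ℂ) * conj q.1 := by
  have hf : DifferentiableAt ℝ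
      (fun q : ℂ × B => (c q.2 * q.1 ^ 4).re + d q.2 * (‖q.1‖ ^ 2) ^ 2) q := by
    have h1 : DifferentiableAt ℝ (fun q : ℂ × B => c q.2) q := hc.comp q differentiableAt_snd
    have h2 : DifferentiableAt ℝ (fun q : ℂ × B => d q.2) q := hd.comp q differentiableAt_snd
    have h3 : DifferentiableAt ℝ (fun q : ℂ × B => ‖q.1‖ ^ 2) q := differentiableAt_fst.norm_sq ℝ
    exact (Complex.reCLM.differentiableAt.comp q (h1.mul (differentiableAt_fst.pow 4))).add
      (h2.mul (h3.pow 2))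
  have hl : fderiv ℝ (fun q : ℂ × B => (c q.2 * q.1 ^ 4).re + d q.2 * (‖q.1‖ ^ 2) ^ 2) q ∘L
      ContinuousLinearMap.inl ℝ ℂ B =
      fderiv ℝ (fun z : ℂ => (c q.2 * z ^ 4).re + d q.2 * (‖z‖ ^ 2) ^ 2) q.1 := by
    have h2 : HasFDerivAt (fun w : ℂ => (w, q.2)) (ContinuousLinearMap.inl ℝ ℂ B) q.1 :=
      (hasFDerivAt_id q.1).prodMk (hasFDerivAt_const q.2 q.1)
    exact (hf.hasFDerivAt.comp q.1 h2).fderiv.symm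
  rw [dirGrad, hl]
  have h1 : HasFDerivAt (fun z : ℂ => c q.2 * z ^ 4) _ q.1 :=
    (((hasDerivAt_pow 4 q.1).const_mul (c q.2)).hasFDerivAt.restrictScalars ℝ)
  have h2 := (((hasStrictFDerivAt_norm_sq q.1).hasFDerivAt.pow 2).const_mul (d q.2))
  have h3 : fderiv ℝ (fun z : ℂ => (c q.2 * z ^ 4).re + d q.2 * (‖z‖ ^ 2) ^ 2) q.1 = _ :=
    ((Complex.reCLM.hasFDerivAt.comp q.1 h1).add h2).fderiv
  rw [h3, conjGrad_apply]
  apply Complex.ext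
  · simp [Complex.inner]; ring
  · simp [Complex.inner]; ring

end Gradients

end

end SBC

namespace SBC

noncomputable section

/-! ### A single binary -/

/-- The variables `(h, θ, x, y)` of a single binary. -/
abbrev BinBase : Type := ℝ × ℝ × ℂ × ℂ

/-- The coordinates `(ζ, (h, θ, x, y))` of a single binary. -/
abbrev Bin : Type := ℂ × BinBase

/-- `h |ζ|²`. -/
def binS (p : Bin) : ℝ := p.2.1 * ‖p.1‖ ^ 2
/-- `U`, the magnitude of the Levi-Civita momentum. -/
def binU (p : Bin) : ℝ := √((1 + √(1 + 4 * binS p)) / 2)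
/-- `Γ`. -/
def binGam (p : Bin) : ℂ := Complex.exp ((p.2.2.1 : ℂ) * Complex.I)
/-- The Levi-Civita position. -/
def binZ (a : ℝ) (p : Bin) : ℂ := ((a / binU p : ℝ) : ℂ) * binGam p * p.1
/-- The conjugate gradient of the potential of a single binary, in the direction `Γ`. -/
def binGrad (m : Fin 4 → ℝ) (j : Fin 2) (p : Bin) : ℂ :=
  binGam p * dirGrad (ContinuousLinearMap.inl ℝ ℂ ℂ) (binPot m j) (binZ (aRoot m j) p, p.2.2.2.1)
/-- The part of the force on the centres of mass due to a single binary. -/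
def binForceOne (m : Fin 4 → ℝ) (j : Fin 2) (p : Bin) : ℂ :=
  conj (dirGrad (ContinuousLinearMap.inr ℝ ℂ ℂ) (binPot m j) (binZ (aRoot m j) p, p.2.2.2.1))
/-- The force on the centres of mass in the absence of the other binary. -/
def binForce (m : Fin 4 → ℝ) (j : Fin 2) (p : Bin) : ℂ :=
  conj (conjGrad (fderiv ℝ (fun x => couplingLC m 0 x) p.2.2.2.1)) + binForceOne m j p
/-- The components of the vector field that concern a single binary, without the factor `|ζ|²` of the
other binary, in terms of the conjugate gradient `c` and the force `n`. -/
def binField (mu : ℝ) (p : Bin) (c n : ℂ) : Bin :=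
  (((binU p ^ 2 + 2 * binS p : ℝ) : ℂ) + ((‖p.1‖ ^ 2 / binU p : ℝ) : ℂ) * (p.1 * c),
    2 * binU p ^ 3 * c.re, p.2.1 * p.1.im - ‖p.1‖ ^ 2 * c.im / binU p,
    ((‖p.1‖ ^ 2 * mu : ℝ) : ℂ) * p.2.2.2.2, ((‖p.1‖ ^ 2 : ℝ) : ℂ) * n)
/-- The vector field of a single binary. -/
def binVec (m : Fin 4 → ℝ) (j : Fin 2) (p : Bin) : Bin :=
  binField (muConst m) p (binGrad m j p) (binForce m j p)

section Bin

variable {b : BinBase} {m : Fin 4 → ℝ}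

theorem vanishOrder_bin_fst : VanishOrder b 1 (fun p : Bin => p.1) :=
  VanishOrder.linear (ContinuousLinearMap.id ℝ ℂ)

theorem vanishOrder_rho : VanishOrder b 2 (fun p : Bin => ‖p.1‖ ^ 2) :=
  vanishOrder_norm_sq vanishOrder_bin_fst

theorem vanishOrder_binS : VanishOrder b 2 binS := by
  have h : VanishOrder b 0 (fun p : Bin => p.2.1) :=
    .smooth (contDiffAt_fst.comp _ contDiffAt_snd)
  exact (h.mul' vanishOrder_rho).mono (by norm_num)

theorem contDiffAt_sqrt_binS : ContDiffAt ℝ ω (fun p : Bin => √(1 + 4 * binS p)) (0, b) := by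
  refine ContDiffAt.sqrt ?_ (by simp [binS])
  exact contDiffAt_const.add (contDiffAt_const.mul vanishOrder_binS.contDiffAt)

theorem contDiffAt_binU : ContDiffAt ℝ ω binU (0, b) := by
  refine ContDiffAt.sqrt ?_ (by simp [binS])
  exact (contDiffAt_const.add contDiffAt_sqrt_binS).div_const 2

theorem binU_zero (b : BinBase) : binU (0, b) = 1 := by simp [binU, binS]

theorem contDiffAt_inv_binU : ContDiffAt ℝ ω (fun p => (binU p)⁻¹) (0, b) :=
  contDiffAt_binU.inv (by simp [binU_zero])

theorem eventually_binU : ∀ᶠ p in 𝓝 ((0 : ℂ), b), 0 < binU p ∧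
    binU p ^ 2 * (binU p ^ 2 - 1) = binS p := by
  have h1 : ∀ᶠ p in 𝓝 ((0 : ℂ), b), 0 < 1 + 4 * binS p := by
    have : ContinuousAt (fun p => 1 + 4 * binS p) ((0 : ℂ), b) :=
      continuousAt_const.add (continuousAt_const.mul vanishOrder_binS.contDiffAt.continuousAt)
    exact this.eventually (lt_mem_nhds (by simp [binS]))
  filter_upwards [h1] with p hp
  have e : binU p ^ 2 = (1 + √(1 + 4 * binS p)) / 2 := Real.sq_sqrt (by positivity)
  refine ⟨Real.sqrt_pos.2 (by positivity), ?_⟩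
  rw [e]
  nlinarith [Real.sq_sqrt hp.le]

theorem vanishOrder_binU_sub_one : VanishOrder b 2 (fun p => binU p - 1) := by
  have h1 : VanishOrder b 0 (fun p => (binU p)⁻¹ ^ 2 * (binU p + 1)⁻¹) := by
    refine .smooth ((contDiffAt_inv_binU.pow 2).mul ?_)
    exact (contDiffAt_binU.add contDiffAt_const).inv (by simp [binU_zero])
  refine (vanishOrder_binS.mul' h1).congr ?_
  filter_upwards [eventually_binU] with p ⟨h, h'⟩
  rw [← h']
  field_simp
  ring

theorem vanishOrder_binU_cube : VanishOrder b 2 (fun p => binU p ^ 3 - 1) := by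
  have h1 : VanishOrder b 0 (fun p => binU p ^ 2 + binU p + 1) :=
    .smooth (((contDiffAt_binU.pow 2).add contDiffAt_binU).add contDiffAt_const)
  exact (vanishOrder_binU_sub_one.mul' h1).congr (by filter_upwards with p using by ring)

theorem vanishOrder_inv_binU : VanishOrder b 2 (fun p => (binU p)⁻¹ - 1) := by
  refine (vanishOrder_binU_sub_one.mul' (VanishOrder.smooth contDiffAt_inv_binU)).neg.congr ?_
  filter_upwards [eventually_binU] with p ⟨h, _⟩
  field_simp
  ring

/-- The relation `U² (U² - 1) = S` gives `U² = 1 + S - S² + 2 S³ + O(S⁴)`, and `S` has order 2. -/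
theorem vanishOrder_binA : VanishOrder b 8 (fun p => binU p ^ 2 + 2 * binS p -
    (1 + 3 * binS p - binS p ^ 2 + 2 * binS p ^ 3)) := by
  have hS : VanishOrder b 0 binS := vanishOrder_binS.mono (by norm_num)
  have hP : VanishOrder b 0 (fun p => (binU p)⁻¹ ^ 4) := .smooth (contDiffAt_inv_binU.pow 4)
  have h := (vanishOrder_binS.pow 4).mul' (((hP.const_mul 4).sub ((hS.mul' (hP.pow 2)).const_mul
    2)).add (hP.pow 2))
  refine (h.neg.mono (by norm_num)).congr ?_
  filter_upwards [eventually_binU] with p ⟨h, h'⟩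
  rw [← h']
  field_simp
  ring

theorem contDiffAt_binGam : ContDiffAt ℝ ω binGam (0, b) := by
  have h : ContDiff ℝ ω (fun t : ℝ => Complex.exp ((t : ℂ) * Complex.I)) := by
    have h2 : ContDiff ℝ ω (fun t : ℝ => (t : ℂ) * Complex.I) :=
      Complex.ofRealCLM.contDiff.mul contDiff_const
    exact Complex.contDiff_exp.comp h2
  exact h.contDiffAt.comp _ (contDiffAt_fst.comp _ (contDiffAt_snd.comp _ contDiffAt_snd))

theorem vanishOrder_binZ_sub (a : ℝ) :
    VanishOrder b 3 (fun p => binZ a p - (a : ℂ) * binGam p * p.1) := by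
  have h1 : VanishOrder b 2 (fun p => ((a * ((binU p)⁻¹ - 1) : ℝ) : ℂ)) :=
    (vanishOrder_inv_binU.const_mul a).clm Complex.ofRealCLM
  refine ((h1.mul' (VanishOrder.smooth contDiffAt_binGam)).mul' vanishOrder_bin_fst).congr ?_
  filter_upwards with p
  rw [binZ]
  push_cast
  ring

theorem vanishOrder_binGam_mul (a : ℝ) :
    VanishOrder b 1 (fun p : Bin => (a : ℂ) * binGam p * p.1) := by
  simpa using ((VanishOrder.smooth contDiffAt_binGam).const_mul (a : ℂ)).mul' vanishOrder_bin_fst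

theorem vanishOrder_binZ (a : ℝ) : VanishOrder b 1 (binZ a) :=
  (((vanishOrder_binZ_sub a).mono (by norm_num)).add (vanishOrder_binGam_mul a)).congr
    (by filter_upwards with p using by ring)

theorem contDiffAt_binSep : ContDiffAt ℝ ω (fun p : Bin => p.2.2.2.1) (0, b) := by fun_prop

theorem contDiffAt_binZ_sep (a : ℝ) :
    ContDiffAt ℝ ω (fun p : Bin => (binZ a p, p.2.2.2.1)) (0, b) :=
  (vanishOrder_binZ a).contDiffAt.prodMk contDiffAt_binSep

theorem binZ_zero (a : ℝ) (b : BinBase) : binZ a (0, b) = 0 := by simp [binZ]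

theorem VanishOrder.comp_binZ {F : Type} [NormedAddCommGroup F] [NormedSpace ℝ F]
    {f : ℂ × ℂ → F} {k : ℕ} (hf : VanishOrder b.2.2.1 k f) (a : ℝ) :
    VanishOrder b k (fun p : Bin => f (binZ a p, p.2.2.2.1)) := by
  simpa using hf.comp (contDiffAt_binZ_sep a) (by rw [binZ_zero]) (vanishOrder_binZ a)

theorem vanishOrder_binPot_four (hm : ∀ i, 0 < m i) {x₀ : ℂ} (hx : x₀ ≠ 0) (j : Fin 2) :
    VanishOrder x₀ 4 (binPot m j) := by
  obtain ⟨c, d, hc, hd, h⟩ := vanishOrder_binPot hm hx j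
  have hz : VanishOrder x₀ 1 (fun q : ℂ × ℂ => q.1) :=
    VanishOrder.linear (ContinuousLinearMap.id ℝ ℂ)
  have hc' : VanishOrder x₀ 0 (fun q : ℂ × ℂ => c q.2) :=
    .smooth (ContDiffAt.comp (0, x₀) hc contDiffAt_snd)
  have hd' : VanishOrder x₀ 0 (fun q : ℂ × ℂ => d q.2) :=
    .smooth (ContDiffAt.comp (0, x₀) hd contDiffAt_snd)
  have h1 := (hc'.mul' (hz.pow 4)).clm Complex.reCLM
  have h2 := hd'.mul' ((vanishOrder_norm_sq hz).pow 2)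
  refine ((h.mono (by norm_num)).add ((h1.mono (by norm_num)).add (h2.mono (by norm_num)))).congr ?_
  filter_upwards with q
  simp

/-- The leading part of the gradient of the potential of a single binary. -/
theorem exists_binGrad_leading (hm : ∀ i, 0 < m i) (hx : b.2.2.1 ≠ 0) (j : Fin 2) :
    ∃ (c : BinBase → ℂ) (d : BinBase → ℝ), ContDiffAt ℝ ω c b ∧ ContDiffAt ℝ ω d b ∧
      VanishOrder b 5 (fun p => binGrad m j p -
        (c p.2 * p.1 ^ 3 + ((d p.2 * ‖p.1‖ ^ 2 : ℝ) : ℂ) * conj p.1)) := by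
  obtain ⟨c, d, hc, hd, h⟩ := vanishOrder_binPot hm hx j
  set a := aRoot m j
  have hsep : ContDiffAt ℝ ω (fun v : BinBase => v.2.2.1) b := by fun_prop
  have hG : ContDiffAt ℝ ω (fun v : BinBase => Complex.exp ((v.2.1 : ℂ) * Complex.I)) b :=
    ContDiffAt.comp (g := binGam) (f := fun v : BinBase => ((0 : ℂ), v)) b contDiffAt_binGam
      (contDiffAt_const.prodMk contDiffAt_id)
  have hcx : ContDiffAt ℝ ω (fun v : BinBase => c v.2.2.1) b := ContDiffAt.comp b hc hsep
  have hdx : ContDiffAt ℝ ω (fun v : BinBase => d v.2.2.1) b := ContDiffAt.comp b hd hsep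
  -- To leading order `z = a Γ ζ`. In `Γ (4 c z³ + 4 d |z|² conj z)` the unit factors combine to
  -- `Γ⁴` in the first term and cancel in the second; both terms carry `a³`.
  refine ⟨fun v => 4 * (a : ℂ) ^ 3 * c v.2.2.1 * Complex.exp ((v.2.1 : ℂ) * Complex.I) ^ 4,
    fun v => 4 * a ^ 3 * d v.2.2.1, (contDiffAt_const.mul hcx).mul (hG.pow 4),
    contDiffAt_const.mul hdx, ?_⟩
  have h1 := vanishOrder_dirGrad (ContinuousLinearMap.inl ℝ ℂ ℂ) h
  have hc1 : ∀ᶠ x in 𝓝 b.2.2.1, DifferentiableAt ℝ c x :=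
    ((hc.of_le (m := 1) le_top).eventually (by simp)).mono
      fun x h => h.differentiableAt (by simp)
  have hd1 : ∀ᶠ x in 𝓝 b.2.2.1, DifferentiableAt ℝ d x :=
    ((hd.of_le (m := 1) le_top).eventually (by simp)).mono
      fun x h => h.differentiableAt (by simp)
  have ht : Tendsto (Prod.snd : ℂ × ℂ → ℂ) (𝓝 (0, b.2.2.1)) (𝓝 b.2.2.1) :=
    continuous_snd.tendsto' _ _ rfl
  have h2 : VanishOrder b.2.2.1 5 (fun q : ℂ × ℂ =>
      dirGrad (ContinuousLinearMap.inl ℝ ℂ ℂ) (binPot m j) q -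
        (4 * c q.2 * q.1 ^ 3 + ((4 * d q.2 * ‖q.1‖ ^ 2 : ℝ) : ℂ) * conj q.1)) := by
    refine h1.congr ?_
    have h3 := (VanishOrder.smooth (contDiffAt_binPot m hx j)).eventually_differentiableAt
    filter_upwards [h3, h.eventually_differentiableAt, ht.eventually hc1, ht.eventually hd1]
      with q hq hq' hcq hdq
    rw [← dirGrad_quartic hcq hdq, dirGrad_sub _ hq]
    have := hq.sub hq'
    refine this.congr_of_eventuallyEq ?_
    filter_upwards with q
    simp
  have h3 := h2.comp_binZ a
  have hGam : VanishOrder b 0 binGam := .smooth contDiffAt_binGam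
  have hZ := vanishOrder_binZ (b := b) a
  have hZ0 := vanishOrder_binGam_mul (b := b) a
  have hZs := vanishOrder_binZ_sub (b := b) a
  have hcv : VanishOrder b 0 (fun p : Bin => c p.2.2.2.1) :=
    .smooth (ContDiffAt.comp (g := fun v : BinBase => c v.2.2.1) ((0 : ℂ), b) hcx contDiffAt_snd)
  have hdv : VanishOrder b 0 (fun p : Bin => ((d p.2.2.2.1 : ℝ) : ℂ)) :=
    (VanishOrder.smooth (ContDiffAt.comp (g := fun v : BinBase => d v.2.2.1) ((0 : ℂ), b) hdx
      contDiffAt_snd)).clm Complex.ofRealCLM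
  have hcube : VanishOrder b 5 (fun p => binZ a p ^ 3 - ((a : ℂ) * binGam p * p.1) ^ 3) := by
    have := hZs.mul' (((hZ.pow 2).add (hZ.mul' hZ0)).add (hZ0.pow 2))
    exact this.congr (by filter_upwards with p using by ring)
  have hcj : VanishOrder b 1 (fun p => conj (binZ a p)) := hZ.clm Complex.conjCLE.toContinuousLinearMap
  have hcj0 : VanishOrder b 1 (fun p : Bin => conj ((a : ℂ) * binGam p * p.1)) :=
    hZ0.clm Complex.conjCLE.toContinuousLinearMap
  have hcjs : VanishOrder b 3 (fun p : Bin => conj (binZ a p - (a : ℂ) * binGam p * p.1)) :=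
    hZs.clm Complex.conjCLE.toContinuousLinearMap
  have hsq : VanishOrder b 5 (fun p => binZ a p * conj (binZ a p) ^ 2 -
      ((a : ℂ) * binGam p * p.1) * conj ((a : ℂ) * binGam p * p.1) ^ 2) := by
    have := (hZs.mul' (hcj.pow 2)).add ((hZ0.mul' hcjs).mul' (hcj.add hcj0))
    refine this.congr ?_
    filter_upwards with p
    rw [map_sub]
    ring
  have h4 := hGam.mul' (h3.add (((hcv.mul' hcube).const_mul 4).add ((hdv.mul' hsq).const_mul 4)))
  refine (h4.mono (by norm_num)).congr ?_
  filter_upwards with p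
  have hunit : binGam p * conj (binGam p) = 1 := by
    rw [Complex.mul_conj, Complex.normSq_eq_norm_sq, binGam, Complex.norm_exp_ofReal_mul_I]
    simp
  have hnorm : ∀ z : ℂ, (‖z‖ : ℂ) ^ 2 = z * conj z := fun z => by
    rw [Complex.mul_conj, Complex.normSq_eq_norm_sq, Complex.ofReal_pow]
  simp only [binGrad]
  push_cast [hnorm]
  simp only [map_mul, Complex.conj_ofReal]
  have e : Complex.exp ((p.2.2.1 : ℂ) * Complex.I) = binGam p := rfl
  rw [e]
  linear_combination (-4 * d p.2.2.2.1 * (a : ℂ) ^ 3 * p.1 * conj p.1 ^ 2 *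
    (binGam p * conj (binGam p) + 1)) * hunit

theorem vanishOrder_binGrad (hm : ∀ i, 0 < m i) (hx : b.2.2.1 ≠ 0) (j : Fin 2) :
    VanishOrder b 3 (binGrad m j) := by
  have h := (vanishOrder_dirGrad (ContinuousLinearMap.inl ℝ ℂ ℂ)
    (vanishOrder_binPot_four hm hx j)).comp_binZ (b := b) (aRoot m j)
  exact ((VanishOrder.smooth contDiffAt_binGam).mul' h).mono (by norm_num)

theorem vanishOrder_binForceOne (hm : ∀ i, 0 < m i) (hx : b.2.2.1 ≠ 0) (j : Fin 2) :
    VanishOrder b 4 (binForceOne m j) :=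
  ((vanishOrder_dirGrad_inr (vanishOrder_binPot_four hm hx j)).comp_binZ (b := b)
    (aRoot m j)).clm Complex.conjCLE.toContinuousLinearMap

theorem contDiffAt_coupling_zero (m : Fin 4 → ℝ) {x₀ : ℂ} (hx : x₀ ≠ 0) :
    ContDiffAt ℝ ω (fun x => couplingLC m 0 x) x₀ :=
  ContDiffAt.comp (g := fun q : (Fin 2 → ℂ) × ℂ => couplingLC m q.1 q.2)
    (f := fun x : ℂ => ((0 : Fin 2 → ℂ), x)) x₀ (contDiffAt_couplingLC m hx)
    (contDiffAt_const.prodMk contDiffAt_id)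

theorem contDiffAt_binForce (hm : ∀ i, 0 < m i) (hx : b.2.2.1 ≠ 0) (j : Fin 2) :
    ContDiffAt ℝ ω (binForce m j) (0, b) := by
  refine ContDiffAt.add ?_ (vanishOrder_binForceOne hm hx j).contDiffAt
  refine Complex.conjCLE.contDiff.contDiffAt.comp _ (conjGrad.contDiff.contDiffAt.comp _ ?_)
  exact ContDiffAt.comp (g := fun x => fderiv ℝ (fun x => couplingLC m 0 x) x)
    (f := fun p : Bin => p.2.2.2.1) (0, b)
    ((contDiffAt_coupling_zero m hx).fderiv_right le_top) contDiffAt_binSep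

/-- The orders of the components of the vector field of a single binary. -/
theorem vanishOrder_binField {E B : Type} [NormedAddCommGroup E] [NormedSpace ℝ E]
    [NormedAddCommGroup B] [NormedSpace ℝ B] {p₀ : B} {π : E × B → Bin}
    (hπ : ContDiffAt ℝ ω π (0, p₀)) (h0 : π (0, p₀) = (0, b))
    (h1 : VanishOrder p₀ 1 (fun q => (π q).1)) {c n : E × B → ℂ} {k l : ℕ}
    (hc : VanishOrder p₀ k c) (hn : VanishOrder p₀ l n) :
    VanishOrder p₀ (k + 3) (fun q =>
      ((‖(π q).1‖ ^ 2 / binU (π q) : ℝ) : ℂ) * ((π q).1 * c q)) ∧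
    VanishOrder p₀ k (fun q => 2 * binU (π q) ^ 3 * (c q).re) ∧
    VanishOrder p₀ (k + 2) (fun q => ‖(π q).1‖ ^ 2 * (c q).im / binU (π q)) ∧
    VanishOrder p₀ (l + 2) (fun q => ((‖(π q).1‖ ^ 2 : ℝ) : ℂ) * n q) := by
  have hρ : VanishOrder p₀ 2 (fun q => ‖(π q).1‖ ^ 2) := vanishOrder_norm_sq h1
  have hU : VanishOrder p₀ 0 (fun q => binU (π q)) := by
    simpa using (VanishOrder.smooth (contDiffAt_binU (b := b))).comp hπ h0 h1
  have hUi : VanishOrder p₀ 0 (fun q => (binU (π q))⁻¹) := by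
    simpa using (VanishOrder.smooth (contDiffAt_inv_binU (b := b))).comp hπ h0 h1
  refine ⟨?_, ?_, ?_, ?_⟩
  · refine ((((hρ.mul' hUi).clm Complex.ofRealCLM).mul' (h1.mul' hc)).mono (by omega)).congr ?_
    filter_upwards with q
    simp [div_eq_mul_inv]
  · refine ((((hU.pow 3).const_mul 2).mul' (hc.clm Complex.reCLM)).mono (by omega)).congr ?_
    filter_upwards with q
    simp
  · refine (((hρ.mul' (hc.clm Complex.imCLM)).mul' hUi).mono (by omega)).congr ?_
    filter_upwards with q
    simp [div_eq_mul_inv]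
  · exact ((hρ.clm Complex.ofRealCLM).mul' hn).mono (by omega)

theorem contDiffAt_binVec (hm : ∀ i, 0 < m i) (hx : b.2.2.1 ≠ 0) (j : Fin 2) :
    ContDiffAt ℝ ω (binVec m j) (0, b) := by
  obtain ⟨h1, h2, h3, h4⟩ := vanishOrder_binField (π := fun p : Bin => p)
    contDiffAt_id rfl vanishOrder_bin_fst (vanishOrder_binGrad hm hx j)
    (VanishOrder.smooth (contDiffAt_binForce hm hx j))
  have hA : ContDiffAt ℝ ω (fun p => ((binU p ^ 2 + 2 * binS p : ℝ) : ℂ)) (0, b) :=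
    Complex.ofRealCLM.contDiff.contDiffAt.comp _ ((contDiffAt_binU.pow 2).add
      (contDiffAt_const.mul vanishOrder_binS.contDiffAt))
  have h5 : ContDiffAt ℝ ω (fun p : Bin => p.2.1 * p.1.im) (0, b) :=
    ContDiffAt.mul (by fun_prop) (Complex.imCLM.contDiff.contDiffAt.comp _ contDiffAt_fst)
  have h6 : ContDiffAt ℝ ω (fun p : Bin => ((‖p.1‖ ^ 2 * muConst m : ℝ) : ℂ) * p.2.2.2.2) (0, b) :=
    ContDiffAt.mul (Complex.ofRealCLM.contDiff.contDiffAt.comp _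
      (vanishOrder_rho.contDiffAt.mul contDiffAt_const)) (by fun_prop)
  exact (hA.add h1.contDiffAt).prodMk (h2.contDiffAt.prodMk ((h5.sub h3.contDiffAt).prodMk
    (h6.prodMk h4.contDiffAt)))

end Bin

end

end SBC

namespace SBC

noncomputable section

/-! ### The vector field in terms of the two binaries -/

/-- The coordinates of the `j`-th binary. -/
def binProj (j : Fin 2) : Phase →L[ℝ] Bin :=
  ((ContinuousLinearMap.proj (R := ℝ) (φ := fun _ : Fin 2 => ℂ) j).comp
    (ContinuousLinearMap.fst ℝ _ _)).prod
  (((ContinuousLinearMap.proj (R := ℝ) (φ := fun _ : Fin 2 => ℝ) j).comp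
    (ContinuousLinearMap.fst ℝ _ _ ∘L ContinuousLinearMap.snd ℝ (Fin 2 → ℂ) Base)).prod
  (((ContinuousLinearMap.proj (R := ℝ) (φ := fun _ : Fin 2 => ℝ) j).comp
    (ContinuousLinearMap.fst ℝ _ _ ∘L ContinuousLinearMap.snd ℝ _ _ ∘L
      ContinuousLinearMap.snd ℝ (Fin 2 → ℂ) Base)).prod
  (ContinuousLinearMap.snd ℝ _ _ ∘L ContinuousLinearMap.snd ℝ _ _ ∘L
      ContinuousLinearMap.snd ℝ (Fin 2 → ℂ) Base)))

theorem binProj_apply (j : Fin 2) (q : Phase) :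
    binProj j q = (q.1 j, q.2.1 j, q.2.2.1 j, q.2.2.2) := rfl

/-- The base point of the `j`-th binary. -/
def binBase (j : Fin 2) (u : Base) : BinBase := (u.1 j, u.2.1 j, u.2.2)

theorem binProj_eq (j : Fin 2) (q : Phase) : binProj j q = (q.1 j, binBase j q.2) := rfl

theorem contDiff_binBase (j : Fin 2) : ContDiff ℝ ω (binBase j) :=
  ((contDiff_apply ℝ ℝ j).comp contDiff_fst).prodMk
    (((contDiff_apply ℝ ℝ j).comp (contDiff_fst.comp contDiff_snd)).prodMk
      (contDiff_snd.comp contDiff_snd))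

theorem binU_binProj (q : Phase) (j : Fin 2) : binU (binProj j q) = magU q j := by
  simp only [binU, binS, magU, binProj_apply, Base.energy, mul_assoc]

theorem binZ_binProj (m : Fin 4 → ℝ) (q : Phase) (j : Fin 2) :
    binZ (aRoot m j) (binProj j q) = zLC m q j := by
  rw [binZ, binU_binProj]; rfl

theorem redMass_pos {m : Fin 4 → ℝ} (hm : ∀ i, 0 < m i) (j : Fin 2) : 0 < redMass m j := by
  have h0 := hm 0
  have h1 := hm 1
  have h2 := hm 2
  have h3 := hm 3
  fin_cases j <;> simp [redMass] <;> positivity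

theorem massProd_pos {m : Fin 4 → ℝ} (hm : ∀ i, 0 < m i) (j : Fin 2) : 0 < massProd m j := by
  have h0 := hm 0
  have h1 := hm 1
  have h2 := hm 2
  have h3 := hm 3
  fin_cases j <;> simp [massProd] <;> positivity

theorem aRoot_pos {m : Fin 4 → ℝ} (hm : ∀ i, 0 < m i) (j : Fin 2) : 0 < aRoot m j := by
  have h1 := redMass_pos hm j
  have h2 := massProd_pos hm j
  exact Real.rpow_pos_of_pos (by unfold aConst; positivity) _

theorem binProj_field {m : Fin 4 → ℝ} (hm : ∀ i, 0 < m i) (q : Phase) (j : Fin 2) :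
    binProj j (field m q) = ‖q.1 j.rev‖ ^ 2 • binField (muConst m) (binProj j q)
      (Gam q j * conj (gradZ m (zLC m q) q.2.sep j)) (gradX m (zLC m q) q.2.sep) := by
  have ha := (aRoot_pos hm j).ne'
  have hρ : ‖q.1 0‖ ^ 2 * ‖q.1 1‖ ^ 2 = ‖q.1 j.rev‖ ^ 2 * ‖q.1 j‖ ^ 2 := by
    fin_cases j
    · exact mul_comm _ _
    · rfl
  rw [binProj_apply, field, binField, binU_binProj]
  refine Prod.ext ?_ (Prod.ext ?_ (Prod.ext ?_ (Prod.ext ?_ ?_)))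
  · have hz : zLC m q j = ((aRoot m j / magU q j : ℝ) : ℂ) * Gam q j * q.1 j := rfl
    simp only [binS, binProj_apply, Prod.smul_fst, Complex.real_smul, Base.energy]
    conv_lhs => rw [hz]
    have ha' : (aRoot m j : ℂ) ≠ 0 := by exact_mod_cast ha
    push_cast
    field_simp
  · simp only [binProj_apply, Prod.smul_snd, Prod.smul_fst, smul_eq_mul]
    ring
  · simp only [binProj_apply, Prod.smul_snd, Prod.smul_fst, smul_eq_mul, Base.energy]
  · simp only [binProj_apply, Prod.smul_snd, Prod.smul_fst, Complex.real_smul, Base.mom, hρ]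
    push_cast
    ring
  · simp only [binProj_apply, Prod.smul_snd, Complex.real_smul, hρ]
    push_cast
    ring

section Field

variable {m : Fin 4 → ℝ} {u₀ : Base}

theorem vanishOrder_phase_norm_sq (j : Fin 2) : VanishOrder u₀ 2 (fun q : Phase => ‖q.1 j‖ ^ 2) :=
  vanishOrder_norm_sq (vanishOrder_proj j)

theorem binProj_base (j : Fin 2) (u₀ : Base) :
    binProj j ((0, u₀) : Phase) = (0, binBase j u₀) := rfl

theorem VanishOrder.comp_binProj {F : Type} [NormedAddCommGroup F] [NormedSpace ℝ F]
    {f : Bin → F} {k : ℕ} {j : Fin 2} (hf : VanishOrder (binBase j u₀) k f) :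
    VanishOrder u₀ k (fun q : Phase => f (binProj j q)) := by
  simpa using hf.comp (binProj j).contDiff.contDiffAt (binProj_base j u₀) (vanishOrder_proj j)

/-- Derivatives of functions of one binary along vector fields on the whole phase space. -/
theorem VanishOrder.fderiv_binProj {F : Type} [NormedAddCommGroup F] [NormedSpace ℝ F]
    {f : Bin → F} {k c : ℕ} {j : Fin 2} (hf : VanishOrder (binBase j u₀) k f) {w : Phase → Bin}
    (h₁ : VanishOrder u₀ (c + 1) (fun q => (w q).1)) (h₂ : VanishOrder u₀ c (fun q => (w q).2)) :
    VanishOrder u₀ (k + c) (fun q : Phase => fderiv ℝ f (binProj j q) (w q)) :=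
  hf.fderiv_comp_apply (binProj j).contDiff.contDiffAt rfl (vanishOrder_proj j) h₁ h₂

theorem fderiv_comp_binProj {F : Type} [NormedAddCommGroup F] [NormedSpace ℝ F]
    {f : Bin → F} {j : Fin 2} (hf : ContDiffAt ℝ ω f (0, binBase j u₀)) :
    ∀ᶠ q in 𝓝 ((0, u₀) : Phase), ∀ v, fderiv ℝ (fun q : Phase => f (binProj j q)) q v =
      fderiv ℝ f (binProj j q) (binProj j v) := by
  have ht : Tendsto (binProj j) (𝓝 ((0, u₀) : Phase)) (𝓝 (0, binBase j u₀)) :=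
    (binProj j).continuous.tendsto' _ _ rfl
  filter_upwards [ht.eventually (VanishOrder.smooth hf).eventually_differentiableAt] with q hq v
  have : fderiv ℝ (fun q : Phase => f (binProj j q)) q = fderiv ℝ f (binProj j q) ∘L binProj j :=
    (hq.hasFDerivAt.comp q (binProj j).hasFDerivAt).fderiv
  rw [this, ContinuousLinearMap.comp_apply]

/-- The effect of the other binary on the gradient. -/
def mixGrad (m : Fin 4 → ℝ) (j : Fin 2) (q : Phase) : ℂ :=
  Gam q j * dirGrad (inlSingle ℂ j) (mixPot m) (zLC m q, q.2.sep)

/-- The part of the force on the centres of mass that depends on both binaries. -/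
def mixForceTwo (m : Fin 4 → ℝ) (q : Phase) : ℂ :=
  conj (dirGrad (ContinuousLinearMap.inr ℝ _ ℂ) (mixPot m) (zLC m q, q.2.sep))

/-- The effect of the other binary on the force on the centres of mass. -/
def mixForce (m : Fin 4 → ℝ) (j : Fin 2) (q : Phase) : ℂ :=
  binForceOne m j.rev (binProj j.rev q) + mixForceTwo m q

/-- The effect of the other binary on the vector field of the `j`-th binary. -/
def mixVec (m : Fin 4 → ℝ) (j : Fin 2) (q : Phase) : Bin :=
  (((‖q.1 j‖ ^ 2 / magU q j : ℝ) : ℂ) * (q.1 j * mixGrad m j q),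
    2 * magU q j ^ 3 * (mixGrad m j q).re, -(‖q.1 j‖ ^ 2 * (mixGrad m j q).im / magU q j),
    0, ((‖q.1 j‖ ^ 2 : ℝ) : ℂ) * mixForce m j q)

theorem vanishOrder_zLC : VanishOrder u₀ 1 (zLC m) :=
  VanishOrder.pi fun j => by
    have h := (vanishOrder_binZ (b := binBase j u₀) (aRoot m j)).comp_binProj
    exact h.congr (by filter_upwards with q using binZ_binProj m q j)

theorem contDiffAt_zLC_sep : ContDiffAt ℝ ω (fun q : Phase => (zLC m q, q.2.sep)) (0, u₀) :=
  vanishOrder_zLC.contDiffAt.prodMk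
    (contDiff_fst.comp (contDiff_snd.comp (contDiff_snd.comp contDiff_snd))).contDiffAt

theorem zLC_base (m : Fin 4 → ℝ) (u₀ : Base) :
    (zLC m (0, u₀), Base.sep (0, u₀).2) = (0, u₀.sep) := by
  refine Prod.ext ?_ rfl
  funext j
  simp [zLC]

theorem VanishOrder.comp_zLC {F : Type} [NormedAddCommGroup F] [NormedSpace ℝ F]
    {f : (Fin 2 → ℂ) × ℂ → F} {k : ℕ} (hf : VanishOrder u₀.sep k f) :
    VanishOrder u₀ k (fun q : Phase => f (zLC m q, q.2.sep)) := by
  simpa using hf.comp contDiffAt_zLC_sep (zLC_base m u₀) vanishOrder_zLC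

theorem contDiffAt_Gam (j : Fin 2) : ContDiffAt ℝ ω (fun q => Gam q j) (0, u₀) :=
  ((VanishOrder.smooth (contDiffAt_binGam (b := binBase j u₀))).comp_binProj).contDiffAt

theorem vanishOrder_mixGrad (hm : ∀ i, 0 < m i) (hx : u₀.sep ≠ 0) (j : Fin 2) :
    VanishOrder u₀ 7 (mixGrad m j) :=
  ((VanishOrder.smooth (contDiffAt_Gam j)).mul'
    (vanishOrder_dirGrad (inlSingle ℂ j) (vanishOrder_mixPot hm hx)).comp_zLC).mono (by norm_num)

theorem vanishOrder_mixForceTwo (hm : ∀ i, 0 < m i) (hx : u₀.sep ≠ 0) :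
    VanishOrder u₀ 8 (mixForceTwo m) :=
  (vanishOrder_dirGrad_inr (vanishOrder_mixPot hm hx)).comp_zLC.clm
    Complex.conjCLE.toContinuousLinearMap

theorem vanishOrder_mixForce (hm : ∀ i, 0 < m i) (hx : u₀.sep ≠ 0) (j : Fin 2) :
    VanishOrder u₀ 4 (mixForce m j) :=
  (vanishOrder_binForceOne (b := binBase j.rev u₀) hm hx j.rev).comp_binProj.add
    ((vanishOrder_mixForceTwo hm hx).mono (by norm_num))

/-- The order 6 of the base part is due to the momentum alone: it is `|ζ_j|²` times the force of the
other binary, of order 2 + 4. Energy and angle are affected by the mixed gradient only, hence in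
orders 7 and 9. -/
theorem vanishOrder_mixVec (hm : ∀ i, 0 < m i) (hx : u₀.sep ≠ 0) (j : Fin 2) :
    VanishOrder u₀ 10 (fun q => (mixVec m j q).1) ∧ VanishOrder u₀ 6 (fun q => (mixVec m j q).2) ∧
      VanishOrder u₀ 9 (fun q => (mixVec m j q).2.2.1) := by
  obtain ⟨h1, h2, h3, h4⟩ := vanishOrder_binField (b := binBase j u₀) (p₀ := u₀)
    (π := binProj j) (binProj j).contDiff.contDiffAt rfl (vanishOrder_proj j)
    (vanishOrder_mixGrad hm hx j) (vanishOrder_mixForce hm hx j)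
  simp only [binU_binProj] at h1 h2 h3 h4
  exact ⟨h1, (h2.mono (by norm_num)).prodMk ((h3.neg.mono (by norm_num)).prodMk
    ((VanishOrder.zero 6).prodMk h4)), h3.neg⟩

/-- The field of one binary is affine in the gradient and in the force. The splitting of these two
into own and mixed contributions therefore splits the field, and the other binary enters the main
part only through the factor `|ζ|²`. -/
theorem eventually_binProj_field (hm : ∀ i, 0 < m i) (hx : u₀.sep ≠ 0) (j : Fin 2) :
    ∀ᶠ q in 𝓝 ((0, u₀) : Phase), binProj j (field m q) =
      ‖q.1 j.rev‖ ^ 2 • (binVec m j (binProj j q) + mixVec m j q) := by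
  have ht : Tendsto (fun q : Phase => (zLC m q, q.2.sep)) (𝓝 (0, u₀)) (𝓝 (0, u₀.sep)) := by
    have := (contDiffAt_zLC_sep (m := m) (u₀ := u₀)).continuousAt
    rwa [ContinuousAt, zLC_base] at this
  filter_upwards [ht.eventually (eventually_dirGrad_coupling hm hx)] with q ⟨h1, h2⟩
  rw [binProj_field hm]
  congr 1
  have e1 : Gam q j * conj (gradZ m (zLC m q) q.2.sep j) =
      binGrad m j (binProj j q) + mixGrad m j q := by
    have := h1 j
    rw [this, binGrad, binZ_binProj, mixGrad, mul_add]
    rfl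
  have e2 : gradX m (zLC m q) q.2.sep = binForce m j (binProj j q) + mixForce m j q := by
    have h3 : gradX m (zLC m q) q.2.sep = conj (conj (gradX m (zLC m q) q.2.sep)) := by simp
    rw [h3, h2]
    simp only [binForce, mixForce, mixForceTwo, binForceOne, binZ_binProj, map_add]
    fin_cases j
    · change _ + (starRingEnd ℂ) (dirGrad _ (binPot m 0) (zLC m q 0, q.2.sep)) +
        (starRingEnd ℂ) (dirGrad _ (binPot m 1) (zLC m q 1, q.2.sep)) + _ =
        _ + (starRingEnd ℂ) (dirGrad _ (binPot m 0) (zLC m q 0, q.2.sep)) +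
        ((starRingEnd ℂ) (dirGrad _ (binPot m 1) (zLC m q 1, q.2.sep)) + _)
      rw [add_assoc]
      rfl
    · change _ + (starRingEnd ℂ) (dirGrad _ (binPot m 0) (zLC m q 0, q.2.sep)) +
        (starRingEnd ℂ) (dirGrad _ (binPot m 1) (zLC m q 1, q.2.sep)) + _ =
        _ + (starRingEnd ℂ) (dirGrad _ (binPot m 1) (zLC m q 1, q.2.sep)) +
        ((starRingEnd ℂ) (dirGrad _ (binPot m 0) (zLC m q 0, q.2.sep)) + _)
      rw [add_right_comm _ ((starRingEnd ℂ) (dirGrad _ (binPot m 0) (zLC m q 0, q.2.sep))),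
        add_assoc]
      rfl
  rw [e1, e2, binVec, binField, binField, mixVec, binU_binProj]
  refine Prod.ext ?_ (Prod.ext ?_ (Prod.ext ?_ (Prod.ext ?_ ?_)))
  · simp only [binProj_apply, Prod.fst_add]
    ring
  · simp only [Prod.fst_add, Prod.snd_add, Complex.add_re]
    ring
  · simp only [binProj_apply, Prod.fst_add, Prod.snd_add, Complex.add_im]
    ring
  · simp
  · simp only [binProj_apply, Prod.snd_add]
    ring

theorem contDiffAt_field (hm : ∀ i, 0 < m i) (hx : u₀.sep ≠ 0) :
    ContDiffAt ℝ ω (field m) (0, u₀) := by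
  have h : ∀ j, ContDiffAt ℝ ω (fun q => binProj j (field m q)) (0, u₀) := fun j => by
    obtain ⟨h1, h2, -⟩ := vanishOrder_mixVec hm hx (m := m) (u₀ := u₀) j
    have hV : ContDiffAt ℝ ω (fun q => binVec m j (binProj j q)) (0, u₀) :=
      ContDiffAt.comp (0, u₀) (g := binVec m j) (contDiffAt_binVec (b := binBase j u₀) hm hx j)
        (binProj j).contDiff.contDiffAt
    exact ((vanishOrder_phase_norm_sq j.rev).contDiffAt.smul
      (hV.add (h1.contDiffAt.prodMk h2.contDiffAt))).congr_of_eventuallyEq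
      (eventually_binProj_field hm hx j)
  have h0 : ContDiffAt ℝ ω (fun q => (field m q).1) (0, u₀) :=
    contDiffAt_pi.2 fun j => contDiffAt_fst.comp _ (h j)
  have h1 : ContDiffAt ℝ ω (fun q => (field m q).2.1) (0, u₀) :=
    contDiffAt_pi.2 fun j => contDiffAt_fst.comp _ (contDiffAt_snd.comp _ (h j))
  have h2 : ContDiffAt ℝ ω (fun q => (field m q).2.2.1) (0, u₀) :=
    contDiffAt_pi.2 fun j => contDiffAt_fst.comp _ (contDiffAt_snd.comp _
      (contDiffAt_snd.comp _ (h j)))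
  have h3 : ContDiffAt ℝ ω (fun q => (field m q).2.2.2) (0, u₀) :=
    ContDiffAt.comp (g := fun p : Bin => p.2.2.2) (f := fun q => binProj 0 (field m q)) _
      (contDiff_snd.comp (contDiff_snd.comp contDiff_snd)).contDiffAt (h 0)
  exact h0.prodMk (h1.prodMk (h2.prodMk h3))

end Field

end

end SBC

namespace SBC

noncomputable section

/-! ### Removing the dependence on a single binary -/

/-- The vector field of a single binary, scaled so that `I' = 1`. -/
def binHat (m : Fin 4 → ℝ) (j : Fin 2) (p : Bin) : Bin :=
  ((binVec m j p).1.re)⁻¹ • binVec m j p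

/-- A truncated antiderivative along `binHat`. -/
def binAnti {F : Type} [NormedAddCommGroup F] [NormedSpace ℝ F] (m : Fin 4 → ℝ) (j : Fin 2)
    (p : Bin → F) : Bin → F :=
  -- Eight terms leave a remainder containing `I ^ 8`. With the factor `|ζ|²` of the other binary it
  -- reaches order 10, the accuracy of the normal form.
  antideriv Complex.reCLM (binHat m j) 8 p

section BinHat

variable {b : BinBase} {m : Fin 4 → ℝ} {j : Fin 2}

theorem vanishOrder_binVec_fst (hm : ∀ i, 0 < m i) (hx : b.2.2.1 ≠ 0) (j : Fin 2) :
    VanishOrder b 6 (fun p => (binVec m j p).1 - ((binU p ^ 2 + 2 * binS p : ℝ) : ℂ)) := by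
  have h := (vanishOrder_binField (π := fun p : Bin => p) contDiffAt_id rfl vanishOrder_bin_fst
    (vanishOrder_binGrad hm hx j) (VanishOrder.smooth (contDiffAt_binForce hm hx j))).1
  refine h.congr ?_
  filter_upwards with p
  simp [binVec, binField]

theorem vanishOrder_binA_sub_one :
    VanishOrder b 2 (fun p => binU p ^ 2 + 2 * binS p - 1) := by
  have h := (vanishOrder_binA (b := b)).mono (show 2 ≤ 8 by norm_num)
  have h2 : VanishOrder b 2 (fun p => 3 * binS p - binS p ^ 2 + 2 * binS p ^ 3) :=
    ((vanishOrder_binS.const_mul 3).sub ((vanishOrder_binS.pow 2).mono (by norm_num))).add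
      (((vanishOrder_binS.pow 3).const_mul 2).mono (by norm_num))
  exact (h.add h2).congr (by filter_upwards with p using by ring)

theorem vanishOrder_binVec_fst_sub_one (hm : ∀ i, 0 < m i) (hx : b.2.2.1 ≠ 0) (j : Fin 2) :
    VanishOrder b 2 (fun p => (binVec m j p).1 - 1) := by
  refine (((vanishOrder_binVec_fst hm hx j).mono (by norm_num)).add
    (vanishOrder_binA_sub_one.clm Complex.ofRealCLM)).congr ?_
  filter_upwards with p
  simp

theorem binVec_base_re (j : Fin 2) : (binVec m j (0, b)).1.re = 1 := by
  simp [binVec, binField, binU_zero, binS]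

theorem contDiffAt_inv_binVec_re (hm : ∀ i, 0 < m i) (hx : b.2.2.1 ≠ 0) (j : Fin 2) :
    ContDiffAt ℝ ω (fun p => ((binVec m j p).1.re)⁻¹) (0, b) :=
  (Complex.reCLM.contDiff.contDiffAt.comp _ (contDiffAt_fst.comp _ (contDiffAt_binVec hm hx j))).inv
    (by change (binVec m j (0, b)).1.re ≠ 0; rw [binVec_base_re]; norm_num)

theorem contDiffAt_binHat (hm : ∀ i, 0 < m i) (hx : b.2.2.1 ≠ 0) (j : Fin 2) :
    ContDiffAt ℝ ω (binHat m j) (0, b) :=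
  (contDiffAt_inv_binVec_re hm hx j).smul (contDiffAt_binVec hm hx j)

theorem eventually_binVec_re (hm : ∀ i, 0 < m i) (hx : b.2.2.1 ≠ 0) (j : Fin 2) :
    ∀ᶠ p in 𝓝 ((0 : ℂ), b), (binVec m j p).1.re ≠ 0 := by
  have : ContinuousAt (fun p => (binVec m j p).1.re) ((0 : ℂ), b) :=
    (Complex.reCLM.contDiff.contDiffAt.comp _
      (contDiffAt_fst.comp _ (contDiffAt_binVec hm hx j))).continuousAt
  exact this.eventually_ne (by rw [binVec_base_re]; norm_num)

theorem eventually_binHat_re (hm : ∀ i, 0 < m i) (hx : b.2.2.1 ≠ 0) (j : Fin 2) :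
    ∀ᶠ p in 𝓝 ((0 : ℂ), b), Complex.reCLM (binHat m j p).1 = 1 := by
  filter_upwards [eventually_binVec_re hm hx j] with p hp
  simp [binHat, hp]

variable {F : Type} [NormedAddCommGroup F] [NormedSpace ℝ F]

theorem vanishOrder_binAnti (hm : ∀ i, 0 < m i) (hx : b.2.2.1 ≠ 0) (j : Fin 2) {k : ℕ}
    {f : Bin → F} (hf : VanishOrder b k f) : VanishOrder b (k + 1) (binAnti m j f) :=
  vanishOrder_antideriv (contDiffAt_binHat hm hx j) hf 8

theorem vanishOrder_fderiv_binAnti (hm : ∀ i, 0 < m i) (hx : b.2.2.1 ≠ 0) (j : Fin 2) {k : ℕ}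
    {f : Bin → F} (hf : VanishOrder b k f) :
    VanishOrder b 8 (fun p => fderiv ℝ (binAnti m j f) p (binVec m j p) -
      (binVec m j p).1.re • f p) := by
  have hv := contDiffAt_binHat hm hx j
  have h1 := dirDeriv_antideriv (l := Complex.reCLM) hv hf (eventually_binHat_re hm hx j) 8
  have h2 : VanishOrder b 8 (fun q : Bin => ((-1) ^ 8 * Complex.reCLM q.1 ^ 8 /
      Nat.factorial 8 : ℝ)) :=
    ((vanishOrder_linear_pow Complex.reCLM 8).const_mul ((-1) ^ 8 / Nat.factorial 8 : ℝ)).congr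
      (by filter_upwards with q using by ring)
  have h3 : VanishOrder b 0 (fun p => (binVec m j p).1.re) := .smooth
    (Complex.reCLM.contDiff.contDiffAt.comp _ (contDiffAt_fst.comp _ (contDiffAt_binVec hm hx j)))
  have h4 := h3.smul (h2.smul (vanishOrder_iterate_dirDeriv hv hf 8))
  refine (h4.neg.mono (by omega)).congr ?_
  filter_upwards [h1, eventually_binVec_re hm hx j] with p hp hp'
  have h5 : fderiv ℝ (binAnti m j f) p (binVec m j p) =
      (binVec m j p).1.re • dirDeriv (binHat m j) (binAnti m j f) p := by
    rw [dirDeriv, binHat, map_smul, smul_smul, mul_inv_cancel₀ hp', one_smul]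
  rw [h5, binAnti, hp, smul_sub]
  abel

end BinHat

section Anti

variable {u₀ : Base} {m : Fin 4 → ℝ} {F : Type} [NormedAddCommGroup F] [NormedSpace ℝ F]

/-- The derivative of a function of one binary along the full vector field. -/
theorem eventually_fderiv_field (hm : ∀ i, 0 < m i) (hx : u₀.sep ≠ 0) (j : Fin 2) {f : Bin → F}
    (hf : ContDiffAt ℝ ω f (0, binBase j u₀)) :
    ∀ᶠ q in 𝓝 ((0, u₀) : Phase), fderiv ℝ (fun q => f (binProj j q)) q (field m q) =
      ‖q.1 j.rev‖ ^ 2 • (fderiv ℝ f (binProj j q) (binVec m j (binProj j q)) +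
        fderiv ℝ f (binProj j q) (mixVec m j q)) := by
  filter_upwards [fderiv_comp_binProj hf, eventually_binProj_field hm hx j] with q h1 h2
  rw [h1, h2, map_smul, map_add]

theorem vanishOrder_fderiv_mixVec (hm : ∀ i, 0 < m i) (hx : u₀.sep ≠ 0) (j : Fin 2) {k : ℕ}
    {f : Bin → F} (hf : VanishOrder (binBase j u₀) k f) :
    VanishOrder u₀ (k + 6) (fun q => fderiv ℝ f (binProj j q) (mixVec m j q)) :=
  hf.fderiv_binProj ((vanishOrder_mixVec hm hx j).1.mono (by norm_num))
    (vanishOrder_mixVec hm hx j).2.1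

/-- Both errors have order at least 8 before the factor `|ζ|²` of the other binary: the truncation
by construction, and the derivative along the mixed field because the antiderivative has order at
least 2 and that field adds 6. -/
theorem vanishOrder_fderiv_binAnti_field (hm : ∀ i, 0 < m i) (hx : u₀.sep ≠ 0) (j : Fin 2) {k : ℕ}
    {f : Bin → F} (hf : VanishOrder (binBase j u₀) (k + 1) f) :
    VanishOrder u₀ 10 (fun q => fderiv ℝ (fun q => binAnti m j f (binProj j q)) q (field m q) -
      ‖q.1 j.rev‖ ^ 2 • ((binVec m j (binProj j q)).1.re • f (binProj j q))) := by
  have hx' : (binBase j u₀).2.2.1 ≠ 0 := hx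
  have hS := vanishOrder_binAnti hm hx' j hf
  have h1 := (vanishOrder_fderiv_binAnti hm hx' j hf).comp_binProj
  have h2 := vanishOrder_fderiv_mixVec hm hx j hS
  have h3 := (vanishOrder_phase_norm_sq (u₀ := u₀) j.rev).smul (h1.add (h2.mono (by omega)))
  refine h3.congr ?_
  filter_upwards [eventually_fderiv_field hm hx j hS.contDiffAt] with q hq
  rw [hq, ← smul_sub]
  congr 1
  abel

/-- `f - S (D f)` is nearly invariant under the vector field. -/
theorem vanishOrder_fderiv_sub_binAnti (hm : ∀ i, 0 < m i) (hx : u₀.sep ≠ 0) (j : Fin 2) {k : ℕ}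
    {f : Bin → F} (hf : ContDiffAt ℝ ω f (0, binBase j u₀))
    (hD : VanishOrder (binBase j u₀) (k + 1) (dirDeriv (binHat m j) f)) :
    VanishOrder u₀ 10 (fun q => fderiv ℝ (fun q =>
        f (binProj j q) - binAnti m j (dirDeriv (binHat m j) f) (binProj j q)) q (field m q) -
      ‖q.1 j.rev‖ ^ 2 • fderiv ℝ f (binProj j q) (mixVec m j q)) := by
  have hx' : (binBase j u₀).2.2.1 ≠ 0 := hx
  have h1 := vanishOrder_fderiv_binAnti_field hm hx j hD
  have hS := (vanishOrder_binAnti hm hx' j hD).comp_binProj (u₀ := u₀)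
  have ht : Tendsto (binProj j) (𝓝 ((0, u₀) : Phase)) (𝓝 (0, binBase j u₀)) :=
    (binProj j).continuous.tendsto' _ _ rfl
  refine h1.neg.congr ?_
  filter_upwards [eventually_fderiv_field hm hx j hf, hS.eventually_differentiableAt,
    (VanishOrder.smooth hf).comp_binProj.eventually_differentiableAt,
    ht.eventually (eventually_binVec_re hm hx' j)] with q h2 h3 h4 h5
  rw [fderiv_fun_sub h4 h3]
  have h6 : (binVec m j (binProj j q)).1.re • dirDeriv (binHat m j) f (binProj j q) =
      fderiv ℝ f (binProj j q) (binVec m j (binProj j q)) := by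
    rw [dirDeriv, binHat, map_smul, smul_smul, mul_inv_cancel₀ h5, one_smul]
  rw [h6]
  rw [sub_apply, h2, smul_add]
  abel

end Anti

end

end SBC

namespace SBC

noncomputable section

/-! ### Binary forms in `(I, L)` -/

/-- The form `∑ᵢ aᵢ I^(k-i) L^i` of degree `k`. -/
def binForm (k : ℕ) (a : ℕ → BinBase → ℝ) (p : Bin) : ℝ :=
  ∑ i ∈ Finset.range (k + 1), a i p.2 * p.1.re ^ (k - i) * p.1.im ^ i

/-- The coefficients of the derivative with respect to `I` of a form of degree `k`. -/
def derivCoeff (k : ℕ) (a : ℕ → BinBase → ℝ) (i : ℕ) (b : BinBase) : ℝ := ((k - i : ℕ) : ℝ) * a i b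

section Form

variable {b : BinBase} {a : ℕ → BinBase → ℝ} {m : Fin 4 → ℝ}

theorem vanishOrder_binForm (ha : ∀ i, ContDiffAt ℝ ω (a i) b) (k : ℕ) :
    VanishOrder b k (binForm k a) := by
  refine VanishOrder.sum _ fun i hi => ?_
  have h1 : VanishOrder b 0 (fun p : Bin => a i p.2) :=
    .smooth (ContDiffAt.comp ((0 : ℂ), b) (ha i) contDiffAt_snd)
  have h2 := vanishOrder_linear_pow (p₀ := b) Complex.reCLM (k - i)
  have h3 := vanishOrder_linear_pow (p₀ := b) Complex.imCLM i
  have hi' := Finset.mem_range.1 hi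
  exact ((h1.mul' h2).mul' h3).mono (by omega)

theorem fderiv_binForm_one {k : ℕ} {p : Bin} (hf : DifferentiableAt ℝ (binForm (k + 1) a) p) :
    fderiv ℝ (binForm (k + 1) a) p (1, 0) = binForm k (derivCoeff (k + 1) a) p := by
  rw [← hf.lineDeriv_eq_fderiv, lineDeriv]
  have h : HasDerivAt (fun t : ℝ => binForm (k + 1) a (p + t • ((1, 0) : Bin)))
      (∑ i ∈ Finset.range (k + 2), a i p.2 * (((k + 1 - i : ℕ) : ℝ) * p.1.re ^ (k + 1 - i - 1)) *
        p.1.im ^ i) 0 := by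
    have e : (fun t : ℝ => binForm (k + 1) a (p + t • ((1, 0) : Bin))) = fun t =>
        ∑ i ∈ Finset.range (k + 2), a i p.2 * (p.1.re + t) ^ (k + 1 - i) * p.1.im ^ i := by
      funext t
      simp [binForm]
    rw [e]
    refine HasDerivAt.fun_sum fun i _ => ?_
    have h1 : HasDerivAt (fun t : ℝ => p.1.re + t) 1 0 := (hasDerivAt_id (0 : ℝ)).const_add _
    have h2 := ((h1.pow (k + 1 - i)).const_mul (a i p.2)).mul_const (p.1.im ^ i)
    simpa using h2
  rw [h.deriv, Finset.sum_range_succ, binForm]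
  simp only [Nat.sub_self, Nat.cast_zero, zero_mul, mul_zero, add_zero]
  refine Finset.sum_congr rfl fun i hi => ?_
  have hi' := Finset.mem_range.1 hi
  rw [derivCoeff, show k + 1 - i - 1 = k - i by omega]
  ring

theorem vanishOrder_binVec_snd (hm : ∀ i, 0 < m i) (hx : b.2.2.1 ≠ 0) (j : Fin 2) :
    VanishOrder b 3 (fun p => (binVec m j p).2.1) ∧
    VanishOrder b 1 (fun p => (binVec m j p).2.2.1) ∧
    VanishOrder b 2 (fun p => (binVec m j p).2.2.2) := by
  obtain ⟨-, h2, h3, h4⟩ := vanishOrder_binField (π := fun p : Bin => p)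
    contDiffAt_id rfl vanishOrder_bin_fst (vanishOrder_binGrad hm hx j)
    (VanishOrder.smooth (contDiffAt_binForce hm hx j))
  have h5 : VanishOrder b 1 (fun p : Bin => p.2.1 * p.1.im) := by
    have : VanishOrder b 0 (fun p : Bin => p.2.1) := .smooth (by fun_prop)
    exact (this.mul' (vanishOrder_bin_fst.clm Complex.imCLM)).mono (by norm_num)
  have h6 : VanishOrder b 2 (fun p : Bin => ((‖p.1‖ ^ 2 * muConst m : ℝ) : ℂ) * p.2.2.2.2) := by
    have h7 : VanishOrder b 0 (fun p : Bin => p.2.2.2.2) := .smooth (by fun_prop)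
    have h8 : VanishOrder b 0 (fun _ : Bin => muConst m) := .smooth contDiffAt_const
    exact (((vanishOrder_rho.mul' h8).clm Complex.ofRealCLM).mul' h7).mono (by norm_num)
  exact ⟨h2, h5.sub (h3.mono (by norm_num)), h6.prodMk (h4.mono (by norm_num))⟩

/-- The derivative of a form along the vector field of a binary. -/
theorem vanishOrder_fderiv_binForm (hm : ∀ i, 0 < m i) (hx : b.2.2.1 ≠ 0) (j : Fin 2)
    (ha : ∀ i, ContDiffAt ℝ ω (a i) b) (k : ℕ) :
    VanishOrder b (k + 2) (fun p => fderiv ℝ (binForm (k + 1) a) p (binVec m j p) -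
      binForm k (derivCoeff (k + 1) a) p) := by
  have hf := vanishOrder_binForm ha (k + 1)
  obtain ⟨h1, h2, h3⟩ := vanishOrder_binVec_snd hm hx j
  have h := hf.fderiv_apply_of_field (c := 1) (v := fun p => binVec m j p - (1, 0))
    (vanishOrder_binVec_fst_sub_one hm hx j)
    (((h1.mono (by norm_num)).prodMk (h2.prodMk (h3.mono (by norm_num)))).congr
      (by filter_upwards with p using by simp))
  refine (h.mono (by omega)).congr ?_
  filter_upwards [hf.eventually_differentiableAt] with p hp
  rw [map_sub, fderiv_binForm_one hp]

/-- The coefficients of `Re (c ζ⁴) + d |ζ|⁴`. -/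
def quarticCoeff (c : BinBase → ℂ) (d : BinBase → ℝ) : ℕ → BinBase → ℝ
  | 0, b => (c b).re + d b
  | 1, b => -4 * (c b).im
  | 2, b => -6 * (c b).re + 2 * d b
  | 3, b => 4 * (c b).im
  | 4, b => (c b).re + d b
  | _, _ => 0

/-- The coefficients of the correction to `I`. -/
def corrReCoeff (c : BinBase → ℂ) (d : BinBase → ℝ) : ℕ → BinBase → ℝ
  -- These coefficients solve `∂(ρF)/∂I = -(5/2) ρ² Q - 35 h³ ρ⁴ - 2 L G`, where `ρ = I² + L²`, `Q`
  -- is the quartic form, and `F`, `G` are the corrections to `I`, `L`. The right side is integrated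
  -- in `I` and divided by `ρ`. Divisibility is a vanishing condition at `(I, L) = (i, 1)`; its real
  -- part fixes the integration constant, the coefficient of `L⁷` in `F`.
  | 0, b => -5 / 18 * ((c b).re + d b) - 35 / 9 * b.1 ^ 3
  | 1, b => 9 / 7 * (c b).im
  | 2, b => 239 / 126 * (c b).re - 145 / 126 * d b - 145 / 9 * b.1 ^ 3
  | 3, b => 1 / 21 * (c b).im
  | 4, b => 391 / 126 * (c b).re - 233 / 126 * d b - 233 / 9 * b.1 ^ 3
  | 5, b => -71 / 21 * (c b).im
  | 6, b => -139 / 126 * (c b).re - 187 / 126 * d b - 187 / 9 * b.1 ^ 3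
  | 7, b => -13 / 21 * (c b).im
  | _, _ => 0

/-- The coefficients of the correction to `L`. -/
def corrImCoeff (c : BinBase → ℂ) (d : BinBase → ℝ) : ℕ → BinBase → ℝ
  | 0, b => -1 / 7 * (c b).im
  | 1, b => -2 / 3 * (c b).re
  | 2, b => (c b).im
  | 4, b => 5 / 3 * (c b).im
  | 5, b => 2 * (c b).re
  | 6, b => -(c b).im
  -- The equation for `∂G/∂I` leaves the coefficient of `L⁷` free. It is fixed by the imaginary part
  -- of the divisibility condition that makes `F` a polynomial.
  | 7, b => -44 / 63 * (c b).re - 32 / 63 * d b - 64 / 9 * b.1 ^ 3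
  | _, _ => 0

theorem contDiffAt_coeff {c : BinBase → ℂ} {d : BinBase → ℝ} (hc : ContDiffAt ℝ ω c b)
    (hd : ContDiffAt ℝ ω d b) : (∀ i, ContDiffAt ℝ ω (quarticCoeff c d i) b) ∧
    (∀ i, ContDiffAt ℝ ω (corrReCoeff c d i) b) ∧ ∀ i, ContDiffAt ℝ ω (corrImCoeff c d i) b := by
  have hr : ContDiffAt ℝ ω (fun b => (c b).re) b := Complex.reCLM.contDiff.contDiffAt.comp _ hc
  have hi : ContDiffAt ℝ ω (fun b => (c b).im) b := Complex.imCLM.contDiff.contDiffAt.comp _ hc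
  refine ⟨fun i => ?_, fun i => ?_, fun i => ?_⟩
  · rcases i with _ | _ | _ | _ | _ | i <;>
      change ContDiffAt ℝ ω (fun b => quarticCoeff c d _ b) b <;> simp only [quarticCoeff] <;> fun_prop
  · rcases i with _ | _ | _ | _ | _ | _ | _ | _ | i <;>
      change ContDiffAt ℝ ω (fun b => corrReCoeff c d _ b) b <;> simp only [corrReCoeff] <;> fun_prop
  · rcases i with _ | _ | _ | _ | _ | _ | _ | _ | i <;>
      change ContDiffAt ℝ ω (fun b => corrImCoeff c d _ b) b <;> simp only [corrImCoeff] <;> fun_prop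

theorem norm_sq_eq (z : ℂ) : ‖z‖ ^ 2 = z.re ^ 2 + z.im ^ 2 := by
  rw [← Complex.normSq_eq_norm_sq, Complex.normSq_apply]; ring

theorem binForm_quartic (c : BinBase → ℂ) (d : BinBase → ℝ) (p : Bin) :
    binForm 4 (quarticCoeff c d) p = (c p.2 * p.1 ^ 4).re + d p.2 * (‖p.1‖ ^ 2) ^ 2 := by
  rw [norm_sq_eq]
  simp only [binForm, Finset.sum_range_succ, Finset.sum_range_zero, quarticCoeff, pow_succ, pow_zero,
    Complex.mul_re, Complex.mul_im, Complex.one_re, Complex.one_im]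
  ring

theorem binForm_deriv_quartic (c : BinBase → ℂ) (d : BinBase → ℝ) (p : Bin) :
    binForm 3 (derivCoeff 4 (quarticCoeff c d)) p =
      4 * (c p.2 * p.1 ^ 3 + ((d p.2 * ‖p.1‖ ^ 2 : ℝ) : ℂ) * conj p.1).re := by
  rw [norm_sq_eq]
  simp [binForm, Finset.sum_range_succ, quarticCoeff, derivCoeff, pow_succ]
  ring

/-- The equation for the correction to `L`. -/
theorem binForm_deriv_corrIm (c : BinBase → ℂ) (d : BinBase → ℝ) (p : Bin) :
    binForm 6 (derivCoeff 7 (corrImCoeff c d)) p = -(‖p.1‖ ^ 2 * (c p.2 * p.1 ^ 4).im) := by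
  rw [norm_sq_eq]
  simp [binForm, Finset.sum_range_succ, corrImCoeff, derivCoeff, pow_succ]
  ring

/-- The equation for the correction to `I`. -/
theorem binForm_deriv_corrRe (c : BinBase → ℂ) (d : BinBase → ℝ) (p : Bin) :
    ‖p.1‖ ^ 2 * binForm 6 (derivCoeff 7 (corrReCoeff c d)) p +
      2 * p.1.re * binForm 7 (corrReCoeff c d) p =
    -(5 / 2) * (‖p.1‖ ^ 2) ^ 2 * binForm 4 (quarticCoeff c d) p -
      35 * p.2.1 ^ 3 * (‖p.1‖ ^ 2) ^ 4 - 2 * p.1.im * binForm 7 (corrImCoeff c d) p := by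
  rw [norm_sq_eq]
  simp [binForm, Finset.sum_range_succ, corrImCoeff, corrReCoeff, quarticCoeff, derivCoeff]
  ring

end Form

end

end SBC

namespace SBC

noncomputable section

/-! ### The rates of the new coordinates -/

/-- The correction of `f` that makes it nearly invariant. -/
def invar {F : Type} [NormedAddCommGroup F] [NormedSpace ℝ F] (m : Fin 4 → ℝ) (j : Fin 2)
    (f : Bin → F) (p : Bin) : F :=
  f p - binAnti m j (dirDeriv (binHat m j) f) p

/-- The energy of a binary, corrected by terms of degree four. -/
def binEnergy (c : BinBase → ℂ) (d : BinBase → ℝ) (p : Bin) : ℝ :=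
  p.2.1 - 1 / 2 * binForm 4 (quarticCoeff c d) p

/-- The coordinate `h` of a binary. -/
def energyL : Bin →L[ℝ] ℝ :=
  ContinuousLinearMap.fst ℝ _ _ ∘L ContinuousLinearMap.snd ℝ ℂ BinBase
/-- The coordinate `θ` of a binary. -/
def angleL : Bin →L[ℝ] ℝ :=
  ContinuousLinearMap.fst ℝ _ _ ∘L ContinuousLinearMap.snd ℝ _ _ ∘L
    ContinuousLinearMap.snd ℝ ℂ BinBase
/-- The coordinate `x`. -/
def sepL : Bin →L[ℝ] ℂ :=
  ContinuousLinearMap.fst ℝ _ _ ∘L ContinuousLinearMap.snd ℝ _ _ ∘L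
    ContinuousLinearMap.snd ℝ _ _ ∘L ContinuousLinearMap.snd ℝ ℂ BinBase
/-- The coordinate `y`. -/
def momL : Bin →L[ℝ] ℂ :=
  ContinuousLinearMap.snd ℝ _ _ ∘L ContinuousLinearMap.snd ℝ _ _ ∘L
    ContinuousLinearMap.snd ℝ _ _ ∘L ContinuousLinearMap.snd ℝ ℂ BinBase

section One

variable {b : BinBase} {m : Fin 4 → ℝ} {F : Type} [NormedAddCommGroup F] [NormedSpace ℝ F]

theorem vanishOrder_dirDeriv_binHat (hm : ∀ i, 0 < m i) (hx : b.2.2.1 ≠ 0) (j : Fin 2) {k : ℕ}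
    {f : Bin → F} (hf : VanishOrder b k (fun p => fderiv ℝ f p (binVec m j p))) :
    VanishOrder b k (dirDeriv (binHat m j) f) := by
  refine (((VanishOrder.smooth (contDiffAt_inv_binVec_re hm hx j)).smul hf).mono (by omega)).congr ?_
  filter_upwards with p
  rw [dirDeriv, binHat, map_smul]

theorem vanishOrder_invar (hm : ∀ i, 0 < m i) (hx : b.2.2.1 ≠ 0) (j : Fin 2) {k : ℕ}
    {f : Bin → F} (hf : VanishOrder b k (fun p => fderiv ℝ f p (binVec m j p))) :
    VanishOrder b (k + 1) (fun p => invar m j f p - f p) :=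
  (vanishOrder_binAnti hm hx j (vanishOrder_dirDeriv_binHat hm hx j hf)).neg.congr
    (by filter_upwards with p using by simp [invar])

theorem vanishOrder_linear_rates (hm : ∀ i, 0 < m i) (hx : b.2.2.1 ≠ 0) (j : Fin 2) :
    VanishOrder b 1 (fun p => fderiv ℝ angleL p (binVec m j p)) ∧
    VanishOrder b 2 (fun p => fderiv ℝ sepL p (binVec m j p)) ∧
    VanishOrder b 2 (fun p => fderiv ℝ momL p (binVec m j p)) := by
  obtain ⟨-, h2, h3⟩ := vanishOrder_binVec_snd hm hx j
  simp only [ContinuousLinearMap.fderiv]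
  exact ⟨h2, h3.clm (ContinuousLinearMap.fst ℝ ℂ ℂ), h3.clm (ContinuousLinearMap.snd ℝ ℂ ℂ)⟩

variable {c : BinBase → ℂ} {d : BinBase → ℝ}

theorem contDiffAt_binEnergy (hc : ContDiffAt ℝ ω c b) (hd : ContDiffAt ℝ ω d b) :
    ContDiffAt ℝ ω (binEnergy c d) (0, b) :=
  energyL.contDiff.contDiffAt.sub
    (contDiffAt_const.mul (vanishOrder_binForm (contDiffAt_coeff hc hd).1 4).contDiffAt)

theorem fderiv_binEnergy (hc : ContDiffAt ℝ ω c b) (hd : ContDiffAt ℝ ω d b) :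
    ∀ᶠ p in 𝓝 ((0 : ℂ), b), ∀ v, fderiv ℝ (binEnergy c d) p v =
      v.2.1 - 1 / 2 * fderiv ℝ (binForm 4 (quarticCoeff c d)) p v := by
  filter_upwards [(vanishOrder_binForm (contDiffAt_coeff hc hd).1 4).eventually_differentiableAt]
    with p hp v
  have h := (energyL.hasFDerivAt (x := p)).sub (hp.hasFDerivAt.const_mul (1 / 2))
  have e : binEnergy c d = (energyL : Bin → ℝ) - fun p => 1 / 2 * binForm 4 (quarticCoeff c d) p := rfl
  rw [e, h.fderiv]
  simp [energyL]

/-- The cubic part of the rate `2 U³ Re (grad)` is `1/2 ∂Q/∂I` with `Q` the quartic form.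
Subtracting `Q / 2` from the energy cancels it, up to two orders more. -/
theorem vanishOrder_energy_rate (hm : ∀ i, 0 < m i) (hx : b.2.2.1 ≠ 0) (j : Fin 2)
    (hc : ContDiffAt ℝ ω c b) (hd : ContDiffAt ℝ ω d b)
    (h : VanishOrder b 5 (fun p => binGrad m j p -
      (c p.2 * p.1 ^ 3 + ((d p.2 * ‖p.1‖ ^ 2 : ℝ) : ℂ) * conj p.1))) :
    VanishOrder b 5 (fun p => fderiv ℝ (binEnergy c d) p (binVec m j p)) := by
  have h1 := vanishOrder_fderiv_binForm hm hx j (contDiffAt_coeff hc hd).1 3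
  have h2 := h.clm Complex.reCLM
  have h3 := vanishOrder_binU_cube.mul' ((vanishOrder_binGrad hm hx j).clm Complex.reCLM)
  refine (((h2.add h3).const_mul 2).sub (h1.const_mul (1 / 2))).congr ?_
  filter_upwards [fderiv_binEnergy hc hd] with p hp
  rw [hp, binForm_deriv_quartic]
  simp only [Complex.reCLM_apply, Complex.sub_re]
  have e : (binVec m j p).2.1 = 2 * binU p ^ 3 * (binGrad m j p).re := rfl
  rw [e]
  ring

/-- The rate of the first coordinate of a binary. -/
theorem vanishOrder_zeta_rate (hm : ∀ i, 0 < m i) (hx : b.2.2.1 ≠ 0) (j : Fin 2)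
    (hc : ContDiffAt ℝ ω c b) (hd : ContDiffAt ℝ ω d b)
    (h : VanishOrder b 5 (fun p => binGrad m j p -
      (c p.2 * p.1 ^ 3 + ((d p.2 * ‖p.1‖ ^ 2 : ℝ) : ℂ) * conj p.1))) :
    VanishOrder b 8 (fun p => (binVec m j p).1 +
      ((fderiv ℝ (binForm 7 (corrReCoeff c d)) p (binVec m j p) : ℝ) +
        (fderiv ℝ (binForm 7 (corrImCoeff c d)) p (binVec m j p) : ℝ) * Complex.I) -
      ((1 + 3 * binS p - binS p ^ 2 + 2 * binS p ^ 3 +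
        ‖p.1‖ ^ 2 * binForm 4 (quarticCoeff c d) p +
        binForm 6 (derivCoeff 7 (corrReCoeff c d)) p : ℝ) : ℂ)) := by
  have h1 := (vanishOrder_fderiv_binForm hm hx j (contDiffAt_coeff hc hd).2.1 6).clm
    Complex.ofRealCLM
  have h2 := ((vanishOrder_fderiv_binForm hm hx j (contDiffAt_coeff hc hd).2.2 6).clm
    Complex.ofRealCLM).const_mul Complex.I
  have h3 := (vanishOrder_binA (b := b)).clm Complex.ofRealCLM
  have hz := vanishOrder_bin_fst (b := b)
  have hρ := (vanishOrder_rho (b := b)).clm Complex.ofRealCLM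
  have h4 := (vanishOrder_inv_binU (b := b)).clm Complex.ofRealCLM
  have h5 := hρ.mul' (h4.mul' (hz.mul' (vanishOrder_binGrad hm hx j)))
  have h6 := hρ.mul' (hz.mul' h)
  refine ((h1.add (h2.add h3)).add ((h5.mono (by norm_num)).add (h6.mono (by norm_num)))).congr ?_
  filter_upwards with p
  rw [binForm_deriv_corrIm, binForm_quartic]
  have e : (binVec m j p).1 = ((binU p ^ 2 + 2 * binS p : ℝ) : ℂ) +
    ((‖p.1‖ ^ 2 / binU p : ℝ) : ℂ) * (p.1 * binGrad m j p) := rfl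
  have e1 : (c p.2 * p.1 ^ 4) = ((c p.2 * p.1 ^ 4).re : ℂ) + ((c p.2 * p.1 ^ 4).im : ℂ) * Complex.I :=
    (Complex.re_add_im _).symm
  have e2 : p.1 * conj p.1 = (‖p.1‖ : ℂ) ^ 2 := by
    rw [Complex.mul_conj, Complex.normSq_eq_norm_sq, Complex.ofReal_pow]
  rw [e]
  simp only [Complex.ofRealCLM_apply]
  push_cast
  -- Multiplying the leading gradient by `ζ` gives `c ζ⁴ + d |ζ|⁴`. Its real part is the quartic
  -- form. The only imaginary contribution, `|ζ|² Im (c ζ⁴)`, is cancelled by the derivative of the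
  -- correction to `L`.
  linear_combination (-(‖p.1‖ : ℂ) ^ 2) * e1 + (-(‖p.1‖ : ℂ) ^ 4 * (d p.2 : ℂ)) * e2

end One

end

end SBC

namespace SBC

noncomputable section

/-! ### The new coordinates -/

/-- The new coordinate `ζ` of a binary. -/
def binZeta (c : BinBase → ℂ) (d : BinBase → ℝ) (p : Bin) : ℂ :=
  p.1 + ((binForm 7 (corrReCoeff c d) p : ℝ) + (binForm 7 (corrImCoeff c d) p : ℝ) * Complex.I)

/-- The rate of the new coordinate `ζ` of a binary. -/
def binRate (c : BinBase → ℂ) (d : BinBase → ℝ) (p : Bin) : ℝ :=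
  1 + 3 * binS p - binS p ^ 2 + 2 * binS p ^ 3 + ‖p.1‖ ^ 2 * binForm 4 (quarticCoeff c d) p +
    binForm 6 (derivCoeff 7 (corrReCoeff c d)) p

/-- The correction of `y` due to the second binary. -/
def momCorr (m : Fin 4 → ℝ) (p : Bin) : ℂ :=
  ((binVec m 1 p).1.re)⁻¹ • (‖p.1‖ ^ 2 • binForceOne m 1 p)

/-- The new coordinates of the normal form. -/
def nfCoord (m : Fin 4 → ℝ) (c : Fin 2 → BinBase → ℂ) (d : Fin 2 → BinBase → ℝ) (q : Phase) : Phase :=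
  (fun j => binZeta (c j) (d j) (binProj j q),
    fun j => invar m j (binEnergy (c j) (d j)) (binProj j q) -
      -- Up to order 10, twice the mixed potential changes at the sum of the two energy rates
      -- weighted by `aRoot m j`. Subtracting it from the second energy only makes the two weighted
      -- rates opposite, as required by the single polynomial `R⁹`.
      (if j = 0 then 0 else 2 / aRoot m 1) * mixPot m (zLC m q, q.2.sep),
    fun j => invar m j angleL (binProj j q),
    invar m 0 sepL (binProj 0 q),
    -- The force of each binary on `y` is integrated along that binary: the first together with the
    -- constant part of the force, the second by a separate antiderivative.
    invar m 0 momL (binProj 0 q) - binAnti m 1 (momCorr m) (binProj 1 q))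

section Rates

variable {u₀ : Base} {m : Fin 4 → ℝ}

theorem fderiv_binZeta {b : BinBase} {c : BinBase → ℂ} {d : BinBase → ℝ}
    (hc : ContDiffAt ℝ ω c b) (hd : ContDiffAt ℝ ω d b) :
    ∀ᶠ p in 𝓝 ((0 : ℂ), b), ∀ v, fderiv ℝ (binZeta c d) p v = v.1 +
      ((fderiv ℝ (binForm 7 (corrReCoeff c d)) p v : ℝ) +
        (fderiv ℝ (binForm 7 (corrImCoeff c d)) p v : ℝ) * Complex.I) := by
  obtain ⟨-, h1, h2⟩ := contDiffAt_coeff hc hd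
  filter_upwards [(vanishOrder_binForm h1 7).eventually_differentiableAt,
    (vanishOrder_binForm h2 7).eventually_differentiableAt] with p hp1 hp2 v
  have h3 : HasFDerivAt (fun p : Bin => p.1) (ContinuousLinearMap.fst ℝ ℂ BinBase) p :=
    hasFDerivAt_fst
  have h4 := (Complex.ofRealCLM.hasFDerivAt.comp p hp1.hasFDerivAt)
  have h5 := (Complex.ofRealCLM.hasFDerivAt.comp p hp2.hasFDerivAt).mul_const Complex.I
  have h6 : HasFDerivAt (binZeta c d) _ p := h3.add (h4.add h5)
  rw [h6.fderiv]
  simp [mul_comm]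

theorem contDiffAt_binZeta {b : BinBase} {c : BinBase → ℂ} {d : BinBase → ℝ}
    (hc : ContDiffAt ℝ ω c b) (hd : ContDiffAt ℝ ω d b) :
    VanishOrder b 7 (fun p => binZeta c d p - p.1) ∧ ContDiffAt ℝ ω (binZeta c d) (0, b) := by
  obtain ⟨-, h1, h2⟩ := contDiffAt_coeff hc hd
  have h3 := ((vanishOrder_binForm h1 7).clm Complex.ofRealCLM).add
    (((vanishOrder_binForm h2 7).clm Complex.ofRealCLM).const_mul Complex.I)
  have h4 : VanishOrder b 7 (fun p => binZeta c d p - p.1) := h3.congr (by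
    filter_upwards with p
    simp [binZeta, mul_comm])
  exact ⟨h4, (h4.contDiffAt.add (vanishOrder_bin_fst (b := b)).contDiffAt).congr_of_eventuallyEq
    (by filter_upwards with p using by simp)⟩

/-- The rates of the new coordinates `ζ`. -/
theorem vanishOrder_nf_zeta_rate (hm : ∀ i, 0 < m i) (hx : u₀.sep ≠ 0) (j : Fin 2)
    {c : BinBase → ℂ} {d : BinBase → ℝ}
    (hc : ContDiffAt ℝ ω c (binBase j u₀)) (hd : ContDiffAt ℝ ω d (binBase j u₀))
    (h : VanishOrder (binBase j u₀) 5 (fun p => binGrad m j p -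
      (c p.2 * p.1 ^ 3 + ((d p.2 * ‖p.1‖ ^ 2 : ℝ) : ℂ) * conj p.1))) :
    VanishOrder u₀ 10 (fun q => fderiv ℝ (fun q => binZeta c d (binProj j q)) q (field m q) -
      ((‖q.1 j.rev‖ ^ 2 * binRate c d (binProj j q) : ℝ) : ℂ)) := by
  have hx' : (binBase j u₀).2.2.1 ≠ 0 := hx
  obtain ⟨-, h1, h2⟩ := contDiffAt_coeff hc hd
  have hz := (vanishOrder_zeta_rate hm hx' j hc hd h).comp_binProj
  have m0 := (vanishOrder_mixVec hm hx j (m := m) (u₀ := u₀)).1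
  have m1 := (vanishOrder_fderiv_mixVec hm hx j (vanishOrder_binForm h1 7)).clm Complex.ofRealCLM
  have m2 := ((vanishOrder_fderiv_mixVec hm hx j (vanishOrder_binForm h2 7)).clm
    Complex.ofRealCLM).const_mul Complex.I
  have h3 := (vanishOrder_phase_norm_sq (u₀ := u₀) j.rev).smul
    (hz.add ((m0.mono (by norm_num)).add ((m1.mono (by norm_num)).add (m2.mono (by norm_num)))))
  refine h3.congr ?_
  have ht : Tendsto (binProj j) (𝓝 ((0, u₀) : Phase)) (𝓝 (0, binBase j u₀)) :=
    (binProj j).continuous.tendsto' _ _ rfl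
  filter_upwards [eventually_fderiv_field hm hx j (contDiffAt_binZeta hc hd).2,
    ht.eventually (fderiv_binZeta hc hd)] with q hq hq'
  rw [hq, hq', hq', binRate]
  simp only [Complex.real_smul, Complex.ofRealCLM_apply]
  push_cast
  ring

/-- Only the leading velocity `a Γ |ζ|²` of `z` is needed. The deviations of `U` and of `I'` from 1
and the rotation of `Γ` are corrections of relative order 2. -/
theorem vanishOrder_zLC_rate (hm : ∀ i, 0 < m i) (hx : u₀.sep ≠ 0) (j : Fin 2) :
    VanishOrder u₀ 4 (fun q => fderiv ℝ (fun q => zLC m q j) q (field m q) -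
      ‖q.1 j.rev‖ ^ 2 • ((aRoot m j : ℂ) * Gam q j)) := by
  have hx' : (binBase j u₀).2.2.1 ≠ 0 := hx
  have hZ := vanishOrder_binZ (b := binBase j u₀) (aRoot m j)
  have hGs := contDiffAt_binGam (b := binBase j u₀)
  have hG : VanishOrder (binBase j u₀) 0 binGam := .smooth hGs
  have hV := contDiffAt_binVec (b := binBase j u₀) hm hx' j
  have h1 := (vanishOrder_binZ_sub (b := binBase j u₀) (aRoot m j)).fderiv_apply hV
  obtain ⟨-, hθ, -⟩ := vanishOrder_binVec_snd (b := binBase j u₀) hm hx' j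
  have h2 : VanishOrder (binBase j u₀) 2 (fun p => ((aRoot m j : ℂ) * binGam p) *
      ((binVec m j p).1 - 1)) := by
    exact ((hG.const_mul (aRoot m j : ℂ)).mul' (vanishOrder_binVec_fst_sub_one hm hx' j)).mono
      (by norm_num)
  have hG1 : VanishOrder (binBase j u₀) 1 (fun p => fderiv ℝ binGam p (binVec m j p)) := by
    have e : ∀ p : Bin, fderiv ℝ binGam p (binVec m j p) =
        (((binVec m j p).2.2.1 : ℝ) : ℂ) * (Complex.I * binGam p) := fun p => by
      have k1 : HasFDerivAt (fun p : Bin => ((p.2.2.1 : ℝ) : ℂ) * Complex.I) _ p :=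
        ((Complex.ofRealCLM ∘L angleL).hasFDerivAt).mul_const Complex.I
      have k2 : HasFDerivAt binGam _ p := k1.cexp
      rw [k2.fderiv]
      simp [angleL, binGam]
      ring
    refine (((hθ.clm Complex.ofRealCLM).mul' (hG.const_mul Complex.I)).mono (by norm_num)).congr ?_
    filter_upwards with p
    rw [e]
    rfl
  have h3 := ((hG1.const_mul (aRoot m j : ℂ)).mul' (vanishOrder_bin_fst (b := binBase j u₀)))
  have h4 : VanishOrder (binBase j u₀) 2 (fun p => fderiv ℝ (binZ (aRoot m j)) p (binVec m j p) -
      (aRoot m j : ℂ) * binGam p) := by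
    refine ((h1.mono (by norm_num)).add (h2.add (h3.mono (by norm_num)))).congr ?_
    filter_upwards [hZ.eventually_differentiableAt, hG.eventually_differentiableAt] with p hp hp'
    have k1 : HasFDerivAt (fun p : Bin => p.1) (ContinuousLinearMap.fst ℝ ℂ BinBase) p :=
      hasFDerivAt_fst
    have k2 := (hp'.hasFDerivAt.const_mul (aRoot m j : ℂ)).mul k1
    have k3 : HasFDerivAt (fun p => binZ (aRoot m j) p - (aRoot m j : ℂ) * binGam p * p.1) _ p :=
      hp.hasFDerivAt.sub k2
    rw [k3.fderiv]
    simp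
    ring
  have h5 := vanishOrder_fderiv_mixVec hm hx j hZ
  have h6 := (vanishOrder_phase_norm_sq (u₀ := u₀) j.rev).smul
    (h4.comp_binProj.add (h5.mono (by norm_num)))
  refine h6.congr ?_
  filter_upwards [eventually_fderiv_field hm hx j hZ.contDiffAt] with q hq
  have e : (fun q => zLC m q j) = fun q => binZ (aRoot m j) (binProj j q) := by
    funext q; exact (binZ_binProj m q j).symm
  rw [e, hq, smul_add, smul_add, smul_sub]
  have e2 : binGam (binProj j q) = Gam q j := rfl
  rw [e2]
  abel

end Rates

end

end SBC

namespace SBC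

noncomputable section

theorem mul_conjGrad_re (L : ℂ →L[ℝ] ℝ) (g : ℂ) : (g * conjGrad L).re = L g := by
  have h : L g = g.re * L 1 + g.im * L Complex.I := by
    conv_lhs => rw [show g = g.re • (1 : ℂ) + g.im • Complex.I by simp]
    rw [map_add, map_smul, map_smul, smul_eq_mul, smul_eq_mul]
  rw [h, conjGrad_apply]
  simp

/-! ### Rates of the mixed potential, the energies, the angles, x and y -/

section Rates

variable {u₀ : Base} {m : Fin 4 → ℝ}

theorem vanishOrder_field_sep :
    VanishOrder u₀ 4 (fun q => (field m q).2.sep) := by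
  have h1 : VanishOrder u₀ 0 (fun q : Phase => q.2.mom) := .smooth
    (contDiff_snd.comp (contDiff_snd.comp (contDiff_snd.comp contDiff_snd))).contDiffAt
  have h2 : VanishOrder u₀ 0 (fun _ : Phase => muConst m) := .smooth contDiffAt_const
  exact ((((vanishOrder_phase_norm_sq 0).mul' (vanishOrder_phase_norm_sq 1)).mul' h2).clm
    Complex.ofRealCLM).mul' h1

/-- The rate of the mixed part of the potential. -/
theorem vanishOrder_mixPot_rate (hm : ∀ i, 0 < m i) (hx : u₀.sep ≠ 0) :
    VanishOrder u₀ 10 (fun q => fderiv ℝ (fun q : Phase => mixPot m (zLC m q, q.2.sep)) q (field m q) -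
      (‖q.1 1‖ ^ 2 * (aRoot m 0 * (mixGrad m 0 q).re) +
        ‖q.1 0‖ ^ 2 * (aRoot m 1 * (mixGrad m 1 q).re))) := by
  have hM := vanishOrder_mixPot hm hx
  set w₀ : Phase → (Fin 2 → ℂ) × ℂ := fun q =>
    (fun j => ‖q.1 j.rev‖ ^ 2 • ((aRoot m j : ℂ) * Gam q j), 0) with hw₀
  have hW := contDiffAt_zLC_sep (m := m) (u₀ := u₀)
  have hd : ∀ᶠ q in 𝓝 ((0, u₀) : Phase), DifferentiableAt ℝ (zLC m) q :=
    vanishOrder_zLC.eventually_differentiableAt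
  -- The velocity of `(z, x)` is compared with its leading part `w₀`. The difference has components
  -- of order at least 4 and 3, so it changes the rate of the mixed potential by terms of order 8 +
  -- 3.
  have h := hM.fderiv_comp_apply hW (zLC_base m u₀) vanishOrder_zLC (c := 3)
    (w := fun q => (fun j => fderiv ℝ (fun q => zLC m q j) q (field m q), (field m q).2.sep) - w₀ q)
    (VanishOrder.pi fun j => vanishOrder_zLC_rate hm hx j)
    ((vanishOrder_field_sep (m := m) (u₀ := u₀)).mono (by norm_num) |>.congr
      (by filter_upwards with q using by simp [hw₀]))
  refine (h.mono (by norm_num)).congr ?_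
  have ht : Tendsto (fun q : Phase => (zLC m q, q.2.sep)) (𝓝 (0, u₀)) (𝓝 (0, u₀.sep)) := by
    have := (contDiffAt_zLC_sep (m := m) (u₀ := u₀)).continuousAt
    rwa [ContinuousAt, zLC_base] at this
  filter_upwards [hd, ht.eventually hM.eventually_differentiableAt] with q hq hq'
  have k1 : HasFDerivAt (fun q : Phase => q.2.sep) (sepL ∘L binProj 0) q :=
    (sepL ∘L binProj 0).hasFDerivAt
  have k2 : HasFDerivAt (fun q : Phase => mixPot m (zLC m q, q.2.sep)) _ q :=
    HasFDerivAt.comp (g := mixPot m) (f := fun q : Phase => (zLC m q, q.2.sep)) q hq'.hasFDerivAt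
      (hq.hasFDerivAt.prodMk k1)
  have k3 : fderiv ℝ (fun q : Phase => mixPot m (zLC m q, q.2.sep)) q (field m q) =
      fderiv ℝ (mixPot m) (zLC m q, q.2.sep)
        (fun j => fderiv ℝ (fun q => zLC m q j) q (field m q), (field m q).2.sep) := by
    rw [k2.fderiv, ContinuousLinearMap.comp_apply]
    congr 1
    refine Prod.ext ?_ rfl
    funext j
    have : HasFDerivAt (fun q => zLC m q j) _ q := (hasFDerivAt_pi'.1 hq.hasFDerivAt) j
    exact (congrArg (fun L => L (field m q)) this.fderiv).symm
  have k4 : ∀ j, (mixGrad m j q).re =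
      fderiv ℝ (mixPot m) (zLC m q, q.2.sep) (inlSingle ℂ j (Gam q j)) := fun j => by
    rw [mixGrad, dirGrad, mul_conjGrad_re]
    rfl
  have k5 : w₀ q = (‖q.1 1‖ ^ 2 * aRoot m 0) • inlSingle ℂ 0 (Gam q 0) +
      (‖q.1 0‖ ^ 2 * aRoot m 1) • inlSingle ℂ 1 (Gam q 1) := by
    refine Prod.ext ?_ (by simp [inlSingle, hw₀])
    funext j
    fin_cases j
    · simp [inlSingle, hw₀, mul_assoc]
    · simp [inlSingle, hw₀, mul_assoc]
  rw [map_sub, k3, k5, map_add, map_smul, map_smul, ← k4, ← k4]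
  simp only [smul_eq_mul]
  ring

/-- The rates of the angles. -/
theorem vanishOrder_nf_angle_rate (hm : ∀ i, 0 < m i) (hx : u₀.sep ≠ 0) (j : Fin 2) :
    VanishOrder u₀ 10 (fun q => fderiv ℝ (fun q => invar m j angleL (binProj j q)) q (field m q)) := by
  have hx' : (binBase j u₀).2.2.1 ≠ 0 := hx
  have h := vanishOrder_fderiv_sub_binAnti (k := 0) hm hx j angleL.contDiff.contDiffAt
    (vanishOrder_dirDeriv_binHat hm hx' j (vanishOrder_linear_rates hm hx' j).1)
  have h2 := (vanishOrder_phase_norm_sq (u₀ := u₀) j.rev).smul (vanishOrder_mixVec hm hx j (m := m)).2.2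
  refine (h.add (h2.mono (by norm_num))).congr ?_
  filter_upwards with q
  rw [ContinuousLinearMap.fderiv]
  simp only [invar]
  simp [angleL]

/-- The rate of the separation. -/
theorem vanishOrder_nf_sep_rate (hm : ∀ i, 0 < m i) (hx : u₀.sep ≠ 0) :
    VanishOrder u₀ 10 (fun q => fderiv ℝ (fun q => invar m 0 sepL (binProj 0 q)) q (field m q)) := by
  have hx' : (binBase 0 u₀).2.2.1 ≠ 0 := hx
  have h := vanishOrder_fderiv_sub_binAnti (k := 1) hm hx 0 sepL.contDiff.contDiffAt
    (vanishOrder_dirDeriv_binHat hm hx' 0 (vanishOrder_linear_rates hm hx' 0).2.1)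
  refine h.congr ?_
  filter_upwards with q
  rw [ContinuousLinearMap.fderiv]
  simp only [invar]
  simp [sepL, mixVec]

theorem vanishOrder_momCorr {b : BinBase} (hm : ∀ i, 0 < m i) (hx : b.2.2.1 ≠ 0) :
    VanishOrder b 6 (momCorr m) :=
  ((VanishOrder.smooth (contDiffAt_inv_binVec_re hm hx 1)).smul
    (vanishOrder_rho.smul (vanishOrder_binForceOne hm hx 1))).mono (by norm_num)

/-- The rate of the momentum. -/
theorem vanishOrder_nf_mom_rate (hm : ∀ i, 0 < m i) (hx : u₀.sep ≠ 0) :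
    VanishOrder u₀ 10 (fun q => fderiv ℝ (fun q => invar m 0 momL (binProj 0 q) -
      binAnti m 1 (momCorr m) (binProj 1 q)) q (field m q)) := by
  have hx0 : (binBase 0 u₀).2.2.1 ≠ 0 := hx
  have hx1 : (binBase 1 u₀).2.2.1 ≠ 0 := hx
  have hD := vanishOrder_dirDeriv_binHat hm hx0 0 (vanishOrder_linear_rates hm hx0 0).2.2
  have h := vanishOrder_fderiv_sub_binAnti (k := 1) hm hx 0 momL.contDiff.contDiffAt hD
  have hc := vanishOrder_momCorr (m := m) (b := binBase 1 u₀) hm hx1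
  have h1 := vanishOrder_fderiv_binAnti_field (k := 5) hm hx 1 hc
  -- The force that depends on both binaries is not integrated at all: with the two factors `|ζ|²`
  -- it has order 12.
  have h2 := (vanishOrder_phase_norm_sq (u₀ := u₀) 1).smul ((vanishOrder_phase_norm_sq 0).smul
    (vanishOrder_mixForceTwo hm hx))
  have hI : ContDiffAt ℝ ω (fun q : Phase => invar m 0 momL (binProj 0 q)) (0, u₀) :=
    (VanishOrder.smooth (momL.contDiff.contDiffAt.sub
      (vanishOrder_binAnti hm hx0 0 hD).contDiffAt)).comp_binProj.contDiffAt
  have hA := (vanishOrder_binAnti hm hx1 1 hc).comp_binProj (u₀ := u₀)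
  refine ((h.sub h1).add (h2.mono (by norm_num))).congr ?_
  have ht : Tendsto (binProj 1) (𝓝 ((0, u₀) : Phase)) (𝓝 (0, binBase 1 u₀)) :=
    (binProj 1).continuous.tendsto' _ _ rfl
  filter_upwards [hA.eventually_differentiableAt,
    (VanishOrder.smooth hI).eventually_differentiableAt,
    ht.eventually (eventually_binVec_re hm hx1 1)] with q k1 k2 k3
  rw [fderiv_fun_sub k2 k1, ContinuousLinearMap.fderiv, sub_apply, momCorr,
    smul_inv_smul₀ k3]
  have e1 : momL (mixVec m 0 q) = ((‖q.1 0‖ ^ 2 : ℝ) : ℂ) *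
    (binForceOne m 1 (binProj 1 q) + mixForceTwo m q) := rfl
  have e2 : (binProj 1 q).1 = q.1 1 := rfl
  have e3 : (Fin.rev 0 : Fin 2) = 1 := rfl
  have e4 : (Fin.rev 1 : Fin 2) = 0 := rfl
  rw [e1, e2, e3, e4]
  simp only [Complex.real_smul, invar]
  push_cast
  ring

/-- The rates of the corrected energies. -/
theorem vanishOrder_invar_energy_rate (hm : ∀ i, 0 < m i) (hx : u₀.sep ≠ 0) (j : Fin 2)
    {c : BinBase → ℂ} {d : BinBase → ℝ}
    (hc : ContDiffAt ℝ ω c (binBase j u₀)) (hd : ContDiffAt ℝ ω d (binBase j u₀))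
    (h : VanishOrder (binBase j u₀) 5 (fun p => binGrad m j p -
      (c p.2 * p.1 ^ 3 + ((d p.2 * ‖p.1‖ ^ 2 : ℝ) : ℂ) * conj p.1))) :
    VanishOrder u₀ 10 (fun q => fderiv ℝ (fun q => invar m j (binEnergy c d) (binProj j q)) q
      (field m q) - ‖q.1 j.rev‖ ^ 2 * (2 * (mixGrad m j q).re)) := by
  have hx' : (binBase j u₀).2.2.1 ≠ 0 := hx
  have h1 := vanishOrder_fderiv_sub_binAnti (k := 4) hm hx j (contDiffAt_binEnergy hc hd)
    (vanishOrder_dirDeriv_binHat hm hx' j (vanishOrder_energy_rate hm hx' j hc hd h))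
  have h2 := vanishOrder_fderiv_mixVec hm hx j (vanishOrder_binForm (contDiffAt_coeff hc hd).1 4)
  have h3 := (vanishOrder_binU_cube (b := binBase j u₀)).comp_binProj.mul'
    ((vanishOrder_mixGrad hm hx j (m := m)).clm Complex.reCLM)
  have h4 := (vanishOrder_phase_norm_sq (u₀ := u₀) j.rev).mul'
    (((h3.const_mul 2).mono (show 9 ≤ 2 + 7 by norm_num)).sub
      ((h2.const_mul (1 / 2)).mono (by norm_num)))
  refine (h1.add (h4.mono (by norm_num))).congr ?_
  have ht : Tendsto (binProj j) (𝓝 ((0, u₀) : Phase)) (𝓝 (0, binBase j u₀)) :=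
    (binProj j).continuous.tendsto' _ _ rfl
  filter_upwards [ht.eventually (fderiv_binEnergy hc hd)] with q hq
  rw [hq, binU_binProj]
  have e : (mixVec m j q).2.1 = 2 * magU q j ^ 3 * (mixGrad m j q).re := rfl
  rw [e]
  simp only [invar, smul_eq_mul, Complex.reCLM_apply]
  ring

end Rates

end

end SBC

namespace SBC

noncomputable section

/-! ### The polynomials of the normal form -/

theorem IsHomFamily.cast {P : Type} [NormedAddCommGroup P] [NormedSpace ℝ P] {k l : ℕ} {p₀ : P}
    {R : P → MvPolynomial (Fin 4) ℝ} (hR : IsHomFamily k p₀ R) (h : k = l) : IsHomFamily l p₀ R :=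
  h ▸ hR

/-- The index of `I` of a binary among `(I₁, L₁, I₂, L₂)`. -/
def idxRe : Fin 2 → Fin 4 := ![0, 2]
/-- The index of `L` of a binary among `(I₁, L₁, I₂, L₂)`. -/
def idxIm : Fin 2 → Fin 4 := ![1, 3]

theorem realCoords_idx (ζ : Fin 2 → ℂ) (j : Fin 2) :
    realCoords ζ (idxRe j) = (ζ j).re ∧ realCoords ζ (idxIm j) = (ζ j).im := by
  fin_cases j <;> exact ⟨rfl, rfl⟩

open MvPolynomial in
/-- `|ζ|²` as a polynomial. -/
def rhoPoly (j : Fin 2) : MvPolynomial (Fin 4) ℝ := X (idxRe j) ^ 2 + X (idxIm j) ^ 2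

theorem eval_rhoPoly (ζ : Fin 2 → ℂ) (j : Fin 2) :
    (rhoPoly j).eval (realCoords ζ) = ‖ζ j‖ ^ 2 := by
  simp [rhoPoly, realCoords_idx, norm_sq_eq]

theorem isHomFamily_rhoPoly {P : Type} [NormedAddCommGroup P] [NormedSpace ℝ P] {p₀ : P}
    (j : Fin 2) : IsHomFamily 2 p₀ (fun _ => rhoPoly j) :=
  ((IsHomFamily.X (idxRe j)).pow 2).add ((IsHomFamily.X (idxIm j)).pow 2)

open MvPolynomial in
/-- A form in `(I, L)` as a polynomial. -/
def formPoly (k : ℕ) (a : ℕ → BinBase → ℝ) (j : Fin 2) (u : Base) : MvPolynomial (Fin 4) ℝ :=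
  ∑ i ∈ Finset.range (k + 1), C (a i (binBase j u)) * (X (idxRe j) ^ (k - i) * X (idxIm j) ^ i)

theorem eval_formPoly (k : ℕ) (a : ℕ → BinBase → ℝ) (j : Fin 2) (q : Phase) :
    (formPoly k a j q.2).eval (realCoords q.1) = binForm k a (binProj j q) := by
  simp [formPoly, binForm, realCoords_idx, binProj_eq, mul_assoc]

theorem isHomFamily_formPoly {k : ℕ} {a : ℕ → BinBase → ℝ} {j : Fin 2} {u₀ : Base}
    (ha : ∀ i, ContDiffAt ℝ ω (a i) (binBase j u₀)) : IsHomFamily k u₀ (formPoly k a j) := by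
  refine IsHomFamily.sum _ fun i hi => ?_
  have h := (((IsHomFamily.X (p₀ := u₀) (idxRe j)).pow (k - i)).mul
    ((IsHomFamily.X (idxIm j)).pow i)).smul (c := fun u => a i (binBase j u))
    ((ContDiffAt.comp u₀ (ha i) (contDiff_binBase j).contDiffAt).of_le le_top)
  have e : (k - i) * 1 + i * 1 = k := by have := Finset.mem_range.1 hi; omega
  rwa [e] at h

open MvPolynomial in
/-- The terms of degree four of the normal form. -/
def nfR₄ (j : Fin 2) (h : Fin 2 → ℝ) : MvPolynomial (Fin 4) ℝ :=
  C (3 * h j) * (rhoPoly j * rhoPoly j.rev)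

open MvPolynomial in
/-- The terms of degree six of the normal form. -/
def nfR₆ (j : Fin 2) (h : Fin 2 → ℝ) : MvPolynomial (Fin 4) ℝ :=
  C (-h j ^ 2) * (rhoPoly j ^ 2 * rhoPoly j.rev)

open MvPolynomial in
/-- The terms of degree eight of the normal form. -/
def nfR₈ (c : Fin 2 → BinBase → ℂ) (d : Fin 2 → BinBase → ℝ) (j : Fin 2) (u : Base) :
    MvPolynomial (Fin 4) ℝ :=
  rhoPoly j.rev * (C (2 * u.1 j ^ 3) * rhoPoly j ^ 3 +
      -- One unit is the gradient term in the rate of `I`; `3/2` arises when `h` in the term `3 h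
      -- |ζ₁|² |ζ₂|²` is replaced by the new energy plus half the quartic form.
      C (5 / 2) * (rhoPoly j * formPoly 4 (quarticCoeff (c j) (d j)) j u) +
      formPoly 6 (derivCoeff 7 (corrReCoeff (c j) (d j))) j u) -
    -- The leading term `|ζ|²` of the other binary is expressed in its corrected coordinate, which
    -- exceeds it by `2 (I F + L G)` to first order.
    C 2 * (X (idxRe j.rev) * formPoly 7 (corrReCoeff (c j.rev) (d j.rev)) j.rev u +
      X (idxIm j.rev) * formPoly 7 (corrImCoeff (c j.rev) (d j.rev)) j.rev u)

section Poly

variable {u₀ : Base} {c : Fin 2 → BinBase → ℂ} {d : Fin 2 → BinBase → ℝ}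

theorem isHomFamily_nfR₄ (j : Fin 2) : IsHomFamily 4 u₀.energy (nfR₄ j) :=
  ((isHomFamily_rhoPoly j).mul (isHomFamily_rhoPoly j.rev)).smul (by fun_prop)

theorem isHomFamily_nfR₆ (j : Fin 2) : IsHomFamily 6 u₀.energy (nfR₆ j) :=
  (((isHomFamily_rhoPoly j).pow 2).mul (isHomFamily_rhoPoly j.rev)).smul (by fun_prop)

theorem contDiffAt_derivCoeff {k : ℕ} {a : ℕ → BinBase → ℝ} {b : BinBase}
    (ha : ∀ i, ContDiffAt ℝ ω (a i) b) (i : ℕ) : ContDiffAt ℝ ω (derivCoeff k a i) b :=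
  contDiffAt_const.mul (ha i)

theorem isHomFamily_nfR₈ (hc : ∀ j, ContDiffAt ℝ ω (c j) (binBase j u₀))
    (hd : ∀ j, ContDiffAt ℝ ω (d j) (binBase j u₀)) (j : Fin 2) :
    IsHomFamily 8 u₀ (nfR₈ c d j) := by
  have hρ : ∀ j, IsHomFamily 2 u₀ (fun _ => rhoPoly j) := fun j => isHomFamily_rhoPoly j
  have hh : ContDiffAt ℝ ∞ (fun u : Base => 2 * u.1 j ^ 3) u₀ := by fun_prop
  have h1 : IsHomFamily 6 u₀ (fun u => MvPolynomial.C (2 * u.1 j ^ 3) * rhoPoly j ^ 3) :=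
    (((hρ j).pow 3).cast (by norm_num)).smul hh
  have h2 : IsHomFamily 6 u₀ (fun u => MvPolynomial.C (5 / 2) *
      (rhoPoly j * formPoly 4 (quarticCoeff (c j) (d j)) j u)) :=
    (((hρ j).mul (isHomFamily_formPoly (contDiffAt_coeff (hc j) (hd j)).1)).cast
      (by norm_num)).smul contDiffAt_const
  have h3 : IsHomFamily 6 u₀ (formPoly 6 (derivCoeff 7 (corrReCoeff (c j) (d j))) j) :=
    isHomFamily_formPoly fun i => contDiffAt_derivCoeff (contDiffAt_coeff (hc j) (hd j)).2.1 i
  have h4 : IsHomFamily 8 u₀ (fun u => rhoPoly j.rev * (MvPolynomial.C (2 * u.1 j ^ 3) * rhoPoly j ^ 3 +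
      MvPolynomial.C (5 / 2) * (rhoPoly j * formPoly 4 (quarticCoeff (c j) (d j)) j u) +
      formPoly 6 (derivCoeff 7 (corrReCoeff (c j) (d j))) j u)) := 
    ((hρ j.rev).mul ((h1.add h2).add h3)).cast (by norm_num)
  have h5 : IsHomFamily 8 u₀ (fun u => MvPolynomial.X (idxRe j.rev) *
      formPoly 7 (corrReCoeff (c j.rev) (d j.rev)) j.rev u) :=
    ((IsHomFamily.X _).mul (isHomFamily_formPoly (contDiffAt_coeff (hc _) (hd _)).2.1)).cast
      (by norm_num)
  have h6 : IsHomFamily 8 u₀ (fun u => MvPolynomial.X (idxIm j.rev) *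
      formPoly 7 (corrImCoeff (c j.rev) (d j.rev)) j.rev u) :=
    ((IsHomFamily.X _).mul (isHomFamily_formPoly (contDiffAt_coeff (hc _) (hd _)).2.2)).cast
      (by norm_num)
  exact h4.sub ((h5.add h6).smul contDiffAt_const)

theorem eval_nfR₄ (j : Fin 2) (q : Phase) : (nfR₄ j q.2.energy).eval (realCoords q.1) =
    3 * q.2.1 j * (‖q.1 j‖ ^ 2 * ‖q.1 j.rev‖ ^ 2) := by
  simp [nfR₄, eval_rhoPoly, Base.energy]

theorem eval_nfR₆ (j : Fin 2) (q : Phase) : (nfR₆ j q.2.energy).eval (realCoords q.1) =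
    -q.2.1 j ^ 2 * ((‖q.1 j‖ ^ 2) ^ 2 * ‖q.1 j.rev‖ ^ 2) := by
  simp [nfR₆, eval_rhoPoly, Base.energy]

theorem eval_nfR₈ (j : Fin 2) (q : Phase) : (nfR₈ c d j q.2).eval (realCoords q.1) =
    ‖q.1 j.rev‖ ^ 2 * (2 * q.2.1 j ^ 3 * (‖q.1 j‖ ^ 2) ^ 3 +
      5 / 2 * (‖q.1 j‖ ^ 2 * binForm 4 (quarticCoeff (c j) (d j)) (binProj j q)) +
      binForm 6 (derivCoeff 7 (corrReCoeff (c j) (d j))) (binProj j q)) -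
    2 * ((q.1 j.rev).re * binForm 7 (corrReCoeff (c j.rev) (d j.rev)) (binProj j.rev q) +
      (q.1 j.rev).im * binForm 7 (corrImCoeff (c j.rev) (d j.rev)) (binProj j.rev q)) := by
  simp [nfR₈, eval_rhoPoly, eval_formPoly, realCoords_idx]

theorem vanishOrder_nfR₈ (hc : ∀ j, ContDiffAt ℝ ω (c j) (binBase j u₀))
    (hd : ∀ j, ContDiffAt ℝ ω (d j) (binBase j u₀)) (j : Fin 2) :
    VanishOrder u₀ 8 (fun q : Phase => (nfR₈ c d j q.2).eval (realCoords q.1)) := by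
  have hρ : ∀ j, VanishOrder u₀ 2 (fun q : Phase => ‖q.1 j‖ ^ 2) := vanishOrder_phase_norm_sq
  have hC := fun j => contDiffAt_coeff (hc j) (hd j)
  have hf := fun j => (vanishOrder_binForm (hC j).2.1 7).comp_binProj (u₀ := u₀)
  have hg := fun j => (vanishOrder_binForm (hC j).2.2 7).comp_binProj (u₀ := u₀)
  have he := (vanishOrder_binForm (hC j).1 4).comp_binProj (u₀ := u₀)
  have h6 := (vanishOrder_binForm (contDiffAt_derivCoeff (k := 7) (hC j).2.1)
    6).comp_binProj (u₀ := u₀)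
  have hI := (vanishOrder_proj (p₀ := u₀) j.rev).clm Complex.reCLM
  have hL := (vanishOrder_proj (p₀ := u₀) j.rev).clm Complex.imCLM
  have hh : VanishOrder u₀ 0 (fun q : Phase => 2 * q.2.1 j ^ 3) := .smooth (by fun_prop)
  have t1 : VanishOrder u₀ 6 _ := (hh.mul' ((hρ j).pow 3)).mono (by norm_num)
  have t2 : VanishOrder u₀ 6 _ := (((hρ j).mul' he).const_mul (5 / 2)).mono (by norm_num)
  have t3 : VanishOrder u₀ 8 _ := ((hρ j.rev).mul' ((t1.add t2).add h6)).mono (by norm_num)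
  have t4 : VanishOrder u₀ 8 _ := (((hI.mul' (hf j.rev)).add (hL.mul' (hg j.rev))).const_mul
    2).mono (by norm_num)
  refine (t3.sub t4).congr ?_
  filter_upwards with q
  simp only [eval_nfR₈, Complex.reCLM_apply, Complex.imCLM_apply]

end Poly

end

end SBC

namespace SBC

noncomputable section

/-! ### Comparison of the rates with the normal form polynomials -/

section NormalForm

variable {u₀ : Base} {m : Fin 4 → ℝ} {c : Fin 2 → BinBase → ℂ} {d : Fin 2 → BinBase → ℝ}

/-- `c` and `d` are the coefficients of the leading part of the gradients of the potentials of the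
binaries. -/
def IsLeading (m : Fin 4 → ℝ) (u₀ : Base) (c : Fin 2 → BinBase → ℂ) (d : Fin 2 → BinBase → ℝ) :
    Prop :=
  ∀ j, ContDiffAt ℝ ω (c j) (binBase j u₀) ∧ ContDiffAt ℝ ω (d j) (binBase j u₀) ∧
    VanishOrder (binBase j u₀) 5 (fun p => binGrad m j p -
      (c j p.2 * p.1 ^ 3 + ((d j p.2 * ‖p.1‖ ^ 2 : ℝ) : ℂ) * conj p.1))

theorem exists_isLeading (hm : ∀ i, 0 < m i) (hx : u₀.sep ≠ 0) : ∃ c d, IsLeading m u₀ c d := by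
  have h := fun j => exists_binGrad_leading (b := binBase j u₀) hm hx j
  choose c d hc hd h using h
  exact ⟨c, d, fun j => ⟨hc j, hd j, h j⟩⟩

theorem vanishOrder_mixPot_zLC (hm : ∀ i, 0 < m i) (hx : u₀.sep ≠ 0) :
    VanishOrder u₀ 8 (fun q : Phase => mixPot m (zLC m q, q.2.sep)) :=
  (vanishOrder_mixPot hm hx).comp_zLC

theorem vanishOrder_invar_energy (hm : ∀ i, 0 < m i) (hx : u₀.sep ≠ 0) (h : IsLeading m u₀ c d)
    (j : Fin 2) : VanishOrder u₀ 6 (fun q =>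
      invar m j (binEnergy (c j) (d j)) (binProj j q) - binEnergy (c j) (d j) (binProj j q)) := by
  obtain ⟨hc, hd, hl⟩ := h j
  exact (vanishOrder_invar hm hx j (vanishOrder_energy_rate hm hx j hc hd hl)).comp_binProj

theorem vanishOrder_nf_energy (hm : ∀ i, 0 < m i) (hx : u₀.sep ≠ 0) (h : IsLeading m u₀ c d)
    (j : Fin 2) : VanishOrder u₀ 6 (fun q => (nfCoord m c d q).2.1 j - q.2.1 j +
      1 / 2 * binForm 4 (quarticCoeff (c j) (d j)) (binProj j q)) := by
  have h1 := ((vanishOrder_mixPot_zLC hm hx (u₀ := u₀)).mono (show 6 ≤ 8 by norm_num)).const_mul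
    (if j = 0 then 0 else 2 / aRoot m 1)
  refine ((vanishOrder_invar_energy hm hx h j).sub h1).congr ?_
  filter_upwards with q
  simp only [nfCoord, binEnergy, binProj_apply]
  ring

theorem vanishOrder_nf_energy_four (hm : ∀ i, 0 < m i) (hx : u₀.sep ≠ 0) (h : IsLeading m u₀ c d)
    (j : Fin 2) : VanishOrder u₀ 4 (fun q => (nfCoord m c d q).2.1 j - q.2.1 j) := by
  have h1 := (vanishOrder_binForm (contDiffAt_coeff (h j).1 (h j).2.1).1 4).comp_binProj (u₀ := u₀)
  exact (((vanishOrder_nf_energy hm hx h j).mono (by norm_num)).sub (h1.const_mul (1 / 2))).congr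
    (by filter_upwards with q using by ring)

theorem vanishOrder_nf_zeta (h : IsLeading m u₀ c d) (j : Fin 2) :
    VanishOrder u₀ 7 (fun q => (nfCoord m c d q).1 j - q.1 j) :=
  (contDiffAt_binZeta (h j).1 (h j).2.1).1.comp_binProj

/-- The new coordinates differ from the identity by terms of second order. -/
theorem vanishOrder_nfCoord_sub (hm : ∀ i, 0 < m i) (hx : u₀.sep ≠ 0) (h : IsLeading m u₀ c d) :
    VanishOrder u₀ 7 (fun q => (nfCoord m c d q).1 - q.1) ∧
    VanishOrder u₀ 2 (fun q => nfCoord m c d q - q) := by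
  have h1 : VanishOrder u₀ 7 (fun q => (nfCoord m c d q).1 - q.1) :=
    VanishOrder.pi fun j => vanishOrder_nf_zeta h j
  have hh : VanishOrder u₀ 2 (fun q => (nfCoord m c d q).2.1 - q.2.1) :=
    VanishOrder.pi fun j => (vanishOrder_nf_energy_four hm hx h j).mono (by norm_num)
  have hθ : VanishOrder u₀ 2 (fun q => (nfCoord m c d q).2.2.1 - q.2.2.1) :=
    VanishOrder.pi fun j => (vanishOrder_invar (b := binBase j u₀) hm hx j
      (vanishOrder_linear_rates hm hx j).1).comp_binProj
  have h3 := ((vanishOrder_invar (b := binBase 0 u₀) hm hx 0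
    (vanishOrder_linear_rates hm hx 0).2.1).comp_binProj (u₀ := u₀)).mono (show 2 ≤ 3 by norm_num)
  have h4 := ((vanishOrder_invar (b := binBase 0 u₀) hm hx 0
    (vanishOrder_linear_rates hm hx 0).2.2).comp_binProj (u₀ := u₀)).mono (show 2 ≤ 3 by norm_num)
  have h5 := ((vanishOrder_binAnti hm hx 1 (vanishOrder_momCorr (b := binBase 1 u₀) hm
    hx)).comp_binProj (u₀ := u₀)).mono (show 2 ≤ 7 by norm_num)
  refine ⟨h1, ((h1.mono (by norm_num)).prodMk (hh.prodMk (hθ.prodMk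
    (h3.prodMk (h4.sub h5))))).congr ?_⟩
  filter_upwards with q
  refine Prod.ext rfl (Prod.ext rfl (Prod.ext rfl (Prod.ext rfl ?_)))
  simp only [nfCoord, Prod.snd_sub]
  rw [sub_right_comm]
  rfl

theorem contDiffAt_nfCoord (hm : ∀ i, 0 < m i) (hx : u₀.sep ≠ 0) (h : IsLeading m u₀ c d) :
    ContDiffAt ℝ ω (nfCoord m c d) (0, u₀) :=
  ((vanishOrder_nfCoord_sub hm hx h).2.contDiffAt.add contDiffAt_id).congr_of_eventuallyEq
    (by filter_upwards with q using by simp)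

theorem nfCoord_base (hm : ∀ i, 0 < m i) (hx : u₀.sep ≠ 0) (h : IsLeading m u₀ c d) :
    nfCoord m c d (0, u₀) = (0, u₀) := by
  have h1 := (vanishOrder_nfCoord_sub hm hx h).2.isBigO
  obtain ⟨C, hC⟩ := h1.bound
  have := hC.self_of_nhds
  simpa [sub_eq_zero] using this

/-- The defect of the normal form of the rates of `ζ`. -/
theorem vanishOrder_nf_defect (hm : ∀ i, 0 < m i) (hx : u₀.sep ≠ 0) (h : IsLeading m u₀ c d)
    (j : Fin 2) : VanishOrder u₀ 10 (fun q : Phase => ‖q.1 j.rev‖ ^ 2 * binRate (c j) (d j) (binProj j q) -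
      (‖(nfCoord m c d q).1 j.rev‖ ^ 2 +
        (nfR₄ j (nfCoord m c d q).2.energy).eval (realCoords (nfCoord m c d q).1) +
        (nfR₆ j (nfCoord m c d q).2.energy).eval (realCoords (nfCoord m c d q).1) +
        (nfR₈ c d j q.2).eval (realCoords q.1))) := by
  have hρ : ∀ j, VanishOrder u₀ 2 (fun q : Phase => ‖q.1 j‖ ^ 2) := vanishOrder_phase_norm_sq
  have hf := fun j => (vanishOrder_binForm (contDiffAt_coeff (h j).1 (h j).2.1).2.1 7).comp_binProj
    (u₀ := u₀)
  have hg := fun j => (vanishOrder_binForm (contDiffAt_coeff (h j).1 (h j).2.1).2.2 7).comp_binProj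
    (u₀ := u₀)
  have hI := fun j => (vanishOrder_proj (p₀ := u₀) j).clm Complex.reCLM
  have hL := fun j => (vanishOrder_proj (p₀ := u₀) j).clm Complex.imCLM
  have e₀ : ∀ (q : Phase) j, ‖(nfCoord m c d q).1 j‖ ^ 2 =
      ((q.1 j).re + binForm 7 (corrReCoeff (c j) (d j)) (binProj j q)) ^ 2 +
      ((q.1 j).im + binForm 7 (corrImCoeff (c j) (d j)) (binProj j q)) ^ 2 := fun q j => by
    rw [norm_sq_eq]
    simp [nfCoord, binZeta, binProj_apply]
  have hδ' : ∀ j, VanishOrder u₀ 14 (fun q => ‖(nfCoord m c d q).1 j‖ ^ 2 - ‖q.1 j‖ ^ 2 -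
      2 * ((q.1 j).re * binForm 7 (corrReCoeff (c j) (d j)) (binProj j q) +
      (q.1 j).im * binForm 7 (corrImCoeff (c j) (d j)) (binProj j q))) := fun j => by
    refine (((hf j).pow 2).add ((hg j).pow 2)).congr ?_
    filter_upwards with q
    rw [e₀, norm_sq_eq (q.1 j)]
    ring
  have hδ : ∀ j, VanishOrder u₀ 8 (fun q => ‖(nfCoord m c d q).1 j‖ ^ 2 - ‖q.1 j‖ ^ 2) := fun j => by
    have := (((hI j).mul' (hf j)).add ((hL j).mul' (hg j))).const_mul 2
    refine (((hδ' j).mono (show 8 ≤ 14 by norm_num)).add (this.mono (by norm_num))).congr ?_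
    filter_upwards with q
    simp only [Complex.reCLM_apply, Complex.imCLM_apply]
    ring
  have hT : ∀ j, VanishOrder u₀ 2 (fun q => ‖(nfCoord m c d q).1 j‖ ^ 2) := fun j =>
    (((hδ j).mono (by norm_num)).add (hρ j)).congr (by filter_upwards with q using by ring)
  have hh : VanishOrder u₀ 0 (fun q : Phase => q.2.1 j) := .smooth (by fun_prop)
  have hH4 := vanishOrder_nf_energy_four hm hx h j
  have hH : VanishOrder u₀ 0 (fun q => (nfCoord m c d q).2.1 j) :=
    ((hH4.mono (by norm_num)).add hh).congr (by filter_upwards with q using by ring)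
  have hH6 := vanishOrder_nf_energy hm hx h j
  -- `t1` comes from the leading term `|ζ|²`; `t2` and `t3` from the energy and the radii in the
  -- term of degree 4; `t4` to `t6` from those in the term of degree 6. The terms of lower order
  -- have been absorbed in `nfR₈`.
  have t1 := (hδ' j.rev).mono (show 10 ≤ 14 by norm_num)
  have t2 : VanishOrder u₀ 10 _ := (hH6.mul' ((hρ j).mul' (hρ j.rev))).mono (by norm_num)
  have t3 : VanishOrder u₀ 10 _ := (hH.mul' (((hδ j).mul' (hT j.rev)).add
    ((((hρ j).mul' (hδ j.rev))).mono (by norm_num)))).mono (by norm_num)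
  have t4 : VanishOrder u₀ 10 _ := ((hH4.mul' (hH.add hh)).mul' (((hT j).pow 2).mul' (hT j.rev))).mono
    (by norm_num)
  have t5 : VanishOrder u₀ 10 _ := ((hh.pow 2).mul' (((hδ j).mul' ((hT j).add (hρ j))).mul'
    (hT j.rev))).mono (by norm_num)
  have t6 : VanishOrder u₀ 10 _ := ((hh.pow 2).mul' (((hρ j).pow 2).mul' (hδ j.rev))).mono
    (by norm_num)
  refine (((((t1.neg.sub (t2.const_mul 3)).sub (t3.const_mul 3)).add t4).add t5).add t6).congr ?_
  filter_upwards with q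
  rw [eval_nfR₄, eval_nfR₆, eval_nfR₈, binRate]
  have e1 : binS (binProj j q) = q.2.1 j * ‖q.1 j‖ ^ 2 := rfl
  have e2 : (binProj j q).1 = q.1 j := rfl
  rw [e1, e2]
  ring

end NormalForm

end

end SBC

namespace SBC

noncomputable section

/-- The vector field of the normal form. -/
def nfVec (m : Fin 4 → ℝ) (R₄ R₆ : Fin 2 → (Fin 2 → ℝ) → MvPolynomial (Fin 4) ℝ)
    (R₈ : Fin 2 → Base → MvPolynomial (Fin 4) ℝ) (R₉ : Base → MvPolynomial (Fin 4) ℝ) (Q : Phase) :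
    Phase :=
  (fun j => ((‖Q.1 j.rev‖ ^ 2 + (R₄ j Q.2.energy).eval (realCoords Q.1) +
      (R₆ j Q.2.energy).eval (realCoords Q.1) + (R₈ j Q.2).eval (realCoords Q.1) : ℝ) : ℂ),
    ![(R₉ Q.2).eval (realCoords Q.1) / aRoot m 0, -((R₉ Q.2).eval (realCoords Q.1) / aRoot m 1)],
    0, 0, 0)

/-! ### Error estimates for the transformed field -/

section NormalForm

variable {u₀ : Base} {m : Fin 4 → ℝ} {c : Fin 2 → BinBase → ℂ} {d : Fin 2 → BinBase → ℝ}

theorem isBigO_comp_nfCoord_sub (hm : ∀ i, 0 < m i) (hx : u₀.sep ≠ 0) (h : IsLeading m u₀ c d)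
    {F : Type} [NormedAddCommGroup F] [NormedSpace ℝ F] {f : Phase → F} {k : ℕ}
    (hf : VanishOrder u₀ k f) :
    (fun q => f (nfCoord m c d q) - f q) =O[𝓝 (0, u₀)] fun q => ‖q.1‖ ^ (k + 2) := by
  obtain ⟨h1, h2⟩ := vanishOrder_nfCoord_sub hm hx h
  exact hf.comp_sub_isBigO (nfCoord_base hm hx h) (contDiffAt_nfCoord hm hx h).continuousAt
    (h1.mono (by norm_num)).isBigO h2.isBigO

/-- In the defect the terms of degree 8 are still evaluated at the old coordinates. Moving them to
the new ones costs two orders more, which is order 10. -/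
theorem isBigO_zeta_rate (hm : ∀ i, 0 < m i) (hx : u₀.sep ≠ 0) (h : IsLeading m u₀ c d) (j : Fin 2) :
    (fun q => fderiv ℝ (fun q => (nfCoord m c d q).1 j) q (field m q) -
      ((‖(nfCoord m c d q).1 j.rev‖ ^ 2 +
        (nfR₄ j (nfCoord m c d q).2.energy).eval (realCoords (nfCoord m c d q).1) +
        (nfR₆ j (nfCoord m c d q).2.energy).eval (realCoords (nfCoord m c d q).1) +
        (nfR₈ c d j (nfCoord m c d q).2).eval (realCoords (nfCoord m c d q).1) : ℝ) : ℂ))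
      =O[𝓝 (0, u₀)] fun q => ‖q.1‖ ^ 10 := by
  have h1 := (vanishOrder_nf_zeta_rate hm hx j (h j).1 (h j).2.1 (h j).2.2).isBigO
  have h2 := ((vanishOrder_nf_defect hm hx h j).clm Complex.ofRealCLM).isBigO
  have h3 := (Complex.ofRealCLM.isBigO_comp _ _).trans (isBigO_comp_nfCoord_sub hm hx h
    (vanishOrder_nfR₈ (fun j => (h j).1) (fun j => (h j).2.1) j))
  refine ((h1.add h2).sub h3).congr_left fun q => ?_
  simp only [Complex.ofRealCLM_apply, nfCoord]
  push_cast
  ring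

/-- The terms of degree nine of the normal form. -/
theorem exists_nfR₉ (hm : ∀ i, 0 < m i) (hx : u₀.sep ≠ 0) (h : IsLeading m u₀ c d) :
    ∃ R₉ : Base → MvPolynomial (Fin 4) ℝ, IsHomFamily 9 u₀ R₉ ∧
      (fun q : Phase => 2 * aRoot m 0 * (‖q.1 1‖ ^ 2 * (mixGrad m 0 q).re) -
        (R₉ (nfCoord m c d q).2).eval (realCoords (nfCoord m c d q).1))
        =O[𝓝 (0, u₀)] fun q => ‖q.1‖ ^ 10 := by
  have h1 : VanishOrder u₀ 9 (fun q : Phase => 2 * aRoot m 0 * (‖q.1 1‖ ^ 2 * (mixGrad m 0 q).re)) :=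
    (((vanishOrder_phase_norm_sq 1).mul' ((vanishOrder_mixGrad hm hx 0).clm
      Complex.reCLM)).mono (by norm_num)).const_mul _
  obtain ⟨R, hR, hV, hR'⟩ := h1.exists_leading
  refine ⟨R, hR, ?_⟩
  have h2 := isBigO_comp_nfCoord_sub hm hx h hV
  have h3 : (fun q : Phase => ‖q.1‖ ^ (9 + 2)) =O[𝓝 (0, u₀)] fun q => ‖q.1‖ ^ 10 := by
    have hb : (fun q : Phase => ‖q.1‖) =O[𝓝 (0, u₀)] fun _ => (1 : ℝ) :=
      ContinuousAt.tendsto (f := fun q : Phase => ‖q.1‖) (by fun_prop) |>.isBigO_one ℝ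
    exact (hb.mul (isBigO_refl (fun q : Phase => ‖q.1‖ ^ 10) _)).congr
      (fun q => by ring) (fun q => by ring)
  exact (hR'.sub (h2.trans h3)).congr_left fun q => by ring

/-- For the second binary the multiple of the mixed potential cancels the binary's own rate and
leaves a negative multiple of the rate of the first. -/
theorem isBigO_energy_rate (hm : ∀ i, 0 < m i) (hx : u₀.sep ≠ 0) (h : IsLeading m u₀ c d)
    (j : Fin 2) : (fun q => fderiv ℝ (fun q => (nfCoord m c d q).2.1 j) q (field m q) -
      (if j = 0 then 1 else -(aRoot m 0 / aRoot m 1)) * (2 * (‖q.1 1‖ ^ 2 * (mixGrad m 0 q).re)))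
      =O[𝓝 (0, u₀)] fun q => ‖q.1‖ ^ 10 := by
  have ha := (aRoot_pos hm 1).ne'
  obtain ⟨hc, hd, hl⟩ := h j
  have h1 := (vanishOrder_invar_energy_rate hm hx j hc hd hl).isBigO
  have h2 := ((vanishOrder_mixPot_rate hm hx (m := m) (u₀ := u₀)).const_mul
    (if j = 0 then 0 else 2 / aRoot m 1)).isBigO
  have hs : ContDiffAt ℝ ω (fun q => invar m j (binEnergy (c j) (d j)) (binProj j q)) (0, u₀) :=
    ((vanishOrder_invar_energy hm hx h j).contDiffAt.add (VanishOrder.smooth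
      (contDiffAt_binEnergy hc hd)).comp_binProj.contDiffAt).congr_of_eventuallyEq
      (by filter_upwards with q using by simp)
  refine (h1.sub h2).congr' ?_ EventuallyEq.rfl
  filter_upwards [(VanishOrder.smooth hs).eventually_differentiableAt,
    (vanishOrder_mixPot_zLC hm hx (u₀ := u₀)).eventually_differentiableAt] with q k1 k2
  have e : (fun q => (nfCoord m c d q).2.1 j) = fun q =>
    invar m j (binEnergy (c j) (d j)) (binProj j q) -
      (if j = 0 then 0 else 2 / aRoot m 1) * mixPot m (zLC m q, q.2.sep) := rfl
  rw [e, fderiv_fun_sub k1 (k2.const_mul _), fderiv_const_mul k2]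
  simp only [sub_apply, smul_apply, smul_eq_mul]
  fin_cases j
  · simp
    ring
  · simp
    field_simp
    ring

theorem isBigO_nf_rates (hm : ∀ i, 0 < m i) (hx : u₀.sep ≠ 0) (h : IsLeading m u₀ c d) :
    ∃ R₉ : Base → MvPolynomial (Fin 4) ℝ, IsHomFamily 9 u₀ R₉ ∧
      (fun q => fderiv ℝ (nfCoord m c d) q (field m q) -
        nfVec m nfR₄ nfR₆ (nfR₈ c d) R₉ (nfCoord m c d q)) =O[𝓝 (0, u₀)] fun q => ‖q.1‖ ^ 10 := by
  obtain ⟨R₉, hR, hR'⟩ := exists_nfR₉ hm hx h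
  have ha := fun j => (aRoot_pos hm j).ne'
  refine ⟨R₉, hR, ?_⟩
  have hE : ∀ j, (fun q => fderiv ℝ (fun q => (nfCoord m c d q).2.1 j) q (field m q) -
      (nfVec m nfR₄ nfR₆ (nfR₈ c d) R₉ (nfCoord m c d q)).2.1 j)
      =O[𝓝 (0, u₀)] fun q => ‖q.1‖ ^ 10 := fun j => by
    refine ((isBigO_energy_rate hm hx h j).add (hR'.const_mul_left
      (if j = 0 then (aRoot m 0)⁻¹ else -(aRoot m 1)⁻¹))).congr_left fun q => ?_
    have h0 := ha 0
    have h1 := ha 1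
    fin_cases j
    · simp [nfVec]
      field_simp
      ring
    · simp [nfVec]
      field_simp
      ring
  have hS := (VanishOrder.smooth (contDiffAt_nfCoord hm hx h)).eventually_differentiableAt
  have hcomp : ∀ {F : Type} [NormedAddCommGroup F] [NormedSpace ℝ F] (L : Phase →L[ℝ] F),
      (fun q => fderiv ℝ (fun q => L (nfCoord m c d q)) q (field m q) -
        L (nfVec m nfR₄ nfR₆ (nfR₈ c d) R₉ (nfCoord m c d q))) =ᶠ[𝓝 (0, u₀)] fun q =>
      L (fderiv ℝ (nfCoord m c d) q (field m q) -
        nfVec m nfR₄ nfR₆ (nfR₈ c d) R₉ (nfCoord m c d q)) := fun L => by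
    filter_upwards [hS] with q hq
    have : HasFDerivAt (fun q => L (nfCoord m c d q)) _ q := L.hasFDerivAt.comp q hq.hasFDerivAt
    rw [this.fderiv, map_sub]
    rfl
  set D := fun q => fderiv ℝ (nfCoord m c d) q (field m q) -
        nfVec m nfR₄ nfR₆ (nfR₈ c d) R₉ (nfCoord m c d q)
  have k1 : ∀ j, (fun q => (D q).1 j) =O[𝓝 (0, u₀)] fun q => ‖q.1‖ ^ 10 := fun j =>
    (isBigO_zeta_rate hm hx h j).congr' (hcomp (ContinuousLinearMap.fst ℝ _ _ ∘L binProj j))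
      EventuallyEq.rfl
  have k2 : ∀ j, (fun q => (D q).2.1 j) =O[𝓝 (0, u₀)] fun q => ‖q.1‖ ^ 10 := fun j =>
    (hE j).congr' (hcomp (energyL ∘L binProj j)) EventuallyEq.rfl
  have k3 : ∀ j, (fun q => (D q).2.2.1 j) =O[𝓝 (0, u₀)] fun q => ‖q.1‖ ^ 10 := fun j =>
    ((vanishOrder_nf_angle_rate hm hx j).isBigO.congr_left fun q => (sub_zero _).symm).congr'
      (hcomp (angleL ∘L binProj j)) EventuallyEq.rfl
  have k4 : (fun q => (D q).2.2.2.1) =O[𝓝 (0, u₀)] fun q => ‖q.1‖ ^ 10 :=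
    ((vanishOrder_nf_sep_rate hm hx).isBigO.congr_left fun q => (sub_zero _).symm).congr'
      (hcomp (sepL ∘L binProj 0)) EventuallyEq.rfl
  have k5 : (fun q => (D q).2.2.2.2) =O[𝓝 (0, u₀)] fun q => ‖q.1‖ ^ 10 :=
    ((vanishOrder_nf_mom_rate hm hx).isBigO.congr_left fun q => (sub_zero _).symm).congr'
      (hcomp (momL ∘L binProj 0)) EventuallyEq.rfl
  exact (isBigO_pi.2 k1).prod_left ((isBigO_pi.2 k2).prod_left ((isBigO_pi.2 k3).prod_left
    (k4.prod_left k5)))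

end NormalForm

end

end SBC

namespace SBC

noncomputable section

/-! ### Existence of the normal form -/

section Inverse

variable {E B : Type} [NormedAddCommGroup E] [NormedSpace ℝ E] [CompleteSpace E]
  [NormedAddCommGroup B] [NormedSpace ℝ B] [CompleteSpace B] {p₀ : B}

/-- An analytic map that is the identity up to terms of second order in `ζ` is a change of
variables near `(0, p₀)`. -/
theorem exists_openPartialHomeomorph {ψ : E × B → E × B} (hψ : ContDiffAt ℝ ω ψ (0, p₀))
    (h2 : VanishOrder p₀ 2 (fun q => ψ q - q)) :
    ∃ Φ : OpenPartialHomeomorph (E × B) (E × B), (∀ q, Φ q = ψ q) ∧ (0, p₀) ∈ Φ.source ∧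
      ContDiffOn ℝ ∞ Φ Φ.source ∧ ContDiffOn ℝ ∞ Φ.symm Φ.target := by
  have h0 : ψ (0, p₀) = (0, p₀) := by
    obtain ⟨C, hC⟩ := h2.isBigO.bound
    simpa [sub_eq_zero] using hC.self_of_nhds
  have hd : HasFDerivAt ψ ((ContinuousLinearEquiv.refl ℝ (E × B) : (E × B) ≃L[ℝ] (E × B)) :
      E × B →L[ℝ] E × B) (0, p₀) := by
    -- The deviation from the identity is quadratic in the distance to the base point, so the
    -- derivative there is the identity and the inverse function theorem applies.
    have h3 : (fun q => ψ q - q) =O[𝓝 (0, p₀)] fun q => ‖q - (0, p₀)‖ ^ 2 := by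
      refine h2.isBigO.trans (IsBigO.of_bound 1 ?_)
      filter_upwards with q
      rw [one_mul, norm_pow, norm_pow, norm_norm, norm_norm]
      gcongr
      have := norm_fst_le (q - (0, p₀))
      rwa [Prod.fst_sub, sub_zero] at this
    have h4 := (h3.hasFDerivAt (by norm_num)).add (hasFDerivAt_id (𝕜 := ℝ) ((0 : E), p₀))
    refine (h4.congr_of_eventuallyEq ?_).congr_fderiv ?_
    · filter_upwards with q
      simp
    · ext <;> simp
  set Φ₀ := hψ.toOpenPartialHomeomorph ψ hd (by simp) with hΦ₀
  have hc : ∀ q, Φ₀ q = ψ q := fun q => by rw [hΦ₀, ContDiffAt.toOpenPartialHomeomorph_coe]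
  have hp : (0, p₀) ∈ Φ₀.source := hψ.mem_toOpenPartialHomeomorph_source hd (by simp)
  have hpt : (0, p₀) ∈ Φ₀.target := by simpa [hc, h0] using Φ₀.map_source hp
  have hsymm : Φ₀.symm (0, p₀) = (0, p₀) := by
    have := Φ₀.left_inv hp
    rwa [hc, h0] at this
  have h5 : ContDiffAt ℝ ω Φ₀.symm (0, p₀) := by
    refine Φ₀.contDiffAt_symm hpt (f₀' := ContinuousLinearEquiv.refl ℝ (E × B)) ?_ ?_
    · rw [hsymm]; exact hd
    · rw [hsymm]; exact hψ
  -- With exponent `ω`, unlike `∞`, regularity at a point spreads to a neighbourhood. The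
  -- homeomorphism is restricted to where it and its inverse are both regular.
  obtain ⟨A, hA, hAo, hpA⟩ := eventually_nhds_iff.1 (hψ.eventually (by simp))
  obtain ⟨A', hA', hAo', hpA'⟩ := eventually_nhds_iff.1 (h5.eventually (by simp))
  have hopen : IsOpen (A ∩ (Φ₀.source ∩ Φ₀ ⁻¹' A')) := hAo.inter (Φ₀.isOpen_inter_preimage hAo')
  refine ⟨Φ₀.restrOpen _ hopen, hc, ?_, ?_, ?_⟩
  · rw [OpenPartialHomeomorph.restrOpen_source]
    exact ⟨hp, hpA, hp, by rw [Set.mem_preimage, hc, h0]; exact hpA'⟩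
  · intro q hq
    rw [OpenPartialHomeomorph.restrOpen_source] at hq
    exact ((hA q hq.2.1).of_le le_top).contDiffWithinAt
  · intro Q hQ
    have h6 := (Φ₀.restrOpen _ hopen).map_target hQ
    rw [OpenPartialHomeomorph.restrOpen_source] at h6
    have h7 := (Φ₀.restrOpen _ hopen).right_inv hQ
    have h8 : Q ∈ A' := by
      have := h6.2.2.2
      rw [Set.mem_preimage] at this
      rwa [← h7]
    exact ((hA' Q h8).of_le le_top).contDiffWithinAt

end Inverse

/-- The estimates of the rates are in the old coordinates. They carry over because the new `ζ`
differs from the old one by order 7, so the two are comparable in size near the collision. -/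
theorem exists_isNormalForm {m : Fin 4 → ℝ} {u₀ : Base} (hm : ∀ i, 0 < m i) (hx : u₀.sep ≠ 0) :
    ∃ c d, IsLeading m u₀ c d ∧ ∃ (Φ : OpenPartialHomeomorph Phase Phase)
      (R₉ : Base → MvPolynomial (Fin 4) ℝ), IsHomFamily 9 u₀ R₉ ∧ IsNormalForm m u₀ Φ ∧
      (fun Q => transformedField m Φ Q - nfVec m nfR₄ nfR₆ (nfR₈ c d) R₉ Q)
        =O[𝓝 (0, u₀)] fun Q => ‖Q.1‖ ^ 10 := by
  obtain ⟨c, d, h⟩ := exists_isLeading hm hx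
  obtain ⟨R₉, hR, hO⟩ := isBigO_nf_rates hm hx h
  obtain ⟨h7, h2⟩ := vanishOrder_nfCoord_sub hm hx h
  have h0 := nfCoord_base hm hx h
  obtain ⟨Φ, hΦ, hs, hΦ1, hΦ2⟩ := exists_openPartialHomeomorph (contDiffAt_nfCoord hm hx h) h2
  have hΦ' : (Φ : Phase → Phase) = nfCoord m c d := funext hΦ
  have hpt : ((0, u₀) : Phase) ∈ Φ.target := by
    have := Φ.map_source hs
    rwa [hΦ, h0] at this
  have hsymm : Φ.symm (0, u₀) = (0, u₀) := by
    have := Φ.left_inv hs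
    rwa [hΦ, h0] at this
  have ht : Tendsto Φ.symm (𝓝 (0, u₀)) (𝓝 (0, u₀)) := by
    have := Φ.symm.continuousAt hpt
    rwa [ContinuousAt, hsymm] at this
  have hQ : ∀ᶠ Q in 𝓝 ((0, u₀) : Phase), Q ∈ Φ.target := Φ.open_target.mem_nhds hpt
  have h8 : (fun q : Phase => q.1) =O[𝓝 (0, u₀)] fun q => (nfCoord m c d q).1 := by
    have h9 : (fun q : Phase => (nfCoord m c d q).1 - q.1) =o[𝓝 (0, u₀)] fun q => q.1 := by
      refine h7.isBigO.trans_isLittleO (IsLittleO.of_norm_right ?_)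
      have h10 : (fun q : Phase => ‖q.1‖ ^ 6) =o[𝓝 (0, u₀)] fun _ => (1 : ℝ) := by
        rw [isLittleO_one_iff]
        exact Continuous.tendsto' (by fun_prop) _ _ (by simp)
      exact (h10.mul_isBigO (isBigO_refl (fun q : Phase => ‖q.1‖) _)).congr
        (fun q => by ring) (fun q => by ring)
    exact h9.right_isBigO_add.congr_right fun q => by simp
  have h9 : (fun Q => (Φ.symm Q).1) =O[𝓝 (0, u₀)] fun Q => Q.1 := by
    refine (h8.comp_tendsto ht).congr' EventuallyEq.rfl ?_
    filter_upwards [hQ] with Q hQ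
    have := Φ.right_inv hQ
    rw [hΦ] at this
    simp [this]
  have hmain : (fun Q => transformedField m Φ Q - nfVec m nfR₄ nfR₆ (nfR₈ c d) R₉ Q)
        =O[𝓝 (0, u₀)] fun Q => ‖Q.1‖ ^ 10 := by
    refine ((hO.comp_tendsto ht).congr' ?_ EventuallyEq.rfl).trans (h9.norm_norm.pow 10)
    filter_upwards [hQ] with Q hQ
    have := Φ.right_inv hQ
    rw [hΦ] at this
    simp only [Function.comp_apply, transformedField, hΦ', this]
  refine ⟨c, d, h, Φ, R₉, hR, ⟨hs, hΦ1, hΦ2, ?_, nfR₄, nfR₆, nfR₈ c d, R₉, isHomFamily_nfR₄,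
    isHomFamily_nfR₆, isHomFamily_nfR₈ (fun j => (h j).1) (fun j => (h j).2.1), hR, hmain⟩, hmain⟩
  rw [hΦ']
  exact h2.isBigO

end

end SBC

namespace SBC

noncomputable section

/-! ### Existence of the approximate integral -/

/-- The contribution of one binary to `κ`. -/
def kapOne (h I L : ℝ) : ℝ :=
  -- The derivative in `I` is `3ρ - 9hρ² + 30h²ρ³` with `ρ = I² + L²`, a truncation of `3ρ / (1 +
  -- 3hρ - h²ρ² + 2h³ρ³)`; the denominator is the leading rate of `I`.
  I ^ 3 + 3 * I * L ^ 2 - 9 * h * (I ^ 5 / 5 + 2 / 3 * (I ^ 3 * L ^ 2) + I * L ^ 4) +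
    30 * h ^ 2 * (I ^ 7 / 7 + 3 / 5 * (I ^ 5 * L ^ 2) + I ^ 3 * L ^ 4 + I * L ^ 6)

/-- The derivative of `kapOne` with respect to `L`. -/
def kapOneL (h I L : ℝ) : ℝ :=
  6 * (I * L) - 9 * h * (4 / 3 * (I ^ 3 * L) + 4 * (I * L ^ 3)) +
    30 * h ^ 2 * (6 / 5 * (I ^ 5 * L) + 4 * (I ^ 3 * L ^ 3) + 6 * (I * L ^ 5))

/-- The derivative of `kapOne` with respect to `h`. -/
def kapOneH (h I L : ℝ) : ℝ :=
  -9 * (I ^ 5 / 5 + 2 / 3 * (I ^ 3 * L ^ 2) + I * L ^ 4) +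
    60 * h * (I ^ 7 / 7 + 3 / 5 * (I ^ 5 * L ^ 2) + I ^ 3 * L ^ 4 + I * L ^ 6)

theorem hasDerivAt_kapOne {h I L : ℝ → ℝ} {h' I' L' t : ℝ} (hh : HasDerivAt h h' t)
    (hI : HasDerivAt I I' t) (hL : HasDerivAt L L' t) :
    HasDerivAt (fun t => kapOne (h t) (I t) (L t))
      ((3 * (I t ^ 2 + L t ^ 2) - 9 * h t * (I t ^ 2 + L t ^ 2) ^ 2 +
        30 * h t ^ 2 * (I t ^ 2 + L t ^ 2) ^ 3) * I' + kapOneL (h t) (I t) (L t) * L' +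
        kapOneH (h t) (I t) (L t) * h') t := by
  have h1 := ((hI.pow 3).add ((hI.mul (hL.pow 2)).const_mul 3)).sub
    ((hh.mul ((((hI.pow 5).div_const 5).add (((hI.pow 3).mul (hL.pow 2)).const_mul (2 / 3))).add
      (hI.mul (hL.pow 4)))).const_mul 9)
  have h2 := ((hh.pow 2).mul (((((hI.pow 7).div_const 7).add (((hI.pow 5).mul (hL.pow 2)).const_mul
    (3 / 5))).add ((hI.pow 3).mul (hL.pow 4))).add (hI.mul (hL.pow 6)))).const_mul 30
  refine ((h1.add h2).congr_deriv ?_).congr_of_eventuallyEq ?_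
  · simp [kapOneL, kapOneH]
    ring
  · filter_upwards with t
    simp [kapOne]
    ring

open MvPolynomial in
/-- The form `∫ |ζ|⁴ dI`. -/
def quinticPoly (j : Fin 2) : MvPolynomial (Fin 4) ℝ :=
  C (1 / 5) * X (idxRe j) ^ 5 + (C (2 / 3) * (X (idxRe j) ^ 3 * X (idxIm j) ^ 2) +
    X (idxRe j) * X (idxIm j) ^ 4)

open MvPolynomial in
/-- The form `∫ |ζ|⁶ dI`. -/
def septicPoly (j : Fin 2) : MvPolynomial (Fin 4) ℝ :=
  C (1 / 7) * X (idxRe j) ^ 7 + (C (3 / 5) * (X (idxRe j) ^ 5 * X (idxIm j) ^ 2) +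
    (X (idxRe j) ^ 3 * X (idxIm j) ^ 4 + X (idxRe j) * X (idxIm j) ^ 6))

open MvPolynomial in
/-- The terms of degree five of `κ`. -/
def nfG₅ (h : Fin 2 → ℝ) : MvPolynomial (Fin 4) ℝ :=
  C (-9 * h 0) * quinticPoly 0 + C (9 * h 1) * quinticPoly 1

open MvPolynomial in
/-- The terms of degree seven of `κ`. -/
def nfG₇ (h : Fin 2 → ℝ) : MvPolynomial (Fin 4) ℝ :=
  C (30 * h 0 ^ 2) * septicPoly 0 + C (-30 * h 1 ^ 2) * septicPoly 1

theorem isBigO_pow_fst_of_le {E B : Type} [NormedAddCommGroup E] [NormedAddCommGroup B] {p₀ : B}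
    {j k : ℕ} (h : j ≤ k) :
    (fun q : E × B => ‖q.1‖ ^ k) =O[𝓝 (0, p₀)] fun q => ‖q.1‖ ^ j := by
  have hb : (fun q : E × B => ‖q.1‖ ^ (k - j)) =O[𝓝 (0, p₀)] fun _ => (1 : ℝ) :=
    Continuous.tendsto (f := fun q : E × B => ‖q.1‖ ^ (k - j)) (by fun_prop) _ |>.isBigO_one ℝ
  refine (hb.mul (isBigO_refl (fun q : E × B => ‖q.1‖ ^ j) _)).congr (fun q => ?_)
    (fun q => by ring)
  rw [← pow_add, Nat.sub_add_cancel h]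

theorem norm_realCoords_le (ζ : Fin 2 → ℂ) : ‖realCoords ζ‖ ≤ ‖ζ‖ := by
  refine (pi_norm_le_iff_of_nonneg (norm_nonneg _)).2 fun i => ?_
  have h0 := norm_le_pi_norm ζ 0
  have h1 := norm_le_pi_norm ζ 1
  fin_cases i
  · exact (Complex.abs_re_le_norm _).trans h0
  · exact (Complex.abs_im_le_norm _).trans h0
  · exact (Complex.abs_re_le_norm _).trans h1
  · exact (Complex.abs_im_le_norm _).trans h1

theorem IsHomFamily.isBigO_eval {B : Type} [NormedAddCommGroup B] [NormedSpace ℝ B] {u₀ : B} {k : ℕ}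
    {R : B → MvPolynomial (Fin 4) ℝ} (hR : IsHomFamily k u₀ R) :
    (fun q : (Fin 2 → ℂ) × B => (R q.2).eval (realCoords q.1)) =O[𝓝 (0, u₀)] fun q => ‖q.1‖ ^ k := by
  obtain ⟨C, hC⟩ := hR.eval_bound
  have ht : Tendsto (Prod.snd : (Fin 2 → ℂ) × B → B) (𝓝 (0, u₀)) (𝓝 u₀) :=
    continuous_snd.tendsto' _ _ rfl
  refine IsBigO.of_bound |C| ?_
  filter_upwards [ht.eventually hC] with q hq
  refine (hq _).trans ?_
  rw [norm_pow, norm_norm]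
  refine (mul_le_mul_of_nonneg_right (le_abs_self C) (by positivity)).trans ?_
  gcongr
  exact norm_realCoords_le _

section Kappa

variable {P : Type} [NormedAddCommGroup P] [NormedSpace ℝ P] {p₀ : P}

theorem isHomFamily_quinticPoly (j : Fin 2) : IsHomFamily 5 p₀ (fun _ => quinticPoly j) := by
  have hI := IsHomFamily.X (p₀ := p₀) (idxRe j)
  have hL := IsHomFamily.X (p₀ := p₀) (idxIm j)
  have h1 := ((hI.pow 5).smul (c := fun _ => (1 / 5 : ℝ)) contDiffAt_const).cast
    (show 5 * 1 = 5 by norm_num)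
  have h2 := (((hI.pow 3).mul (hL.pow 2)).smul (c := fun _ => (2 / 3 : ℝ)) contDiffAt_const).cast
    (show 3 * 1 + 2 * 1 = 5 by norm_num)
  have h3 := (hI.mul (hL.pow 4)).cast (show 1 + 4 * 1 = 5 by norm_num)
  exact h1.add (h2.add h3)

theorem isHomFamily_septicPoly (j : Fin 2) : IsHomFamily 7 p₀ (fun _ => septicPoly j) := by
  have hI := IsHomFamily.X (p₀ := p₀) (idxRe j)
  have hL := IsHomFamily.X (p₀ := p₀) (idxIm j)
  have h1 := ((hI.pow 7).smul (c := fun _ => (1 / 7 : ℝ)) contDiffAt_const).cast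
    (show 7 * 1 = 7 by norm_num)
  have h2 := (((hI.pow 5).mul (hL.pow 2)).smul (c := fun _ => (3 / 5 : ℝ)) contDiffAt_const).cast
    (show 5 * 1 + 2 * 1 = 7 by norm_num)
  have h3 := ((hI.pow 3).mul (hL.pow 4)).cast (show 3 * 1 + 4 * 1 = 7 by norm_num)
  have h4 := (hI.mul (hL.pow 6)).cast (show 1 + 6 * 1 = 7 by norm_num)
  exact h1.add (h2.add (h3.add h4))

theorem isHomFamily_nfG₅ {h₀ : Fin 2 → ℝ} : IsHomFamily 5 h₀ nfG₅ :=
  ((isHomFamily_quinticPoly 0).smul (by fun_prop)).add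
    ((isHomFamily_quinticPoly 1).smul (by fun_prop))

theorem isHomFamily_nfG₇ {h₀ : Fin 2 → ℝ} : IsHomFamily 7 h₀ nfG₇ :=
  ((isHomFamily_septicPoly 0).smul (by fun_prop)).add
    ((isHomFamily_septicPoly 1).smul (by fun_prop))

theorem kappa_nf (Q : Phase) : kappa nfG₅ nfG₇ Q =
    kapOne (Q.2.1 0) (Q.1 0).re (Q.1 0).im - kapOne (Q.2.1 1) (Q.1 1).re (Q.1 1).im := by
  simp [kappa, kappaLead, nfG₅, nfG₇, quinticPoly, septicPoly, idxRe, idxIm, realCoords, kapOne,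
    Base.energy]
  ring

theorem fderiv_kappa_nf (Q v : Phase) : fderiv ℝ (kappa nfG₅ nfG₇) Q v =
    ((3 * ‖Q.1 0‖ ^ 2 - 9 * Q.2.1 0 * (‖Q.1 0‖ ^ 2) ^ 2 +
        30 * Q.2.1 0 ^ 2 * (‖Q.1 0‖ ^ 2) ^ 3) * (v.1 0).re +
      kapOneL (Q.2.1 0) (Q.1 0).re (Q.1 0).im * (v.1 0).im +
      kapOneH (Q.2.1 0) (Q.1 0).re (Q.1 0).im * v.2.1 0) -
    ((3 * ‖Q.1 1‖ ^ 2 - 9 * Q.2.1 1 * (‖Q.1 1‖ ^ 2) ^ 2 +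
        30 * Q.2.1 1 ^ 2 * (‖Q.1 1‖ ^ 2) ^ 3) * (v.1 1).re +
      kapOneL (Q.2.1 1) (Q.1 1).re (Q.1 1).im * (v.1 1).im +
      kapOneH (Q.2.1 1) (Q.1 1).re (Q.1 1).im * v.2.1 1) := by
  have e : kappa nfG₅ nfG₇ = fun Q : Phase =>
    kapOne (Q.2.1 0) (Q.1 0).re (Q.1 0).im - kapOne (Q.2.1 1) (Q.1 1).re (Q.1 1).im :=
    funext kappa_nf
  have hd : DifferentiableAt ℝ (kappa nfG₅ nfG₇) Q := by
    have h1 : ∀ j, Differentiable ℝ (fun Q : Phase => (Q.1 j).re) := fun j =>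
      (Complex.reCLM ∘L ContinuousLinearMap.fst ℝ ℂ BinBase ∘L binProj j).differentiable
    have h2 : ∀ j, Differentiable ℝ (fun Q : Phase => (Q.1 j).im) := fun j =>
      (Complex.imCLM ∘L ContinuousLinearMap.fst ℝ ℂ BinBase ∘L binProj j).differentiable
    rw [e]
    simp only [kapOne]
    fun_prop
  rw [← hd.lineDeriv_eq_fderiv, lineDeriv, e]
  have hl : ∀ a b : ℝ, HasDerivAt (fun t : ℝ => a + t * b) b 0 := fun a b => by
    simpa using ((hasDerivAt_id (0 : ℝ)).mul_const b).const_add a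
  have h1 := fun j => hasDerivAt_kapOne (hl (Q.2.1 j) (v.2.1 j)) (hl (Q.1 j).re (v.1 j).re)
    (hl (Q.1 j).im (v.1 j).im)
  have h2 := ((h1 0).sub (h1 1)).deriv
  simp only [zero_mul, add_zero, ← norm_sq_eq] at h2
  rw [← h2]
  congr 1
  funext t
  simp

end Kappa

section Existence

variable {u₀ : Base} {m : Fin 4 → ℝ} {c : Fin 2 → BinBase → ℂ} {d : Fin 2 → BinBase → ℝ}

/-- The vector field of the normal form preserves `κ` up to terms of order twelve. -/
theorem vanishOrder_kappa_nfVec (h : IsLeading m u₀ c d) :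
    VanishOrder u₀ 12 (fun Q : Phase =>
      (3 * ‖Q.1 0‖ ^ 2 - 9 * Q.2.1 0 * (‖Q.1 0‖ ^ 2) ^ 2 +
        30 * Q.2.1 0 ^ 2 * (‖Q.1 0‖ ^ 2) ^ 3) * (‖Q.1 1‖ ^ 2 +
          (nfR₄ 0 Q.2.energy).eval (realCoords Q.1) + (nfR₆ 0 Q.2.energy).eval (realCoords Q.1) +
          (nfR₈ c d 0 Q.2).eval (realCoords Q.1)) -
      (3 * ‖Q.1 1‖ ^ 2 - 9 * Q.2.1 1 * (‖Q.1 1‖ ^ 2) ^ 2 +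
        30 * Q.2.1 1 ^ 2 * (‖Q.1 1‖ ^ 2) ^ 3) * (‖Q.1 0‖ ^ 2 +
          (nfR₄ 1 Q.2.energy).eval (realCoords Q.1) + (nfR₆ 1 Q.2.energy).eval (realCoords Q.1) +
          (nfR₈ c d 1 Q.2).eval (realCoords Q.1))) := by
  have hρ : ∀ j, VanishOrder u₀ 2 (fun q : Phase => ‖q.1 j‖ ^ 2) := vanishOrder_phase_norm_sq
  have hh : ∀ j, VanishOrder u₀ 0 (fun q : Phase => q.2.1 j) := fun j => .smooth (by fun_prop)
  have h8 := vanishOrder_nfR₈ (fun j => (h j).1) (fun j => (h j).2.1)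
  have hB : ∀ j, VanishOrder u₀ 4 (fun q : Phase => -9 * (q.2.1 j * (‖q.1 j‖ ^ 2) ^ 2) +
      30 * (q.2.1 j ^ 2 * (‖q.1 j‖ ^ 2) ^ 3)) := fun j =>
    ((((hh j).mul' ((hρ j).pow 2)).const_mul (-9)).mono (by norm_num)).add
      (((((hh j).pow 2).mul' ((hρ j).pow 3)).const_mul 30).mono (by norm_num))
  -- What survives has order 12: the higher terms of `∂κ/∂I` times the terms of degree 8 (`t1`), and
  -- the product of the coefficients of degree 6 (`t2`).
  have t1 : ∀ j, VanishOrder u₀ 12 _ := fun j => (hB j).mul' (h8 j)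
  have t2 : ∀ j, VanishOrder u₀ 12 _ := fun j => ((((hh j).pow 4).mul' (((hρ j).pow 5).mul'
    (hρ j.rev))).const_mul 30).mono (show 12 ≤ 4 * 0 + (5 * 2 + 2) by norm_num)
  refine (((t1 0).sub (t1 1)).sub ((t2 0).sub (t2 1))).congr ?_
  filter_upwards with Q
  simp only [eval_nfR₄, eval_nfR₆, eval_nfR₈]
  have e3 : (Fin.rev 0 : Fin 2) = 1 := rfl
  have e4 : (Fin.rev 1 : Fin 2) = 0 := rfl
  have k := fun j => binForm_deriv_corrRe (c j) (d j) (binProj j Q)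
  have e5 : ∀ j, (binProj j Q).1 = Q.1 j := fun j => rfl
  have e6 : ∀ j, (binProj j Q).2.1 = Q.2.1 j := fun j => rfl
  simp only [e5, e6] at k
  rw [e3, e4]
  -- Degrees 4, 6 and 8 cancel by the coefficients 9 and 30. Degree 10 is the equation for `F`, used
  -- once for each binary; there `35 = 2 + 3 + 30` collects the products of the series coefficients.
  linear_combination (3 * ‖Q.1 0‖ ^ 2) * k 1 - 3 * ‖Q.1 1‖ ^ 2 * k 0

/-- The error of the normal form has order 10 and meets derivatives of `κ` in `I` and `L` of order
2. The energy rates have order 9 and meet a derivative in `h` of order 5. Both products exceed order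
11. -/
theorem exists_isApproxIntegral (hm : ∀ i, 0 < m i) (hx : u₀.sep ≠ 0) :
    ∃ (Φ : OpenPartialHomeomorph Phase Phase) (G₅ G₇ : (Fin 2 → ℝ) → MvPolynomial (Fin 4) ℝ),
      IsNormalForm m u₀ Φ ∧ IsApproxIntegral m u₀ Φ G₅ G₇ := by
  obtain ⟨c, d, h, Φ, R₉, hR, hΦ, hO⟩ := exists_isNormalForm hm hx
  refine ⟨Φ, nfG₅, nfG₇, hΦ, isHomFamily_nfG₅, isHomFamily_nfG₇, ?_⟩
  set D := fun Q => transformedField m Φ Q - nfVec m nfR₄ nfR₆ (nfR₈ c d) R₉ Q with hD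
  have hD1 : ∀ j, (fun Q => (D Q).1 j) =O[𝓝 (0, u₀)] fun Q => ‖Q.1‖ ^ 10 := fun j =>
    ((ContinuousLinearMap.fst ℝ ℂ BinBase ∘L binProj j).isBigO_comp _ _).trans hO
  have hre : ∀ j, (fun Q => ((D Q).1 j).re) =O[𝓝 (0, u₀)] fun Q => ‖Q.1‖ ^ 10 := fun j =>
    (Complex.reCLM.isBigO_comp _ _).trans (hD1 j)
  have him : ∀ j, (fun Q => ((D Q).1 j).im) =O[𝓝 (0, u₀)] fun Q => ‖Q.1‖ ^ 10 := fun j =>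
    (Complex.imCLM.isBigO_comp _ _).trans (hD1 j)
  have hV : ∀ j, (fun Q => (transformedField m Φ Q).2.1 j) =O[𝓝 (0, u₀)] fun Q => ‖Q.1‖ ^ 9 :=
    fun j => by
    have h1 : (fun Q => (D Q).2.1 j) =O[𝓝 (0, u₀)] fun Q => ‖Q.1‖ ^ 9 :=
      (((energyL ∘L binProj j).isBigO_comp _ _).trans hO).trans (isBigO_pow_fst_of_le (by norm_num))
    refine (h1.add (hR.isBigO_eval.const_mul_left
      (if j = 0 then (aRoot m 0)⁻¹ else -(aRoot m 1)⁻¹))).congr_left fun Q => ?_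
    fin_cases j
    · simp [hD, nfVec]
      ring
    · simp [hD, nfVec]
      ring
  have hρ : ∀ j, VanishOrder u₀ 2 (fun q : Phase => ‖q.1 j‖ ^ 2) := vanishOrder_phase_norm_sq
  have hh : ∀ j, VanishOrder u₀ 0 (fun q : Phase => q.2.1 j) := fun j => .smooth (by fun_prop)
  have hA : ∀ j, VanishOrder u₀ 2 (fun Q : Phase => 3 * ‖Q.1 j‖ ^ 2 -
      9 * (Q.2.1 j * (‖Q.1 j‖ ^ 2) ^ 2) + 30 * (Q.2.1 j ^ 2 * (‖Q.1 j‖ ^ 2) ^ 3)) := fun j =>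
    (((hρ j).const_mul 3).sub ((((hh j).mul' ((hρ j).pow 2)).const_mul 9).mono (by norm_num))).add
      (((((hh j).pow 2).mul' ((hρ j).pow 3)).const_mul 30).mono (by norm_num))
  have hI := fun j => (vanishOrder_proj (p₀ := u₀) j).clm Complex.reCLM
  have hL := fun j => (vanishOrder_proj (p₀ := u₀) j).clm Complex.imCLM
  have hp : ∀ j (a b k : ℕ), k ≤ a + b → VanishOrder u₀ k (fun Q : Phase =>
      (Q.1 j).re ^ a * (Q.1 j).im ^ b) := fun j a b k hk =>
    (((hI j).pow a).mul' ((hL j).pow b)).mono (by omega)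
  have hKL : ∀ j, VanishOrder u₀ 2 (fun Q : Phase => kapOneL (Q.2.1 j) (Q.1 j).re (Q.1 j).im) :=
    fun j => by
    have t1 := (hp j 1 1 2 (by norm_num)).const_mul 6
    have t2 := ((hh j).mul' (((hp j 3 1 2 (by norm_num)).const_mul (4 / 3)).add
      ((hp j 1 3 2 (by norm_num)).const_mul 4))).const_mul 9
    have t3 := (((hh j).pow 2).mul' ((((hp j 5 1 2 (by norm_num)).const_mul (6 / 5)).add
      ((hp j 3 3 2 (by norm_num)).const_mul 4)).add ((hp j 1 5 2 (by norm_num)).const_mul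
        6))).const_mul 30
    refine ((t1.sub (t2.mono (by norm_num))).add (t3.mono (by norm_num))).congr ?_
    filter_upwards with Q
    rw [kapOneL]
    ring
  have hKH : ∀ j, VanishOrder u₀ 5 (fun Q : Phase => kapOneH (Q.2.1 j) (Q.1 j).re (Q.1 j).im) :=
    fun j => by
    have t1 := ((((hp j 5 0 5 (by norm_num)).const_mul (1 / 5)).add
      ((hp j 3 2 5 (by norm_num)).const_mul (2 / 3))).add (hp j 1 4 5 (by norm_num))).const_mul (-9)
    have t2 := ((hh j).mul' (((((hp j 7 0 5 (by norm_num)).const_mul (1 / 7)).add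
      ((hp j 5 2 5 (by norm_num)).const_mul (3 / 5))).add (hp j 3 4 5 (by norm_num))).add
      (hp j 1 6 5 (by norm_num)))).const_mul 60
    refine (t1.add (t2.mono (by norm_num))).congr ?_
    filter_upwards with Q
    rw [kapOneH]
    ring
  have hle : ∀ {f g : Phase → ℝ} {a b : ℕ}, VanishOrder u₀ a f →
      g =O[𝓝 (0, u₀)] (fun Q => ‖Q.1‖ ^ b) → 11 ≤ a + b →
      (fun Q => f Q * g Q) =O[𝓝 (0, u₀)] fun Q => ‖Q.1‖ ^ 11 := fun hf hg hab =>
    ((hf.isBigO.mul hg).congr_right fun Q => (pow_add _ _ _).symm).trans (isBigO_pow_fst_of_le hab)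
  have s1 := fun j => hle (hA j) (hre j) (by norm_num)
  have s2 := fun j => hle (hKL j) (him j) (by norm_num)
  have s3 := fun j => hle (hKH j) (hV j) (by norm_num)
  have s0 := ((vanishOrder_kappa_nfVec h).mono (show 11 ≤ 12 by norm_num)).isBigO
  refine (s0.add ((((s1 0).add (s2 0)).add (s3 0)).sub (((s1 1).add (s2 1)).add
    (s3 1)))).congr_left fun Q => ?_
  have e1 : ∀ j, ((transformedField m Φ Q).1 j).re = ((D Q).1 j).re +
      (‖Q.1 j.rev‖ ^ 2 + (nfR₄ j Q.2.energy).eval (realCoords Q.1) +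
      (nfR₆ j Q.2.energy).eval (realCoords Q.1) + (nfR₈ c d j Q.2).eval (realCoords Q.1)) :=
    fun j => by
    have : (nfVec m nfR₄ nfR₆ (nfR₈ c d) R₉ Q).1 j = ((‖Q.1 j.rev‖ ^ 2 +
      (nfR₄ j Q.2.energy).eval (realCoords Q.1) + (nfR₆ j Q.2.energy).eval (realCoords Q.1) +
      (nfR₈ c d j Q.2).eval (realCoords Q.1) : ℝ) : ℂ) := rfl
    simp only [hD, Prod.fst_sub, Pi.sub_apply, this, Complex.sub_re, Complex.ofReal_re]
    ring
  have e2 : ∀ j, ((transformedField m Φ Q).1 j).im = ((D Q).1 j).im := fun j => by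
    have : ((nfVec m nfR₄ nfR₆ (nfR₈ c d) R₉ Q).1 j).im = 0 := Complex.ofReal_im _
    simp only [hD, Prod.fst_sub, Pi.sub_apply, this, Complex.sub_im, sub_zero]
  have e3 : (Fin.rev 0 : Fin 2) = 1 := rfl
  have e4 : (Fin.rev 1 : Fin 2) = 0 := rfl
  rw [fderiv_kappa_nf, e1, e1, e2, e2, e3, e4]
  ring

end Existence

end

end SBC

/-! ### Uniform estimates on a polydisc -/

namespace SBC
noncomputable section

/-- On the unit ball each monomial is Lipschitz by compactness. Homogeneity with the scale `‖v‖ +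
‖w‖` extends the bound to all vectors. -/
theorem IsHomFamily.eval_lipschitz {P : Type} [NormedAddCommGroup P] [NormedSpace ℝ P] {p₀ : P}
    {k : ℕ} {R : P → MvPolynomial (Fin 4) ℝ} (hR : IsHomFamily (k + 1) p₀ R) :
    ∃ C, ∀ᶠ p in 𝓝 p₀, ∀ v w : Fin 4 → ℝ,
      |(R p).eval v - (R p).eval w| ≤ C * (‖v‖ + ‖w‖) ^ k * ‖v - w‖ := by
  have hm : ∀ d : Fin 4 →₀ ℕ, ∃ K : NNReal, LipschitzOnWith K
      (fun v : Fin 4 → ℝ => ∏ i, v i ^ d i) (Metric.closedBall 0 1) := fun d =>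
    LocallyLipschitzOn.exists_lipschitzOnWith_of_compact (isCompact_closedBall _ _)
      (ContDiff.locallyLipschitz (𝕂 := ℝ) (by fun_prop)).locallyLipschitzOn
  choose K hK using hm
  set S := (Finset.univ : Finset (Fin 4)).finsuppAntidiag (k + 1)
  set C := ∑ d ∈ S, (|(R p₀).coeff d| + 1) * (K d : ℝ)
  have h : ∀ᶠ p in 𝓝 p₀, ∀ d ∈ S, |(R p).coeff d| < |(R p₀).coeff d| + 1 := by
    rw [Filter.eventually_all_finset]
    intro d _
    exact (hR.2 d).continuousAt.abs.eventually_lt continuousAt_const (by simp)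
  refine ⟨C, ?_⟩
  filter_upwards [h] with p hp
  have hball : ∀ v w : Fin 4 → ℝ, ‖v‖ ≤ 1 → ‖w‖ ≤ 1 →
      |(R p).eval v - (R p).eval w| ≤ C * ‖v - w‖ := fun v w hv hw => by
    rw [hR.eval_eq, hR.eval_eq, ← Finset.sum_sub_distrib, Finset.sum_mul]
    refine (Finset.abs_sum_le_sum_abs _ _).trans (Finset.sum_le_sum fun d hd => ?_)
    rw [← mul_sub, abs_mul, mul_assoc]
    have := (hK d).dist_le_mul v (by simpa using hv) w (by simpa using hw)
    rw [Real.dist_eq, dist_eq_norm] at this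
    exact mul_le_mul (hp d hd).le this (abs_nonneg _) (by positivity)
  intro v w
  rcases eq_or_lt_of_le (add_nonneg (norm_nonneg v) (norm_nonneg w)) with h0 | h0
  · have hv : v = 0 := norm_eq_zero.1 (by linarith [norm_nonneg v, norm_nonneg w])
    have hw : w = 0 := norm_eq_zero.1 (by linarith [norm_nonneg v, norm_nonneg w])
    simp [hv, hw]
  · set s := ‖v‖ + ‖w‖
    have e : ∀ x : Fin 4 → ℝ, (fun i => s * (s⁻¹ • x) i) = x := fun x => by
      funext i
      simp [h0.ne']
    have hn : ∀ x : Fin 4 → ℝ, ‖x‖ ≤ s → ‖s⁻¹ • x‖ ≤ 1 := fun x hx => by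
      rw [norm_smul, Real.norm_of_nonneg (by positivity), inv_mul_le_one₀ h0]
      exact hx
    have h1 := hball (s⁻¹ • v) (s⁻¹ • w) (hn v (by simp [s])) (hn w (by simp [s]))
    rw [← smul_sub, norm_smul, Real.norm_of_nonneg (inv_nonneg.2 h0.le)] at h1
    rw [← e v, ← e w, hR.eval_smul, hR.eval_smul, e v, e w, ← mul_sub, abs_mul,
      abs_of_pos (pow_pos h0 _)]
    refine (mul_le_mul_of_nonneg_left h1 (by positivity)).trans (le_of_eq ?_)
    field_simp
    ring

/-- Quantitative consequences of the normal form and of the approximate integral, on a polydisc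
around the simultaneous binary collision. -/
structure FieldBounds (V : Phase → Phase) (G₅ G₇ : (Fin 2 → ℝ) → MvPolynomial (Fin 4) ℝ) (u₀ : Base)
    (r₀ η C : ℝ) : Prop where
  r_pos : 0 < r₀
  eta_pos : 0 < η
  C_pos : 0 < C
  smooth : ∀ Q : Phase, ‖Q.1‖ < r₀ → ‖Q.2 - u₀‖ < η → ContDiffAt ℝ 1 V Q
  re : ∀ Q : Phase, ‖Q.1‖ < r₀ → ‖Q.2 - u₀‖ < η → ∀ j,
    |((V Q).1 j).re - ‖Q.1 j.rev‖ ^ 2| ≤ C * ‖Q.1‖ ^ 4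
  im : ∀ Q : Phase, ‖Q.1‖ < r₀ → ‖Q.2 - u₀‖ < η → ∀ j, |((V Q).1 j).im| ≤ C * ‖Q.1‖ ^ 10
  base : ∀ Q : Phase, ‖Q.1‖ < r₀ → ‖Q.2 - u₀‖ < η → ‖(V Q).2‖ ≤ C * ‖Q.1‖ ^ 9
  kappa_diff : ∀ Q : Phase, ‖Q.1‖ < r₀ → ‖Q.2 - u₀‖ < η → DifferentiableAt ℝ (kappa G₅ G₇) Q
  kappa_deriv : ∀ Q : Phase, ‖Q.1‖ < r₀ → ‖Q.2 - u₀‖ < η →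
    |fderiv ℝ (kappa G₅ G₇) Q (V Q)| ≤ C * ‖Q.1‖ ^ 11
  lip₅ : ∀ u : Base, ‖u - u₀‖ < η → ∀ v w : Fin 4 → ℝ,
    |(G₅ u.energy).eval v - (G₅ u.energy).eval w| ≤ C * (‖v‖ + ‖w‖) ^ 4 * ‖v - w‖
  lip₇ : ∀ u : Base, ‖u - u₀‖ < η → ∀ v w : Fin 4 → ℝ,
    |(G₇ u.energy).eval v - (G₇ u.energy).eval w| ≤ C * (‖v‖ + ‖w‖) ^ 6 * ‖v - w‖
  smul₅ : ∀ h c v, (G₅ h).eval (fun i => c * v i) = c ^ 5 * (G₅ h).eval v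
  smul₇ : ∀ h c v, (G₇ h).eval (fun i => c * v i) = c ^ 7 * (G₇ h).eval v

theorem exists_bound_eventually {F : Type} [NormedAddCommGroup F] {X : Type} {l : Filter X}
    {f : X → F} {g : X → ℝ} (hg : ∀ x, 0 ≤ g x) (h : f =O[l] g) :
    ∃ C, ∀ D, C ≤ D → ∀ᶠ x in l, ‖f x‖ ≤ D * g x := by
  obtain ⟨C, hC⟩ := h.bound
  refine ⟨C, fun D hD => ?_⟩
  filter_upwards [hC] with x hx
  rw [Real.norm_of_nonneg (hg x)] at hx
  exact hx.trans (mul_le_mul_of_nonneg_right hD (hg x))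

variable {m : Fin 4 → ℝ} {u₀ : Base} {Φ : OpenPartialHomeomorph Phase Phase}
  {G₅ G₇ : (Fin 2 → ℝ) → MvPolynomial (Fin 4) ℝ}

theorem IsNormalForm.map_eq (h : IsNormalForm m u₀ Φ) : Φ (0, u₀) = (0, u₀) := by
  obtain ⟨C, hC⟩ := h.2.2.2.1.bound
  have := hC.self_of_nhds
  simp only [norm_zero, ne_eq, OfNat.ofNat_ne_zero, not_false_eq_true, zero_pow, mul_zero,
    norm_le_zero_iff] at this
  exact sub_eq_zero.1 this

theorem IsNormalForm.mem_target (h : IsNormalForm m u₀ Φ) : ((0, u₀) : Phase) ∈ Φ.target := by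
  have := Φ.map_source h.1
  rwa [h.map_eq] at this

theorem IsNormalForm.contDiffAt_transformedField (hm : ∀ i, 0 < m i) (hx : u₀.sep ≠ 0)
    (h : IsNormalForm m u₀ Φ) : ContDiffAt ℝ ∞ (transformedField m Φ) (0, u₀) := by
  have ht := h.mem_target
  have hs : Φ.symm (0, u₀) = (0, u₀) := by
    have := Φ.left_inv h.1
    rwa [h.map_eq] at this
  have h1 : ContDiffAt ℝ ∞ Φ.symm (0, u₀) := h.2.2.1.contDiffAt (Φ.open_target.mem_nhds ht)
  have h2 : ContDiffAt ℝ ∞ (fderiv ℝ Φ) (0, u₀) :=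
    (h.2.1.contDiffAt (Φ.open_source.mem_nhds h.1)).fderiv_right (by norm_cast)
  have h3 : ContDiffAt ℝ ∞ (field m) (0, u₀) := (contDiffAt_field hm hx).of_le le_top
  refine ContDiffAt.clm_apply (ContDiffAt.comp _ (g := fderiv ℝ Φ) ?_ h1)
    (ContDiffAt.comp _ (g := field m) ?_ h1)
  · rwa [hs]
  · rwa [hs]

theorem contDiffAt_kappa (h5 : IsHomFamily 5 u₀.energy G₅) (h7 : IsHomFamily 7 u₀.energy G₇) :
    ContDiffAt ℝ ∞ (kappa G₅ G₇) (0, u₀) := by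
  have hr : ContDiffAt ℝ ∞ (fun Q : Phase => realCoords Q.1) (0, u₀) :=
    (contDiff_realCoords.comp contDiff_fst).contDiffAt
  have hE : ContDiffAt ℝ ∞ (fun Q : Phase => Q.2.energy) (0, u₀) := by unfold Base.energy; fun_prop
  have hG : ∀ {k : ℕ} {G : (Fin 2 → ℝ) → MvPolynomial (Fin 4) ℝ}, IsHomFamily k u₀.energy G →
      ContDiffAt ℝ ∞ (fun Q : Phase => (G Q.2.energy).eval (realCoords Q.1)) (0, u₀) :=
    fun {k G} h => by
      have hg := h.contDiffAt_eval (realCoords 0)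
      generalize hgg : (fun q : (Fin 2 → ℝ) × (Fin 4 → ℝ) => (G q.1).eval q.2) = g at hg
      exact (ContDiffAt.comp (f := fun Q : Phase => (Q.2.energy, realCoords Q.1))
        ((0, u₀) : Phase) hg (hE.prodMk hr)).congr_of_eventuallyEq
          (.of_forall fun Q => by rw [← hgg, Function.comp_apply])
  have hL : ContDiff ℝ ∞ kappaLead := by unfold kappaLead; fun_prop
  exact ((hL.contDiffAt.comp _ hr).add (hG h5)).add (hG h7)

/-- For an arbitrary normal form and integral, finitely many estimates valid near one point become
inequalities with a common constant on a common polydisc. Nothing else about the pair is used for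
the transition. -/
theorem exists_fieldBounds (hm : ∀ i, 0 < m i) (hx : u₀.sep ≠ 0) (h : IsNormalForm m u₀ Φ)
    (hG : IsApproxIntegral m u₀ Φ G₅ G₇) :
    ∃ r₀ η C, FieldBounds (transformedField m Φ) G₅ G₇ u₀ r₀ η C ∧
      ∀ Q : Phase, ‖Q.1‖ < r₀ → ‖Q.2 - u₀‖ < η → Q ∈ Φ.target := by
  obtain ⟨h5, h7, hκ⟩ := hG
  have hV := h.contDiffAt_transformedField hm hx
  have htar : ∀ᶠ Q : Phase in 𝓝 (0, u₀), Q ∈ Φ.target := Φ.open_target.mem_nhds h.mem_target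
  obtain ⟨-, -, -, -, R₄, R₆, R₈, R₉, k4, k6, k8, k9, hO⟩ := h
  set V := transformedField m Φ
  have hE : ContDiffAt ℝ ∞ (fun u : Base => u.energy) u₀ := by unfold Base.energy; fun_prop
  have hre : ∀ j, (fun Q : Phase => ((V Q).1 j).re - ‖Q.1 j.rev‖ ^ 2)
      =O[𝓝 (0, u₀)] fun Q => ‖Q.1‖ ^ 4 := fun j => by
    have h1 := (((Complex.reCLM ∘L ContinuousLinearMap.proj j ∘L
      ContinuousLinearMap.fst ℝ (Fin 2 → ℂ) Base).isBigO_comp _ _).trans hO).trans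
      (isBigO_pow_fst_of_le (show 4 ≤ 10 by norm_num))
    have h2 := ((k4 j).comp hE rfl).isBigO_eval
    have h3 := ((k6 j).comp hE rfl).isBigO_eval.trans (isBigO_pow_fst_of_le (show 4 ≤ 6 by norm_num))
    have h4 := (k8 j).isBigO_eval.trans (isBigO_pow_fst_of_le (show 4 ≤ 8 by norm_num))
    refine (((h1.add h2).add h3).add h4).congr_left fun Q => ?_
    simp only [ContinuousLinearMap.comp_apply, ContinuousLinearMap.coe_fst',
      ContinuousLinearMap.proj_apply, Complex.reCLM_apply, Prod.fst_sub, Pi.sub_apply,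
      Complex.sub_re, Complex.ofReal_re]
    ring
  have him : ∀ j, (fun Q : Phase => ((V Q).1 j).im) =O[𝓝 (0, u₀)] fun Q => ‖Q.1‖ ^ 10 := fun j => by
    refine (((Complex.imCLM ∘L ContinuousLinearMap.proj j ∘L
      ContinuousLinearMap.fst ℝ (Fin 2 → ℂ) Base).isBigO_comp _ _).trans hO).congr_left fun Q => ?_
    simp only [ContinuousLinearMap.comp_apply, ContinuousLinearMap.coe_fst',
      ContinuousLinearMap.proj_apply, Complex.imCLM_apply, Prod.fst_sub, Pi.sub_apply,
      Complex.sub_im, Complex.ofReal_im, sub_zero]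
  have hbase : (fun Q : Phase => (V Q).2) =O[𝓝 (0, u₀)] fun Q => ‖Q.1‖ ^ 9 := by
    have h1 := (((ContinuousLinearMap.snd ℝ (Fin 2 → ℂ) Base).isBigO_comp _ _).trans hO).trans
      (isBigO_pow_fst_of_le (show 9 ≤ 10 by norm_num))
    have h2 : (fun Q : Phase => (![(R₉ Q.2).eval (realCoords Q.1) / aRoot m 0,
        -((R₉ Q.2).eval (realCoords Q.1) / aRoot m 1)] : Fin 2 → ℝ))
        =O[𝓝 (0, u₀)] fun Q => ‖Q.1‖ ^ 9 := by
      refine isBigO_pi.2 fun i => ?_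
      fin_cases i
      · refine (k9.isBigO_eval.const_mul_left (aRoot m 0)⁻¹).congr_left fun Q => ?_
        simp; ring
      · refine (k9.isBigO_eval.const_mul_left (-(aRoot m 1)⁻¹)).congr_left fun Q => ?_
        simp; ring
    have h3 := (h2.prod_left (isBigO_zero (E' := (Fin 2 → ℝ) × ℂ × ℂ) _ _))
    refine (h1.add h3).congr_left fun Q => ?_
    simp only [ContinuousLinearMap.coe_snd', Prod.snd_sub]
    exact sub_add_cancel _ _
  have hkd : ∀ᶠ Q in 𝓝 ((0, u₀) : Phase), DifferentiableAt ℝ (kappa G₅ G₇) Q := by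
    have := contDiffAt_kappa h5 h7
    exact (this.of_le (m := 1) (by norm_cast)).eventually (by simp) |>.mono
      fun Q hQ => hQ.differentiableAt (by simp)
  have hVs : ∀ᶠ Q in 𝓝 ((0, u₀) : Phase), ContDiffAt ℝ 1 V Q :=
    (hV.of_le (m := 1) (by norm_cast)).eventually (by simp)
  have hn : ∀ (k : ℕ) (Q : Phase), 0 ≤ ‖Q.1‖ ^ k := fun k Q => by positivity
  choose c1 hc1 using fun j => exists_bound_eventually (hn 4) (hre j)
  choose c2 hc2 using fun j => exists_bound_eventually (hn 10) (him j)
  obtain ⟨c3, hc3⟩ := exists_bound_eventually (hn 9) hbase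
  obtain ⟨c4, hc4⟩ := exists_bound_eventually (hn 11) hκ
  obtain ⟨c5, hc5⟩ := h5.eval_lipschitz
  obtain ⟨c7, hc7⟩ := h7.eval_lipschitz
  set C := |c1 0| + |c1 1| + |c2 0| + |c2 1| + |c3| + |c4| + |c5| + |c7| + 1
  have hb1 : ∀ j, c1 j ≤ C := fun j => by
    refine (le_abs_self _).trans ?_
    fin_cases j <;> simp only [C] <;> simp <;> linarith [abs_nonneg (c1 0), abs_nonneg (c1 1),
      abs_nonneg (c2 0), abs_nonneg (c2 1), abs_nonneg c3, abs_nonneg c4, abs_nonneg c5, abs_nonneg c7]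
  have hb2 : ∀ j, c2 j ≤ C := fun j => by
    refine (le_abs_self _).trans ?_
    fin_cases j <;> simp only [C] <;> simp <;> linarith [abs_nonneg (c1 0), abs_nonneg (c1 1),
      abs_nonneg (c2 0), abs_nonneg (c2 1), abs_nonneg c3, abs_nonneg c4, abs_nonneg c5, abs_nonneg c7]
  have hb : c3 ≤ C ∧ c4 ≤ C ∧ c5 ≤ C ∧ c7 ≤ C := by
    refine ⟨?_, ?_, ?_, ?_⟩ <;> refine (le_abs_self _).trans ?_ <;> simp only [C] <;>
    linarith [abs_nonneg (c1 0), abs_nonneg (c1 1),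
      abs_nonneg (c2 0), abs_nonneg (c2 1), abs_nonneg c3, abs_nonneg c4, abs_nonneg c5, abs_nonneg c7]
  have tE : Tendsto (fun Q : Phase => Q.2.energy) (𝓝 (0, u₀)) (𝓝 u₀.energy) :=
    Continuous.tendsto' (by unfold Base.energy; fun_prop) _ _ rfl
  have hall := htar.and (hVs.and ((eventually_all.2 fun j => hc1 j C (hb1 j)).and
    ((eventually_all.2 fun j => hc2 j C (hb2 j)).and ((hc3 C hb.1).and ((hc4 C hb.2.1).and
    (hkd.and ((tE.eventually hc5).and (tE.eventually hc7))))))))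
  obtain ⟨ε, hε, hball⟩ := Metric.eventually_nhds_iff.1 hall
  have key : ∀ Q : Phase, ‖Q.1‖ < ε → ‖Q.2 - u₀‖ < ε → dist Q (0, u₀) < ε := fun Q h1 h2 => by
    rw [Prod.dist_eq, max_lt_iff, dist_zero_right, dist_eq_norm]
    exact ⟨h1, h2⟩
  refine ⟨ε, ε, C, ⟨hε, hε, by positivity, fun Q h1 h2 => (hball (key Q h1 h2)).2.1,
    fun Q h1 h2 => (hball (key Q h1 h2)).2.2.1, fun Q h1 h2 => (hball (key Q h1 h2)).2.2.2.1,
    fun Q h1 h2 => (hball (key Q h1 h2)).2.2.2.2.1,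
    fun Q h1 h2 => (hball (key Q h1 h2)).2.2.2.2.2.2.1,
    fun Q h1 h2 => (hball (key Q h1 h2)).2.2.2.2.2.1, fun u hu v w => ?_, fun u hu v w => ?_,
    h5.eval_smul, h7.eval_smul⟩, fun Q h1 h2 => (hball (key Q h1 h2)).1⟩
  · refine ((hball (key (0, u) (by simpa using hε) hu)).2.2.2.2.2.2.2.1 v w).trans ?_
    have := hb.2.2.1
    gcongr
  · refine ((hball (key (0, u) (by simpa using hε) hu)).2.2.2.2.2.2.2.2 v w).trans ?_
    have := hb.2.2.2
    gcongr

end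
end SBC

namespace SBC
noncomputable section

/-! ### Existence and uniqueness of orbits -/

section ODE

variable {E : Type} [NormedAddCommGroup E] [NormedSpace ℝ E]

theorem exists_cutoff [FiniteDimensional ℝ E] {K : Set E} (hK : IsCompact K) {F : E → E}
    (hF : ∀ x ∈ K, ContDiffAt ℝ 1 F x) :
    ∃ G : E → E, ContDiff ℝ 1 G ∧ HasCompactSupport G ∧ ∀ x ∈ K, G x = F x := by
  set U : Set E := {x | ContDiffAt ℝ 1 F x}
  have hU : IsOpen U := isOpen_iff_mem_nhds.2 fun x hx => ContDiffAt.eventually hx (by simp)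
  obtain ⟨L, hL, hKL, hLU⟩ := exists_compact_between hK hU hF
  obtain ⟨f, hf1, hf0, -⟩ := exists_contMDiffMap_one_nhds_of_subset_interior
    (modelWithCornersSelf ℝ E) (n := 1) hK.isClosed hKL
  have hsupp : ∀ x ∉ L, (f : E → ℝ) x • F x = 0 := fun x hx => by rw [hf0 x hx, zero_smul]
  refine ⟨fun x => f x • F x, contDiff_iff_contDiffAt.2 fun x => ?_,
    HasCompactSupport.intro hL hsupp, fun x hx => ?_⟩
  · by_cases hx : x ∈ L
    · exact f.contMDiff.contDiff.contDiffAt.smul (hLU hx)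
    · refine (contDiffAt_const (c := (0 : E))).congr_of_eventuallyEq ?_
      filter_upwards [hL.isClosed.isOpen_compl.mem_nhds hx] with y hy using hsupp y hy
  · simp [hf1.self_of_nhdsSet x hx]

/-- Cut off outside a neighbourhood of `K`, the field is bounded and globally Lipschitz, so
Picard–Lindelöf covers all of `[0, T]` at once. The curve solves the original equation at the times
when it lies in `K`. -/
theorem exists_solution [FiniteDimensional ℝ E] {K : Set E} (hK : IsCompact K) {F : E → E}
    (hF : ∀ x ∈ K, ContDiffAt ℝ 1 F x) (x₀ : E) {T : ℝ} (hT : 0 ≤ T) :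
    ∃ α : ℝ → E, α 0 = x₀ ∧ ContinuousOn α (Set.Icc 0 T) ∧
      ∀ t ∈ Set.Icc 0 T, α t ∈ K → HasDerivWithinAt α (F (α t)) (Set.Icc 0 T) t := by
  obtain ⟨G, hG, hGc, hGF⟩ := exists_cutoff hK hF
  obtain ⟨k, hk⟩ := hG.lipschitzWith_of_hasCompactSupport hGc (by simp)
  obtain ⟨M, hM⟩ := hGc.exists_bound_of_continuous hG.continuous
  have hPL : IsPicardLindelof (fun _ : ℝ => G) (⟨0, le_rfl, hT⟩ : Set.Icc (0 : ℝ) T) x₀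
      (M.toNNReal * T.toNNReal) 0 M.toNNReal k := by
    refine .of_time_independent (fun x _ => (hM x).trans (Real.le_coe_toNNReal M)) hk.lipschitzOnWith ?_
    simp [hT]
  obtain ⟨α, h0, hα⟩ := hPL.exists_eq_forall_mem_Icc_hasDerivWithinAt₀
  refine ⟨α, h0, fun t ht => (hα t ht).continuousWithinAt, fun t ht htK => ?_⟩
  rw [← hGF _ htK]
  exact hα t ht

/-- A solution is unique as long as the vector field is Lipschitz at the points of one solution. -/
theorem solution_unique {F : E → E} {c d : ℝ → E} {T : ℝ}
    (hc : ∀ t ∈ Set.Icc 0 T, HasDerivWithinAt c (F (c t)) (Set.Icc 0 T) t)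
    (hd : ∀ t ∈ Set.Icc 0 T, HasDerivWithinAt d (F (d t)) (Set.Icc 0 T) t) (h0 : c 0 = d 0)
    (hF : ∀ t ∈ Set.Icc 0 T, ∃ K, ∃ U ∈ 𝓝 (c t), ∀ s ∈ Set.Icc 0 T, c s ∈ U → ∀ x ∈ U,
      ‖F (c s) - F x‖ ≤ K * ‖c s - x‖) :
    ∀ t ∈ Set.Icc 0 T, c t = d t := by
  have cc : ContinuousOn c (Set.Icc 0 T) := fun t ht => (hc t ht).continuousWithinAt
  have cd : ContinuousOn d (Set.Icc 0 T) := fun t ht => (hd t ht).continuousWithinAt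
  -- The coincidence set is closed, and by Grönwall it extends to the right. The estimate only ever
  -- compares a point of `c` with another point, so no Lipschitz bound between two arbitrary points
  -- is required.
  refine IsClosed.Icc_subset_of_forall_exists_gt (s := {t | c t = d t}) ?_ h0 ?_
  · have : {t | c t = d t} ∩ Set.Icc 0 T = Set.Icc 0 T ∩ (fun t => c t - d t) ⁻¹' {0} := by
      ext t; simp [sub_eq_zero, and_comm]
    rw [this]
    exact (cc.sub cd).preimage_isClosed_of_isClosed isClosed_Icc isClosed_singleton
  · rintro t ⟨hcd, ht⟩ y hy
    obtain ⟨K, U, hU, hK⟩ := hF t ⟨ht.1, ht.2.le⟩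
    have ht' : t ∈ Set.Icc 0 T := ⟨ht.1, ht.2.le⟩
    have h1 := (cc t ht').preimage_mem_nhdsWithin hU
    have h2 := (cd t ht').preimage_mem_nhdsWithin (show U ∈ 𝓝 (d t) from hcd ▸ hU)
    obtain ⟨δ, hδ, hball⟩ := Metric.mem_nhdsWithin_iff.1 (inter_mem h1 h2)
    set b := min (min y T) (t + δ / 2)
    have hb : t < b := lt_min (lt_min hy ht.2) (by linarith)
    have hbT : b ≤ T := (min_le_left _ _).trans (min_le_right _ _)
    have hin : ∀ s ∈ Set.Icc t b, s ∈ Set.Icc 0 T ∧ c s ∈ U ∧ d s ∈ U := fun s hs => by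
      have hsT : s ∈ Set.Icc 0 T := ⟨ht.1.trans hs.1, hs.2.trans hbT⟩
      have hb2 : b ≤ t + δ / 2 := min_le_right _ _
      have := hball ⟨by
        rw [Metric.mem_ball, Real.dist_eq, abs_of_nonneg (by linarith [hs.1])]
        linarith [hs.2], hsT⟩
      exact ⟨hsT, this⟩
    have hder : ∀ {e : ℝ → E}, (∀ t ∈ Set.Icc 0 T, HasDerivWithinAt e (F (e t)) (Set.Icc 0 T) t) →
        ∀ s ∈ Set.Ico t b, HasDerivWithinAt e (F (e s)) (Set.Ici s) s := fun {e} he s hs => by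
      refine (he s (hin s ⟨hs.1, hs.2.le⟩).1).mono_of_mem_nhdsWithin ?_
      refine mem_of_superset (Icc_mem_nhdsGE (show s < T from hs.2.trans_le hbT)) ?_
      exact Set.Icc_subset_Icc_left (ht.1.trans hs.1)
    have hz := eq_zero_of_abs_deriv_le_mul_abs_self_of_eq_zero_right (f := fun s => c s - d s)
      (f' := fun s => F (c s) - F (d s)) (K := K) (a := t) (b := b)
      ((cc.sub cd).mono fun s hs => (hin s hs).1)
      (fun s hs => (hder hc s hs).sub (hder hd s hs)) (sub_eq_zero.2 hcd)
      (fun s hs => hK s (hin s ⟨hs.1, hs.2.le⟩).1 (hin s ⟨hs.1, hs.2.le⟩).2.1 _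
        (hin s ⟨hs.1, hs.2.le⟩).2.2)
    exact ⟨b, sub_eq_zero.1 (hz b ⟨hb.le, le_rfl⟩), hb, (min_le_left _ _).trans (min_le_left _ _)⟩

end ODE

end
end SBC

/-! ### Rescaled coordinates -/

namespace SBC
noncomputable section

/-- Coordinates `(J₁, J₂, L₁, L₂) / ε` and `u` in the normal form coordinates. -/
abbrev State : Type := ℝ × ℝ × ℝ × ℝ × Base

/-- The vector `(I₁, L₁, I₂, L₂) / ε`. -/
def State.vec (ξ : State) : Fin 4 → ℝ := ![ξ.1 + ξ.2.1, ξ.2.2.1, ξ.1 - ξ.2.1, ξ.2.2.2.1]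

/-- The base component of a state. -/
def State.base (ξ : State) : Base := ξ.2.2.2.2

/-- The point of the normal form coordinates with given rescaled coordinates. -/
def scaleDown (ε : ℝ) (ξ : State) : Phase :=
  (![⟨ε * (ξ.1 + ξ.2.1), ε * ξ.2.2.1⟩, ⟨ε * (ξ.1 - ξ.2.1), ε * ξ.2.2.2.1⟩], ξ.base)

/-- The point of the `γ`-chart with given rescaled coordinates. -/
def toChart (ε : ℝ) (ξ : State) : Chart :=
  (ε * ξ.2.1, ξ.1 / ξ.2.1, ξ.2.2.1 / ξ.2.1, ξ.2.2.2.1 / ξ.2.1, ξ.base)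

/-- The vector field `-(ε J₂)⁻¹ X` in the rescaled coordinates, with its limit at `ε = 0`. -/
def stateField (V : Phase → Phase) (ε : ℝ) (ξ : State) : State :=
  if ε = 0 then
    (-(ξ.1 ^ 2 + ξ.2.1 ^ 2 + (ξ.2.2.1 ^ 2 + ξ.2.2.2.1 ^ 2) / 2) / ξ.2.1,
      (2 * ξ.1 * ξ.2.1 + (ξ.2.2.1 ^ 2 - ξ.2.2.2.1 ^ 2) / 2) / ξ.2.1, 0, 0, 0)
  else
    (-(((V (scaleDown ε ξ)).1 0).re + ((V (scaleDown ε ξ)).1 1).re) / 2 / (ε ^ 2 * ξ.2.1),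
      -(((V (scaleDown ε ξ)).1 0).re - ((V (scaleDown ε ξ)).1 1).re) / 2 / (ε ^ 2 * ξ.2.1),
      -((V (scaleDown ε ξ)).1 0).im / (ε ^ 2 * ξ.2.1),
      -((V (scaleDown ε ξ)).1 1).im / (ε ^ 2 * ξ.2.1),
      -(ε * ξ.2.1)⁻¹ • (V (scaleDown ε ξ)).2)

/-- The rescaled approximate integral `ε⁻³ κ`. -/
def scaledKappa (G₅ G₇ : (Fin 2 → ℝ) → MvPolynomial (Fin 4) ℝ) (ε : ℝ) (ξ : State) : ℝ :=
  kappaLead ξ.vec + ε ^ 2 * (G₅ ξ.base.energy).eval ξ.vec + ε ^ 4 * (G₇ ξ.base.energy).eval ξ.vec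

variable {V : Phase → Phase} {m : Fin 4 → ℝ} {Φ : OpenPartialHomeomorph Phase Phase}
  {G₅ G₇ : (Fin 2 → ℝ) → MvPolynomial (Fin 4) ℝ} {u₀ : Base} {r₀ η C ε : ℝ} {ξ : State}

theorem blowDown_toChart (h : ξ.2.1 ≠ 0) : blowDown (toChart ε ξ) = scaleDown ε ξ := by
  obtain ⟨j₁, j₂, l₁, l₂, v⟩ := ξ
  simp only at h
  have e1 : ε * j₂ * (j₁ / j₂ + 1) = ε * (j₁ + j₂) := by field_simp
  have e2 : ε * j₂ * (j₁ / j₂ - 1) = ε * (j₁ - j₂) := by field_simp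
  have e3 : ε * j₂ * (l₁ / j₂) = ε * l₁ := by field_simp
  have e4 : ε * j₂ * (l₂ / j₂) = ε * l₂ := by field_simp
  simp only [blowDown, toChart, scaleDown, State.base, e1, e2, e3, e4]

theorem realCoords_scaleDown : realCoords (scaleDown ε ξ).1 = fun i => ε * ξ.vec i := by
  funext i
  fin_cases i <;> simp [realCoords, scaleDown, State.vec]

theorem kappaLead_mul (c : ℝ) (v : Fin 4 → ℝ) :
    kappaLead (fun i => c * v i) = c ^ 3 * kappaLead v := by
  simp only [kappaLead]
  ring

theorem FieldBounds.kappa_scaleDown (h : FieldBounds V G₅ G₇ u₀ r₀ η C) :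
    kappa G₅ G₇ (scaleDown ε ξ) = ε ^ 3 * scaledKappa G₅ G₇ ε ξ := by
  rw [kappa, realCoords_scaleDown, h.smul₅, h.smul₇, kappaLead_mul, scaledKappa]
  simp only [scaleDown]
  ring

/-- By homogeneity the factors `J₂` cancel in the quotient, and `γ̃_α` is the rescaled `κ` over `6
J₁³`. The face conditions become polynomial equations that make sense for `ε = 0` too. -/
theorem FieldBounds.onFace_toChart (h : FieldBounds V G₅ G₇ u₀ r₀ η C) (hj : ξ.2.1 ≠ 0) {σ : ℝ} :
    OnFace G₅ G₇ σ (toChart ε ξ) ↔ ξ.1 ≠ 0 ∧ scaledKappa G₅ G₇ ε ξ = 6 * σ * ξ.1 ^ 3 := by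
  have hv : (![ξ.1 / ξ.2.1 + 1, ξ.2.2.1 / ξ.2.1, ξ.1 / ξ.2.1 - 1, ξ.2.2.2.1 / ξ.2.1] : Fin 4 → ℝ) =
      fun i => ξ.2.1⁻¹ * ξ.vec i := by
    funext i
    fin_cases i <;> simp [State.vec] <;> field_simp
  have hg : gammaTilde G₅ G₇ (toChart ε ξ) =
      ((ξ.2.1)⁻¹ ^ 3 * scaledKappa G₅ G₇ ε ξ) / (6 * (ξ.1 / ξ.2.1) ^ 3) := by
    simp only [gammaTilde, toChart]
    rw [hv, h.smul₅, h.smul₇, kappaLead_mul, scaledKappa]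
    congr 1
    field_simp
  have h0 : (toChart ε ξ).2.1 ≠ 0 ↔ ξ.1 ≠ 0 := by simp [toChart, hj]
  rw [OnFace, h0, hg]
  refine and_congr_right fun h1 => ?_
  have : (ξ.2.1)⁻¹ ^ 3 * scaledKappa G₅ G₇ ε ξ / (6 * (ξ.1 / ξ.2.1) ^ 3) =
      scaledKappa G₅ G₇ ε ξ / (6 * ξ.1 ^ 3) := by
    field_simp
  rw [this, div_eq_iff (by positivity)]
  constructor <;> intro h <;> linear_combination h

theorem faceCoords_toChart (hj : ξ.2.1 ≠ 0) (h1 : ξ.1 ≠ 0) (σ : ℝ) :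
    faceCoords σ (toChart ε ξ) =
      (σ * (ε * ξ.1), σ * (ξ.2.2.1 / ξ.1), σ * (ξ.2.2.2.1 / ξ.1), ξ.base) := by
  have e1 : ε * ξ.2.1 * (ξ.1 / ξ.2.1) = ε * ξ.1 := by field_simp
  have e2 : ξ.2.2.1 / ξ.2.1 / (ξ.1 / ξ.2.1) = ξ.2.2.1 / ξ.1 := by field_simp
  have e3 : ξ.2.2.2.1 / ξ.2.1 / (ξ.1 / ξ.2.1) = ξ.2.2.2.1 / ξ.1 := by field_simp
  simp only [faceCoords, toChart, e1, e2, e3]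

section Curve

variable {c : ℝ → State} {c' : State} {S : Set ℝ} {t : ℝ}

theorem hasDerivWithinAt_state_iff : HasDerivWithinAt c c' S t ↔
    HasDerivWithinAt (fun s => (c s).1) c'.1 S t ∧ HasDerivWithinAt (fun s => (c s).2.1) c'.2.1 S t ∧
    HasDerivWithinAt (fun s => (c s).2.2.1) c'.2.2.1 S t ∧
    HasDerivWithinAt (fun s => (c s).2.2.2.1) c'.2.2.2.1 S t ∧
    HasDerivWithinAt (fun s => (c s).base) c'.base S t := by
  constructor
  · intro h
    exact ⟨(ContinuousLinearMap.fst ℝ ℝ (ℝ × ℝ × ℝ × Base)).hasFDerivAt.comp_hasDerivWithinAt t h,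
      (ContinuousLinearMap.fst ℝ ℝ (ℝ × ℝ × Base) ∘L
        ContinuousLinearMap.snd ℝ ℝ (ℝ × ℝ × ℝ × Base)).hasFDerivAt.comp_hasDerivWithinAt t h,
      (ContinuousLinearMap.fst ℝ ℝ (ℝ × Base) ∘L ContinuousLinearMap.snd ℝ ℝ (ℝ × ℝ × Base) ∘L
        ContinuousLinearMap.snd ℝ ℝ (ℝ × ℝ × ℝ × Base)).hasFDerivAt.comp_hasDerivWithinAt t h,
      (ContinuousLinearMap.fst ℝ ℝ Base ∘L ContinuousLinearMap.snd ℝ ℝ (ℝ × Base) ∘L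
        ContinuousLinearMap.snd ℝ ℝ (ℝ × ℝ × Base) ∘L
        ContinuousLinearMap.snd ℝ ℝ (ℝ × ℝ × ℝ × Base)).hasFDerivAt.comp_hasDerivWithinAt t h,
      (ContinuousLinearMap.snd ℝ ℝ Base ∘L ContinuousLinearMap.snd ℝ ℝ (ℝ × Base) ∘L
        ContinuousLinearMap.snd ℝ ℝ (ℝ × ℝ × Base) ∘L
        ContinuousLinearMap.snd ℝ ℝ (ℝ × ℝ × ℝ × Base)).hasFDerivAt.comp_hasDerivWithinAt t h⟩
  · rintro ⟨h1, h2, h3, h4, h5⟩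
    exact h1.prodMk (h2.prodMk (h3.prodMk (h4.prodMk h5)))

/-- The rescaled field is minus the desingularised field read through the chart map, by the quotient
rule. For `ε = 0` both are given by their explicit limits, so the collision manifold needs no
separate treatment later. -/
theorem hasDerivWithinAt_toChart
    (h : HasDerivWithinAt c (stateField (transformedField m Φ) ε (c t)) S t) (hj : (c t).2.1 ≠ 0) :
    HasDerivWithinAt (fun s => toChart ε (c s)) (-blowUpField m Φ (toChart ε (c t))) S t := by
  obtain ⟨h1, h2, h3, h4, h5⟩ := hasDerivWithinAt_state_iff.1 h
  refine hasDerivWithinAt_state_iff.2 ⟨(h2.const_mul ε).congr_deriv ?_,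
    (h1.div h2 hj).congr_deriv ?_, (h3.div h2 hj).congr_deriv ?_, (h4.div h2 hj).congr_deriv ?_,
    h5.congr_deriv ?_⟩
  all_goals
    have hb := blowDown_toChart (ε := ε) hj
    rcases eq_or_ne ε 0 with rfl | hε
    · simp [stateField, blowUpField, toChart, State.base]
      try (field_simp; try ring)
    · simp only [toChart] at hb
      simp only [stateField, blowUpField, toChart, hε, mul_eq_zero, hj, or_self, if_false, hb]
      simp [State.base]
      try (field_simp; try ring)

end Curve

end
end SBC

/-! ### Estimates of the rescaled field on a box -/

namespace SBC
noncomputable section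

/-- The compact region of rescaled states that contains the transition. -/
def stateBox (u₀ : Base) (η : ℝ) : Set State :=
  Set.Icc (-2) 2 ×ˢ Set.Icc (1 / 50) 2 ×ˢ Set.Icc (-2) 2 ×ˢ Set.Icc (-2) 2 ×ˢ
    Metric.closedBall u₀ (η / 2)

variable {V : Phase → Phase} {m : Fin 4 → ℝ} {Φ : OpenPartialHomeomorph Phase Phase}
  {G₅ G₇ : (Fin 2 → ℝ) → MvPolynomial (Fin 4) ℝ} {u₀ : Base} {r₀ η C ε : ℝ} {ξ : State}

theorem isCompact_stateBox : IsCompact (stateBox u₀ η) :=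
  isCompact_Icc.prod (isCompact_Icc.prod (isCompact_Icc.prod
    (isCompact_Icc.prod (isCompact_closedBall _ _))))

theorem mem_stateBox : ξ ∈ stateBox u₀ η ↔ |ξ.1| ≤ 2 ∧ (1 / 50 ≤ ξ.2.1 ∧ ξ.2.1 ≤ 2) ∧
    |ξ.2.2.1| ≤ 2 ∧ |ξ.2.2.2.1| ≤ 2 ∧ ‖ξ.base - u₀‖ ≤ η / 2 := by
  simp only [stateBox, Set.mem_prod, Set.mem_Icc, Metric.mem_closedBall, dist_eq_norm, abs_le]
  rfl

theorem norm_scaleDown_fst_le (h : ξ ∈ stateBox u₀ η) : ‖(scaleDown ε ξ).1‖ ≤ 6 * |ε| := by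
  obtain ⟨h1, ⟨h2, h2'⟩, h3, h4, -⟩ := mem_stateBox.1 h
  have key : ∀ a b : ℝ, |a| ≤ 4 → |b| ≤ 2 → ‖(⟨ε * a, ε * b⟩ : ℂ)‖ ≤ 6 * |ε| := fun a b ha hb => by
    refine (Complex.norm_le_abs_re_add_abs_im _).trans ?_
    simp only [abs_mul]
    nlinarith [abs_nonneg ε]
  have h1' := abs_le.1 h1
  refine (pi_norm_le_iff_of_nonneg (by positivity)).2 fun i => ?_
  fin_cases i
  · exact key _ _ (abs_le.2 ⟨by linarith, by linarith⟩) h3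
  · exact key _ _ (abs_le.2 ⟨by linarith, by linarith⟩) h4

theorem contDiff_scaleDown : ContDiff ℝ ∞ (scaleDown ε) := by
  refine ContDiff.prodMk (contDiff_pi.2 fun i => ?_) (by unfold State.base; fun_prop)
  have key : ∀ a b : State → ℝ, ContDiff ℝ ∞ a → ContDiff ℝ ∞ b →
      ContDiff ℝ ∞ (fun ξ => (⟨a ξ, b ξ⟩ : ℂ)) := fun a b ha hb =>
    Complex.equivRealProdCLM.symm.contDiff.comp (ha.prodMk hb)
  fin_cases i
  · exact key _ _ (by fun_prop) (by fun_prop)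
  · exact key _ _ (by fun_prop) (by fun_prop)

namespace FieldBounds

theorem scaleDown_mem (h : FieldBounds V G₅ G₇ u₀ r₀ η C) (hε : 6 * |ε| < r₀)
    (hξ : ξ ∈ stateBox u₀ η) :
    ‖(scaleDown ε ξ).1‖ < r₀ ∧ ‖(scaleDown ε ξ).2 - u₀‖ < η :=
  ⟨(norm_scaleDown_fst_le hξ).trans_lt hε,
    (mem_stateBox.1 hξ).2.2.2.2.trans_lt (by linarith [h.eta_pos])⟩

theorem contDiffAt_stateField (h : FieldBounds V G₅ G₇ u₀ r₀ η C) (hε : 6 * |ε| < r₀)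
    (hξ : ξ ∈ stateBox u₀ η) : ContDiffAt ℝ 1 (stateField V ε) ξ := by
  have hj : ξ.2.1 ≠ 0 := by linarith [(mem_stateBox.1 hξ).2.1.1]
  rcases eq_or_ne ε 0 with rfl | hε0
  · have : stateField V 0 = fun ξ => (-(ξ.1 ^ 2 + ξ.2.1 ^ 2 + (ξ.2.2.1 ^ 2 + ξ.2.2.2.1 ^ 2) / 2) / ξ.2.1,
      (2 * ξ.1 * ξ.2.1 + (ξ.2.2.1 ^ 2 - ξ.2.2.2.1 ^ 2) / 2) / ξ.2.1, 0, 0, 0) := by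
      funext ξ
      simp [stateField]
    rw [this]
    refine ContDiffAt.prodMk (.div (by fun_prop) (by fun_prop) hj) (ContDiffAt.prodMk
      (.div (by fun_prop) (by fun_prop) hj) contDiffAt_const)
  · have hs := h.scaleDown_mem hε hξ
    have hV : ContDiffAt ℝ 1 (fun ξ => V (scaleDown ε ξ)) ξ :=
      (h.smooth _ hs.1 hs.2).comp ξ (contDiff_scaleDown.contDiffAt.of_le (by norm_cast))
    have hre : ∀ j, ContDiffAt ℝ 1 (fun ξ => ((V (scaleDown ε ξ)).1 j).re) ξ := fun j =>
      (Complex.reCLM ∘L ContinuousLinearMap.proj (R := ℝ) (φ := fun _ : Fin 2 => ℂ) j ∘L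
        ContinuousLinearMap.fst ℝ (Fin 2 → ℂ) Base).contDiff.contDiffAt.comp ξ hV
    have him : ∀ j, ContDiffAt ℝ 1 (fun ξ => ((V (scaleDown ε ξ)).1 j).im) ξ := fun j =>
      (Complex.imCLM ∘L ContinuousLinearMap.proj (R := ℝ) (φ := fun _ : Fin 2 => ℂ) j ∘L
        ContinuousLinearMap.fst ℝ (Fin 2 → ℂ) Base).contDiff.contDiffAt.comp ξ hV
    have hd : ContDiffAt ℝ 1 (fun ξ : State => ε ^ 2 * ξ.2.1) ξ := by fun_prop
    have hd0 : ε ^ 2 * ξ.2.1 ≠ 0 := by positivity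
    have : stateField V ε = fun ξ =>
      (-(((V (scaleDown ε ξ)).1 0).re + ((V (scaleDown ε ξ)).1 1).re) / 2 / (ε ^ 2 * ξ.2.1),
      -(((V (scaleDown ε ξ)).1 0).re - ((V (scaleDown ε ξ)).1 1).re) / 2 / (ε ^ 2 * ξ.2.1),
      -((V (scaleDown ε ξ)).1 0).im / (ε ^ 2 * ξ.2.1),
      -((V (scaleDown ε ξ)).1 1).im / (ε ^ 2 * ξ.2.1),
      -(ε * ξ.2.1)⁻¹ • (V (scaleDown ε ξ)).2) := by
      funext ξ
      simp [stateField, hε0]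
    rw [this]
    refine ContDiffAt.prodMk (((((hre 0).add (hre 1)).neg).div_const 2).div hd hd0)
      (ContDiffAt.prodMk (((((hre 0).sub (hre 1)).neg).div_const 2).div hd hd0)
      (ContDiffAt.prodMk ((him 0).neg.div hd hd0) (ContDiffAt.prodMk ((him 1).neg.div hd hd0)
      (ContDiffAt.smul (f := fun ξ : State => -(ε * ξ.2.1)⁻¹) ?_ hV.snd))))
    exact ContDiffAt.neg (ContDiffAt.inv (by fun_prop) (by positivity))

/-- In the limit the rate is at most `-J₂ ≤ -1/50`. The error of the field is at most `C (6ε)⁴ =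
1296 C ε⁴ ≤ ε² / 5000`, which explains `6480000 = 1296 · 5000`. Half of the rate remains because
`J₂² - J₂ / 100 ≥ 1/5000` for `J₂ ≥ 1/50`. -/
theorem rate_le (h : FieldBounds V G₅ G₇ u₀ r₀ η C) (hε : 6 * |ε| < r₀)
    (hC : 6480000 * C * ε ^ 2 ≤ 1) (hξ : ξ ∈ stateBox u₀ η) :
    (stateField V ε ξ).1 ≤ -(1 / 100) := by
  obtain ⟨h1, ⟨h2, h2'⟩, h3, h4, -⟩ := mem_stateBox.1 hξ
  have hj : 0 < ξ.2.1 := by linarith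
  rcases eq_or_ne ε 0 with rfl | hε0
  · simp only [stateField, if_true]
    rw [div_le_iff₀ hj]
    nlinarith [sq_nonneg ξ.1, sq_nonneg ξ.2.2.1, sq_nonneg ξ.2.2.2.1]
  · have hs := h.scaleDown_mem hε hξ
    have e2 : 0 < ε ^ 2 := by positivity
    have hb : C * ‖(scaleDown ε ξ).1‖ ^ 4 ≤ C * (6 * |ε|) ^ 4 := by
      have := norm_scaleDown_fst_le (ε := ε) hξ
      have := h.C_pos
      gcongr
    have e4 : (6 * |ε|) ^ 4 = 1296 * (ε ^ 2) ^ 2 := by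
      rw [mul_pow, ← sq_abs ε]; ring
    rw [e4] at hb
    have k0 := abs_le.1 ((h.re _ hs.1 hs.2 0).trans hb)
    have k1 := abs_le.1 ((h.re _ hs.1 hs.2 1).trans hb)
    have n0 : ‖(scaleDown ε ξ).1 0‖ ^ 2 = ε ^ 2 * ((ξ.1 + ξ.2.1) ^ 2 + ξ.2.2.1 ^ 2) := by
      rw [norm_sq_eq]; simp [scaleDown]; ring
    have n1 : ‖(scaleDown ε ξ).1 1‖ ^ 2 = ε ^ 2 * ((ξ.1 - ξ.2.1) ^ 2 + ξ.2.2.2.1 ^ 2) := by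
      rw [norm_sq_eq]; simp [scaleDown]; ring
    rw [show Fin.rev (0 : Fin 2) = 1 from rfl, n1] at k0
    rw [show Fin.rev (1 : Fin 2) = 0 from rfl, n0] at k1
    simp only [stateField, hε0, if_false]
    rw [div_le_iff₀ (by positivity)]
    have q : ε ^ 2 * (ξ.2.1 ^ 2) ≤ ε ^ 2 * (((ξ.1 + ξ.2.1) ^ 2 + ξ.2.2.1 ^ 2 + (ξ.1 - ξ.2.1) ^ 2 + ξ.2.2.2.1 ^ 2) / 2) :=
      mul_le_mul_of_nonneg_left (by nlinarith [sq_nonneg ξ.1, sq_nonneg ξ.2.2.1, sq_nonneg ξ.2.2.2.1]) e2.le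
    have q2 : C * (1296 * (ε ^ 2) ^ 2) ≤ ε ^ 2 * (1 / 5000) := by nlinarith
    have q3 : ε ^ 2 * (1 / 5000 + 1 / 100 * ξ.2.1) ≤ ε ^ 2 * ξ.2.1 ^ 2 :=
      mul_le_mul_of_nonneg_left (by nlinarith) e2.le
    nlinarith

/-- The rate of `L`, of order 10, is divided by `ε² J₂`; that of `u`, of order 9, by `ε J₂`. Both
leave `ε⁸`. The factor 50 bounds `1 / J₂` and the powers of 6 come from `‖ζ‖ ≤ 6 |ε|`. -/
theorem abs_im_rate_le (h : FieldBounds V G₅ G₇ u₀ r₀ η C) (hε : 6 * |ε| < r₀)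
    (hξ : ξ ∈ stateBox u₀ η) :
    |(stateField V ε ξ).2.2.1| ≤ 50 * 6 ^ 10 * C * |ε| ^ 8 ∧
      |(stateField V ε ξ).2.2.2.1| ≤ 50 * 6 ^ 10 * C * |ε| ^ 8 ∧
      ‖(stateField V ε ξ).base‖ ≤ 50 * 6 ^ 10 * C * |ε| ^ 8 := by
  have hC := h.C_pos
  rcases eq_or_ne ε 0 with rfl | hε0
  · simp [stateField, State.base]
  · have hj2 := (mem_stateBox.1 hξ).2.1.1
    have hj : 0 < ξ.2.1 := by linarith
    have hs := h.scaleDown_mem hε hξ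
    have e0 : 0 < |ε| := abs_pos.2 hε0
    have hn := norm_scaleDown_fst_le (ε := ε) hξ
    have hd : ∀ y : ℝ, |y| ≤ C * ‖(scaleDown ε ξ).1‖ ^ 10 →
        |-y / (ε ^ 2 * ξ.2.1)| ≤ 50 * 6 ^ 10 * C * |ε| ^ 8 := fun y hy => by
      rw [abs_div, abs_neg, abs_mul, abs_of_pos hj, abs_pow, div_le_iff₀ (by positivity)]
      calc |y| ≤ C * ‖(scaleDown ε ξ).1‖ ^ 10 := hy
        _ ≤ C * (6 * |ε|) ^ 10 := by gcongr
        _ = 50 * 6 ^ 10 * C * |ε| ^ 8 * (|ε| ^ 2 * (1 / 50)) := by ring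
        _ ≤ _ := by gcongr
    simp only [stateField, hε0, if_false]
    refine ⟨hd _ (h.im _ hs.1 hs.2 0), hd _ (h.im _ hs.1 hs.2 1), ?_⟩
    simp only [State.base]
    rw [norm_smul, norm_neg, norm_inv, Real.norm_eq_abs, abs_mul, abs_of_pos hj,
      inv_mul_le_iff₀ (by positivity)]
    calc _ ≤ C * ‖(scaleDown ε ξ).1‖ ^ 9 := h.base _ hs.1 hs.2
      _ ≤ C * (6 * |ε|) ^ 9 := by gcongr
      _ ≤ (|ε| * (1 / 50)) * (50 * 6 ^ 10 * C * |ε| ^ 8) := by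
        have : 0 ≤ C * |ε| ^ 9 := by positivity
        nlinarith
      _ ≤ _ := by gcongr

end FieldBounds

section Kappa

variable {c : ℝ → State} {S : Set ℝ} {t : ℝ}

theorem hasDerivWithinAt_scaleDown (hε : ε ≠ 0) (hj : (c t).2.1 ≠ 0)
    (h : HasDerivWithinAt c (stateField V ε (c t)) S t) :
    HasDerivWithinAt (fun s => scaleDown ε (c s))
      (-(ε * (c t).2.1)⁻¹ • V (scaleDown ε (c t))) S t := by
  obtain ⟨h1, h2, h3, h4, h5⟩ := hasDerivWithinAt_state_iff.1 h
  have key : ∀ {a b : ℝ → ℝ} {a' b' : ℝ}, HasDerivWithinAt a a' S t → HasDerivWithinAt b b' S t →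
      HasDerivWithinAt (fun s => (⟨a s, b s⟩ : ℂ)) ⟨a', b'⟩ S t := fun ha hb =>
    Complex.equivRealProdCLM.symm.hasFDerivAt.comp_hasDerivWithinAt t (ha.prodMk hb)
  refine HasDerivWithinAt.prodMk (hasDerivWithinAt_pi.2 fun i => ?_) (h5.congr_deriv ?_)
  · fin_cases i
    · refine (key ((h1.add h2).const_mul ε) (h3.const_mul ε)).congr_deriv ?_
      apply Complex.ext <;> simp [stateField, hε] <;> (field_simp; try ring)
    · refine (key ((h1.sub h2).const_mul ε) (h4.const_mul ε)).congr_deriv ?_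
      apply Complex.ext <;> simp [stateField, hε] <;> (field_simp; try ring)
  · simp [stateField, hε, State.base]

/-- The rate of `κ` has order 11, of which three powers of `ε` go into the rescaling of `κ` and one
into the rescaling of time. For `ε = 0` the leading cubic is an exact integral of the limit field.
-/
theorem FieldBounds.hasDerivWithinAt_scaledKappa (h : FieldBounds V G₅ G₇ u₀ r₀ η C)
    (hε : 6 * |ε| < r₀) (hξ : c t ∈ stateBox u₀ η)
    (hc : HasDerivWithinAt c (stateField V ε (c t)) S t) :
    ∃ d, HasDerivWithinAt (fun s => scaledKappa G₅ G₇ ε (c s)) d S t ∧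
      |d| ≤ 50 * 6 ^ 11 * C * |ε| ^ 7 := by
  have hC := h.C_pos
  have hj2 := (mem_stateBox.1 hξ).2.1.1
  have hj : 0 < (c t).2.1 := by linarith
  rcases eq_or_ne ε 0 with rfl | hε0
  · obtain ⟨h1, h2, h3, h4, -⟩ := hasDerivWithinAt_state_iff.1 hc
    refine ⟨0, ?_, by simp⟩
    have e : (fun s => scaledKappa G₅ G₇ 0 (c s)) = fun s =>
        (((c s).1 + (c s).2.1) ^ 3 + 3 * ((c s).1 + (c s).2.1) * (c s).2.2.1 ^ 2) -
        (((c s).1 - (c s).2.1) ^ 3 + 3 * ((c s).1 - (c s).2.1) * (c s).2.2.2.1 ^ 2) := by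
      funext s
      simp [scaledKappa, kappaLead, State.vec]
    rw [e]
    refine ((((h1.add h2).pow 3).add (((h1.add h2).const_mul 3).mul (h3.pow 2))).sub
      (((h1.sub h2).pow 3).add (((h1.sub h2).const_mul 3).mul (h4.pow 2)))).congr_deriv ?_
    simp [stateField]
    field_simp
    ring
  · have hs := h.scaleDown_mem hε hξ
    have e0 : 0 < |ε| := abs_pos.2 hε0
    have hd := (h.kappa_diff _ hs.1 hs.2).hasFDerivAt.comp_hasDerivWithinAt t
      (hasDerivWithinAt_scaleDown hε0 hj.ne' hc)
    have e : (fun s => scaledKappa G₅ G₇ ε (c s)) =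
        fun s => (ε ^ 3)⁻¹ * kappa G₅ G₇ (scaleDown ε (c s)) := by
      funext s
      rw [h.kappa_scaleDown]
      field_simp
    rw [e]
    refine ⟨_, hd.const_mul _, ?_⟩
    have hn := norm_scaleDown_fst_le (ε := ε) hξ
    rw [map_smul, smul_eq_mul, abs_mul, abs_mul, abs_neg, abs_inv, abs_inv, abs_mul, abs_pow,
      abs_of_pos hj, inv_mul_le_iff₀ (by positivity), inv_mul_le_iff₀ (by positivity)]
    calc _ ≤ C * ‖(scaleDown ε (c t)).1‖ ^ 11 := h.kappa_deriv _ hs.1 hs.2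
      _ ≤ C * (6 * |ε|) ^ 11 := by gcongr
      _ = |ε| * (1 / 50) * (|ε| ^ 3 * (50 * 6 ^ 11 * C * |ε| ^ 7)) := by ring
      _ ≤ _ := by gcongr

end Kappa

end
end SBC

/-! ### First exit times and confinement by κ -/

namespace SBC
noncomputable section

/-- The time is the infimum of the bad times, at which the curve is outside `O` or `g ≤ 0`. The
curve is only known to be regular in `K`, so `g` is assumed continuous at times spent in `K` only;
the closure of `O` lies in `K`, which covers the exit time itself. -/
theorem exists_first_time {E : Type} [TopologicalSpace E] {α : ℝ → E} {T : ℝ}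
    (hα : ContinuousOn α (Set.Icc 0 T)) {O K : Set E} (hO : IsOpen O) (hK : IsClosed K)
    (hOK : O ⊆ K) {g : ℝ → ℝ}
    (hg : ∀ t ∈ Set.Icc 0 T, α t ∈ K → ContinuousWithinAt g (Set.Icc 0 T) t) (h0 : α 0 ∈ O)
    (hg0 : 0 < g 0) (hex : ∃ t ∈ Set.Icc 0 T, α t ∉ O ∨ g t ≤ 0) :
    ∃ τ, 0 < τ ∧ τ ≤ T ∧ (∀ t ∈ Set.Icc 0 τ, α t ∈ K) ∧ (∀ t ∈ Set.Ico 0 τ, 0 < g t) ∧ 0 ≤ g τ ∧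
      (α τ ∈ O → g τ = 0) := by
  set S := {t | t ∈ Set.Icc 0 T ∧ (α t ∉ O ∨ g t ≤ 0)}
  have hne : S.Nonempty := hex
  have hbd : BddBelow S := ⟨0, fun t ht => ht.1.1⟩
  obtain ⟨t₁, ht₁⟩ := hne
  set τ := sInf S
  have hτ0 : 0 ≤ τ := le_csInf ⟨t₁, ht₁⟩ fun t ht => ht.1.1
  have hτT : τ ≤ T := (csInf_le hbd ht₁).trans ht₁.1.2
  have hlt : ∀ t ∈ Set.Ico 0 τ, α t ∈ O ∧ 0 < g t := fun t ht => by
    by_contra hcon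
    refine absurd (csInf_le hbd (show t ∈ S from ⟨⟨ht.1, ht.2.le.trans hτT⟩, ?_⟩)) (not_le.2 ht.2)
    by_contra h
    push Not at h
    exact hcon h
  have hmem : τ ∈ S := by
    by_contra hcon
    have hOg : α τ ∈ O ∧ 0 < g τ := by
      by_contra h
      refine hcon ⟨⟨hτ0, hτT⟩, ?_⟩
      by_contra h'
      push Not at h'
      exact h h'
    have h1 := (hα τ ⟨hτ0, hτT⟩).eventually (hO.mem_nhds hOg.1)
    have h2 := (hg τ ⟨hτ0, hτT⟩ (hOK hOg.1)).eventually (lt_mem_nhds hOg.2)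
    have h3 := eventually_nhdsWithin_iff.1 (h1.and h2)
    obtain ⟨t, ht, htS⟩ := ((mem_closure_iff_frequently.1 (csInf_mem_closure ⟨t₁, ht₁⟩ hbd)).and_eventually
      h3).exists
    rcases ht.2 with h | h
    · exact h (htS ht.1).1
    · exact absurd (htS ht.1).2 (not_lt.2 h)
  have hpos : 0 < τ := by
    refine hτ0.lt_of_ne fun h => ?_
    rw [← h] at hmem
    rcases hmem.2 with h | h
    · exact h h0
    · exact absurd hg0 (not_lt.2 h)
  have hcl : τ ∈ closure (Set.Ico 0 τ) := by
    rw [closure_Ico hpos.ne]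
    exact ⟨hτ0, le_rfl⟩
  have hsub : Set.Ico 0 τ ⊆ Set.Icc 0 T := fun t ht => ⟨ht.1, ht.2.le.trans hτT⟩
  have hτK : α τ ∈ K := by
    have := ((hα τ ⟨hτ0, hτT⟩).mono hsub).mem_closure hcl (fun t ht => hOK (hlt t ht).1)
    rwa [hK.closure_eq] at this
  have hgτ : 0 ≤ g τ := by
    have hm : Set.MapsTo g (Set.Ico 0 τ) (Set.Ioi 0) := fun t ht => (hlt t ht).2
    have := ((hg τ ⟨hτ0, hτT⟩ hτK).mono hsub).mem_closure hcl hm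
    rwa [closure_Ioi] at this
  refine ⟨τ, hpos, hτT, fun t ht => ?_, fun t ht => (hlt t ht).2, hgτ, fun h => ?_⟩
  · rcases eq_or_lt_of_le ht.2 with rfl | h
    · exact hτK
    · exact hOK (hlt t ⟨ht.1, h⟩).1
  · rcases hmem.2 with h' | h'
    · exact absurd h h'
    · exact le_antisymm h' hgτ

theorem le_sub_mul_of_hasDerivWithinAt {f f' : ℝ → ℝ} {b k : ℝ}
    (hf : ∀ t ∈ Set.Icc 0 b, HasDerivWithinAt f (f' t) (Set.Icc 0 b) t)
    (hk : ∀ t ∈ Set.Icc 0 b, f' t ≤ -k) {t : ℝ} (ht : t ∈ Set.Icc 0 b) : f t ≤ f 0 - k * t := by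
  have h : AntitoneOn (fun t => f t + k * t) (Set.Icc 0 b) := by
    refine antitoneOn_of_hasDerivWithinAt_nonpos (f' := fun t => f' t + k * 1) (convex_Icc _ _)
      (fun t ht => ((hf t ht).add ((hasDerivWithinAt_id _ _).const_mul k)).continuousWithinAt)
      (fun t ht => ?_) fun t ht => ?_
    · have ht' := interior_subset ht
      exact ((hf t ht').add ((hasDerivWithinAt_id _ _).const_mul k)).mono interior_subset
    · linarith [hk t (interior_subset ht)]
  have := h ⟨le_rfl, ht.1.trans ht.2⟩ ht ht.1
  simp only [mul_zero, add_zero] at this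
  linarith

variable {V : Phase → Phase} {m : Fin 4 → ℝ} {Φ : OpenPartialHomeomorph Phase Phase}
  {G₅ G₇ : (Fin 2 → ℝ) → MvPolynomial (Fin 4) ℝ} {u₀ : Base} {r₀ η C ε : ℝ} {ξ : State}

namespace FieldBounds

theorem abs_eval₅_le (h : FieldBounds V G₅ G₇ u₀ r₀ η C) {u : Base} (hu : ‖u - u₀‖ < η)
    (v : Fin 4 → ℝ) : |(G₅ u.energy).eval v| ≤ C * ‖v‖ ^ 5 := by
  have h0 : (G₅ u.energy).eval (0 : Fin 4 → ℝ) = 0 := by simpa using h.smul₅ u.energy 0 v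
  have := h.lip₅ u hu v 0
  rw [h0, sub_zero, norm_zero, add_zero, sub_zero] at this
  exact this.trans (le_of_eq (by ring))

theorem abs_eval₇_le (h : FieldBounds V G₅ G₇ u₀ r₀ η C) {u : Base} (hu : ‖u - u₀‖ < η)
    (v : Fin 4 → ℝ) : |(G₇ u.energy).eval v| ≤ C * ‖v‖ ^ 7 := by
  have h0 : (G₇ u.energy).eval (0 : Fin 4 → ℝ) = 0 := by simpa using h.smul₇ u.energy 0 v
  have := h.lip₇ u hu v 0
  rw [h0, sub_zero, norm_zero, add_zero, sub_zero] at this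
  exact this.trans (le_of_eq (by ring))

theorem abs_scaledKappa_sub_le (h : FieldBounds V G₅ G₇ u₀ r₀ η C) (hε : |ε| ≤ 1)
    (hu : ‖ξ.base - u₀‖ < η) (hv : ‖ξ.vec‖ ≤ 4) :
    |scaledKappa G₅ G₇ ε ξ - kappaLead ξ.vec| ≤ 20000 * C * |ε| := by
  have hC := h.C_pos
  have h5 : |(G₅ ξ.base.energy).eval ξ.vec| ≤ C * 4 ^ 5 :=
    (h.abs_eval₅_le hu _).trans (by gcongr)
  have h7 : |(G₇ ξ.base.energy).eval ξ.vec| ≤ C * 4 ^ 7 :=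
    (h.abs_eval₇_le hu _).trans (by gcongr)
  have e2 : |ε| ^ 2 ≤ |ε| := pow_le_of_le_one (abs_nonneg _) hε (by norm_num)
  have e4 : |ε| ^ 4 ≤ |ε| := pow_le_of_le_one (abs_nonneg _) hε (by norm_num)
  rw [scaledKappa, add_assoc, add_sub_cancel_left]
  refine (abs_add_le _ _).trans ?_
  rw [abs_mul, abs_mul, abs_pow, abs_pow]
  calc _ ≤ |ε| * (C * 4 ^ 5) + |ε| * (C * 4 ^ 7) := by gcongr
    -- The constant 20000 bounds `4⁵ + 4⁷`.
    _ ≤ _ := by nlinarith [mul_nonneg hC.le (abs_nonneg ε)]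

end FieldBounds

theorem kappaLead_vec : kappaLead ξ.vec = 6 * ξ.1 ^ 2 * ξ.2.1 + 2 * ξ.2.1 ^ 3 +
    3 * ξ.1 * (ξ.2.2.1 ^ 2 - ξ.2.2.2.1 ^ 2) + 3 * ξ.2.1 * (ξ.2.2.1 ^ 2 + ξ.2.2.2.1 ^ 2) := by
  simp [kappaLead, State.vec]
  ring

theorem norm_vec_le (h : ξ ∈ stateBox u₀ η) : ‖ξ.vec‖ ≤ 4 := by
  obtain ⟨h1, ⟨h2, h2'⟩, h3, h4, -⟩ := mem_stateBox.1 h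
  have h1' := abs_le.1 h1
  refine (pi_norm_le_iff_of_nonneg (by norm_num)).2 fun i => ?_
  fin_cases i
  · exact abs_le.2 ⟨by simp [State.vec]; linarith, by simp [State.vec]; linarith⟩
  · exact h3.trans (by norm_num)
  · exact abs_le.2 ⟨by simp [State.vec]; linarith, by simp [State.vec]; linarith⟩
  · exact h4.trans (by norm_num)

/-- If `κ` is close to its value on `Σ⁺` and the state has not passed `Σ⁻`, then the state is well
inside the box. -/
theorem bounds_of_scaledKappa {j₁ j₂ l₁ l₂ k : ℝ} (h1 : j₁ ≤ 1) (hl1 : |l₁| ≤ 101 / 100)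
    (hl2 : |l₂| ≤ 101 / 100) (hj : 1 / 50 ≤ j₂) (hk : |k - 6| ≤ 1 / 100)
    (hk' : |k - (6 * j₁ ^ 2 * j₂ + 2 * j₂ ^ 3 + 3 * j₁ * (l₁ ^ 2 - l₂ ^ 2) +
      3 * j₂ * (l₁ ^ 2 + l₂ ^ 2))| ≤ 1 / 100) (hg : 0 ≤ k + 6 * j₁ ^ 3) :
    -(11 / 10) < j₁ ∧ 1 / 50 < j₂ ∧ j₂ < 2 := by
  obtain ⟨k1, k2⟩ := abs_le.1 hk
  obtain ⟨k3, k4⟩ := abs_le.1 hk'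
  have a1 : l₁ ^ 2 ≤ 103 / 100 := by nlinarith [abs_nonneg l₁, sq_abs l₁]
  have a2 : l₂ ^ 2 ≤ 103 / 100 := by nlinarith [abs_nonneg l₂, sq_abs l₂]
  have b1 := sq_nonneg l₁
  have b2 := sq_nonneg l₂
  -- Before `Σ⁻` is crossed `6 j₁³ ≥ -k ≥ -6.01`, whereas `j₁ ≤ -1.1` would give `6 j₁³ < -7`.
  have c1 : -(11 / 10) < j₁ := by
    by_contra hcon
    push Not at hcon
    nlinarith [mul_nonneg (sub_nonneg.2 hcon) (sq_nonneg (j₁ - 11 / 10)), sq_nonneg (j₁ + 11 / 10)]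
  have c2 : |j₁ * (l₁ ^ 2 - l₂ ^ 2)| ≤ 11 / 10 * (103 / 100) := by
    rw [abs_mul]
    exact mul_le_mul (abs_le.2 ⟨c1.le, by linarith⟩) (abs_le.2 ⟨by linarith, by linarith⟩)
      (abs_nonneg _) (by norm_num)
  obtain ⟨d1, d2⟩ := abs_le.1 c2
  have c3 : j₁ ^ 2 ≤ 121 / 100 := by nlinarith
  refine ⟨c1, ?_, ?_⟩
  · by_contra hcon
    -- At the lower wall the leading cubic is below 4, since `3 j₁ (l₁² - l₂²)` is at most about
    -- 3.4, and cannot be close to 6. At the upper wall `2 j₂³ ≥ 16` is too large.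
    have e : j₂ = 1 / 50 := le_antisymm (not_lt.1 hcon) hj
    subst e
    nlinarith
  · by_contra hcon
    push Not at hcon
    have e1 : 0 ≤ j₂ * j₁ ^ 2 := by positivity
    have e2 : 0 ≤ j₂ * (l₁ ^ 2 + l₂ ^ 2) := by positivity
    have e3 : 8 ≤ j₂ ^ 3 := by
      calc (8 : ℝ) = 2 ^ 3 := by norm_num
        _ ≤ j₂ ^ 3 := by gcongr
    nlinarith

end
end SBC

/-! ### The rescaled orbit from Σ⁺ to Σ⁻ -/

namespace SBC
noncomputable section

variable {V : Phase → Phase} {m : Fin 4 → ℝ} {Φ : OpenPartialHomeomorph Phase Phase}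
  {G₅ G₇ : (Fin 2 → ℝ) → MvPolynomial (Fin 4) ℝ} {u₀ : Base} {r₀ η C ε : ℝ} {ξ : State}

theorem isOpen_interior_stateBox {S : Set State} (h : S = Set.Ioo (-2) 2 ×ˢ Set.Ioo (1 / 50) 2 ×ˢ
    Set.Ioo (-2) 2 ×ˢ Set.Ioo (-2) 2 ×ˢ Metric.ball u₀ (η / 2)) : IsOpen S := by
  rw [h]
  exact isOpen_Ioo.prod (isOpen_Ioo.prod (isOpen_Ioo.prod (isOpen_Ioo.prod Metric.isOpen_ball)))

/-- On `Σ⁻` the defect `k - 6` equals `-6 (j³ + 1)`, and the quadratic factor of `j³ + 1` is at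
least `3/4`. -/
theorem abs_add_one_le_of_cube {k j : ℝ} (h : k + 6 * j ^ 3 = 0) : |j + 1| ≤ |k - 6| := by
  have e : k - 6 = -((j + 1) * (6 * (j ^ 2 - j + 1))) := by linear_combination h
  have hq : 1 ≤ 6 * (j ^ 2 - j + 1) := by nlinarith [sq_nonneg (j - 1 / 2)]
  rw [e, abs_neg, abs_mul, abs_of_pos (a := 6 * (j ^ 2 - j + 1)) (by linarith)]
  exact le_mul_of_one_le_right (abs_nonneg _) hq

set_option maxHeartbeats 1000000 in
/-- The rescaled orbit from `Σ⁺` reaches `Σ⁻`, and `L` and `u` are almost conserved on the way. -/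
theorem FieldBounds.exists_transit (h : FieldBounds V G₅ G₇ u₀ r₀ η C) :
    ∃ a > 0, a ≤ 1 ∧ 6 * a ≤ r₀ ∧ ∃ D, ∀ ε, |ε| < a → ∀ ξ : State, ξ.1 = 1 → 1 / 20 ≤ ξ.2.1 →
      ξ.2.1 ≤ 1 → |ξ.2.2.1| ≤ 1 → |ξ.2.2.2.1| ≤ 1 → ‖ξ.base - u₀‖ < η / 4 →
      scaledKappa G₅ G₇ ε ξ = 6 →
      ∃ (s : ℝ) (c : ℝ → State), 0 < s ∧ c 0 = ξ ∧
        (∀ t ∈ Set.Icc 0 s, c t ∈ stateBox u₀ η ∧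
          HasDerivWithinAt c (stateField V ε (c t)) (Set.Icc 0 s) t) ∧
        (∀ t ∈ Set.Ico 0 s, scaledKappa G₅ G₇ ε (c t) ≠ 6 * (-1) * (c t).1 ^ 3) ∧
        scaledKappa G₅ G₇ ε (c s) = 6 * (-1) * (c s).1 ^ 3 ∧ (c s).1 ≤ -(1 / 2) ∧
        |(c s).1 + 1| ≤ D * |ε| ^ 7 ∧ |(c s).2.2.1 - ξ.2.2.1| ≤ D * |ε| ^ 8 ∧
        |(c s).2.2.2.1 - ξ.2.2.2.1| ≤ D * |ε| ^ 8 ∧ ‖(c s).base - ξ.base‖ ≤ D * |ε| ^ 8 := by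
  have hC := h.C_pos
  have hη := h.eta_pos
  have hr := h.r_pos
  set B := 50 * 6 ^ 11 * C * 301
  have hB : 0 < B := by positivity
  -- One summand for each smallness requirement on `ε`: the rate of `J₁`, drifts below `1/100` and
  -- below `η / 8`, the higher terms of `κ` below `1/100`, the polydisc, and `|ε| ≤ 1`.
  set M := 6480000 * C + 100 * B + 8 * B / η + 2000000 * C + 6 / r₀ + 1
  have hM : 1 ≤ M := by
    have : 0 ≤ 6480000 * C + 100 * B + 8 * B / η + 2000000 * C + 6 / r₀ := by positivity
    linarith
  have hM0 : 0 < M := by linarith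
  refine ⟨1 / M, by positivity, (div_le_one hM0).2 hM, ?_, B, ?_⟩
  · rw [mul_one_div, div_le_iff₀ hM0]
    have : 6 / r₀ ≤ M := by
      have : 0 ≤ 6480000 * C + 100 * B + 8 * B / η + 2000000 * C + 1 := by positivity
      linarith
    rwa [div_le_iff₀ hr, mul_comm] at this
  intro ε hε ξ hξ1 hξ2 hξ2' hξ3 hξ4 hξ5 hκ0
  have e0 := abs_nonneg ε
  have hεM : M * |ε| < 1 := by rwa [lt_div_iff₀ hM0, mul_comm] at hε
  have small : ∀ x, x ≤ M → x * |ε| ≤ 1 := fun x hx =>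
    (mul_le_mul_of_nonneg_right hx e0).trans hεM.le
  have p1 : 0 ≤ 6480000 * C := by positivity
  have p2 : 0 ≤ 100 * B := by positivity
  have p3 : 0 ≤ 8 * B / η := by positivity
  have p4 : 0 ≤ 2000000 * C := by positivity
  have p5 : 0 ≤ 6 / r₀ := by positivity
  have s0 : |ε| ≤ 1 := by simpa using small 1 hM
  have s1 := small (6480000 * C) (by simp only [M]; linarith)
  have s2 := small (100 * B) (by simp only [M]; linarith)
  have s3 := small (8 * B / η) (by simp only [M]; linarith)
  have s4 := small (2000000 * C) (by simp only [M]; linarith)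
  have s5 : 6 * |ε| < r₀ := by
    have : 6 / r₀ * |ε| < 1 :=
      (mul_le_mul_of_nonneg_right (by simp only [M]; linarith) e0).trans_lt hεM
    rwa [div_mul_eq_mul_div, div_lt_one hr] at this
  have s1' : 6480000 * C * ε ^ 2 ≤ 1 := by
    have : ε ^ 2 ≤ |ε| := by
      rw [← sq_abs]
      exact pow_le_of_le_one e0 s0 (by norm_num)
    exact (mul_le_mul_of_nonneg_left this p1).trans s1
  have s3' : B * |ε| ≤ η / 8 := by
    rw [div_mul_eq_mul_div, div_le_one hη] at s3
    linarith
  have e7 : |ε| ^ 7 ≤ |ε| := pow_le_of_le_one e0 s0 (by norm_num)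
  have e8 : |ε| ^ 8 ≤ |ε| := pow_le_of_le_one e0 s0 (by norm_num)
  obtain ⟨α, hα0, hαc, hα⟩ := exists_solution (isCompact_stateBox (u₀ := u₀) (η := η))
    (fun x hx => h.contDiffAt_stateField s5 hx) ξ (show (0 : ℝ) ≤ 301 by norm_num)
  set O : Set State := Set.Ioo (-2) 2 ×ˢ Set.Ioo (1 / 50) 2 ×ˢ
    Set.Ioo (-2) 2 ×ˢ Set.Ioo (-2) 2 ×ˢ Metric.ball u₀ (η / 2) with hO
  have hOK : O ⊆ stateBox u₀ η := Set.prod_mono Set.Ioo_subset_Icc_self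
    (Set.prod_mono Set.Ioo_subset_Icc_self (Set.prod_mono Set.Ioo_subset_Icc_self
      (Set.prod_mono Set.Ioo_subset_Icc_self Metric.ball_subset_closedBall)))
  have memO : ∀ x : State, x ∈ O ↔ |x.1| < 2 ∧ (1 / 50 < x.2.1 ∧ x.2.1 < 2) ∧ |x.2.2.1| < 2 ∧
      |x.2.2.2.1| < 2 ∧ ‖x.base - u₀‖ < η / 2 := fun x => by
    simp only [hO, Set.mem_prod, Set.mem_Ioo, Metric.mem_ball, dist_eq_norm, abs_lt]
    rfl
  -- Remaining in the box up to time 301 with rate at most `-1/100` would push `J₁` from 1 below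
  -- `-2`.
  have hex : ∃ t ∈ Set.Icc (0 : ℝ) 301, α t ∉ O ∨
      scaledKappa G₅ G₇ ε (α t) + 6 * (α t).1 ^ 3 ≤ 0 := by
    by_contra hcon
    push Not at hcon
    have hin : ∀ t ∈ Set.Icc (0 : ℝ) 301, α t ∈ stateBox u₀ η := fun t ht => hOK (hcon t ht).1
    have := le_sub_mul_of_hasDerivWithinAt (k := 1 / 100)
      (fun t ht => (hasDerivWithinAt_state_iff.1 (hα t ht (hin t ht))).1)
      (fun t ht => h.rate_le s5 s1' (hin t ht)) (show (301 : ℝ) ∈ Set.Icc 0 301 by norm_num)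
    rw [hα0, hξ1] at this
    have h2 := (abs_le.1 (mem_stateBox.1 (hin 301 (by norm_num))).1).1
    linarith
  have hcont : ∀ t ∈ Set.Icc (0 : ℝ) 301, α t ∈ stateBox u₀ η → ContinuousWithinAt
      (fun t => scaledKappa G₅ G₇ ε (α t) + 6 * (α t).1 ^ 3) (Set.Icc 0 301) t := fun t ht hK => by
    obtain ⟨d, hd, -⟩ := h.hasDerivWithinAt_scaledKappa s5 hK (hα t ht hK)
    exact hd.continuousWithinAt.add (((hαc t ht).fst.pow 3).const_mul 6)
  obtain ⟨s, hs, hs', hbox, hpos, hg0, hhit⟩ := exists_first_time hαc (isOpen_interior_stateBox hO)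
    isCompact_stateBox.isClosed hOK hcont
    ((memO _).2 (by
      rw [hα0, hξ1]
      refine ⟨by norm_num, ⟨by linarith, by linarith⟩, by linarith, by linarith, by linarith⟩))
    (by simp only [hα0, hκ0, hξ1]; norm_num) hex
  have hsub : Set.Icc 0 s ⊆ Set.Icc 0 301 := Set.Icc_subset_Icc_right hs'
  have hder : ∀ t ∈ Set.Icc 0 s, HasDerivWithinAt α (stateField V ε (α t)) (Set.Icc 0 s) t :=
    fun t ht => (hα t (hsub ht) (hbox t ht)).mono hsub
  have hss : s ∈ Set.Icc 0 s := ⟨hs.le, le_rfl⟩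
  have mean : ∀ {F : Type} [NormedAddCommGroup F] [NormedSpace ℝ F] {f f' : ℝ → F} {k : ℝ}
      {n : ℕ}, (∀ t ∈ Set.Icc 0 s, HasDerivWithinAt f (f' t) (Set.Icc 0 s) t) →
      (∀ t ∈ Set.Icc 0 s, ‖f' t‖ ≤ k * |ε| ^ n) → 0 ≤ k → k * 301 ≤ B →
      ‖f s - f 0‖ ≤ B * |ε| ^ n := by
    intro F _ _ f f' k n hf hf' hk hkB
    refine (norm_image_sub_le_of_norm_deriv_le_segment' hf
      (fun t ht => hf' t ⟨ht.1, ht.2.le⟩) s hss).trans ?_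
    rw [sub_zero]
    calc k * |ε| ^ n * s ≤ k * |ε| ^ n * 301 := by gcongr
      _ = k * 301 * |ε| ^ n := by ring
      _ ≤ B * |ε| ^ n := by gcongr
  have hk1 : 50 * 6 ^ 10 * C * 301 ≤ B := by simp only [B]; nlinarith
  have hb1 := mean (fun t ht => (hasDerivWithinAt_state_iff.1 (hder t ht)).2.2.1)
    (fun t ht => (h.abs_im_rate_le s5 (hbox t ht)).1) (by positivity) hk1
  have hb2 := mean (fun t ht => (hasDerivWithinAt_state_iff.1 (hder t ht)).2.2.2.1)
    (fun t ht => (h.abs_im_rate_le s5 (hbox t ht)).2.1) (by positivity) hk1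
  have hb3 := mean (fun t ht => (hasDerivWithinAt_state_iff.1 (hder t ht)).2.2.2.2)
    (fun t ht => (h.abs_im_rate_le s5 (hbox t ht)).2.2) (by positivity) hk1
  have hex' : ∀ t, ∃ d, t ∈ Set.Icc 0 s →
      HasDerivWithinAt (fun s => scaledKappa G₅ G₇ ε (α s)) d (Set.Icc 0 s) t ∧
      |d| ≤ 50 * 6 ^ 11 * C * |ε| ^ 7 := fun t => by
    by_cases ht : t ∈ Set.Icc 0 s
    · obtain ⟨d, hd⟩ := h.hasDerivWithinAt_scaledKappa s5 (hbox t ht) (hder t ht)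
      exact ⟨d, fun _ => hd⟩
    · exact ⟨0, fun h => absurd h ht⟩
  choose κ' hκ' using hex'
  have hb4 := mean (fun t ht => (hκ' t ht).1) (fun t ht => (hκ' t ht).2) (by positivity) le_rfl
  simp only [hα0] at hb1 hb2 hb3 hb4
  rw [hκ0] at hb4
  rw [Real.norm_eq_abs] at hb1 hb2 hb4
  have hj1 : (α s).1 ≤ 1 := by
    have := le_sub_mul_of_hasDerivWithinAt (k := 1 / 100)
      (fun t ht => (hasDerivWithinAt_state_iff.1 (hder t ht)).1)
      (fun t ht => h.rate_le s5 s1' (hbox t ht)) hss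
    rw [hα0, hξ1] at this
    linarith
  have hsm : B * |ε| ≤ 1 / 100 := by linarith
  have b7 : B * |ε| ^ 7 ≤ 1 / 100 := (mul_le_mul_of_nonneg_left e7 hB.le).trans hsm
  have b8 : B * |ε| ^ 8 ≤ 1 / 100 := (mul_le_mul_of_nonneg_left e8 hB.le).trans hsm
  have b8' : B * |ε| ^ 8 ≤ η / 8 := (mul_le_mul_of_nonneg_left e8 hB.le).trans s3'
  have hl1 : |(α s).2.2.1| ≤ 101 / 100 := by
    have := abs_sub_abs_le_abs_sub (α s).2.2.1 ξ.2.2.1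
    linarith
  have hl2 : |(α s).2.2.2.1| ≤ 101 / 100 := by
    have := abs_sub_abs_le_abs_sub (α s).2.2.2.1 ξ.2.2.2.1
    linarith
  have hv : ‖(α s).base - u₀‖ < η / 2 := by
    have : (α s).base - u₀ = ((α s).base - ξ.base) + (ξ.base - u₀) := by abel
    rw [this]
    exact (norm_add_le _ _).trans_lt (by linarith [hb3.trans b8'])
  have hpert := h.abs_scaledKappa_sub_le s0 (hv.trans (by linarith)) (norm_vec_le (hbox s hss))
  rw [kappaLead_vec] at hpert
  obtain ⟨k1, k2, k3⟩ := bounds_of_scaledKappa hj1 hl1 hl2 (mem_stateBox.1 (hbox s hss)).2.1.1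
    (hb4.trans b7) (hpert.trans (by linarith)) hg0
  -- At the stopping time the state is in the open box, so the orbit has stopped because it reached
  -- `Σ⁻`.
  have hzero := hhit ((memO _).2 ⟨abs_lt.2 ⟨by linarith, by linarith⟩, ⟨k2, k3⟩, by linarith,
    by linarith, hv⟩)
  have hj' : |(α s).1 + 1| ≤ B * |ε| ^ 7 := (abs_add_one_le_of_cube hzero).trans hb4
  refine ⟨s, α, hs, hα0, fun t ht => ⟨hbox t ht, hder t ht⟩, fun t ht hcon => ?_, by linarith, ?_,
    hj', hb1, hb2, hb3⟩
  · have := hpos t ht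
    linarith
  · linarith [(abs_le.1 (hj'.trans b7)).2]

end
end SBC

/-! ### The points of Σ⁺ with given coordinates -/

namespace SBC
noncomputable section

variable {V : Phase → Phase} {m : Fin 4 → ℝ} {Φ : OpenPartialHomeomorph Phase Phase}
  {G₅ G₇ : (Fin 2 → ℝ) → MvPolynomial (Fin 4) ℝ} {u₀ : Base} {r₀ η C ε : ℝ} {ξ : State}

/-- The state with `J₁ = ε` in the rescaled coordinates. -/
def startState (β δ : ℝ) (u : Base) (s : ℝ) : State := (1, s, β, δ, u)

/-- The scale is `ε = r_α`, so `J₁ = 1`. The only unknown is the rescaled `J₂ = 1 / α_γ`, which may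
have either sign and any size. -/
theorem exists_startState {r β δ : ℝ} {u : Base} {w : Chart} (hw : w.2.1 ≠ 0)
    (h : faceCoords 1 w = (r, β, δ, u)) :
    ∃ s, s ≠ 0 ∧ w = toChart r (startState β δ u s) := by
  obtain ⟨r', α, β', δ', u'⟩ := w
  simp only at hw
  simp only [faceCoords, one_mul, Prod.mk.injEq] at h
  obtain ⟨rfl, rfl, rfl, rfl⟩ := h
  refine ⟨α⁻¹, inv_ne_zero hw, ?_⟩
  simp [toChart, startState, State.base, hw]

theorem norm_vec_startState_le {β δ : ℝ} {u : Base} (hβ : |β| ≤ 1) (hδ : |δ| ≤ 1) (s : ℝ) :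
    ‖(startState β δ u s).vec‖ ≤ 1 + |s| := by
  have := abs_nonneg s
  refine (pi_norm_le_iff_of_nonneg (by positivity)).2 fun i => ?_
  fin_cases i
  · exact (abs_add_le 1 s).trans (by simp)
  · exact hβ.trans (by linarith)
  · exact (abs_sub 1 s).trans (by simp)
  · exact hδ.trans (by linarith)

theorem norm_vec_startState_sub_le {β δ s s' : ℝ} {u : Base} (h : s < s') :
    ‖(startState β δ u s').vec - (startState β δ u s).vec‖ ≤ s' - s := by
  refine (pi_norm_le_iff_of_nonneg (by linarith)).2 fun i => ?_
  fin_cases i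
  · simp [State.vec, startState, abs_of_pos (sub_pos.2 h)]
  · simp [State.vec, startState, h.le]
  · simp [State.vec, startState, abs_sub_comm s s', abs_of_pos (sub_pos.2 h)]
  · simp [State.vec, startState, h.le]

namespace FieldBounds

/-- The leading cubic in `s` has a difference quotient that grows quadratically in `s` and `s'`. The
higher terms involve larger powers, but `|r s|` and `|r s'|` are small: with `|r| A ≤ ρ` their
difference quotients are at most `C ρ A²` each. This covers arbitrarily large `s`, which uniqueness
in terms of the bound on `r_γ` demands. -/
theorem scaledKappa_startState_lt (h : FieldBounds V G₅ G₇ u₀ r₀ η C) {r β δ ρ s s' : ℝ} {u : Base}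
    (hρ : ρ ≤ 1) (hCρ : 6 * C * ρ ≤ 1) (hβ : |β| ≤ 1) (hδ : |δ| ≤ 1) (hu : ‖u - u₀‖ < η)
    (hr : |r| ≤ ρ / 4) (hs : |r * s| ≤ ρ / 4) (hs' : |r * s'| ≤ ρ / 4) (hss : s < s') :
    scaledKappa G₅ G₇ r (startState β δ u s) < scaledKappa G₅ G₇ r (startState β δ u s') := by
  have hC := h.C_pos
  have hρ0 : 0 ≤ ρ := by linarith [abs_nonneg r]
  obtain ⟨v, hv⟩ : ∃ v, v = (startState β δ u s).vec := ⟨_, rfl⟩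
  obtain ⟨v', hv'⟩ : ∃ v, v = (startState β δ u s').vec := ⟨_, rfl⟩
  have hn := norm_vec_startState_le (u := u) hβ hδ
  have hd : ‖v' - v‖ ≤ s' - s := hv ▸ hv' ▸ norm_vec_startState_sub_le hss
  obtain ⟨A, hAeq⟩ : ∃ A, A = 2 + |s| + |s'| := ⟨_, rfl⟩
  have hA : ‖v'‖ + ‖v‖ ≤ A := by
    rw [hAeq, hv, hv']
    linarith [hn s, hn s']
  have hA0 : 0 ≤ A := hAeq ▸ by positivity
  have hrA : |r| * A ≤ ρ := by
    rw [abs_mul] at hs hs'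
    rw [hAeq]
    linarith
  have hrA0 : 0 ≤ |r| * A := by positivity
  have h5 := h.lip₅ u hu v' v
  have h7 := h.lip₇ u hu v' v
  have d0 : 0 ≤ s' - s := by linarith
  have k5 : |r ^ 2 * ((G₅ u.energy).eval v' - (G₅ u.energy).eval v)| ≤
      C * ρ * A ^ 2 * (s' - s) := by
    rw [abs_mul, abs_pow]
    calc _ ≤ |r| ^ 2 * (C * A ^ 4 * (s' - s)) := by
          refine mul_le_mul_of_nonneg_left (h5.trans ?_) (by positivity)
          gcongr
      _ = C * (|r| * A) ^ 2 * A ^ 2 * (s' - s) := by ring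
      _ ≤ C * ρ * A ^ 2 * (s' - s) := by
          have : (|r| * A) ^ 2 ≤ ρ :=
            (pow_le_pow_left₀ hrA0 hrA 2).trans (pow_le_of_le_one hρ0 hρ (by norm_num))
          gcongr
  have k7 : |r ^ 4 * ((G₇ u.energy).eval v' - (G₇ u.energy).eval v)| ≤
      C * ρ * A ^ 2 * (s' - s) := by
    rw [abs_mul, abs_pow]
    calc _ ≤ |r| ^ 4 * (C * A ^ 6 * (s' - s)) := by
          refine mul_le_mul_of_nonneg_left (h7.trans ?_) (by positivity)
          gcongr
      _ = C * (|r| * A) ^ 4 * A ^ 2 * (s' - s) := by ring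
      _ ≤ C * ρ * A ^ 2 * (s' - s) := by
          have : (|r| * A) ^ 4 ≤ ρ :=
            (pow_le_pow_left₀ hrA0 hrA 4).trans (pow_le_of_le_one hρ0 hρ (by norm_num))
          gcongr
  have hlead : kappaLead v' - kappaLead v =
      (s' - s) * (6 + 2 * (s ^ 2 + s * s' + s' ^ 2) + 3 * (β ^ 2 + δ ^ 2)) := by
    rw [hv, hv', kappaLead_vec, kappaLead_vec]
    simp only [startState]
    ring
  have hA2 : 2 * (C * ρ * A ^ 2) < 6 + 2 * (s ^ 2 + s * s' + s' ^ 2) + 3 * (β ^ 2 + δ ^ 2) := by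
    have e1 : A ^ 2 ≤ 3 * (4 + s ^ 2 + s' ^ 2) := by
      rw [hAeq, ← sq_abs s, ← sq_abs s']
      linarith [sq_nonneg (2 - |s|), sq_nonneg (2 - |s'|), sq_nonneg (|s| - |s'|)]
    have e2 : 2 * (C * ρ * A ^ 2) ≤ 2 * (C * ρ * (3 * (4 + s ^ 2 + s' ^ 2))) := by gcongr
    have e3 : 6 * C * ρ * (4 + s ^ 2 + s' ^ 2) ≤ 1 * (4 + s ^ 2 + s' ^ 2) := by gcongr
    linarith [sq_nonneg (s + s'), sq_nonneg β, sq_nonneg δ, sq_nonneg s, sq_nonneg s']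
  have hmain := mul_lt_mul_of_pos_left hA2 (sub_pos.2 hss)
  have b5 := (abs_le.1 k5).1
  have b7 := (abs_le.1 k7).1
  have eb : ∀ s, (startState β δ u s).base = u := fun _ => rfl
  rw [scaledKappa, scaledKappa, eb, eb, ← hv, ← hv']
  linarith

theorem continuous_scaledKappa_startState {r β δ : ℝ} {u : Base} :
    Continuous fun s => scaledKappa G₅ G₇ r (startState β δ u s) := by
  have hv : Continuous fun s => (startState β δ u s).vec := by
    refine continuous_pi fun i => ?_
    fin_cases i <;> simp [startState, State.vec] <;> fun_prop
  have hl : Continuous kappaLead := by unfold kappaLead; fun_prop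
  exact ((hl.comp hv).add (continuous_const.mul
    ((MvPolynomial.continuous_eval (G₅ u.energy)).comp hv))).add
    (continuous_const.mul ((MvPolynomial.continuous_eval (G₇ u.energy)).comp hv))

/-- Existence is the intermediate value theorem on `[1/20, 1]`, uniqueness the strict monotonicity.
The bound `b` on `r_γ = r s` expresses nearness to the collision manifold. -/
theorem exists_start (h : FieldBounds V G₅ G₇ u₀ r₀ η C) :
    ∃ b > 0, ∀ (r β δ : ℝ) (u : Base), |r| < b → |β| ≤ 1 → |δ| ≤ 1 → ‖u - u₀‖ < η →
      ∃ s, 1 / 20 ≤ s ∧ s ≤ 1 ∧ |r * s| < b ∧ scaledKappa G₅ G₇ r (startState β δ u s) = 6 ∧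
        ∀ s', |r * s'| < b → scaledKappa G₅ G₇ r (startState β δ u s') = 6 → s' = s := by
  have hC := h.C_pos
  -- This makes the higher terms of `κ` at most `20000 C ρ / 4 ≤ 1/2` on the interval and gives `6 C
  -- ρ ≤ 1` for the monotonicity.
  obtain ⟨ρ, hρ, hρ1, hCρ⟩ : ∃ ρ : ℝ, 0 < ρ ∧ ρ ≤ 1 ∧ 10000 * (C * ρ) ≤ 1 := by
    have hden : 0 < 10000 * C + 1 := by positivity
    refine ⟨1 / (10000 * C + 1), by positivity, (div_le_one hden).2 (by linarith), ?_⟩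
    rw [mul_one_div, mul_div_assoc', div_le_one hden]
    linarith
  have hCρ0 : 0 < C * ρ := by positivity
  refine ⟨ρ / 4, by positivity, fun r β δ u hr hβ hδ hu => ?_⟩
  have hβ2 : β ^ 2 ≤ 1 := by nlinarith [sq_abs β, abs_nonneg β]
  have hδ2 : δ ^ 2 ≤ 1 := by nlinarith [sq_abs δ, abs_nonneg δ]
  have hpert : ∀ s ∈ Set.Icc (1 / 20 : ℝ) 1,
      |scaledKappa G₅ G₇ r (startState β δ u s) - kappaLead (startState β δ u s).vec| ≤ 1 / 2 := by
    intro s hs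
    have hn : ‖(startState β δ u s).vec‖ ≤ 4 :=
      (norm_vec_startState_le hβ hδ s).trans
        (by rw [abs_of_pos (by linarith [hs.1])]; linarith [hs.2])
    refine (h.abs_scaledKappa_sub_le (ξ := startState β δ u s) (by linarith) hu hn).trans ?_
    have : C * |r| ≤ C * (ρ / 4) := by gcongr
    linarith
  -- The leading cubic is at most 4 at `1/20` and at least 8 at `1`, whatever `β` and `δ`; a
  -- perturbation by `1/2` leaves 6 in between.
  have hlo : scaledKappa G₅ G₇ r (startState β δ u (1 / 20)) ≤ 6 := by
    have := (abs_le.1 (hpert (1 / 20) ⟨le_rfl, by norm_num⟩)).2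
    rw [kappaLead_vec] at this
    have e : 6 * (1 : ℝ) ^ 2 * (1 / 20) + 2 * (1 / 20) ^ 3 + 3 * 1 * (β ^ 2 - δ ^ 2) +
      3 * (1 / 20) * (β ^ 2 + δ ^ 2) ≤ 4 := by linarith [sq_nonneg δ]
    exact (sub_le_iff_le_add.1 this).trans ((add_le_add_right e _).trans (by norm_num))
  have hhi : 6 ≤ scaledKappa G₅ G₇ r (startState β δ u 1) := by
    have := (abs_le.1 (hpert 1 ⟨by norm_num, le_rfl⟩)).1
    rw [kappaLead_vec] at this
    have e : 8 ≤ 6 * (1 : ℝ) ^ 2 * 1 + 2 * 1 ^ 3 + 3 * 1 * (β ^ 2 - δ ^ 2) +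
      3 * 1 * (β ^ 2 + δ ^ 2) := by linarith [sq_nonneg β]
    have e' := le_sub_iff_add_le.1 this
    exact le_trans (by linarith : (6 : ℝ) ≤ -(1 / 2) + 8) ((add_le_add_right e _).trans e')
  obtain ⟨s, hs, hs6⟩ := intermediate_value_Icc (by norm_num)
    (continuous_scaledKappa_startState.continuousOn) ⟨hlo, hhi⟩
  have hrs : |r * s| < ρ / 4 := by
    rw [abs_mul, abs_of_pos (a := s) (by linarith [hs.1])]
    exact (mul_le_of_le_one_right (abs_nonneg _) hs.2).trans_lt hr
  refine ⟨s, hs.1, hs.2, hrs, hs6, fun s' hs' h6 => ?_⟩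
  have h6C : 6 * C * ρ ≤ 1 := by linarith
  simp only at hs6
  rcases lt_trichotomy s' s with hlt | heq | hgt
  · have := h.scaledKappa_startState_lt hρ1 h6C hβ hδ hu hr.le hs'.le hrs.le hlt
    linarith
  · exact heq
  · have := h.scaledKappa_startState_lt hρ1 h6C hβ hδ hu hr.le hrs.le hs'.le hgt
    linarith

end FieldBounds

end
end SBC

/-! ### Regularity of the desingularised field across r = 0 -/

namespace SBC
noncomputable section

variable {m : Fin 4 → ℝ} {Φ : OpenPartialHomeomorph Phase Phase}
  {G₅ G₇ : (Fin 2 → ℝ) → MvPolynomial (Fin 4) ℝ} {u₀ : Base} {r₀ η C ε : ℝ} {ξ : State}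

/-- The polynomial extension of the desingularised field off the collision manifold `r = 0`. -/
def collisionField (x : Chart) : Chart :=
  (0, 1 + 3 * x.2.1 ^ 2 + (x.2.2.1 ^ 2 + x.2.2.2.1 ^ 2) / 2 +
      x.2.1 * (x.2.2.1 ^ 2 - x.2.2.2.1 ^ 2) / 2,
    x.2.2.1 * (2 * x.2.1 + (x.2.2.1 ^ 2 - x.2.2.2.1 ^ 2) / 2),
    x.2.2.2.1 * (2 * x.2.1 + (x.2.2.1 ^ 2 - x.2.2.2.1 ^ 2) / 2), 0)

theorem blowUpField_of_eq_zero {x : Chart} (h : x.1 = 0) : blowUpField m Φ x = collisionField x := by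
  obtain ⟨r, α, β, δ, u⟩ := x
  simp only at h
  simp [blowUpField, collisionField, h]

theorem contDiff_blowDown : ContDiff ℝ ∞ blowDown := by
  refine ContDiff.prodMk (contDiff_pi.2 fun i => ?_) (by fun_prop)
  have key : ∀ a b : Chart → ℝ, ContDiff ℝ ∞ a → ContDiff ℝ ∞ b →
      ContDiff ℝ ∞ (fun ξ => (⟨a ξ, b ξ⟩ : ℂ)) := fun a b ha hb =>
    Complex.equivRealProdCLM.symm.contDiff.comp (ha.prodMk hb)
  fin_cases i
  · exact key _ _ (by fun_prop) (by fun_prop)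
  · exact key _ _ (by fun_prop) (by fun_prop)

theorem contDiffAt_blowUpField {x : Chart} (hx : x.1 ≠ 0)
    (hV : ContDiffAt ℝ 1 (transformedField m Φ) (blowDown x)) :
    ContDiffAt ℝ 1 (blowUpField m Φ) x := by
  have hW : ContDiffAt ℝ 1 (fun x => transformedField m Φ (blowDown x)) x :=
    hV.comp x (contDiff_blowDown.contDiffAt.of_le (by norm_cast))
  have hre : ∀ j, ContDiffAt ℝ 1 (fun x => ((transformedField m Φ (blowDown x)).1 j).re) x := fun j =>
    (Complex.reCLM ∘L ContinuousLinearMap.proj (R := ℝ) (φ := fun _ : Fin 2 => ℂ) j ∘L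
      ContinuousLinearMap.fst ℝ (Fin 2 → ℂ) Base).contDiff.contDiffAt.comp x hW
  have him : ∀ j, ContDiffAt ℝ 1 (fun x => ((transformedField m Φ (blowDown x)).1 j).im) x := fun j =>
    (Complex.imCLM ∘L ContinuousLinearMap.proj (R := ℝ) (φ := fun _ : Fin 2 => ℂ) j ∘L
      ContinuousLinearMap.fst ℝ (Fin 2 → ℂ) Base).contDiff.contDiffAt.comp x hW
  have h1 : ContDiffAt ℝ 1 (fun x => (((transformedField m Φ (blowDown x)).1 0).re +
      ((transformedField m Φ (blowDown x)).1 1).re) / 2) x := ((hre 0).add (hre 1)).div_const 2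
  have h2 : ContDiffAt ℝ 1 (fun x => (((transformedField m Φ (blowDown x)).1 0).re -
      ((transformedField m Φ (blowDown x)).1 1).re) / 2) x := ((hre 0).sub (hre 1)).div_const 2
  have hr : ContDiffAt ℝ 1 (fun x : Chart => x.1) x := by fun_prop
  have key : ContDiffAt ℝ 1 (fun x : Chart => x.1⁻¹ •
      (((((transformedField m Φ (blowDown x)).1 0).re -
          ((transformedField m Φ (blowDown x)).1 1).re) / 2,
        ((((transformedField m Φ (blowDown x)).1 0).re +
          ((transformedField m Φ (blowDown x)).1 1).re) / 2 - x.2.1 *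
          ((((transformedField m Φ (blowDown x)).1 0).re -
          ((transformedField m Φ (blowDown x)).1 1).re) / 2)) / x.1,
        (((transformedField m Φ (blowDown x)).1 0).im - x.2.2.1 *
          ((((transformedField m Φ (blowDown x)).1 0).re -
          ((transformedField m Φ (blowDown x)).1 1).re) / 2)) / x.1,
        (((transformedField m Φ (blowDown x)).1 1).im - x.2.2.2.1 *
          ((((transformedField m Φ (blowDown x)).1 0).re -
          ((transformedField m Φ (blowDown x)).1 1).re) / 2)) / x.1,
        (transformedField m Φ (blowDown x)).2) : Chart)) x := by
    refine ContDiffAt.smul (f := fun x : Chart => x.1⁻¹) (hr.inv hx) (ContDiffAt.prodMk h2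
      (ContDiffAt.prodMk (ContDiffAt.div (h1.sub (ContDiffAt.mul (by fun_prop) h2)) hr hx)
      (ContDiffAt.prodMk (ContDiffAt.div ((him 0).sub (ContDiffAt.mul (by fun_prop) h2)) hr hx)
      (ContDiffAt.prodMk (ContDiffAt.div ((him 1).sub (ContDiffAt.mul (by fun_prop) h2)) hr hx)
      hW.snd))))
  refine key.congr_of_eventuallyEq ?_
  filter_upwards [hr.continuousAt.eventually_ne hx] with y hy
  obtain ⟨r, α, β, δ, u⟩ := y
  simp only at hy
  simp only [blowUpField, hy, if_false]

theorem norm_blowDown_fst_le {x : Chart} {R : ℝ} (h1 : |x.2.1| ≤ R) (h2 : |x.2.2.1| ≤ R)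
    (h3 : |x.2.2.2.1| ≤ R) (hR : 1 ≤ R) : ‖(blowDown x).1‖ ≤ 3 * R * |x.1| := by
  have key : ∀ a b : ℝ, |a| ≤ 2 * R → |b| ≤ R → ‖(⟨x.1 * a, x.1 * b⟩ : ℂ)‖ ≤ 3 * R * |x.1| :=
    fun a b ha hb => by
      refine (Complex.norm_le_abs_re_add_abs_im _).trans ?_
      simp only [abs_mul]
      nlinarith [abs_nonneg x.1]
  have h1' := abs_le.1 h1
  refine (pi_norm_le_iff_of_nonneg (by positivity)).2 fun i => ?_
  fin_cases i
  · exact key _ _ (abs_le.2 ⟨by linarith, by linarith⟩) h2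
  · exact key _ _ (abs_le.2 ⟨by linarith, by linarith⟩) h3

/-- Error estimate for a quotient of rates in the `γ`-chart. -/
theorem abs_quotient_sub_le {r a p q e₁ e₂ R M : ℝ} (hr : r ≠ 0) (ha : |a| ≤ R)
    (h1 : |e₁| ≤ M * |r| ^ 3) (h2 : |e₂| ≤ M * |r| ^ 3) :
    |r⁻¹ * ((r ^ 2 * p + e₁ - a * (r ^ 2 * q + e₂)) / r) - (p - a * q)| ≤ M * (1 + R) * |r| := by
  have hr0 : 0 < |r| := abs_pos.2 hr
  have e : r⁻¹ * ((r ^ 2 * p + e₁ - a * (r ^ 2 * q + e₂)) / r) - (p - a * q) =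
      (e₁ - a * e₂) / r ^ 2 := by
    field_simp
    ring
  rw [e, abs_div, abs_pow, div_le_iff₀ (by positivity)]
  calc |e₁ - a * e₂| ≤ |e₁| + |a| * |e₂| := by rw [← abs_mul]; exact abs_sub _ _
    _ ≤ M * |r| ^ 3 + R * (M * |r| ^ 3) :=
        add_le_add h1 (mul_le_mul ha h2 (abs_nonneg _) ((abs_nonneg _).trans ha))
    _ = _ := by ring

theorem norm_rates_sub_le {r a b d R M p₀ p₁ q₀ q₁ : ℝ} {u W : Base} (hr : r ≠ 0) (hr1 : |r| ≤ 1)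
    (hR : 1 ≤ R) (hM : 0 ≤ M) (ha : |a| ≤ R) (hb : |b| ≤ R) (hd : |d| ≤ R)
    (hp₀ : |p₀ - r ^ 2 * ((a - 1) ^ 2 + d ^ 2)| ≤ M * |r| ^ 3)
    (hp₁ : |p₁ - r ^ 2 * ((a + 1) ^ 2 + b ^ 2)| ≤ M * |r| ^ 3)
    (hq₀ : |q₀| ≤ M * |r| ^ 3) (hq₁ : |q₁| ≤ M * |r| ^ 3) (hW : ‖W‖ ≤ M * |r| ^ 3) :
    ‖(r⁻¹ • (((p₀ - p₁) / 2, ((p₀ + p₁) / 2 - a * ((p₀ - p₁) / 2)) / r,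
      (q₀ - b * ((p₀ - p₁) / 2)) / r, (q₁ - d * ((p₀ - p₁) / 2)) / r, W) : Chart)) -
      collisionField (r, a, b, d, u)‖ ≤ (2 * R + R ^ 2 + M * (1 + R)) * |r| := by
  have hr0 : 0 < |r| := abs_pos.2 hr
  obtain ⟨e₀, he₀⟩ : ∃ e, e = p₀ - r ^ 2 * ((a - 1) ^ 2 + d ^ 2) := ⟨_, rfl⟩
  obtain ⟨e₁, he₁⟩ : ∃ e, e = p₁ - r ^ 2 * ((a + 1) ^ 2 + b ^ 2) := ⟨_, rfl⟩
  rw [← he₀] at hp₀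
  rw [← he₁] at hp₁
  have eJ₁ : (p₀ + p₁) / 2 = r ^ 2 * (a ^ 2 + 1 + (b ^ 2 + d ^ 2) / 2) + (e₀ + e₁) / 2 := by
    rw [he₀, he₁]; ring
  have eJ₂ : (p₀ - p₁) / 2 = r ^ 2 * (-2 * a - (b ^ 2 - d ^ 2) / 2) + (e₀ - e₁) / 2 := by
    rw [he₀, he₁]; ring
  have f1 : |(e₀ + e₁) / 2| ≤ M * |r| ^ 3 := by
    rw [abs_div, abs_two]
    linarith [abs_add_le e₀ e₁]
  have f2 : |(e₀ - e₁) / 2| ≤ M * |r| ^ 3 := by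
    rw [abs_div, abs_two]
    linarith [abs_sub e₀ e₁]
  have hle : M * (1 + R) * |r| ≤ (2 * R + R ^ 2 + M * (1 + R)) * |r| := by
    refine mul_le_mul_of_nonneg_right ?_ hr0.le
    linarith [sq_nonneg R]
  have q2 : M * |r| ^ 3 ≤ M * (1 + R) * |r| ^ 2 := by
    have h3 : |r| ^ 3 ≤ |r| ^ 2 := pow_le_pow_of_le_one hr0.le hr1 (by norm_num)
    have h4 : M ≤ M * (1 + R) := le_mul_of_one_le_right hM (by linarith)
    gcongr
  rw [eJ₁, eJ₂]
  refine max_le ?_ (max_le ?_ (max_le ?_ (max_le ?_ ?_)))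
  · have : |r⁻¹ * (r ^ 2 * (-2 * a - (b ^ 2 - d ^ 2) / 2) + (e₀ - e₁) / 2) - 0| ≤
        (2 * R + R ^ 2 + M * (1 + R)) * |r| := by
      rw [sub_zero, abs_mul, abs_inv, inv_mul_le_iff₀ hr0]
      have q1 : |-2 * a - (b ^ 2 - d ^ 2) / 2| ≤ 2 * R + R ^ 2 := by
        have b1 := abs_le.1 ha
        have b2 := sq_le_sq' (abs_le.1 hb).1 (abs_le.1 hb).2
        have b3 := sq_le_sq' (abs_le.1 hd).1 (abs_le.1 hd).2
        exact abs_le.2 ⟨by linarith [sq_nonneg d, sq_nonneg b, sq_nonneg R],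
          by linarith [sq_nonneg d, sq_nonneg b, sq_nonneg R]⟩
      calc _ ≤ |r| ^ 2 * |-2 * a - (b ^ 2 - d ^ 2) / 2| + |(e₀ - e₁) / 2| := by
            rw [← abs_pow, ← abs_mul]
            exact abs_add_le _ _
        _ ≤ |r| ^ 2 * (2 * R + R ^ 2) + M * (1 + R) * |r| ^ 2 :=
            add_le_add (by gcongr) (f2.trans q2)
        _ = _ := by ring
    exact this
  · have := abs_quotient_sub_le hr ha f1 f2 (p := a ^ 2 + 1 + (b ^ 2 + d ^ 2) / 2)
      (q := -2 * a - (b ^ 2 - d ^ 2) / 2)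
    rw [show a ^ 2 + 1 + (b ^ 2 + d ^ 2) / 2 - a * (-2 * a - (b ^ 2 - d ^ 2) / 2) =
      1 + 3 * a ^ 2 + (b ^ 2 + d ^ 2) / 2 + a * (b ^ 2 - d ^ 2) / 2 by ring] at this
    exact this.trans hle
  · have := abs_quotient_sub_le hr hb hq₀ f2 (p := 0) (q := -2 * a - (b ^ 2 - d ^ 2) / 2)
    rw [mul_zero, zero_add, show 0 - b * (-2 * a - (b ^ 2 - d ^ 2) / 2) =
      b * (2 * a + (b ^ 2 - d ^ 2) / 2) by ring] at this
    exact this.trans hle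
  · have := abs_quotient_sub_le hr hd hq₁ f2 (p := 0) (q := -2 * a - (b ^ 2 - d ^ 2) / 2)
    rw [mul_zero, zero_add, show 0 - d * (-2 * a - (b ^ 2 - d ^ 2) / 2) =
      d * (2 * a + (b ^ 2 - d ^ 2) / 2) by ring] at this
    exact this.trans hle
  · have : ‖r⁻¹ • W - 0‖ ≤ M * (1 + R) * |r| := by
      rw [sub_zero, norm_smul, norm_inv, Real.norm_eq_abs, inv_mul_le_iff₀ hr0]
      exact (hW.trans q2).trans (le_of_eq (by ring))
    exact this.trans hle

/-- The pulled-back field is quadratic up to errors of order at least 4 in `r`. Dividing by `r²`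
leaves the collision field in the `α`, `β`, `δ` components up to `O(r)`; the `r` and base components
are `O(r)` themselves. -/
theorem FieldBounds.blowUpField_sub_collisionField
    (h : FieldBounds (transformedField m Φ) G₅ G₇ u₀ r₀ η C) {x : Chart} {R : ℝ}
    (h1 : |x.2.1| ≤ R) (h2 : |x.2.2.1| ≤ R) (h3 : |x.2.2.2.1| ≤ R) (hR : 1 ≤ R)
    (hx : 3 * R * |x.1| < r₀) (hx1 : |x.1| ≤ 1) (hu : ‖x.2.2.2.2 - u₀‖ < η) :
    ‖blowUpField m Φ x - collisionField x‖ ≤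
      (2 * R + R ^ 2 + C * (3 * R) ^ 10 * (1 + R)) * |x.1| := by
  have hC := h.C_pos
  rcases eq_or_ne x.1 0 with h0 | h0
  · rw [blowUpField_of_eq_zero h0, h0]
    simp
  have hr0 : 0 < |x.1| := abs_pos.2 h0
  have hn := norm_blowDown_fst_le h1 h2 h3 hR
  have hQ1 := hn.trans_lt hx
  have hQ2 : ‖(blowDown x).2 - u₀‖ < η := hu
  have n0 : ‖(blowDown x).1 0‖ ^ 2 = x.1 ^ 2 * ((x.2.1 + 1) ^ 2 + x.2.2.1 ^ 2) := by
    rw [norm_sq_eq]; simp [blowDown]; ring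
  have n1 : ‖(blowDown x).1 1‖ ^ 2 = x.1 ^ 2 * ((x.2.1 - 1) ^ 2 + x.2.2.2.1 ^ 2) := by
    rw [norm_sq_eq]; simp [blowDown]; ring
  have hpow : ∀ k, 3 ≤ k → k ≤ 10 →
      C * ‖(blowDown x).1‖ ^ k ≤ C * (3 * R) ^ 10 * |x.1| ^ 3 := fun k hk hk' => by
    calc C * ‖(blowDown x).1‖ ^ k ≤ C * (3 * R * |x.1|) ^ k := by gcongr
      _ = C * (3 * R) ^ k * |x.1| ^ k := by ring
      _ ≤ C * (3 * R) ^ 10 * |x.1| ^ 3 := by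
        have e1 : (3 * R) ^ k ≤ (3 * R) ^ 10 := pow_le_pow_right₀ (by linarith) hk'
        have e2 : |x.1| ^ k ≤ |x.1| ^ 3 := pow_le_pow_of_le_one hr0.le hx1 hk
        gcongr
  have k0 := (h.re _ hQ1 hQ2 0).trans (hpow 4 (by norm_num) (by norm_num))
  have k1 := (h.re _ hQ1 hQ2 1).trans (hpow 4 (by norm_num) (by norm_num))
  rw [show Fin.rev (0 : Fin 2) = 1 from rfl, n1] at k0
  rw [show Fin.rev (1 : Fin 2) = 0 from rfl, n0] at k1
  have hY := norm_rates_sub_le (u := x.2.2.2.2) h0 hx1 hR (by positivity) h1 h2 h3 k0 k1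
    ((h.im _ hQ1 hQ2 0).trans (hpow 10 (by norm_num) le_rfl))
    ((h.im _ hQ1 hQ2 1).trans (hpow 10 (by norm_num) le_rfl))
    ((h.base _ hQ1 hQ2).trans (hpow 9 (by norm_num) (by norm_num)))
  refine le_trans (le_of_eq ?_) hY
  obtain ⟨r, α, β, δ, u⟩ := x
  simp only at h0
  simp only [blowUpField, h0, if_false]

/-- The desingularised field is Lipschitz at the points of an orbit in the rescaled box. -/
theorem FieldBounds.exists_lipschitz (h : FieldBounds (transformedField m Φ) G₅ G₇ u₀ r₀ η C)
    (hε : 6 * |ε| < r₀) (hξ : ξ ∈ stateBox u₀ η) :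
    ∃ K, ∃ U ∈ 𝓝 (toChart ε ξ), ∀ ζ : State, toChart ε ζ ∈ U → ∀ x ∈ U,
      ‖blowUpField m Φ (toChart ε ζ) - blowUpField m Φ x‖ ≤ K * ‖toChart ε ζ - x‖ := by
  have hj : ξ.2.1 ≠ 0 := by linarith [(mem_stateBox.1 hξ).2.1.1]
  rcases eq_or_ne ε 0 with rfl | hε0
  · obtain ⟨w, hw⟩ : ∃ w, w = toChart 0 ξ := ⟨_, rfl⟩
    have hw1 : w.1 = 0 := by simp [hw, toChart]
    have hu : ‖w.2.2.2.2 - u₀‖ < η := by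
      rw [hw]
      exact (h.scaleDown_mem hε hξ).2
    have hcol : ContDiff ℝ 1 collisionField := by
      unfold collisionField
      fun_prop
    obtain ⟨K, U, hU, hK⟩ := (hcol.contDiffAt (x := w)).exists_lipschitzOnWith
    obtain ⟨R, hR⟩ : ∃ R, R = |w.2.1| + |w.2.2.1| + |w.2.2.2.1| + 1 := ⟨_, rfl⟩
    have n1 := abs_nonneg w.2.1
    have n2 := abs_nonneg w.2.2.1
    have n3 := abs_nonneg w.2.2.2.1
    have h1 : ∀ᶠ x : Chart in 𝓝 w, |x.2.1| < R :=
      ContinuousAt.eventually_lt (f := fun x : Chart => |x.2.1|) (by fun_prop) continuousAt_const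
        (by rw [hR]; linarith)
    have h2 : ∀ᶠ x : Chart in 𝓝 w, |x.2.2.1| < R :=
      ContinuousAt.eventually_lt (f := fun x : Chart => |x.2.2.1|) (by fun_prop) continuousAt_const
        (by rw [hR]; linarith)
    have h3 : ∀ᶠ x : Chart in 𝓝 w, |x.2.2.2.1| < R :=
      ContinuousAt.eventually_lt (f := fun x : Chart => |x.2.2.2.1|) (by fun_prop)
        continuousAt_const (by rw [hR]; linarith)
    have h4 : ∀ᶠ x : Chart in 𝓝 w, 3 * R * |x.1| < r₀ :=
      ContinuousAt.eventually_lt (f := fun x : Chart => 3 * R * |x.1|) (by fun_prop)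
        continuousAt_const (by simpa [hw1] using h.r_pos)
    have h5 : ∀ᶠ x : Chart in 𝓝 w, |x.1| < 1 :=
      ContinuousAt.eventually_lt (f := fun x : Chart => |x.1|) (by fun_prop)
        continuousAt_const (by simp [hw1])
    have h6 : ∀ᶠ x : Chart in 𝓝 w, ‖x.2.2.2.2 - u₀‖ < η :=
      ContinuousAt.eventually_lt (f := fun x : Chart => ‖x.2.2.2.2 - u₀‖) (by fun_prop)
        continuousAt_const hu
    have hall := ((h1.and h2).and (h3.and h4)).and (h5.and h6)
    rw [← hw]
    -- On the collision manifold the field is the polynomial `collisionField`, which is Lipschitz.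
    -- At the other point the deviation is bounded by a multiple of its `r`, hence of the distance
    -- between the points.
    refine ⟨K + (2 * R + R ^ 2 + C * (3 * R) ^ 10 * (1 + R)), _, inter_mem hU hall,
      fun ζ hζ x hx => ?_⟩
    have hp1 : (toChart 0 ζ).1 = 0 := by simp [toChart]
    have hb := h.blowUpField_sub_collisionField hx.2.1.1.1.le hx.2.1.1.2.le hx.2.1.2.1.le
      (by rw [hR]; linarith) hx.2.1.2.2 hx.2.2.1.le hx.2.2.2
    have hl := hK.dist_le_mul _ hζ.1 _ hx.1
    rw [dist_eq_norm, dist_eq_norm] at hl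
    have hx1 : |x.1| ≤ ‖toChart 0 ζ - x‖ := by
      have : ‖(toChart 0 ζ - x).1‖ ≤ ‖toChart 0 ζ - x‖ := norm_fst_le _
      rwa [Prod.fst_sub, hp1, zero_sub, norm_neg] at this
    have hCp := h.C_pos
    have hRp : 0 ≤ 2 * R + R ^ 2 + C * (3 * R) ^ 10 * (1 + R) := by
      have : 0 ≤ R := by rw [hR]; linarith
      positivity
    rw [blowUpField_of_eq_zero hp1]
    calc _ = ‖(collisionField (toChart 0 ζ) - collisionField x) -
          (blowUpField m Φ x - collisionField x)‖ := by congr 1; abel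
      _ ≤ _ := norm_sub_le _ _
      _ ≤ K * ‖toChart 0 ζ - x‖ + _ * ‖toChart 0 ζ - x‖ :=
          add_le_add hl (hb.trans (mul_le_mul_of_nonneg_left hx1 hRp))
      _ = _ := by ring
  · have hs := h.scaleDown_mem hε hξ
    have hw1 : (toChart ε ξ).1 ≠ 0 := mul_ne_zero hε0 hj
    have hV := h.smooth _ hs.1 hs.2
    rw [← blowDown_toChart hj] at hV
    obtain ⟨K, U, hU, hK⟩ := (contDiffAt_blowUpField hw1 hV).exists_lipschitzOnWith
    refine ⟨K, U, hU, fun ζ hζ x hx => ?_⟩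
    have := hK.dist_le_mul _ hζ _ hx
    rwa [dist_eq_norm, dist_eq_norm] at this

end
end SBC

/-! ### The transition map -/

namespace SBC
noncomputable section

variable {m : Fin 4 → ℝ} {Φ : OpenPartialHomeomorph Phase Phase}
  {G₅ G₇ : (Fin 2 → ℝ) → MvPolynomial (Fin 4) ℝ} {u₀ : Base} {r₀ η C ε : ℝ}

/-- The two orbits coincide on the common time interval. If one reached `Σ⁻` earlier, the other
would be on it as well, against the condition of first arrival. -/
theorem FieldBounds.transition_unique (h : FieldBounds (transformedField m Φ) G₅ G₇ u₀ r₀ η C)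
    (hε : 6 * |ε| < r₀) {s : ℝ} {c : ℝ → State} (hs : 0 < s)
    (hc : ∀ t ∈ Set.Icc 0 s, c t ∈ stateBox u₀ η ∧
      HasDerivWithinAt c (stateField (transformedField m Φ) ε (c t)) (Set.Icc 0 s) t)
    (hfirst : ∀ t ∈ Set.Ico 0 s, ¬ OnFace G₅ G₇ (-1) (toChart ε (c t)))
    (hend : OnFace G₅ G₇ (-1) (toChart ε (c s))) {w : Chart}
    (hw : IsTransition m Φ G₅ G₇ (toChart ε (c 0)) w) : w = toChart ε (c s) := by
  obtain ⟨s', d, hs', hd0, hds', hd, hface, hfirst'⟩ := hw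
  have hj : ∀ t ∈ Set.Icc 0 s, (c t).2.1 ≠ 0 := fun t ht => by
    linarith [(mem_stateBox.1 (hc t ht).1).2.1.1]
  have h1 : Set.Icc 0 (min s s') ⊆ Set.Icc 0 s := Set.Icc_subset_Icc_right (min_le_left _ _)
  have h2 : Set.Icc 0 (min s s') ⊆ Set.Icc 0 s' := Set.Icc_subset_Icc_right (min_le_right _ _)
  have heq := solution_unique (F := fun x => -blowUpField m Φ x) (T := min s s')
    (c := fun t => toChart ε (c t)) (d := d)
    (fun t ht => (hasDerivWithinAt_toChart (hc t (h1 ht)).2 (hj t (h1 ht))).mono h1)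
    (fun t ht => (hd t (h2 ht)).2.mono h2) hd0.symm (fun t ht => by
      obtain ⟨K, U, hU, hK⟩ := h.exists_lipschitz hε (hc t (h1 ht)).1
      refine ⟨K, U, hU, fun r _ hr x hx => ?_⟩
      rw [neg_sub_neg, norm_sub_rev]
      exact hK _ hr x hx)
  rcases lt_trichotomy s s' with hlt | rfl | hgt
  · have := heq s ⟨hs.le, by rw [min_eq_left hlt.le]⟩
    exact absurd (this ▸ hend) (hfirst' s ⟨hs.le, hlt⟩)
  · rw [← hds', ← heq s ⟨hs.le, by rw [min_self]⟩]
  · have := heq s' ⟨hs'.le, by rw [min_eq_right hgt.le]⟩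
    refine absurd ?_ (hfirst s' ⟨hs'.le, hgt⟩)
    rw [this, hds']
    exact hface

/-- All estimates are read off from `J₁ = -1 + O(ε⁷)` and the drift of `L` and `u`. The change of
`r_α` is `ε |J₁ + 1|`, in fact of order 8; the order 7 for `β` and `δ` comes from the division by
`J₁`. -/
theorem exists_transition (hm : ∀ i, 0 < m i) (hx : u₀.sep ≠ 0) (hΦ : IsNormalForm m u₀ Φ)
    (hG : IsApproxIntegral m u₀ Φ G₅ G₇) :
    ∃ a > 0, ∃ b > 0, ∃ η > 0, ∃ D, ∀ (r β δ : ℝ) (u : Base),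
      |r| < a → |β| ≤ 1 → |δ| ≤ 1 → ‖u - u₀‖ < η → ∃ w₁ w₂ : Chart,
        (|w₁.1| < b ∧ OnFace G₅ G₇ 1 w₁ ∧ faceCoords 1 w₁ = (r, β, δ, u)) ∧
        (∀ w : Chart, |w.1| < b → OnFace G₅ G₇ 1 w → faceCoords 1 w = (r, β, δ, u) → w = w₁) ∧
        IsTransition m Φ G₅ G₇ w₁ w₂ ∧ (∀ w, IsTransition m Φ G₅ G₇ w₁ w → w = w₂) ∧
        |(faceCoords (-1) w₂).1 - r| ≤ D * |r| ^ 7 ∧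
        |(faceCoords (-1) w₂).2.1 - β| ≤ D * |r| ^ 7 ∧
        |(faceCoords (-1) w₂).2.2.1 - δ| ≤ D * |r| ^ 7 ∧
        ‖(faceCoords (-1) w₂).2.2.2 - u‖ ≤ D * |r| ^ 8 := by
  obtain ⟨r₀, η, C, h, htar⟩ := exists_fieldBounds hm hx hΦ hG
  obtain ⟨a, ha, ha1, har, D, htrans⟩ := h.exists_transit
  obtain ⟨b, hb, hstart⟩ := h.exists_start
  have hη := h.eta_pos
  -- The quotients `L / J₁` have an error of two terms `D |r|⁷` in the numerator and a denominator
  -- of modulus at least `1/2`, hence `4 * D`.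
  refine ⟨min a b, lt_min ha hb, b, hb, η / 4, by positivity, 4 * D,
    fun r β δ u hr hβ hδ hu => ?_⟩
  obtain ⟨s₀, hs1, hs2, hsb, hs6, hsu⟩ := hstart r β δ u (hr.trans_le (min_le_right _ _)) hβ hδ
    (hu.trans (by linarith))
  have hra := hr.trans_le (min_le_left _ _)
  have hε : 6 * |r| < r₀ := by linarith
  obtain ⟨s, c, hs, hc0, hc, hfirst, hend, hneg, e1, e2, e3, e4⟩ :=
    htrans r hra (startState β δ u s₀) rfl hs1 hs2 hβ hδ hu hs6
  have hss : s ∈ Set.Icc 0 s := ⟨hs.le, le_rfl⟩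
  have hj : ∀ t ∈ Set.Icc 0 s, (c t).2.1 ≠ 0 := fun t ht => by
    linarith [(mem_stateBox.1 (hc t ht).1).2.1.1]
  have hj0 : (startState β δ u s₀).2.1 ≠ 0 := by
    simp only [startState]
    linarith
  have hface : ∀ {s : ℝ}, s ≠ 0 → (OnFace G₅ G₇ 1 (toChart r (startState β δ u s)) ↔
      scaledKappa G₅ G₇ r (startState β δ u s) = 6) := fun {s} hs => by
    rw [h.onFace_toChart (show (startState β δ u s).2.1 ≠ 0 from hs)]
    simp [startState]
  have hface2 : ∀ t ∈ Set.Icc 0 s, OnFace G₅ G₇ (-1) (toChart r (c t)) ↔ (c t).1 ≠ 0 ∧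
      scaledKappa G₅ G₇ r (c t) = 6 * (-1) * (c t).1 ^ 3 := fun t ht => h.onFace_toChart (hj t ht)
  have hend' := (hface2 s hss).2 ⟨by linarith, hend⟩
  have hfirst' : ∀ t ∈ Set.Ico 0 s, ¬ OnFace G₅ G₇ (-1) (toChart r (c t)) := fun t ht hcon =>
    hfirst t ht ((hface2 t ⟨ht.1, ht.2.le⟩).1 hcon).2
  refine ⟨toChart r (startState β δ u s₀), toChart r (c s), ⟨hsb, (hface hj0).2 hs6, ?_⟩,
    fun w hwb hw hwc => ?_, ⟨s, fun t => toChart r (c t), hs, by simp only [hc0], rfl,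
      fun t ht => ⟨?_, hasDerivWithinAt_toChart (hc t ht).2 (hj t ht)⟩, hend', hfirst'⟩,
    fun w hw => h.transition_unique hε hs hc hfirst' hend' (by rwa [hc0]), ?_⟩
  · rw [faceCoords_toChart hj0 one_ne_zero]
    simp [startState, State.base]
  · obtain ⟨s', hs', rfl⟩ := exists_startState hw.1 hwc
    rw [hsu s' hwb ((hface hs').1 hw)]
  · rw [blowDown_toChart (hj t ht)]
    exact htar _ (h.scaleDown_mem hε (hc t ht).1).1 (h.scaleDown_mem hε (hc t ht).1).2
  · have hcs : (c s).1 ≠ 0 := by linarith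
    have hr1 : |r| ≤ 1 := hra.le.trans ha1
    have h0 := abs_nonneg r
    have hD7 : 0 ≤ D * |r| ^ 7 := (abs_nonneg _).trans e1
    have hD8 : 0 ≤ D * |r| ^ 8 := (abs_nonneg _).trans e2
    have h87 : D * |r| ^ 8 ≤ D * |r| ^ 7 := by
      calc D * |r| ^ 8 = D * |r| ^ 7 * |r| := by ring
        _ ≤ D * |r| ^ 7 := mul_le_of_le_one_right hD7 hr1
    have hq : ∀ l l₀ : ℝ, |l₀| ≤ 1 → |l - l₀| ≤ D * |r| ^ 8 →
        |-1 * (l / (c s).1) - l₀| ≤ 4 * D * |r| ^ 7 := fun l l₀ hl₀ hl => by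
      have e : -1 * (l / (c s).1) - l₀ = -((l - l₀ + l₀ * ((c s).1 + 1)) / (c s).1) := by
        field_simp
        ring
      have hc2 : 1 / 2 ≤ |(c s).1| := by
        rw [abs_of_neg (by linarith)]
        linarith
      have hc3 : |l₀ * ((c s).1 + 1)| ≤ D * |r| ^ 7 := by
        rw [abs_mul]
        exact (mul_le_of_le_one_left (abs_nonneg _) hl₀).trans e1
      rw [e, abs_neg, abs_div, div_le_iff₀ (by linarith)]
      calc _ ≤ |l - l₀| + |l₀ * ((c s).1 + 1)| := abs_add_le _ _
        _ ≤ D * |r| ^ 7 + D * |r| ^ 7 := add_le_add (hl.trans h87) hc3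
        _ = 4 * D * |r| ^ 7 * (1 / 2) := by ring
        _ ≤ _ := mul_le_mul_of_nonneg_left hc2 (by linarith)
    rw [faceCoords_toChart (hj s hss) hcs]
    refine ⟨?_, hq _ _ hβ e2, hq _ _ hδ e3, ?_⟩
    · have e : -1 * (r * (c s).1) - r = -(r * ((c s).1 + 1)) := by ring
      simp only
      rw [e, abs_neg, abs_mul]
      calc |r| * |(c s).1 + 1| ≤ |(c s).1 + 1| := mul_le_of_le_one_left (abs_nonneg _) hr1
        _ ≤ _ := by linarith
    · exact e4.trans (by linarith)

end
end SBC

open SBC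
theorem mainTheorem9 (m : Fin 4 → ℝ) (hm : ∀ i, 0 < m i) (u₀ : Base) (hx : u₀.sep ≠ 0) :
    (∃ (Φ : OpenPartialHomeomorph Phase Phase)
        (G₅ G₇ : (Fin 2 → ℝ) → MvPolynomial (Fin 4) ℝ),
        IsNormalForm m u₀ Φ ∧ IsApproxIntegral m u₀ Φ G₅ G₇) ∧
    ∀ (Φ : OpenPartialHomeomorph Phase Phase)
      (G₅ G₇ : (Fin 2 → ℝ) → MvPolynomial (Fin 4) ℝ),
      IsNormalForm m u₀ Φ → IsApproxIntegral m u₀ Φ G₅ G₇ →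
      ∃ (T : ℝ × ℝ × ℝ × Base → ℝ × ℝ × ℝ × Base),
      ∃ a > (0 : ℝ), ∃ b > (0 : ℝ), ∃ N ∈ 𝓝 u₀, ∃ C : ℝ,
      ∀ (r₁ β₁ δ₁ : ℝ) (u₁ : Base), |r₁| < a → |β₁| ≤ 1 → |δ₁| ≤ 1 → u₁ ∈ N →
        (∃! w₁ : Chart, |w₁.1| < b ∧ OnFace G₅ G₇ 1 w₁ ∧ faceCoords 1 w₁ = (r₁, β₁, δ₁, u₁)) ∧
        (∀ w₁ : Chart, |w₁.1| < b → OnFace G₅ G₇ 1 w₁ → faceCoords 1 w₁ = (r₁, β₁, δ₁, u₁) →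
          (∃ w₂, IsTransition m Φ G₅ G₇ w₁ w₂) ∧
          ∀ w₂, IsTransition m Φ G₅ G₇ w₁ w₂ → faceCoords (-1) w₂ = T (r₁, β₁, δ₁, u₁)) ∧
        (∀ (r₂ β₂ δ₂ : ℝ) (u₂ : Base), T (r₁, β₁, δ₁, u₁) = (r₂, β₂, δ₂, u₂) →
          |r₂ - r₁| ≤ C * |r₁| ^ 7 ∧ |β₂ - β₁| ≤ C * |r₁| ^ 7 ∧
          |δ₂ - δ₁| ≤ C * |r₁| ^ 7 ∧ ‖u₂ - u₁‖ ≤ C * |r₁| ^ 8) := by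
  classical
  refine ⟨exists_isApproxIntegral hm hx, fun Φ G₅ G₇ hΦ hG => ?_⟩
  obtain ⟨a, ha, b, hb, η, hη, D, h⟩ := exists_transition hm hx hΦ hG
  -- The end point is selected by choice and is unique for the coordinates considered; the value for
  -- coordinates without a transition is immaterial.
  let T : ℝ × ℝ × ℝ × Base → ℝ × ℝ × ℝ × Base := fun x =>
    if h : ∃ w₂ w₁ : Chart, |w₁.1| < b ∧ OnFace G₅ G₇ 1 w₁ ∧ faceCoords 1 w₁ = x ∧
      IsTransition m Φ G₅ G₇ w₁ w₂ then faceCoords (-1) h.choose else x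
  refine ⟨T, a, ha, b, hb, Metric.ball u₀ η, Metric.ball_mem_nhds _ hη, D,
    fun r β δ u hr hβ hδ hu => ?_⟩
  obtain ⟨w₁, w₂, hw₁, huniq, htrans, huniq', hbounds⟩ :=
    h r β δ u hr hβ hδ (by simpa [dist_eq_norm] using hu)
  have hT : T (r, β, δ, u) = faceCoords (-1) w₂ := by
    have hex : ∃ w₂ w₁ : Chart, |w₁.1| < b ∧ OnFace G₅ G₇ 1 w₁ ∧
        faceCoords 1 w₁ = (r, β, δ, u) ∧ IsTransition m Φ G₅ G₇ w₁ w₂ :=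
      ⟨w₂, w₁, hw₁.1, hw₁.2.1, hw₁.2.2, htrans⟩
    obtain ⟨w, hwb, hwf, hwc, hwt⟩ := hex.choose_spec
    rw [huniq w hwb hwf hwc] at hwt
    simp only [T, dif_pos hex]
    rw [huniq' _ hwt]
  refine ⟨⟨w₁, hw₁, fun w hw => huniq w hw.1 hw.2.1 hw.2.2⟩, fun w hwb hwf hwc => ?_,
    fun r₂ β₂ δ₂ u₂ h₂ => ?_⟩
  · rw [huniq w hwb hwf hwc, hT]
    exact ⟨⟨w₂, htrans⟩, fun w' hw' => by rw [huniq' w' hw']⟩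
  · rw [hT] at h₂
    rw [h₂] at hbounds
    exact hbounds
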